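/- All varieties are over $\mathbb{C}$. An $N$-dimensional variety $W$ admits a unirational parametrization of degree $d$ if there is a dominant rational map $\mathbb{P}^N \dashrightarrow W$ of degree $d$ (that is, the induced extension of function fields is finite of degree $d$). Let $X$ be one of the following smooth cubic hypersurfaces. (a) $X\subset\mathbb{P}^4$ is a smooth cubic threefold defined by $$t_1x_1^2x_3+t_2x_2^3+t_3x_1x_3^2+t_4x_4^2x_5+t_5x_4x_5^2+t_6x_1x_2x_3+t_7x_2x_4x_5=0,$$ where $t_1,\dots,t_5\in\mathbb{C}^*$ and $t_6,t_7\in\mathbb{C}$; put $n=3$. (b) $n\ge 5$ is an odd integer and $X\subset\mathbb{P}^{n+1}$ is a smooth cubic hypersurface of dimension $n$ whose equation is given by a form $\sum_i F_i$, where the $F_i$ are cubic forms in pairwise disjoint sets of variables and each $F_i$ involves at most three variables. Then for every integer $m\ge 1$ there are coprime positive integers $d_1,d_2$ such that the $(n+m)$-dimensional variety $X\times\mathbb{P}^m$ admits unirational parametrizations of degree $d_1$ and of degree $d_2$. -/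

import Mathlib

open MvPolynomial

open scoped LinearAlgebra.Projectivization

noncomputable section

/-- Complex projective space `ℙⁿ`, as the set of lines through the origin in `ℂⁿ⁺¹`. -/
abbrev CProj (n : ℕ) : Type := ℙ ℂ (Fin (n + 1) → ℂ)

/-! ### Hypersurfaces -/

/-- The zero locus in `ℙᵏ` of a homogeneous polynomial `F` in `k + 1` variables. -/
def projHypersurface {k : ℕ} (F : MvPolynomial (Fin (k + 1)) ℂ) : Set (CProj k) :=
  {p | eval p.rep F = 0}

/-- The hypersurface `F = 0` in `ℙᵏ` is smooth: at none of its points do all the partial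
derivatives of `F` vanish. -/
def IsSmoothProjHypersurface {k : ℕ} (F : MvPolynomial (Fin (k + 1)) ℂ) : Prop :=
  ∀ p : CProj k, p ∈ projHypersurface F → ∃ i, eval p.rep (pderiv i F) ≠ 0

/-- The form
`t₁x₁²x₃ + t₂x₂³ + t₃x₁x₃² + t₄x₄²x₅ + t₅x₄x₅² + t₆x₁x₂x₃ + t₇x₂x₄x₅`
(the variables `x₁, …, x₅` are `X 0, …, X 4`, the coefficients `t₁, …, t₇` are `t 0, …, t 6`). -/
def familyCubic (t : Fin 7 → ℂ) : MvPolynomial (Fin 5) ℂ :=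
  C (t 0) * X 0 ^ 2 * X 2 + C (t 1) * X 1 ^ 3 + C (t 2) * X 0 * X 2 ^ 2
    + C (t 3) * X 3 ^ 2 * X 4 + C (t 4) * X 3 * X 4 ^ 2
    + C (t 5) * X 0 * X 1 * X 2 + C (t 6) * X 1 * X 3 * X 4

/-- `F` is a sum of cubic forms in pairwise disjoint sets of variables, each of which involves at
most three variables. -/
def IsSeparatedCubicForm {k : ℕ} (F : MvPolynomial (Fin (k + 1)) ℂ) : Prop :=
  ∃ (r : ℕ) (G : Fin r → MvPolynomial (Fin (k + 1)) ℂ),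
    F = ∑ i, G i ∧
    (∀ i, (G i).IsHomogeneous 3 ∧ (G i).vars.card ≤ 3) ∧
    ∀ i j, i ≠ j → Disjoint (G i).vars (G j).vars

/-! ### Fields of rational functions -/

/-- Let `w` be a grading of the polynomial ring in the variables `τ` and `θ` a homomorphism to the
polynomial ring in the variables `σ`. This is the field of all fractions `θ(G) / θ(H)`, where
`G` and `H` are `w`-homogeneous of the same degree and `θ(H) ≠ 0`. -/
def homogeneousFractions {σ τ M : Type} [AddCommMonoid M] (w : τ → M)
    (θ : MvPolynomial τ ℂ →ₐ[ℂ] MvPolynomial σ ℂ) :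
    IntermediateField ℂ (FractionRing (MvPolynomial σ ℂ)) where
  carrier := {z | ∃ (e : M) (G H : MvPolynomial τ ℂ),
    IsWeightedHomogeneous w G e ∧ IsWeightedHomogeneous w H e ∧ θ H ≠ 0 ∧
    z = algebraMap (MvPolynomial σ ℂ) (FractionRing (MvPolynomial σ ℂ)) (θ G) /
      algebraMap (MvPolynomial σ ℂ) (FractionRing (MvPolynomial σ ℂ)) (θ H)}
  mul_mem' := by
    rintro _ _ ⟨e, G, H, hG, hH, h0, rfl⟩ ⟨e', G', H', hG', hH', h0', rfl⟩
    refine ⟨e + e', G * G', H * H', hG.mul hG', hH.mul hH', ?_, ?_⟩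
    · rw [map_mul]; exact mul_ne_zero h0 h0'
    · simp only [map_mul]; rw [div_mul_div_comm]
  add_mem' := by
    rintro _ _ ⟨e, G, H, hG, hH, h0, rfl⟩ ⟨e', G', H', hG', hH', h0', rfl⟩
    refine ⟨e + e', G * H' + H * G', H * H', (hG.mul hH').add (hH.mul hG'), hH.mul hH', ?_, ?_⟩
    · rw [map_mul]; exact mul_ne_zero h0 h0'
    · simp only [map_mul, map_add]
      rw [div_add_div] <;>
        simpa using ‹_›
  algebraMap_mem' := by
    intro c
    refine ⟨0, C c, 1, isWeightedHomogeneous_C w c, isWeightedHomogeneous_one ℂ w, by simp, ?_⟩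
    rw [← MvPolynomial.algebraMap_eq, AlgHom.commutes, map_one, map_one, div_one]
    exact IsScalarTower.algebraMap_apply ℂ (MvPolynomial σ ℂ) _ c
  inv_mem' := by
    rintro _ ⟨e, G, H, hG, hH, h0, rfl⟩
    by_cases h : θ G = 0
    · refine ⟨e, 0, H, isWeightedHomogeneous_zero ℂ w e, hH, h0, ?_⟩
      simp [h]
    · exact ⟨e, H, G, hH, hG, h, by rw [inv_div]⟩

/-- The function field of `ℙᴺ`: fractions of homogeneous polynomials of the same degree. -/
def projFunctionField (N : ℕ) :
    IntermediateField ℂ (FractionRing (MvPolynomial (Fin (N + 1)) ℂ)) :=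
  homogeneousFractions (fun _ => (1 : ℕ)) (AlgHom.id ℂ _)

/-! ### Rational maps from `ℙᴺ` to subvarieties of `ℙᵃ × ℙᵇ` -/

/-- The bigrading of the coordinate ring of `ℙᵃ × ℙᵇ`. -/
def biWeight (a b : ℕ) : Fin (a + 1) ⊕ Fin (b + 1) → ℕ × ℕ :=
  Sum.elim (fun _ => (1, 0)) (fun _ => (0, 1))

/-- A rational map `ℙᴺ ⇢ ℙᵃ × ℙᵇ`, written as a pair `((f₀ : ⋯ : f_a), (g₀ : ⋯ : g_b))` of
nonzero tuples of homogeneous polynomials, of the same degree within each tuple. -/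
structure ProjRatMap (N a b : ℕ) where
  f : Fin (a + 1) → MvPolynomial (Fin (N + 1)) ℂ
  g : Fin (b + 1) → MvPolynomial (Fin (N + 1)) ℂ
  degf : ℕ
  degg : ℕ
  homogeneous_f : ∀ i, (f i).IsHomogeneous degf
  homogeneous_g : ∀ j, (g j).IsHomogeneous degg
  f_ne_zero : f ≠ 0
  g_ne_zero : g ≠ 0

namespace ProjRatMap

variable {N a b : ℕ}

/-- The set of values of the rational map at the points of `ℙᴺ` where neither of the tuples
vanishes. -/
def image (φ : ProjRatMap N a b) : Set (CProj a × CProj b) :=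
  {q | ∃ (p : CProj N) (hf : (fun i => eval p.rep (φ.f i)) ≠ 0)
    (hg : (fun j => eval p.rep (φ.g j)) ≠ 0),
    q = (Projectivization.mk ℂ _ hf, Projectivization.mk ℂ _ hg)}

/-- The rational map has its values in `W` and is dominant as a rational map to `W`: its image is
Zariski dense in `W`, that is, every bihomogeneous polynomial that vanishes on the image vanishes
on `W`. -/
def IsDominantTo (φ : ProjRatMap N a b) (W : Set (CProj a × CProj b)) : Prop :=
  φ.image ⊆ W ∧
  ∀ (e : ℕ × ℕ) (G : MvPolynomial (Fin (a + 1) ⊕ Fin (b + 1)) ℂ),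
    IsWeightedHomogeneous (biWeight a b) G e →
    (∀ q ∈ φ.image, eval (Sum.elim q.1.rep q.2.rep) G = 0) →
    ∀ q ∈ W, eval (Sum.elim q.1.rep q.2.rep) G = 0

/-- The subfield `φ^* ℂ(W)` of the function field of `ℙᴺ`, when `φ` is dominant to `W`: the
pullbacks `G(f, g) / H(f, g)` of the rational functions `G / H` on `W`, where `G` and `H` are
bihomogeneous of the same bidegree. By dominance, `H(f, g) ≠ 0` means that `H` does not vanish
identically on `W`. -/
def pullbackField (φ : ProjRatMap N a b) :
    IntermediateField ℂ (FractionRing (MvPolynomial (Fin (N + 1)) ℂ)) :=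
  homogeneousFractions (biWeight a b) (aeval (Sum.elim φ.f φ.g))

/-- The degree `[ℂ(ℙᴺ) : φ^* ℂ(W)]` of a dominant rational map (`0` if it is infinite). -/
def degree (φ : ProjRatMap N a b) : ℕ :=
  IntermediateField.relfinrank φ.pullbackField (projFunctionField N)

end ProjRatMap

/-- The `N`-dimensional subvariety `W` of `ℙᵃ × ℙᵇ` admits a unirational parametrization of degree
`d`: there is a dominant rational map `ℙᴺ ⇢ W` of (finite) degree `d`. -/
def AdmitsUnirationalParametrization {a b : ℕ} (N : ℕ) (W : Set (CProj a × CProj b))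
    (d : ℕ) : Prop :=
  0 < d ∧ ∃ φ : ProjRatMap N a b, φ.IsDominantTo W ∧ φ.degree = d

/-- The `N`-dimensional subvariety `W` of `ℙᵃ × ℙᵇ` admits unirational parametrizations of coprime
degrees. -/
def AdmitsCoprimeParametrizations {a b : ℕ} (N : ℕ) (W : Set (CProj a × CProj b)) : Prop :=
  ∃ d₁ d₂ : ℕ, Nat.Coprime d₁ d₂ ∧
    AdmitsUnirationalParametrization N W d₁ ∧ AdmitsUnirationalParametrization N W d₂

end

/-! It suffices to parametrize by a degree which is one or two, and by an odd degree. In suitable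
coordinates all the hypersurfaces have the equation `niceForm`,

  `x₁ x₃ (t₁ x₁ + t₃ x₃ + t₆ x₂) + t₂ x₂³ + l r² + s x₂ r l + r h₁ + h₀ = 0`,

where `h₁` and `h₀` are forms in `l` and the remaining variables. For a separated form, some of the
summands together are a smooth ternary cubic form (`exists_ternary_summand`), which has a flex and
therefore the shape of the first terms (`exists_linearEquiv_planeCubic`), and the sum of the others
is `H = l r² + r h₁ + h₀` at a zero (`exists_linearEquiv_cubicForm`); here `s = 0`. The members of
the family of threefolds have the required shape already.

*Degree at most two.* For `l = 1`, the substitution `x₁ = -ϱ² / t₃`, `r = r' + ϱ x₃` makes the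
equation linear in `x₃` (`hasGenericParametrization_of_adjoin_eq_top`).

*From lifts to odd degrees.* Let `E` be the function field of the product of the hypersurface with
`ℙᵐ⁻¹`, and let `K` be an extension of `E` of odd degree. Suppose that the generic point lifts to
every integrally closed local domain with residue field `K` which is not a field. The field `E` is
finite over a rational function field `k`, so `K` is the residue field of a local ring `O` of the
affine line over `k`. The lift embeds `E` in `O`, which makes the rational function field
`L = Frac O` the function field of a curve over `E` with a point of odd degree. A suitable `z` then
has `[L : E(z)]` odd (`exists_odd_finrank_adjoin`), and `L` parametrizes the product with `ℙᵐ`, the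
additional affine coordinate being `z`.

*Lifting points.* Let `A` be a ring with a local homomorphism to a field. The line through two
conjugate points of a cubic over `A[√D]` meets the cubic in a third point over `A` (`thirdPoint`).
If the two specialisations of a point over `A[√D]` are the given point and an Eckardt point, then
the third point specialises to the image of the given point under the Eckardt involution, which is
defined over `ℂ`; so the given point lifts (`IsEckardt.liftable_of_evalSqrt`). Points over `A[√D]`
with prescribed specialisations come from parametrizations. The basic one is a family of points of
the surface `v (W³ - θ³ u³) + p q (a p + b q + g u) = 0` with two parameters, which uses the
factorization of `W³ - θ³ u³` (`surface_family`). Adjoining cube roots is harmless, as their degrees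
are odd.

If `s = 0` and `H(z)` is a cube `σ³`, the surface is `σ³ + g(x₁, x₂, x₃) = 0`, and `√D` serves to
keep `H(r, z) = σ³` when `z` and `σ` are lifted (`liftable_niceForm_of_cube`). This covers the
separated forms, and the threefolds with `t₆ = 0`, in which the two blocks of variables trade
places.

For the threefolds with `t₆ ≠ 0`, the plane cubic is in the pencil spanned by three lines and by
`u³`. This gives the equation `k₀ (τ³ - 1) (σ³ - 1) + t₂ + p q (t₄ p + t₅ q + t₇) = 0` for `u = 1`,
where `τ` and `σ` are the roots of `T² - e₁ T + e₂` (`normForm`); smoothness of the threefold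
entails `k₀ + t₂ ≠ 0`. With `τ` and a cube root `θ` of `1 - t₂ / (k₀ (τ³ - 1))`, this is the surface
with `v = k₀ (τ³ - 1)`. So `(τ, θ)` has to be lifted as a point of a cubic curve, which in the
normalisation `x³ + y³ = Δ (1 + x³ y³)` is obtained from a line by adjoining two square roots
(`cubicCurve_identity`). The roots `τ` and `σ` are disposed of by a further chord, and Cardano's
resolvent supplies `θ` in an extension of `E` of odd degree together with `τ` and `σ`
(`liftable_normForm`). -/

open MvPolynomial
open scoped LinearAlgebra.Projectivization QuadraticAlgebra

noncomputable section

/-! ### Curves with a point of odd degree -/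

section OddDegree

open IntermediateField Module
open scoped algebraAdjoinAdjoin

variable {E L : Type*} [Field E] [Field L] [Algebra E L]

theorem isPrincipalIdealRing_adjoin_singleton (x : L) :
    IsPrincipalIdealRing (Algebra.adjoin E {x}) := by
  let f : Polynomial E →ₐ[E] Algebra.adjoin E {x} :=
    Polynomial.aeval ⟨x, Algebra.self_mem_adjoin_singleton E x⟩
  refine IsPrincipalIdealRing.of_surjective f.toRingHom ?_
  rintro ⟨y, hy⟩
  have hy' := hy
  rw [Algebra.adjoin_singleton_eq_range_aeval] at hy'
  obtain ⟨p, hp⟩ := hy'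
  refine ⟨p, Subtype.ext ?_⟩
  change _ = y
  rw [← hp]
  exact (Polynomial.aeval_algebraMap_apply L
    (⟨x, Algebra.self_mem_adjoin_singleton E x⟩ : Algebra.adjoin E {x}) p).symm

/-- The integral closure of `E[x]` in `L`. -/
abbrev closureOfAdjoin (E : Type*) {L : Type*} [Field E] [Field L] [Algebra E L] (x : L) :
    Subalgebra (Algebra.adjoin E {x}) L :=
  integralClosure (Algebra.adjoin E {x}) L

section

variable (x : L) [FiniteDimensional E⟮x⟯ L]

theorem isDedekindDomain_closureOfAdjoin [CharZero E] : IsDedekindDomain (closureOfAdjoin E x) := by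
  have := isPrincipalIdealRing_adjoin_singleton (E := E) x
  exact integralClosure.isDedekindDomain (Algebra.adjoin E {x}) E⟮x⟯ L

theorem isFractionRing_closureOfAdjoin : IsFractionRing (closureOfAdjoin E x) L :=
  integralClosure.isFractionRing_of_finite_extension (A := Algebra.adjoin E {x}) E⟮x⟯ L

theorem finite_closureOfAdjoin [CharZero E] :
    Module.Finite (Algebra.adjoin E {x}) (closureOfAdjoin E x) := by
  have := isPrincipalIdealRing_adjoin_singleton (E := E) x
  exact IsIntegralClosure.finite (Algebra.adjoin E {x}) E⟮x⟯ L (closureOfAdjoin E x)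

theorem finrank_closureOfAdjoin :
    finrank (Algebra.adjoin E {x}) (closureOfAdjoin E x) = finrank E⟮x⟯ L := by
  have := isFractionRing_closureOfAdjoin (E := E) x
  exact (IsFractionRing.finrank_eq (Algebra.adjoin E {x}) E⟮x⟯
    (closureOfAdjoin E x) L).symm

end

/-- The generator `x` as an element of the integral closure of `E[x]`. -/
def closureGen (E : Type*) {L : Type*} [Field E] [Field L] [Algebra E L] (x : L) :
    closureOfAdjoin E x :=
  algebraMap (Algebra.adjoin E {x}) _ ⟨x, Algebra.self_mem_adjoin_singleton E x⟩

omit [Algebra E L] in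
open IsDedekindDomain in
/-- The fundamental identity `∑ e f = [S : R]` modulo 2, at a maximal ideal `(g)` of `R` with
residue field `E`: a single place of `S` over `g` is simple of odd degree, all others have even
ramification. -/
theorem odd_finrank_of_odd_place {R S : Type*} [CommRing R] [IsDomain R] [IsPrincipalIdealRing R]
    [Algebra E R] [CommRing S] [IsDedekindDomain S] [Algebra R S] [Algebra E S]
    [IsScalarTower E R S] [Module.Finite R S] [Module.IsTorsionFree R S]
    [Algebra S L] [IsFractionRing S L] (g : R) (hg0 : g ≠ 0)
    (hsurj : ∀ y : R, ∃ c : E, y - algebraMap E R c ∈ Ideal.span {g})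
    (v₀ : HeightOneSpectrum S)
    (h0 : algebraMap R S g ∈ v₀.asIdeal) (h1 : algebraMap R S g ∉ v₀.asIdeal ^ 2)
    (hodd : Odd (finrank E (S ⧸ v₀.asIdeal)))
    (hev : ∀ v : HeightOneSpectrum S, algebraMap R S g ∈ v.asIdeal → v ≠ v₀ →
      ∃ b : L, v.valuation L (algebraMap S L (algebraMap R S g)) = v.valuation L b ^ 2) :
    Odd (finrank R S) := by
  classical
  obtain ⟨p, hp⟩ : ∃ p : Ideal R, p = Ideal.span {g} := ⟨_, rfl⟩
  have hgp : g ∈ p := hp ▸ Ideal.mem_span_singleton_self g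
  have hv₀ : v₀.asIdeal.comap (algebraMap R S) ≠ ⊤ :=
    Ideal.comap_ne_top _ v₀.isPrime.ne_top
  have hle : p ≤ v₀.asIdeal.comap (algebraMap R S) := by
    rw [hp, Ideal.span_singleton_le_iff_mem]; exact h0
  have hpt : p ≠ ⊤ := fun h => hv₀ (top_le_iff.1 (h ▸ hle))
  have hmax : p.IsMaximal := by
    refine Ideal.isMaximal_iff.2 ⟨fun h => hpt ((Ideal.eq_top_iff_one _).2 h), ?_⟩
    intro J y hJ hy hyJ
    obtain ⟨c, hc⟩ := hsurj y
    rw [← hp] at hc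
    have hc0 : c ≠ 0 := by
      rintro rfl
      exact hy (by simpa using hc)
    have : algebraMap E R c ∈ J := by
      have := J.sub_mem hyJ (hJ hc)
      simpa using this
    have := J.mul_mem_left (algebraMap E R c⁻¹) this
    rwa [← map_mul, inv_mul_cancel₀ hc0, map_one] at this
  have hp0 : p ≠ ⊥ := by rw [hp]; simpa using hg0
  have hmap : p.map (algebraMap R S) = Ideal.span {algebraMap R S g} := by
    rw [hp, Ideal.map_span, Set.image_singleton]
  have hG0 : algebraMap R S g ≠ 0 := by
    rw [Ne, FaithfulSMul.algebraMap_eq_zero_iff]; exact hg0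
  have hmap0 : p.map (algebraMap R S) ≠ ⊥ := by rw [hmap]; simpa using hG0
  -- the residue field of `R` at `g` is `E`
  have hone : finrank E (R ⧸ p) = 1 := by
    have hpr := hmax.isPrime
    have hb : Function.Bijective (algebraMap E (R ⧸ p)) := by
      refine ⟨(algebraMap E (R ⧸ p)).injective, fun y => ?_⟩
      obtain ⟨y, rfl⟩ := Ideal.Quotient.mk_surjective y
      obtain ⟨c, hc⟩ := hsurj y
      rw [← hp] at hc
      exact ⟨c, (Ideal.Quotient.eq.2 hc).symm⟩
    exact (LinearEquiv.ofBijective (Algebra.linearMap E (R ⧸ p)) hb).finrank_eq.symm.trans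
      (finrank_self E)
  have hPover : ∀ Q : Ideal S, Q ∈ p.primesOver S ↔ Q.IsPrime ∧ algebraMap R S g ∈ Q := by
    intro Q
    constructor
    · rintro ⟨h, h'⟩
      refine ⟨h, ?_⟩
      have : g ∈ Q.comap (algebraMap R S) := by
        have := h'.over
        rw [Ideal.under] at this
        rw [← this]; exact hgp
      exact this
    · rintro ⟨h, h'⟩
      refine ⟨h, ⟨hmax.eq_of_le (Ideal.comap_ne_top _ h.ne_top) ?_⟩⟩
      rw [hp, Ideal.span_singleton_le_iff_mem]; exact h'
  have hfinite : (p.primesOver S).Finite := IsDedekindDomain.primesOver_finite p S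
  have := hfinite.fintype
  rw [← Ideal.sum_ramification_inertia_eq_finrank p S]
  let q₀ : p.primesOver S := ⟨v₀.asIdeal, (hPover _).2 ⟨v₀.isPrime, h0⟩⟩
  rw [← Finset.add_sum_erase _ _ (Finset.mem_univ q₀)]
  have hram : ∀ q : p.primesOver S,
      q.1.ramificationIdx R = multiplicity q.1 (Ideal.span {algebraMap R S g}) := by
    intro q
    have := q.2.1
    have := q.2.2
    rw [Ideal.IsDedekindDomain.ramificationIdx_eq_multiplicity p q.1 hmap0, hmap]
  have hinert : Odd (q₀.1.inertiaDeg R) := by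
    have : v₀.asIdeal.LiesOver p := q₀.2.2
    have : v₀.asIdeal.IsMaximal := v₀.isMaximal
    rw [Ideal.inertiaDeg_eq_of_isMaximal p v₀.asIdeal]
    have : IsScalarTower E (R ⧸ p) (S ⧸ v₀.asIdeal) := by
      refine IsScalarTower.of_algebraMap_eq fun c => ?_
      rw [IsScalarTower.algebraMap_apply E R (R ⧸ p),
        IsScalarTower.algebraMap_apply E R (S ⧸ v₀.asIdeal),
        IsScalarTower.algebraMap_apply R (R ⧸ p) (S ⧸ v₀.asIdeal)]
    let _ := Ideal.Quotient.field p
    rw [← finrank_mul_finrank E (R ⧸ p) (S ⧸ v₀.asIdeal), hone, one_mul] at hodd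
    exact hodd
  -- In `∑ e f`, the place `v₀` contributes an odd number and every other place an even one.
  refine Odd.add_even ?_ ?_
  · refine Odd.mul ?_ hinert
    rw [hram, show multiplicity q₀.1 (Ideal.span {algebraMap R S g}) = 1 from ?_]
    · exact odd_one
    · refine multiplicity_eq_of_dvd_of_not_dvd ?_ ?_
      · rw [pow_one]; exact Ideal.dvd_span_singleton.2 h0
      · exact fun h => h1 (Ideal.dvd_span_singleton.1 h)
  · refine Finset.even_sum _ fun q hq => Even.mul_right ?_ _
    have hqp := (hPover _).1 q.2
    have hq0 : q.1 ≠ ⊥ := fun h => hG0 (by simpa [h] using hqp.2)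
    let v : HeightOneSpectrum S := ⟨q.1, hqp.1, hq0⟩
    obtain ⟨b, hb⟩ := hev v hqp.2 (fun h => (Finset.mem_erase.1 hq).1
      (Subtype.ext (congrArg HeightOneSpectrum.asIdeal h)))
    rw [hram]
    rw [v.valuation_of_algebraMap, HeightOneSpectrum.intValuation_eq_exp_neg_multiplicity v hG0]
      at hb
    have hb0 : v.valuation L b ≠ 0 := by
      intro h
      rw [h] at hb
      simp at hb
    obtain ⟨k, hk⟩ : ∃ k : ℤ, v.valuation L b = WithZero.exp k :=
      ⟨_, (WithZero.exp_log hb0).symm⟩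
    rw [hk, ← WithZero.exp_nsmul, WithZero.exp_inj] at hb
    rw [← Int.even_coe_nat]
    have hb' : -(multiplicity q.1 (Ideal.span {algebraMap R S g}) : ℤ) = k + k := by
      rw [← two_nsmul]; exact hb
    exact ⟨-k, by omega⟩

/-- The residue field of `E[x]` at `x` is `E`. -/
theorem exists_sub_mem_span_adjoin (x : L) (y : Algebra.adjoin E {x}) :
    ∃ c : E, y - algebraMap E _ c ∈
      Ideal.span {(⟨x, Algebra.self_mem_adjoin_singleton E x⟩ : Algebra.adjoin E {x})} := by
  obtain ⟨y, hy⟩ := y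
  have hy' := hy
  rw [Algebra.adjoin_singleton_eq_range_aeval] at hy'
  obtain ⟨p, hp⟩ := hy'
  let g : Algebra.adjoin E {x} := ⟨x, Algebra.self_mem_adjoin_singleton E x⟩
  refine ⟨p.coeff 0, Ideal.mem_span_singleton'.2 ⟨Polynomial.aeval g p.divX, Subtype.ext ?_⟩⟩
  have h2 : (Polynomial.aeval g p.divX : L) = Polynomial.aeval x p.divX :=
    (Polynomial.aeval_algebraMap_apply L g p.divX).symm
  have h3 := congrArg (Polynomial.aeval x) (Polynomial.divX_mul_X_add p)
  simp only [map_add, map_mul, Polynomial.aeval_X, Polynomial.aeval_C] at h3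
  change (Polynomial.aeval g p.divX : L) * x = y - algebraMap E L (p.coeff 0)
  rw [h2, ← hp]
  exact eq_sub_of_add_eq h3

omit [Algebra E L] in
theorem odd_finrank_quotient_ker {S K : Type*} [CommRing S] [Algebra E S] [Field K] [Algebra E K]
    (f : S →ₐ[E] K) (hf : (RingHom.ker f).IsMaximal) (hodd : Odd (finrank E K)) :
    Odd (finrank E (S ⧸ RingHom.ker f)) := by
  let _ : Field (S ⧸ RingHom.ker f) := Ideal.Quotient.field _
  let _ : Algebra (S ⧸ RingHom.ker f) K := (Ideal.kerLiftAlg f).toAlgebra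
  have : IsScalarTower E (S ⧸ RingHom.ker f) K :=
    IsScalarTower.of_algebraMap_eq fun c => ((Ideal.kerLiftAlg f).commutes c).symm
  rw [← finrank_mul_finrank E (S ⧸ RingHom.ker f) K] at hodd
  exact (Nat.odd_mul.1 hodd).1

/-- A nonzero element of the kernel of `φ` is transcendental over `E`, as the nonzero elements of a
ring which are algebraic over a subfield are units. -/
theorem transcendental_of_map_eq_zero {O K : Type*} [CommRing O] [IsDomain O] [Algebra E O]
    [Algebra O L] [IsFractionRing O L] [IsScalarTower E O L] [Field K] [Algebra E K]
    (φ : O →ₐ[E] K) {x : O} (hx : φ x = 0) (h0 : x ≠ 0) :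
    Transcendental E (algebraMap O L x) := by
  intro hal
  rw [isAlgebraic_algebraMap_iff (IsFractionRing.injective O L)] at hal
  obtain ⟨y, hy, hxy⟩ := IsAlgebraic.exists_nonzero_dvd (R := E) hal (mem_nonZeroDivisors_of_ne_zero h0)
  obtain ⟨z, hz⟩ := hxy
  have h1 := congrArg φ hz
  rw [map_mul, hx, zero_mul, AlgHom.commutes] at h1
  exact hy ((map_eq_zero _).1 h1)

open IsDedekindDomain in
/-- Let `O` be an integrally closed local domain containing the field `E`, with residue field `K` of
odd degree over `E` and with fraction field `L` of transcendence degree one over `E`. If the maximal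
ideal of `O` differs from its square, then `L` has odd degree over some simple transcendental
extension of `E`. -/
theorem exists_odd_finrank_adjoin [CharZero E] {O K : Type*} [CommRing O] [IsDomain O]
    [IsIntegrallyClosed O] [Algebra E O] [Algebra O L] [IsFractionRing O L] [IsScalarTower E O L]
    [Field K] [Algebra E K] [FiniteDimensional E K] (hodd : Odd (finrank E K))
    (φ : O →ₐ[E] K) (hunit : ∀ x, φ x ≠ 0 → IsUnit x)
    (hfin : ∀ x : L, Transcendental E x → FiniteDimensional E⟮x⟯ L)
    {τ : O} (hτ : φ τ = 0) (hτ2 : τ ∉ RingHom.ker φ ^ 2) :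
    ∃ z : L, Transcendental E z ∧ Odd (finrank E⟮z⟯ L) := by
  have hinj := IsFractionRing.injective O L
  have hτ0 : τ ≠ 0 := by rintro rfl; exact hτ2 (zero_mem _)
  obtain ⟨t, ht⟩ : ∃ t : L, t = algebraMap O L τ := ⟨_, rfl⟩
  have ht0 : t ≠ 0 := by rw [ht, Ne, map_eq_zero_iff _ hinj]; exact hτ0
  have htr : Transcendental E t := ht ▸ transcendental_of_map_eq_zero φ hτ hτ0
  have := hfin t htr
  have hD := isDedekindDomain_closureOfAdjoin (E := E) t
  have hF := isFractionRing_closureOfAdjoin (E := E) t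
  -- the integral closure of `E[x]` lies in `O` as soon as `x` does
  have key : ∀ x : O, ∃ ι : closureOfAdjoin E (algebraMap O L x) →ₐ[E] O,
      ∀ y, algebraMap O L (ι y) = y := by
    intro x
    have h : ∀ y : closureOfAdjoin E (algebraMap O L x), ∃ o : O, algebraMap O L o = y := by
      intro y
      have hle : Algebra.adjoin E {algebraMap O L x} ≤ (IsScalarTower.toAlgHom E O L).range :=
        Algebra.adjoin_le (by rintro _ rfl; exact ⟨x, rfl⟩)
      refine IsIntegrallyClosed.isIntegral_iff.1 ?_
      obtain ⟨p, hp, hpy⟩ := y.2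
      choose g hg using fun z : Algebra.adjoin E {algebraMap O L x} => hle z.2
      have hg' : ∀ z, algebraMap O L (g z) = z := hg
      let G : Algebra.adjoin E {algebraMap O L x} →+* O :=
        { toFun := g
          map_one' := hinj (by rw [hg']; simp)
          map_zero' := hinj (by rw [hg']; simp)
          map_mul' := fun a b => hinj (by simp [hg'])
          map_add' := fun a b => hinj (by simp [hg']) }
      refine ⟨p.map G, hp.map G, ?_⟩
      rw [Polynomial.eval₂_map]
      have : (algebraMap O L).comp G = algebraMap (Algebra.adjoin E {algebraMap O L x}) L :=
        RingHom.ext hg'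
      rw [this, hpy]
    choose g hg using h
    exact ⟨{ toFun := g
             map_one' := hinj (by rw [hg]; simp)
             map_zero' := hinj (by rw [hg]; simp)
             map_mul' := fun a b => hinj (by simp [hg])
             map_add' := fun a b => hinj (by simp [hg])
             commutes' := fun c => hinj (by rw [hg, ← IsScalarTower.algebraMap_apply]; rfl) }, hg⟩
  -- a valuation trivial on `E` and at most one at `x` is at most one on the integral closure
  have hval : ∀ (x : L) (v : Valuation L (WithZero (Multiplicative ℤ))),
      (∀ c : E, v (algebraMap E L c) ≤ 1) → v x ≤ 1 → ∀ y : closureOfAdjoin E x, v y ≤ 1 := by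
    intro x v hc hx y
    have hle : Algebra.adjoin E {x} ≤
        { v.integer with algebraMap_mem' := hc : Subalgebra E L } :=
      Algebra.adjoin_le (by rintro _ rfl; exact hx)
    obtain ⟨p, hp, hpy⟩ := y.2
    let G : Algebra.adjoin E {x} →+* v.integer := (Subalgebra.inclusion hle).toRingHom
    have hin : IsIntegral v.integer (y : L) := by
      refine ⟨p.map G, hp.map G, ?_⟩
      rw [Polynomial.eval₂_map]
      exact hpy
    exact Valuation.Integers.mem_of_integral (Valuation.integer.integers v) hin
  subst ht
  obtain ⟨ι, hι⟩ := key τ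
  let p : Ideal (closureOfAdjoin E (algebraMap O L τ)) := RingHom.ker (φ.comp ι)
  have hpmem : ∀ y, y ∈ p ↔ φ (ι y) = 0 := fun y => Iff.rfl
  have hp : p.IsPrime := RingHom.ker_isPrime _
  have hιτ : ι (closureGen E _) = τ := hinj (hι _)
  have hτp : closureGen E (algebraMap O L τ) ∈ p := by rw [hpmem, hιτ, hτ]
  have hg0 : closureGen E (algebraMap O L τ) ≠ 0 := fun h => ht0 (congrArg Subtype.val h)
  have hp0 : p ≠ ⊥ := fun h => hg0 (by simpa [h] using hτp)
  have hpmax : p.IsMaximal := hp.isMaximal hp0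
  let pv : HeightOneSpectrum (closureOfAdjoin E (algebraMap O L τ)) := ⟨p, hp, hp0⟩
  -- Write `(τ) = p J`. As `τ` is not in the square of the maximal ideal, `J` is prime to `p` and
  -- contains an element `b` with the value `1` in `K`.
  obtain ⟨J, hJ⟩ := Ideal.dvd_span_singleton.2 hτp
  have hJp : ¬ J ≤ p := by
    intro h
    have h1 : closureGen E (algebraMap O L τ) ∈ p ^ 2 := by
      rw [sq]
      refine Ideal.mul_mono_right h ?_
      rw [← hJ]; exact Ideal.mem_span_singleton_self _
    have h2 := Ideal.le_comap_pow (ι : closureOfAdjoin E (algebraMap O L τ) →+* O)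
      (K := RingHom.ker φ) 2 (show _ ∈ (Ideal.comap _ (RingHom.ker φ)) ^ 2 from h1)
    rw [Ideal.mem_comap] at h2
    exact hτ2 (hιτ ▸ h2)
  obtain ⟨b, hbJ, hb1⟩ : ∃ b ∈ J, φ (ι b) = 1 := by
    have h : p ⊔ J = ⊤ := hpmax.1.2 _ (left_lt_sup.2 hJp)
    have h1 : (1 : closureOfAdjoin E (algebraMap O L τ)) ∈ p ⊔ J := h ▸ Submodule.mem_top
    obtain ⟨a, ha, b, hb, hab⟩ := Submodule.mem_sup.1 h1
    refine ⟨b, hb, ?_⟩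
    have := congrArg (fun y => φ (ι y)) hab
    simp only [map_add, map_one] at this
    rw [(hpmem a).1 ha, zero_add] at this
    exact this
  obtain ⟨β, hβ⟩ : ∃ β, β = ι b := ⟨_, rfl⟩
  have hβL : algebraMap O L β = b := by rw [hβ, hι]
  rw [← hβ] at hb1
  obtain ⟨u₁, hu₁⟩ := hunit β (by rw [hb1]; exact one_ne_zero)
  obtain ⟨u₂, hu₂⟩ := hunit (β ^ 2 + τ) (by simp [hb1, hτ])
  -- The parameter `w` with `1 / w = 1 / τ + 1 / b²`. At the zeros of `τ` other than `p`, the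
  -- element `b` vanishes at least to the order of `τ`, so that the pole of `1 / b²` dominates and
  -- `w` has even order. At `p`, the order of `w` is one.
  obtain ⟨w, hw⟩ : ∃ w : O, w * (β ^ 2 + τ) = τ * β ^ 2 :=
    ⟨τ * β ^ 2 * (u₂⁻¹ : Oˣ), by rw [← hu₂, mul_assoc, Units.inv_mul, mul_one]⟩
  have hwφ : φ w = 0 := by
    have := congrArg φ hw
    simpa [hb1, hτ] using this
  have hw2 : w ∉ RingHom.ker φ ^ 2 := by
    intro h
    apply hτ2
    have : τ = w * ((β ^ 2 + τ) * (u₁⁻¹ : Oˣ) ^ 2) := by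
      rw [← mul_assoc, hw, mul_assoc, ← mul_pow, ← hu₁, Units.mul_inv, one_pow, mul_one]
    rw [this]
    exact Ideal.mul_mem_right _ _ h
  have hw0 : w ≠ 0 := by rintro rfl; exact hw2 (zero_mem _)
  have hwtr := transcendental_of_map_eq_zero (L := L) φ hwφ hw0
  have := hfin _ hwtr
  have hD' := isDedekindDomain_closureOfAdjoin (E := E) (algebraMap O L w)
  have hF' := isFractionRing_closureOfAdjoin (E := E) (algebraMap O L w)
  have hfin' := finite_closureOfAdjoin (E := E) (algebraMap O L w)
  have hPID := isPrincipalIdealRing_adjoin_singleton (E := E) (algebraMap O L w)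
  refine ⟨algebraMap O L w, hwtr, ?_⟩
  rw [← finrank_closureOfAdjoin]
  obtain ⟨ι', hι'⟩ := key w
  let q : Ideal (closureOfAdjoin E (algebraMap O L w)) := RingHom.ker (φ.comp ι')
  have hqmem : ∀ y, y ∈ q ↔ φ (ι' y) = 0 := fun y => Iff.rfl
  have hq : q.IsPrime := RingHom.ker_isPrime _
  have hιw : ι' (closureGen E _) = w := hinj (hι' _)
  have hwq : closureGen E (algebraMap O L w) ∈ q := by rw [hqmem, hιw, hwφ]
  have hwL0 : algebraMap O L w ≠ 0 := by rw [Ne, map_eq_zero_iff _ hinj]; exact hw0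
  have hg0' : closureGen E (algebraMap O L w) ≠ 0 := fun h => hwL0 (congrArg Subtype.val h)
  have hq0 : q ≠ ⊥ := fun h => hg0' (by simpa [h] using hwq)
  have hqmax : q.IsMaximal := hq.isMaximal hq0
  let qv : HeightOneSpectrum (closureOfAdjoin E (algebraMap O L w)) := ⟨q, hq, hq0⟩
  refine odd_finrank_of_odd_place (E := E) (L := L) ⟨_, Algebra.self_mem_adjoin_singleton E _⟩
    (fun h => hwL0 (congrArg Subtype.val h)) (exists_sub_mem_span_adjoin _) qv hwq ?_ ?_ ?_
  · intro h1
    have h2 := Ideal.le_comap_pow (ι' : closureOfAdjoin E (algebraMap O L w) →+* O)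
      (K := RingHom.ker φ) 2 (show _ ∈ (Ideal.comap _ (RingHom.ker φ)) ^ 2 from h1)
    rw [Ideal.mem_comap] at h2
    exact hw2 (hιw ▸ h2)
  · exact odd_finrank_quotient_ker (φ.comp ι') hqmax hodd
  · intro v hv hne
    obtain ⟨u, hu⟩ : ∃ u, u = v.valuation L := ⟨_, rfl⟩
    refine ⟨algebraMap O L β, ?_⟩
    change v.valuation L (algebraMap O L w) = _
    rw [← hu]
    have huE : ∀ c : E, u (algebraMap E L c) ≤ 1 := fun c => by
      rw [hu]
      exact v.valuation_le_one (algebraMap E (closureOfAdjoin E (algebraMap O L w)) c)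
    have huw : u (algebraMap O L w) < 1 := by
      rw [hu]
      exact (v.valuation_lt_one_iff_mem (closureGen E (algebraMap O L w))).2 hv
    have hrel : u (algebraMap O L w) * u (algebraMap O L β ^ 2 + algebraMap O L τ) =
        u (algebraMap O L τ) * u (algebraMap O L β) ^ 2 := by
      rw [← map_pow u, ← map_mul u, ← map_mul u]
      congr 1
      have := congrArg (algebraMap O L) hw
      simpa using this
    have hut0 : u (algebraMap O L τ) ≠ 0 := by rwa [Ne, map_eq_zero]
    have hub0 : u (algebraMap O L β) ≠ 0 := by
      rw [Ne, map_eq_zero, map_eq_zero_iff _ hinj]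
      exact hu₁ ▸ u₁.ne_zero
    -- If the pole of `1 / b²` is the larger one, then `w` and `b²` have the same value.
    by_cases hlt : u (algebraMap O L β) ^ 2 < u (algebraMap O L τ)
    · rw [← map_pow] at hlt
      rw [Valuation.map_add_eq_of_lt_right u hlt, mul_comm] at hrel
      exact mul_left_cancel₀ hut0 hrel
    -- Otherwise `τ` has value less than one, and `v` lies over the zero `p` of `τ`, since `b` is
    -- divisible by `τ` at all other ones. Hence `v = q`.
    exfalso
    rw [not_lt] at hlt
    have hut1 : u (algebraMap O L τ) < 1 := by
      have h1 : u (algebraMap O L β ^ 2 + algebraMap O L τ) ≤ u (algebraMap O L β) ^ 2 := by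
        refine (u.map_add _ _).trans (max_le (map_pow u _ 2).le hlt)
      have h2 := mul_le_mul_right h1 (u (algebraMap O L w))
      rw [hrel] at h2
      exact (le_of_mul_le_mul_right h2 (pow_pos (zero_lt_iff.2 hub0) 2)).trans_lt huw
    have hB := hval _ u huE hut1.le
    have hpu : ∀ y, y ∈ p → u y < 1 := by
      intro y hy
      refine lt_of_le_of_ne (hB y) fun hy1 => ?_
      have h1 : y * b ∈ p * J := Ideal.mul_mem_mul hy hbJ
      rw [← hJ, Ideal.mem_span_singleton'] at h1
      obtain ⟨c, hc⟩ := h1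
      have h2 : (c : L) * algebraMap O L τ = y * b := congrArg Subtype.val hc
      have h3 := congrArg u h2
      rw [map_mul, map_mul, hy1, one_mul, ← hβL] at h3
      have h4 : u (algebraMap O L β) ≤ u (algebraMap O L τ) := by
        rw [← h3]; exact mul_le_of_le_one_left' (hB c)
      have h5 : u (algebraMap O L β) ^ 2 ≤ u (algebraMap O L τ) ^ 2 := pow_le_pow_left' h4 2
      have h6 : u (algebraMap O L τ) ^ 2 < u (algebraMap O L τ) := by
        rw [sq]
        exact mul_lt_of_lt_one_left (zero_lt_iff.2 hut0) hut1
      exact absurd (hlt.trans h5) (not_le.2 h6)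
    have hpu' : ∀ y, y ∉ p → u y = 1 := by
      intro y hy
      refine le_antisymm (hB y) (not_lt.1 fun hlt => ?_)
      obtain ⟨y', i, hi, hyi⟩ := hpmax.exists_inv hy
      have h1 : (y' : L) * y + i = 1 := congrArg Subtype.val hyi
      have h2 : u ((y' : L) * y + i) < 1 := by
        refine (u.map_add_lt ?_ (hpu i hi))
        rw [map_mul]
        exact mul_lt_one_of_nonneg_of_lt_one_right (hB y') zero_le hlt
      rw [h1, map_one] at h2
      exact lt_irrefl _ h2
    apply hne
    have hvq : v.asIdeal ≤ q := by
      intro s hs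
      have hus : u s < 1 := by
        rw [hu]; exact (v.valuation_lt_one_iff_mem s).2 hs
      obtain ⟨n, ⟨d, hd⟩, h | h⟩ := pv.exists_primeCompl_mul_eq_or_mul_eq (K := L) (s : L)
      · have h' : (s : L) * d = n := h
        have hn : u n < 1 := by
          rw [← h', map_mul, hpu' d hd, mul_one]; exact hus
        have hnp : n ∈ p := by
          by_contra hnp
          exact hn.ne (hpu' n hnp)
        have h2 : ι' s * ι d = ι n := hinj (by rw [map_mul, hι', hι, hι, h'])
        have h3 := congrArg φ h2
        rw [map_mul, (hpmem n).1 hnp] at h3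
        exact (mul_eq_zero.1 h3).resolve_right hd
      · have h' : (s : L) * n = d := h
        have h2 : u d < 1 := by
          rw [← h', map_mul]
          exact mul_lt_one_of_nonneg_of_lt_one_left zero_le hus (hB n)
        exact absurd (hpu' d hd) h2.ne
    exact HeightOneSpectrum.ext (v.isMaximal.eq_of_le hqmax.ne_top hvq)

end OddDegree

/-! ### Evaluation of weighted homogeneous polynomials -/

section Scaling

/-- Evaluating a weighted homogeneous polynomial of degree `n` at coordinates scaled by a character
`χ` of the grading monoid multiplies its value by `χ n`. -/
theorem aeval_mul_of_isWeightedHomogeneous {σ M R A : Type*} [AddCommMonoid M] [CommSemiring R]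
    [CommSemiring A] [Algebra R A] {w : σ → M} {φ : MvPolynomial σ R} {n : M}
    (h : IsWeightedHomogeneous w φ n) (χ : Multiplicative M →* A) (x : σ → A) :
    aeval (fun i => χ (.ofAdd (w i)) * x i) φ = χ (.ofAdd n) * aeval x φ := by
  rw [aeval_def, aeval_def, eval₂_eq, eval₂_eq, Finset.mul_sum]
  refine Finset.sum_congr rfl fun d hd => ?_
  have hw := h (mem_support_iff.1 hd)
  have hχ : ∏ i ∈ d.support, χ (.ofAdd (w i)) ^ d i = χ (.ofAdd n) := by
    rw [← hw, Finsupp.weight_apply, Finsupp.sum, ofAdd_sum, map_prod]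
    refine Finset.prod_congr rfl fun i _ => ?_
    rw [ofAdd_nsmul, map_pow]
  simp only [mul_pow]
  rw [Finset.prod_mul_distrib, hχ]
  ring

theorem IsHomogeneous.aeval_const_mul {σ R A : Type*} [CommSemiring R]
    [CommSemiring A] [Algebra R A] {φ : MvPolynomial σ R} {n : ℕ}
    (h : φ.IsHomogeneous n) (s : A) (x : σ → A) :
    aeval (fun i => s * x i) φ = s ^ n * aeval x φ := by
  have := aeval_mul_of_isWeightedHomogeneous h (powersHom A s) x
  simpa [powersHom_apply] using this

/-- The character `(i, j) ↦ sⁱ tʲ`. -/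
def biChar {A : Type*} [CommSemiring A] (s t : A) : Multiplicative (ℕ × ℕ) →* A where
  toFun e := s ^ e.toAdd.1 * t ^ e.toAdd.2
  map_one' := by simp
  map_mul' a b := by simp only [toAdd_mul, Prod.fst_add, Prod.snd_add, pow_add]; ring

/-- The bigrading of the coordinate ring of a product of two affine cones. -/
def sumWeight (κ ν : Type*) : κ ⊕ ν → ℕ × ℕ := Sum.elim (fun _ => (1, 0)) (fun _ => (0, 1))

theorem aeval_biscale {κ ν R A : Type*} [CommSemiring R] [CommSemiring A] [Algebra R A]
    {G : MvPolynomial (κ ⊕ ν) R} {e : ℕ × ℕ}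
    (h : IsWeightedHomogeneous (sumWeight κ ν) G e) (s t : A) (x : κ → A) (y : ν → A) :
    aeval (Sum.elim (fun i => s * x i) (fun j => t * y j)) G =
      s ^ e.1 * t ^ e.2 * aeval (Sum.elim x y) G := by
  have := aeval_mul_of_isWeightedHomogeneous h (biChar s t) (Sum.elim x y)
  have h2 : (fun i => biChar s t (.ofAdd (sumWeight κ ν i)) * Sum.elim x y i) =
      Sum.elim (fun i => s * x i) (fun j => t * y j) := by
    funext i
    cases i <;> simp [biChar, sumWeight]
  rw [h2] at this
  simpa [biChar] using this

end Scaling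

/-! ### Rational function fields and rational maps -/

section FunctionField

theorem aeval_fun_algebraMap {σ A B : Type*} [CommRing A] [CommRing B]
    [Algebra ℂ A] [Algebra A B] [Algebra ℂ B] [IsScalarTower ℂ A B] (x : σ → A)
    (p : MvPolynomial σ ℂ) :
    aeval (fun i => algebraMap A B (x i)) p = algebraMap A B (aeval x p) :=
  aeval_algebraMap_apply (B := B) x p

theorem aeval_fun_algHom {σ A B : Type*} [CommRing A] [CommRing B]
    [Algebra ℂ A] [Algebra ℂ B] (f : A →ₐ[ℂ] B) (x : σ → A) (p : MvPolynomial σ ℂ) :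
    aeval (fun i => f (x i)) p = f (aeval x p) :=
  (comp_aeval_apply x f p).symm

/-- A finite family in the function field of `ℙᴺ` can be written with a common denominator. -/
theorem exists_common_denominator {N : ℕ} {κ : Type*} [Finite κ]
    (a : κ → FractionRing (MvPolynomial (Fin (N + 1)) ℂ)) (ha : ∀ i, a i ∈ projFunctionField N) :
    ∃ (e : ℕ) (D : MvPolynomial (Fin (N + 1)) ℂ) (f : κ → MvPolynomial (Fin (N + 1)) ℂ),
      D ≠ 0 ∧ D.IsHomogeneous e ∧ (∀ i, (f i).IsHomogeneous e) ∧
      ∀ i, algebraMap _ (FractionRing (MvPolynomial (Fin (N + 1)) ℂ)) (f i) =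
        algebraMap _ (FractionRing (MvPolynomial (Fin (N + 1)) ℂ)) D * a i := by
  classical
  have := Fintype.ofFinite κ
  choose e G H hG hH h0 ha using ha
  simp only [AlgHom.coe_id, id_eq] at h0 ha
  refine ⟨∑ i, e i, ∏ i, H i, fun i => G i * ∏ j ∈ Finset.univ.erase i, H j, ?_, ?_, ?_, ?_⟩
  · exact Finset.prod_ne_zero_iff.2 fun i _ => h0 i
  · exact IsHomogeneous.prod _ _ _ fun i _ => hH i
  · intro i
    rw [← Finset.add_sum_erase _ _ (Finset.mem_univ i)]
    exact IsHomogeneous.mul (hG i) (IsHomogeneous.prod _ _ _ fun i _ => hH i)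
  · intro i
    have h1 : algebraMap _ (FractionRing (MvPolynomial (Fin (N + 1)) ℂ)) (H i) ≠ 0 := by
      simpa using h0 i
    rw [ha i, ← Finset.mul_prod_erase _ _ (Finset.mem_univ i), map_mul, map_mul]
    field_simp

/-- `L` is a purely transcendental extension of `ℂ` of transcendence degree `N`. -/
def IsRationalFunctionField (N : ℕ) (L : Type) [Field L] [Algebra ℂ L] : Prop :=
  ∃ x : Fin N → L, AlgebraicIndependent ℂ x ∧ IntermediateField.adjoin ℂ (Set.range x) = ⊤

theorem isAlgebraic_algebra_adjoin {L : Type} [Field L] [Algebra ℂ L] (S : Set L)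
    [Algebra.IsAlgebraic (IntermediateField.adjoin ℂ S) L] :
    Algebra.IsAlgebraic (Algebra.adjoin ℂ S) L := by
  open scoped IntermediateField.algebraAdjoinAdjoin in
  exact Algebra.IsAlgebraic.trans _ (IntermediateField.adjoin ℂ S) _

theorem isAlgebraic_of_adjoin_eq_top {L : Type} [Field L] [Algebra ℂ L] {S : Set L}
    (htop : IntermediateField.adjoin ℂ S = ⊤) :
    Algebra.IsAlgebraic (IntermediateField.adjoin ℂ S) L := by
  rw [htop]
  exact ⟨fun y => isAlgebraic_algebraMap (⟨y, trivial⟩ : (⊤ : IntermediateField ℂ L))⟩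

theorem IsRationalFunctionField.trdeg_eq {N : ℕ} {L : Type} [Field L] [Algebra ℂ L]
    (h : IsRationalFunctionField N L) : Algebra.trdeg ℂ L = N := by
  obtain ⟨x, hx, htop⟩ := h
  have hb : IsTranscendenceBasis ℂ x := by
    have := isAlgebraic_of_adjoin_eq_top htop
    exact hx.isTranscendenceBasis_iff_isAlgebraic.2 (isAlgebraic_algebra_adjoin _)
  simpa using hb.cardinalMk_eq_trdeg.symm

/-- A finite family which generates, up to an algebraic extension, a field whose transcendence
degree is the number of its members is algebraically independent. -/
theorem algebraicIndependent_of_isAlgebraic {ι L : Type} [Field L] [Algebra ℂ L] [Fintype ι]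
    (x : ι → L) (htr : Algebra.trdeg ℂ L = Fintype.card ι)
    [Algebra.IsAlgebraic (IntermediateField.adjoin ℂ (Set.range x)) L] :
    AlgebraicIndependent ℂ x := by
  have := isAlgebraic_algebra_adjoin (Set.range x)
  refine (Algebra.IsAlgebraic.isTranscendenceBasis_of_le_trdeg_of_finite ℂ x ?_).1
  rw [htr]; simp

theorem algebraicIndependent_of_adjoin_eq_top {ι L : Type} [Field L] [Algebra ℂ L] [Fintype ι]
    (x : ι → L) (htr : Algebra.trdeg ℂ L = Fintype.card ι)
    (htop : IntermediateField.adjoin ℂ (Set.range x) = ⊤) :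
    AlgebraicIndependent ℂ x := by
  have := isAlgebraic_of_adjoin_eq_top htop
  exact algebraicIndependent_of_isAlgebraic x htr

theorem isRationalFunctionField_of_trdeg {N : ℕ} {ι L : Type} [Field L] [Algebra ℂ L] [Fintype ι]
    (hN : Fintype.card ι = N)
    (x : ι → L) (htr : Algebra.trdeg ℂ L = N)
    (htop : IntermediateField.adjoin ℂ (Set.range x) = ⊤) :
    IsRationalFunctionField N L := by
  let e : Fin N ≃ ι := (Fintype.equivFinOfCardEq hN).symm
  refine ⟨x ∘ e, ?_, by rw [e.surjective.range_comp, htop]⟩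
  exact (algebraicIndependent_of_adjoin_eq_top x (by rw [htr, hN]) htop).comp e e.injective

theorem trdeg_fractionRing_mvPolynomial (ι : Type) [Fintype ι] :
    Algebra.trdeg ℂ (FractionRing (MvPolynomial ι ℂ)) = Fintype.card ι := by
  have h1 := trdeg_add_eq ℂ (MvPolynomial ι ℂ) (A := FractionRing (MvPolynomial ι ℂ))
  have h2 : Algebra.trdeg (MvPolynomial ι ℂ) (FractionRing (MvPolynomial ι ℂ)) = 0 := by
    have : Algebra.IsAlgebraic (MvPolynomial ι ℂ) (FractionRing (MvPolynomial ι ℂ)) :=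
      IsLocalization.isAlgebraic _ (nonZeroDivisors (MvPolynomial ι ℂ))
    exact trdeg_eq_zero
  rw [← h1, h2, add_zero, MvPolynomial.trdeg_of_isDomain]
  simp

theorem adjoin_range_X_fractionRing (ι : Type) :
    IntermediateField.adjoin ℂ (Set.range fun i : ι =>
      algebraMap (MvPolynomial ι ℂ) (FractionRing (MvPolynomial ι ℂ)) (X i)) = ⊤ := by
  refine eq_top_iff.2 fun z _ => ?_
  have hp : ∀ p : MvPolynomial ι ℂ, algebraMap (MvPolynomial ι ℂ) (FractionRing (MvPolynomial ι ℂ)) p ∈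
      IntermediateField.adjoin ℂ (Set.range fun i : ι =>
        algebraMap (MvPolynomial ι ℂ) (FractionRing (MvPolynomial ι ℂ)) (X i)) := by
    intro p
    induction p using MvPolynomial.induction_on with
    | C a => exact IntermediateField.algebraMap_mem _ a
    | add p q hp hq => rw [map_add]; exact add_mem hp hq
    | mul_X p i hp =>
      rw [map_mul]; exact mul_mem hp (IntermediateField.subset_adjoin _ _ ⟨i, rfl⟩)
  obtain ⟨a, b, hb, rfl⟩ := IsFractionRing.div_surjective (A := MvPolynomial ι ℂ) z
  exact div_mem (hp a) (hp b)

theorem isRationalFunctionField_fractionRing {N : ℕ} (ι : Type) [Fintype ι]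
    (hN : Fintype.card ι = N) :
    IsRationalFunctionField N (FractionRing (MvPolynomial ι ℂ)) :=
  isRationalFunctionField_of_trdeg hN _ (by rw [trdeg_fractionRing_mvPolynomial, hN])
    (adjoin_range_X_fractionRing ι)

/-- The function field of `ℙᴺ` is generated by the `N` affine coordinates `Xᵢ / X₀`. -/
theorem projFunctionField_eq_adjoin (N : ℕ) :
    projFunctionField N = IntermediateField.adjoin ℂ (Set.range fun i : Fin N =>
      algebraMap _ (FractionRing (MvPolynomial (Fin (N + 1)) ℂ)) (X (R := ℂ) i.succ) /
        algebraMap _ (FractionRing (MvPolynomial (Fin (N + 1)) ℂ)) (X (R := ℂ) (0 : Fin (N + 1)))) := by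
  have hX0 : algebraMap _ (FractionRing (MvPolynomial (Fin (N + 1)) ℂ)) (X (R := ℂ) (0 : Fin (N + 1))) ≠ 0 := by
    simp [X_ne_zero]
  apply le_antisymm
  · rintro z ⟨e, G, H, hG, hH, h0, rfl⟩
    set A := IntermediateField.adjoin ℂ (Set.range fun i : Fin N =>
      algebraMap _ (FractionRing (MvPolynomial (Fin (N + 1)) ℂ)) (X (R := ℂ) i.succ) /
        algebraMap _ (FractionRing (MvPolynomial (Fin (N + 1)) ℂ)) (X (R := ℂ) (0 : Fin (N + 1)))) with hA
    let y : Fin (N + 1) → A := Fin.cons 1 fun i => ⟨_, IntermediateField.subset_adjoin _ _ ⟨i, rfl⟩⟩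
    have key : ∀ P : MvPolynomial (Fin (N + 1)) ℂ, P.IsHomogeneous e →
        algebraMap _ (FractionRing (MvPolynomial (Fin (N + 1)) ℂ)) P =
        algebraMap _ (FractionRing (MvPolynomial (Fin (N + 1)) ℂ)) (X (R := ℂ) (0 : Fin (N + 1))) ^ e * (aeval y P : A) := by
      intro P hP
      have h1 := IsHomogeneous.aeval_const_mul hP
        (algebraMap _ (FractionRing (MvPolynomial (Fin (N + 1)) ℂ)) (X (R := ℂ) (0 : Fin (N + 1)))) (fun i => (y i : FractionRing (MvPolynomial (Fin (N + 1)) ℂ)))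
      have h2 : (fun i => algebraMap _ (FractionRing (MvPolynomial (Fin (N + 1)) ℂ)) (X (R := ℂ) (0 : Fin (N + 1))) *
          (y i : FractionRing (MvPolynomial (Fin (N + 1)) ℂ))) =
          fun i => algebraMap _ (FractionRing (MvPolynomial (Fin (N + 1)) ℂ)) (X (R := ℂ) i) := by
        funext i
        refine Fin.cases ?_ (fun i => ?_) i
        · simp [y]
        · simp only [y, Fin.cons_succ]
          field_simp
      rw [h2] at h1
      have h3 : aeval (fun i => (y i : FractionRing (MvPolynomial (Fin (N + 1)) ℂ))) P =
          ((aeval y P : A) : FractionRing (MvPolynomial (Fin (N + 1)) ℂ)) :=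
        aeval_algebraMap_apply (B := FractionRing (MvPolynomial (Fin (N + 1)) ℂ)) y P
      rw [← h3, ← h1, aeval_fun_algebraMap, aeval_X_left_apply]
    simp only [AlgHom.coe_id, id_eq] at h0 ⊢
    rw [key G hG, key H hH, mul_div_mul_left _ _ (pow_ne_zero e hX0)]
    exact div_mem (SetLike.coe_mem _) (SetLike.coe_mem _)
  · refine IntermediateField.adjoin_le_iff.2 ?_
    rintro _ ⟨i, rfl⟩
    exact ⟨1, X i.succ, X 0, isHomogeneous_X _ _, isHomogeneous_X _ _, X_ne_zero _, rfl⟩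

theorem IsRationalFunctionField.exists_algHom {N : ℕ} {L : Type} [Field L] [Algebra ℂ L]
    (h : IsRationalFunctionField N L) :
    ∃ j : L →ₐ[ℂ] FractionRing (MvPolynomial (Fin (N + 1)) ℂ),
      j.fieldRange = projFunctionField N := by
  obtain ⟨x, hx, htop⟩ := h
  let y : Fin N → FractionRing (MvPolynomial (Fin (N + 1)) ℂ) := fun i =>
    algebraMap _ (FractionRing (MvPolynomial (Fin (N + 1)) ℂ)) (X (R := ℂ) i.succ) /
        algebraMap _ (FractionRing (MvPolynomial (Fin (N + 1)) ℂ)) (X (R := ℂ) (0 : Fin (N + 1)))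
  let y0 := algebraMap _ (FractionRing (MvPolynomial (Fin (N + 1)) ℂ)) (X (R := ℂ) (0 : Fin (N + 1)))
  have hX0 : y0 ≠ 0 := by simp [y0, X_ne_zero]
  have hy : AlgebraicIndependent ℂ y := by
    have h1 : AlgebraicIndependent ℂ (Fin.cons y0 y : Fin (N + 1) → _) := by
      refine algebraicIndependent_of_adjoin_eq_top _ (trdeg_fractionRing_mvPolynomial _) ?_
      rw [eq_top_iff, ← adjoin_range_X_fractionRing, IntermediateField.adjoin_le_iff]
      rintro _ ⟨i, rfl⟩
      have h0 := IntermediateField.subset_adjoin ℂ (Set.range (Fin.cons y0 y : Fin (N + 1) → _)) ⟨0, rfl⟩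
      refine Fin.cases ?_ (fun i => ?_) i
      · simpa using h0
      · have h1 := IntermediateField.subset_adjoin ℂ (Set.range (Fin.cons y0 y : Fin (N + 1) → _)) ⟨i.succ, rfl⟩
        have h2 := mul_mem h0 h1
        simp only [Fin.cons_zero, Fin.cons_succ] at h2
        have h3 : y0 * y i = algebraMap _ (FractionRing (MvPolynomial (Fin (N + 1)) ℂ)) (X (R := ℂ) i.succ) := by
          simp only [y]
          exact mul_div_cancel₀ _ hX0
        rw [h3] at h2
        exact h2
    have h2 := h1.comp Fin.succ (Fin.succ_injective N)
    exact h2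
  let e1 := hx.aevalEquivField.symm
  let e2 := hy.aevalEquivField
  let e0 : L ≃ₐ[ℂ] IntermediateField.adjoin ℂ (Set.range x) :=
    (IntermediateField.topEquiv.symm).trans (IntermediateField.equivOfEq htop.symm)
  let e : L ≃ₐ[ℂ] IntermediateField.adjoin ℂ (Set.range y) := (e0.trans e1).trans e2
  refine ⟨(IntermediateField.val _).comp e.toAlgHom, ?_⟩
  rw [projFunctionField_eq_adjoin]
  apply SetLike.ext
  intro z
  constructor
  · rintro ⟨w, rfl⟩
    exact (e w).2
  · intro hz
    exact ⟨e.symm ⟨z, hz⟩, by simp⟩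

/-- A dominant rational map of degree `d` from a point of `{F = 0} × ℙᵇ` over a rational function
field `L` whose coordinates generate a subfield of codegree `d`. The coordinates are normalised: a
linear form takes the value `1` at `α`, and `β 0 = 1`. -/
theorem admitsUnirationalParametrization_of_point {N a b : ℕ}
    {F : MvPolynomial (Fin (a + 1)) ℂ} (hF : F.IsHomogeneous 3)
    {L : Type} [Field L] [Algebra ℂ L] (hL : IsRationalFunctionField N L)
    (α : Fin (a + 1) → L) (β : Fin (b + 1) → L) (c : Fin (a + 1) → ℂ)
    (hα : ∑ i, algebraMap ℂ L (c i) * α i = 1) (hβ : β 0 = 1) (h0 : aeval α F = 0)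
    (hker : ∀ (e : ℕ × ℕ) (G : MvPolynomial (Fin (a + 1) ⊕ Fin (b + 1)) ℂ),
      IsWeightedHomogeneous (sumWeight _ _) G e → aeval (Sum.elim α β) G = 0 →
      ∀ x y, eval x F = 0 → eval (Sum.elim x y) G = 0)
    {d : ℕ} (hd : 0 < d)
    (hdeg : Module.finrank (IntermediateField.adjoin ℂ (Set.range α ∪ Set.range β)) L = d) :
    AdmitsUnirationalParametrization N (projHypersurface F ×ˢ (Set.univ : Set (CProj b))) d := by
  obtain ⟨j, hj⟩ := hL.exists_algHom
  have hinj := IsFractionRing.injective (MvPolynomial (Fin (N + 1)) ℂ)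
    (FractionRing (MvPolynomial (Fin (N + 1)) ℂ))
  obtain ⟨e₁, D₁, f, hD₁, hD₁h, hfh, hf⟩ := exists_common_denominator (fun i => j (α i))
    fun i => hj ▸ ⟨α i, rfl⟩
  obtain ⟨e₂, D₂, g, hD₂, hD₂h, hgh, hg⟩ := exists_common_denominator (fun i => j (β i))
    fun i => hj ▸ ⟨β i, rfl⟩
  have hcf : ∑ i, C (c i) * f i = D₁ := by
    apply hinj
    have h1 := congrArg j hα
    rw [map_sum, map_one] at h1
    rw [map_sum, ← mul_one (algebraMap _ _ D₁), ← h1, Finset.mul_sum]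
    refine Finset.sum_congr rfl fun i _ => ?_
    rw [map_mul, map_mul, hf, AlgHom.commutes, ← MvPolynomial.algebraMap_eq,
      ← IsScalarTower.algebraMap_apply]
    ring
  have hg0 : g 0 = D₂ := by
    apply hinj
    rw [hg, hβ, map_one, mul_one]
  -- bihomogeneous polynomials evaluated at `(f, g)` and at `(α, β)`
  have hval : ∀ (e : ℕ × ℕ) (G : MvPolynomial (Fin (a + 1) ⊕ Fin (b + 1)) ℂ),
      IsWeightedHomogeneous (sumWeight _ _) G e →
      algebraMap _ (FractionRing (MvPolynomial (Fin (N + 1)) ℂ)) (aeval (Sum.elim f g) G) =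
        algebraMap _ (FractionRing (MvPolynomial (Fin (N + 1)) ℂ)) D₁ ^ e.1 *
        algebraMap _ (FractionRing (MvPolynomial (Fin (N + 1)) ℂ)) D₂ ^ e.2 *
          j (aeval (Sum.elim α β) G) := by
    intro e G hG
    have h1 := aeval_biscale hG
      (algebraMap _ (FractionRing (MvPolynomial (Fin (N + 1)) ℂ)) D₁)
      (algebraMap _ (FractionRing (MvPolynomial (Fin (N + 1)) ℂ)) D₂)
      (fun i => j (α i)) (fun i => j (β i))
    have h2 : Sum.elim (fun i => algebraMap _ (FractionRing (MvPolynomial (Fin (N + 1)) ℂ)) D₁ *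
          j (α i)) (fun i => algebraMap _ (FractionRing (MvPolynomial (Fin (N + 1)) ℂ)) D₂ *
          j (β i)) = fun i => algebraMap _ (FractionRing (MvPolynomial (Fin (N + 1)) ℂ))
            (Sum.elim f g i) := by
      funext i
      cases i <;> simp [hf, hg]
    have h3 : Sum.elim (fun i => j (α i)) (fun i => j (β i)) = fun i => j (Sum.elim α β i) := by
      funext i
      cases i <;> rfl
    rw [h2, h3, aeval_fun_algebraMap, aeval_fun_algHom] at h1
    exact h1
  let φ : ProjRatMap N a b :=
    { f := f, g := g, degf := e₁, degg := e₂, homogeneous_f := hfh, homogeneous_g := hgh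
      f_ne_zero := by
        rintro h
        apply hD₁
        rw [← hcf, h]
        simp
      g_ne_zero := by
        rintro h
        apply hD₂
        rw [← hg0, h]
        rfl }
  refine ⟨hd, φ, ⟨?_, ?_⟩, ?_⟩
  · rintro _ ⟨p, hfp, hgp, rfl⟩
    refine ⟨?_, trivial⟩
    obtain ⟨s, hs⟩ := Projectivization.exists_smul_eq_mk_rep ℂ _ hfp
    change eval _ F = 0
    rw [← hs]
    have h1 : aeval f F = 0 := by
      apply hinj
      have h2 := IsHomogeneous.aeval_const_mul hF
        (algebraMap _ (FractionRing (MvPolynomial (Fin (N + 1)) ℂ)) D₁) (fun i => j (α i))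
      simp only [← hf] at h2
      rw [aeval_fun_algebraMap, aeval_fun_algHom, h0, map_zero, mul_zero] at h2
      rw [h2, map_zero]
    have h2 := IsHomogeneous.aeval_const_mul hF (s : ℂ) (fun i => eval p.rep (f i))
    have h3 : aeval (fun i => eval p.rep (f i)) F = 0 := by
      have := comp_aeval_apply f (aeval p.rep) F
      rw [h1, map_zero] at this
      exact this.symm
    rw [h3, mul_zero] at h2
    exact h2
  · intro e G hG hv q hq
    refine hker e G hG ?_ _ _ hq.1
    -- A form which vanishes on the image vanishes at `(f, g)`, as the points with `D₁ D₂ X₀ ≠ 0`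
    -- are in the domain of the rational map.
    have hΦ : aeval (Sum.elim f g) G * (D₁ * D₂ * X 0) = 0 := by
      refine MvPolynomial.funext fun x => ?_
      rw [map_zero, map_mul]
      by_cases h1 : eval x (D₁ * D₂ * X 0) = 0
      · rw [h1, mul_zero]
      have hh : eval x D₁ ≠ 0 ∧ eval x D₂ ≠ 0 ∧ x 0 ≠ 0 := by
        simp only [map_mul, eval_X, mul_eq_zero, not_or] at h1
        tauto
      have hx : x ≠ 0 := fun h => hh.2.2 (congrFun h 0)
      obtain ⟨t, ht⟩ := Projectivization.exists_smul_eq_mk_rep ℂ x hx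
      set p := Projectivization.mk ℂ x hx
      have hscale : ∀ (P : MvPolynomial (Fin (N + 1)) ℂ) (k : ℕ), P.IsHomogeneous k →
          eval p.rep P = (t : ℂ) ^ k * eval x P := by
        intro P k hP
        rw [← ht]
        exact IsHomogeneous.aeval_const_mul hP (t : ℂ) x
      have hfp : (fun i => eval p.rep (f i)) ≠ 0 := by
        intro h
        have h3 : eval p.rep D₁ = 0 := by
          rw [← hcf, map_sum]
          refine Finset.sum_eq_zero fun i _ => ?_
          have h4 : eval p.rep (f i) = 0 := congrFun h i
          rw [map_mul, h4, mul_zero]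
        rw [hscale D₁ e₁ hD₁h] at h3
        exact mul_ne_zero (pow_ne_zero _ t.ne_zero) hh.1 h3
      have hgp : (fun i => eval p.rep (g i)) ≠ 0 := by
        intro h
        have h3 : eval p.rep D₂ = 0 := by
          rw [← hg0]
          exact congrFun h 0
        rw [hscale D₂ e₂ hD₂h] at h3
        exact mul_ne_zero (pow_ne_zero _ t.ne_zero) hh.2.1 h3
      have h3 := hv _ ⟨p, hfp, hgp, rfl⟩
      obtain ⟨s, hs⟩ := Projectivization.exists_smul_eq_mk_rep ℂ _ hfp
      obtain ⟨u, hu⟩ := Projectivization.exists_smul_eq_mk_rep ℂ _ hgp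
      simp only [φ] at h3
      rw [← hs, ← hu] at h3
      have h4 := aeval_biscale hG ((s : ℂ) * (t : ℂ) ^ e₁) ((u : ℂ) * (t : ℂ) ^ e₂)
        (fun i => eval x (f i)) (fun i => eval x (g i))
      have h5 : Sum.elim (fun i => (s : ℂ) * (t : ℂ) ^ e₁ * eval x (f i))
          (fun i => (u : ℂ) * (t : ℂ) ^ e₂ * eval x (g i)) =
          Sum.elim (s • fun i => eval p.rep (f i)) (u • fun i => eval p.rep (g i)) := by
        funext i
        cases i with
        | inl i =>
          simp only [Sum.elim_inl, Pi.smul_apply, hscale _ _ (hfh i), Units.smul_def, smul_eq_mul]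
          ring
        | inr i =>
          simp only [Sum.elim_inr, Pi.smul_apply, hscale _ _ (hgh i), Units.smul_def, smul_eq_mul]
          ring
      rw [h5] at h4
      have h6 : aeval (Sum.elim (fun i => eval x (f i)) fun i => eval x (g i)) G = 0 := by
        refine (mul_eq_zero.1 (h4.symm.trans h3)).resolve_left ?_
        refine mul_ne_zero (pow_ne_zero _ ?_) (pow_ne_zero _ ?_)
        · exact mul_ne_zero s.ne_zero (pow_ne_zero _ t.ne_zero)
        · exact mul_ne_zero u.ne_zero (pow_ne_zero _ t.ne_zero)
      have h7 := comp_aeval_apply (Sum.elim f g) (aeval x) G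
      have h8 : (fun i => aeval x (Sum.elim f g i)) =
          Sum.elim (fun i => eval x (f i)) fun i => eval x (g i) := by
        funext i
        cases i <;> rfl
      rw [h8, h6] at h7
      have h9 : eval x (aeval (Sum.elim f g) G) = 0 := h7
      rw [h9, zero_mul]
    have hΦ0 : aeval (Sum.elim f g) G = 0 :=
      (mul_eq_zero.1 hΦ).resolve_right (mul_ne_zero (mul_ne_zero hD₁ hD₂) (X_ne_zero _))
    have h1 := hval e G hG
    rw [hΦ0, map_zero] at h1
    have hD₁' : algebraMap _ (FractionRing (MvPolynomial (Fin (N + 1)) ℂ)) D₁ ≠ 0 := by simpa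
    have hD₂' : algebraMap _ (FractionRing (MvPolynomial (Fin (N + 1)) ℂ)) D₂ ≠ 0 := by simpa
    have h2 := (mul_eq_zero.1 h1.symm).resolve_left
      (mul_ne_zero (pow_ne_zero _ hD₁') (pow_ne_zero _ hD₂'))
    exact (map_eq_zero j).1 h2
  · have hD₁' : algebraMap _ (FractionRing (MvPolynomial (Fin (N + 1)) ℂ)) D₁ ≠ 0 := by simpa
    have hD₂' : algebraMap _ (FractionRing (MvPolynomial (Fin (N + 1)) ℂ)) D₂ ≠ 0 := by simpa
    -- With the linear form `c` and with the coordinate `0` as denominators, the coordinates `α` and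
    -- `β` are pullbacks of rational functions.
    have hE : φ.pullbackField =
        (IntermediateField.adjoin ℂ (Set.range α ∪ Set.range β)).map j := by
      apply le_antisymm
      · rintro z ⟨e, G, H, hG, hH, h0, rfl⟩
        have hmem : ∀ P : MvPolynomial (Fin (a + 1) ⊕ Fin (b + 1)) ℂ, aeval (Sum.elim α β) P ∈
            IntermediateField.adjoin ℂ (Set.range α ∪ Set.range β) := by
          intro P
          let γ : Fin (a + 1) ⊕ Fin (b + 1) →
              IntermediateField.adjoin ℂ (Set.range α ∪ Set.range β) := fun i =>
            ⟨Sum.elim α β i, IntermediateField.subset_adjoin _ _ (by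
              cases i with
              | inl i => exact Or.inl ⟨i, rfl⟩
              | inr i => exact Or.inr ⟨i, rfl⟩)⟩
          have h1 : aeval (fun i => (γ i : L)) P = ((aeval γ P : _) : L) :=
            aeval_algebraMap_apply (B := L) γ P
          have h2 : (fun i => (γ i : L)) = Sum.elim α β := rfl
          rw [← h2, h1]
          exact (aeval γ P).2
        have h1 := hval e G hG
        have h2 := hval e H hH
        change algebraMap _ _ (aeval (Sum.elim f g) G) / algebraMap _ _ (aeval (Sum.elim f g) H) ∈ _
        rw [h1, h2, mul_div_mul_left _ _ (mul_ne_zero (pow_ne_zero _ hD₁') (pow_ne_zero _ hD₂')),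
          ← map_div₀]
        exact ⟨_, IntermediateField.div_mem _ (hmem G) (hmem H), rfl⟩
      · rw [IntermediateField.adjoin_map, IntermediateField.adjoin_le_iff]
        rintro _ ⟨z, hz | hz, rfl⟩
        · obtain ⟨i, rfl⟩ := hz
          have hlin : aeval (Sum.elim φ.f φ.g) (∑ k, C (c k) * X (Sum.inl k)) = D₁ := by
            rw [← hcf, map_sum]
            refine Finset.sum_congr rfl fun k _ => ?_
            rw [map_mul, aeval_X, ← MvPolynomial.algebraMap_eq, AlgHom.commutes]
            rfl
          refine ⟨(1, 0), X (Sum.inl i), ∑ k, C (c k) * X (Sum.inl k),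
            isWeightedHomogeneous_X _ _ _, ?_, ?_, ?_⟩
          · refine IsWeightedHomogeneous.sum _ _ _ fun k _ => ?_
            rw [← zero_add ((1, 0) : ℕ × ℕ)]
            exact (isWeightedHomogeneous_C _ _).mul (isWeightedHomogeneous_X _ _ (Sum.inl k))
          · rw [hlin]; exact hD₁
          · rw [hlin, aeval_X]
            simp only [Sum.elim_inl, φ, hf]
            exact (mul_div_cancel_left₀ _ hD₁').symm
        · obtain ⟨i, rfl⟩ := hz
          refine ⟨(0, 1), X (Sum.inr i), X (Sum.inr 0),
            isWeightedHomogeneous_X _ _ _, isWeightedHomogeneous_X _ _ _, ?_, ?_⟩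
          · simpa [φ, hg0] using hD₂
          · rw [aeval_X, aeval_X]
            simp only [Sum.elim_inr, φ, hg, hβ, map_one, mul_one]
            exact (mul_div_cancel_left₀ _ hD₂').symm
    have hT : projFunctionField N = (⊤ : IntermediateField ℂ L).map j := by
      rw [← hj, AlgHom.fieldRange_eq_map]
    change IntermediateField.relfinrank φ.pullbackField (projFunctionField N) = d
    rw [hE, hT, IntermediateField.relfinrank_map_map, IntermediateField.relfinrank_top_right, hdeg]

end FunctionField

/-! ### Polars of cubic forms and third intersection points -/

section Polar

variable {ι : Type*} [Fintype ι]

/-- The first polar `∑ yᵢ ∂ᵢF(x)` of a form `F`. -/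
def polar (F : MvPolynomial ι ℂ) {A : Type*} [CommRing A] [Algebra ℂ A] (x y : ι → A) : A :=
  ∑ i, y i * aeval x (pderiv i F)

variable {A B : Type*} [CommRing A] [Algebra ℂ A] [CommRing B] [Algebra ℂ B]

theorem polar_add_left (F G : MvPolynomial ι ℂ) (x y : ι → A) :
    polar (F + G) x y = polar F x y + polar G x y := by
  simp only [polar, map_add, mul_add, Finset.sum_add_distrib]

theorem polar_mul (F G : MvPolynomial ι ℂ) (x y : ι → A) :
    polar (F * G) x y = aeval x F * polar G x y + aeval x G * polar F x y := by
  simp only [polar, Finset.mul_sum, ← Finset.sum_add_distrib]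
  refine Finset.sum_congr rfl fun i _ => ?_
  rw [Derivation.leibniz]
  simp only [smul_eq_mul, map_add, map_mul]
  ring

theorem polar_X (j : ι) (x y : ι → A) : polar (X j) x y = y j := by
  classical
  simp [polar, pderiv_X, Pi.single_apply]

theorem polar_C (c : ℂ) (x y : ι → A) : polar (C c) x y = 0 := by
  simp [polar]

theorem map_polar (F : MvPolynomial ι ℂ) (φ : A →ₐ[ℂ] B) (x y : ι → A) :
    φ (polar F x y) = polar F (fun i => φ (x i)) (fun i => φ (y i)) := by
  simp only [polar, map_sum, map_mul, aeval_fun_algHom]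

omit [Fintype ι] in
theorem exists_monomial_eq_X_mul {n : ℕ} {d : ι →₀ ℕ} (hd : d.degree = n + 1) :
    ∃ (i : ι) (d' : ι →₀ ℕ), d'.degree = n ∧
      (monomial d 1 : MvPolynomial ι ℂ) = X i * monomial d' 1 := by
  classical
  obtain ⟨i, hi⟩ : ∃ i, d i ≠ 0 := by
    by_contra! h
    have : d = 0 := Finsupp.ext h
    subst this
    simp at hd
  have hle : Finsupp.single i 1 ≤ d := by
    rw [Finsupp.single_le_iff]; exact Nat.one_le_iff_ne_zero.2 hi
  have h1 : Finsupp.single i 1 + (d - Finsupp.single i 1) = d := add_tsub_cancel_of_le hle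
  refine ⟨i, d - Finsupp.single i 1, ?_, ?_⟩
  · rw [← h1, map_add, Finsupp.degree_single] at hd
    omega
  · rw [X, monomial_mul, h1, one_mul]

omit [Fintype ι] in
/-- Cubic forms are sums of multiples of products of three variables. -/
theorem IsHomogeneous.cubic_induction {F : MvPolynomial ι ℂ} (hF : F.IsHomogeneous 3)
    {P : MvPolynomial ι ℂ → Prop} (h0 : P 0) (hadd : ∀ f g, P f → P g → P (f + g))
    (hX : ∀ c i j k, P (C c * (X i * (X j * X k)))) : P F := by
  rw [F.as_sum]
  refine Finset.sum_induction _ P hadd h0 fun d hd => ?_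
  have h3 : d.degree = 3 := by
    have := hF (mem_support_iff.1 hd)
    rw [Finsupp.degree_eq_weight_one]
    exact this
  obtain ⟨i, d₁, h₁, e₁⟩ := exists_monomial_eq_X_mul h3
  obtain ⟨j, d₂, h₂, e₂⟩ := exists_monomial_eq_X_mul h₁
  obtain ⟨k, d₃, h₃, e₃⟩ := exists_monomial_eq_X_mul h₂
  have h4 : d₃ = 0 := (Finsupp.degree_eq_zero_iff d₃).1 h₃
  have h5 : monomial d (coeff d F) = C (coeff d F) * (X i * (X j * X k)) := by
    rw [← mul_one (coeff d F), ← C_mul_monomial, e₁, e₂, e₃, h4]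
    simp
  rw [h5]
  exact hX _ _ _ _

/-- The Taylor expansion of a cubic form on a line. -/
theorem aeval_cubic_add {F : MvPolynomial ι ℂ} (hF : F.IsHomogeneous 3) (x y : ι → A) (s t : A) :
    aeval (fun i => s * x i + t * y i) F =
      s ^ 3 * aeval x F + s ^ 2 * t * polar F x y + s * t ^ 2 * polar F y x + t ^ 3 * aeval y F := by
  refine IsHomogeneous.cubic_induction hF (P := fun F => aeval (fun i => s * x i + t * y i) F =
    s ^ 3 * aeval x F + s ^ 2 * t * polar F x y + s * t ^ 2 * polar F y x + t ^ 3 * aeval y F)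
    ?_ ?_ ?_
  · simp [polar]
  · intro f g hf hg
    simp only [map_add, polar_add_left, hf, hg]
    ring
  · intro c i j k
    simp only [map_mul, aeval_X, aeval_C, polar_mul, polar_X, polar_C]
    ring

theorem polar_smul {F : MvPolynomial ι ℂ} (hF : F.IsHomogeneous 3) (x y : ι → A) (s t : A) :
    polar F (fun i => s * x i) (fun i => t * y i) = s ^ 2 * t * polar F x y := by
  refine IsHomogeneous.cubic_induction hF (P := fun F => polar F (fun i => s * x i)
    (fun i => t * y i) = s ^ 2 * t * polar F x y) ?_ ?_ ?_
  · simp [polar]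
  · intro f g hf hg
    simp only [polar_add_left, hf, hg]
    ring
  · intro c i j k
    simp only [map_mul, aeval_X, aeval_C, polar_mul, polar_X, polar_C]
    ring

/-- If `F` vanishes at the two conjugate points `x ± √D y`, then the third intersection of the line
through them with `F = 0` is defined without `√D`. -/
def thirdPoint (F : MvPolynomial ι ℂ) (x y : ι → A) (i : ι) : A :=
  aeval y F * x i - polar F y x * y i

theorem aeval_thirdPoint {F : MvPolynomial ι ℂ} (hF : F.IsHomogeneous 3) {x y : ι → A} {D : A}
    (h1 : aeval x F + D * polar F y x = 0) (h2 : polar F x y + D * aeval y F = 0) :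
    aeval (thirdPoint F x y) F = 0 := by
  have h3 := aeval_cubic_add hF x y (aeval y F) (-polar F y x)
  have h4 : (fun i => aeval y F * x i + -polar F y x * y i) = thirdPoint F x y := by
    funext i; simp only [thirdPoint]; ring
  rw [h4] at h3
  rw [h3]
  linear_combination (aeval y F) ^ 3 * h1 - (aeval y F) ^ 2 * polar F y x * h2

theorem map_thirdPoint (F : MvPolynomial ι ℂ) (φ : A →ₐ[ℂ] B) (x y : ι → A) (i : ι) :
    φ (thirdPoint F x y i) = thirdPoint F (fun i => φ (x i)) (fun i => φ (y i)) i := by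
  simp only [thirdPoint, map_sub, map_mul, map_polar, aeval_fun_algHom]

/-- The third point in terms of the two points `u = x + r y`, `v = x - r y`. -/
theorem thirdPoint_eq {F : MvPolynomial ι ℂ} (hF : F.IsHomogeneous 3) (x y u v : ι → A) (r : A)
    (hu : ∀ i, u i = x i + r * y i) (hv : ∀ i, v i = x i - r * y i)
    (h1 : aeval u F = 0) (h2 : aeval v F = 0) (i : ι) :
    8 * r ^ 3 * thirdPoint F x y i = polar F v u * u i - polar F u v * v i := by
  have hx : (fun i => (1 : A) * u i + 1 * v i) = fun i => 2 * x i := by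
    funext i; rw [hu, hv]; ring
  have hy : (fun i => (1 : A) * u i + -1 * v i) = fun i => 2 * r * y i := by
    funext i; rw [hu, hv]; ring
  have e1 := aeval_cubic_add hF u v 1 1
  have e2 := aeval_cubic_add hF u v 1 (-1)
  rw [hx, IsHomogeneous.aeval_const_mul hF] at e1
  rw [hy, IsHomogeneous.aeval_const_mul hF] at e2
  have e3 := aeval_cubic_add hF (fun i => 2 * x i) (fun i => 2 * r * y i) 1 1
  have e4 := aeval_cubic_add hF (fun i => 2 * x i) (fun i => 2 * r * y i) 1 (-1)
  have e5 : (fun i => (1 : A) * (2 * x i) + 1 * (2 * r * y i)) = fun i => 2 * u i := by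
    funext i; rw [hu]; ring
  have e6 : (fun i => (1 : A) * (2 * x i) + -1 * (2 * r * y i)) = fun i => 2 * v i := by
    funext i; rw [hv]; ring
  rw [e5, IsHomogeneous.aeval_const_mul hF, h1, polar_smul hF, polar_smul hF,
    IsHomogeneous.aeval_const_mul hF, IsHomogeneous.aeval_const_mul hF] at e3
  rw [e6, IsHomogeneous.aeval_const_mul hF, h2, polar_smul hF, polar_smul hF,
    IsHomogeneous.aeval_const_mul hF, IsHomogeneous.aeval_const_mul hF] at e4
  rw [h1, h2] at e1 e2
  have h16 : IsUnit (algebraMap ℂ A 2) := (IsUnit.mk0 (2 : ℂ) two_ne_zero).map _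
  rw [map_ofNat] at h16
  refine h16.mul_left_cancel ?_
  have hi := hu i
  have hi' := hv i
  simp only [thirdPoint]
  have k1 : 8 * r ^ 3 * aeval y F = polar F v u - polar F u v := by linear_combination e2
  have k2 : 8 * aeval x F = polar F u v + polar F v u := by linear_combination e1
  have k3 : 8 * r ^ 2 * polar F y x = -(polar F u v + polar F v u) := by
    refine h16.mul_left_cancel ?_
    linear_combination -e3 - e4 - 2 * k2
  have k4 : (2 : A) * x i = u i + v i := by rw [hi, hi']; ring
  have k5 : (2 : A) * (r * y i) = u i - v i := by rw [hi, hi']; ring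
  linear_combination 2 * x i * k1 - 2 * r * y i * k3 + (polar F v u - polar F u v) * k4 +
    (polar F u v + polar F v u) * k5

/-- The third intersection point of the line through two points of a cubic hypersurface. -/
theorem aeval_chord {F : MvPolynomial ι ℂ} (hF : F.IsHomogeneous 3) {u v : ι → A}
    (h1 : aeval u F = 0) (h2 : aeval v F = 0) :
    aeval (fun i => polar F v u * u i - polar F u v * v i) F = 0 := by
  have h3 := aeval_cubic_add hF u v (polar F v u) (-polar F u v)
  have h4 : (fun i => polar F v u * u i + -polar F u v * v i) =
      fun i => polar F v u * u i - polar F u v * v i := by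
    funext i; ring
  rw [← h4, h3, h1, h2]
  ring

end Polar

/-! ### Lifting points along local homomorphisms -/

section Lifting

variable {A B C : Type*} [CommRing A] [Algebra ℂ A] [CommRing B] [Algebra ℂ B]
  [CommRing C] [Algebra ℂ C]

/-- A surjective homomorphism that reflects units, such as the map from a local ring to its residue
field. -/
structure IsLocalSurj (φ : A →ₐ[ℂ] B) : Prop where
  surj : Function.Surjective φ
  unit : ∀ x, IsUnit (φ x) → IsUnit x

/-- The point `R` of the affine cone over `F = 0` lifts along `φ`. -/
def Liftable {ι : Type*} (φ : A →ₐ[ℂ] B) (F : MvPolynomial ι ℂ) (R : ι → B) : Prop :=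
  ∃ S : ι → A, aeval S F = 0 ∧ ∀ i, φ (S i) = R i

theorem Liftable.of_smul {ι : Type*} {φ : A →ₐ[ℂ] B} (hφ : IsLocalSurj φ)
    {F : MvPolynomial ι ℂ} (hF : F.IsHomogeneous 3) {R R' : ι → B} {u : B} (hu : IsUnit u)
    (hR : Liftable φ F R) (h : ∀ i, R i = u * R' i) : Liftable φ F R' := by
  obtain ⟨S, hS, hSR⟩ := hR
  obtain ⟨v, rfl⟩ := hu
  obtain ⟨w, hw⟩ := hφ.surj (v⁻¹ : Bˣ)
  refine ⟨fun i => w * S i, ?_, fun i => ?_⟩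
  · rw [IsHomogeneous.aeval_const_mul hF, hS, mul_zero]
  · rw [map_mul, hw, hSR, h, Units.inv_mul_cancel_left]

open QuadraticAlgebra in
/-- The homomorphism `A[√D] → C` that extends `φ : A → C` and sends `√D` to `r`. -/
def evalSqrt (φ : A →ₐ[ℂ] C) (D : A) (r : C) (hr : r ^ 2 = φ D) :
    QuadraticAlgebra A D 0 →ₐ[ℂ] C where
  toFun z := φ z.re + φ z.im * r
  map_one' := by simp
  map_zero' := by simp
  map_mul' z w := by
    simp only [re_mul, im_mul, map_add, map_mul, map_zero]
    linear_combination -φ z.im * φ w.im * hr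
  map_add' z w := by simp only [re_add, im_add, map_add]; ring
  commutes' c := by
    rw [IsScalarTower.algebraMap_apply ℂ A (QuadraticAlgebra A D 0)]
    simp [QuadraticAlgebra.algebraMap_eq]

theorem evalSqrt_apply (φ : A →ₐ[ℂ] C) (D : A) (r : C) (hr : r ^ 2 = φ D)
    (z : QuadraticAlgebra A D 0) : evalSqrt φ D r hr z = φ z.re + φ z.im * r := rfl

/-- If `D` has an invertible square root `r` in `C`, then `A[√D] → C × C` is surjective and reflects
units. -/
theorem isLocalSurj_evalSqrt_prod {φ : A →ₐ[ℂ] C} (hφ : IsLocalSurj φ) (D : A) (r : C)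
    (hr : r ^ 2 = φ D) (hu : IsUnit r) :
    IsLocalSurj ((evalSqrt φ D r hr).prod (evalSqrt φ D (-r) (by rw [neg_sq, hr]))) := by
  have h2 : IsUnit (algebraMap ℂ C 2) := (IsUnit.mk0 (2 : ℂ) two_ne_zero).map _
  rw [map_ofNat] at h2
  constructor
  · rintro ⟨a, b⟩
    obtain ⟨v, hv⟩ := h2.mul hu
    obtain ⟨w, hw⟩ := h2
    obtain ⟨x, hx⟩ := hφ.surj ((w⁻¹ : Cˣ) * (a + b))
    obtain ⟨y, hy⟩ := hφ.surj ((v⁻¹ : Cˣ) * (a - b))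
    refine ⟨⟨x, y⟩, ?_⟩
    have h3 : 2 * φ x = a + b := by rw [hx, ← hw, Units.mul_inv_cancel_left]
    have h4 : 2 * r * φ y = a - b := by rw [hy, ← hv, Units.mul_inv_cancel_left]
    refine Prod.ext ?_ ?_
    · refine (hw ▸ w.isUnit : IsUnit (2 : C)).mul_left_cancel ?_
      simp only [AlgHom.prod_apply, evalSqrt_apply]
      linear_combination h3 + h4
    · refine (hw ▸ w.isUnit : IsUnit (2 : C)).mul_left_cancel ?_
      simp only [AlgHom.prod_apply, evalSqrt_apply]
      linear_combination h3 - h4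
  · intro z hz
    rw [QuadraticAlgebra.isUnit_iff_norm_isUnit]
    refine hφ.unit _ ?_
    have h3 := (Prod.isUnit_iff.1 hz)
    have h4 : φ (QuadraticAlgebra.norm z) =
        evalSqrt φ D r hr z * evalSqrt φ D (-r) (by rw [neg_sq, hr]) z := by
      simp only [QuadraticAlgebra.norm_def, evalSqrt_apply, map_sub, map_add, map_mul, map_zero]
      linear_combination φ z.im ^ 2 * hr
    rw [h4]
    exact h3.1.mul h3.2

/-- The homomorphism `A[√D] → B[√φ(D)]` induced by `φ : A → B`. -/
def mapSqrt (φ : A →ₐ[ℂ] B) (D : A) (d : B) (hd : φ D = d) :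
    QuadraticAlgebra A D 0 →ₐ[ℂ] QuadraticAlgebra B d 0 where
  toFun z := ⟨φ z.re, φ z.im⟩
  map_one' := by ext <;> simp
  map_zero' := by ext <;> simp
  map_mul' z w := by ext <;> simp [hd]
  map_add' z w := by ext <;> simp
  commutes' c := by
    rw [IsScalarTower.algebraMap_apply ℂ A (QuadraticAlgebra A D 0),
      IsScalarTower.algebraMap_apply ℂ B (QuadraticAlgebra B d 0)]
    simp [QuadraticAlgebra.algebraMap_eq]

theorem isLocalSurj_mapSqrt {φ : A →ₐ[ℂ] B} (hφ : IsLocalSurj φ) (D : A) (d : B) (hd : φ D = d) :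
    IsLocalSurj (mapSqrt φ D d hd) := by
  constructor
  · rintro ⟨a, b⟩
    obtain ⟨x, rfl⟩ := hφ.surj a
    obtain ⟨y, rfl⟩ := hφ.surj b
    exact ⟨⟨x, y⟩, rfl⟩
  · intro z hz
    rw [QuadraticAlgebra.isUnit_iff_norm_isUnit] at hz ⊢
    refine hφ.unit _ ?_
    convert hz using 1
    simp [QuadraticAlgebra.norm_def, mapSqrt, hd]

/-- The two equations expressing `F(x + √D y) = 0`. -/
theorem aeval_quadratic {ι : Type*} [Fintype ι] {F : MvPolynomial ι ℂ} (hF : F.IsHomogeneous 3)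
    {D : A} (R : ι → QuadraticAlgebra A D 0) (h : aeval R F = 0) :
    (aeval (fun i => (R i).re) F + D * polar F (fun i => (R i).im) (fun i => (R i).re) = 0) ∧
    (polar F (fun i => (R i).re) (fun i => (R i).im) + D * aeval (fun i => (R i).im) F = 0) := by
  let j : A →ₐ[ℂ] QuadraticAlgebra A D 0 := IsScalarTower.toAlgHom ℂ A _
  have h1 := aeval_cubic_add hF (fun i => j (R i).re) (fun i => j (R i).im) 1 ⟨0, 1⟩
  have h2 : (fun i => (1 : QuadraticAlgebra A D 0) * j (R i).re + ⟨0, 1⟩ * j (R i).im) = R := by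
    funext i
    ext <;> simp [j, QuadraticAlgebra.algebraMap_eq]
  rw [h2, h, aeval_fun_algHom, aeval_fun_algHom, ← map_polar, ← map_polar] at h1
  have hre : ∀ a, (j a).re = a := fun _ => rfl
  have him : ∀ a, (j a).im = 0 := fun _ => rfl
  have h3 := congrArg QuadraticAlgebra.re h1
  have h4 := congrArg QuadraticAlgebra.im h1
  simp [hre, him, pow_succ] at h3 h4
  exact ⟨h3.symm, h4.symm⟩

end Lifting

/-! ### Points of cubic surfaces over fields with a cube root -/

section Surface

theorem exists_primitive_cubeRoot : ∃ w : ℂ, w ^ 2 + w + 1 = 0 ∧ w - w ^ 2 ≠ 0 := by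
  obtain ⟨w, hw⟩ := IsAlgClosed.exists_root (Polynomial.X ^ 2 + Polynomial.X + 1 : Polynomial ℂ)
    (ne_of_eq_of_ne (b := 2) (by compute_degree!) (by norm_num))
  have hw' : w ^ 2 + w + 1 = 0 := by simpa using hw
  refine ⟨w, hw', fun h => ?_⟩
  have : (3 : ℂ) = 0 := by linear_combination 4 * hw' - (2 * w + 1) * (hw' + h)
  norm_num at this

/-- A two-parameter family of points on the cubic surface
`v (W³ - θ³ u³) + p q (a p + b q + g u) = 0`: the points with `q = 1` on which `W - ω θ u = m` and
`W - ω² θ u = - η G`, where `G = a p + b + g u`. -/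
theorem surface_family {A : Type*} [CommRing A] {w v θ k a b g m η c G : A}
    (hw : w ^ 2 + w + 1 = 0) (hk : θ * (w - w ^ 2) * k = 1)
    (hc : (1 - a * v * w ^ 2 * m * η ^ 2 + g * η * k) * c = 1)
    (hG : G = (b - a * v * w * m ^ 2 * η - g * m * k) * c) :
    v * ((-w * m + w ^ 2 * η * G + θ * (-(m + η * G) * k)) ^ 3 - θ ^ 3 * (-(m + η * G) * k) ^ 3) +
      (v * m * η * (-w * m + w ^ 2 * η * G)) * 1 *
        (a * (v * m * η * (-w * m + w ^ 2 * η * G)) + b * 1 + g * (-(m + η * G) * k)) = 0 := by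
  obtain ⟨u, hu⟩ : ∃ u, u = -(m + η * G) * k := ⟨_, rfl⟩
  obtain ⟨l, hl⟩ : ∃ l, l = -w * m + w ^ 2 * η * G := ⟨_, rfl⟩
  rw [← hu, ← hl]
  have hw3 : w ^ 3 = 1 := by linear_combination (w - 1) * hw
  have h0 : (1 - a * v * w ^ 2 * m * η ^ 2 + g * η * k) * G =
      b - a * v * w * m ^ 2 * η - g * m * k := by
    rw [hG]; linear_combination (b - a * v * w * m ^ 2 * η - g * m * k) * hc
  have h1 : a * (v * m * η * l) + b * 1 + g * u = G := by
    rw [hl, hu]; linear_combination -h0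
  have hk' : (1 - w) * θ * k = w ^ 2 := by linear_combination w ^ 2 * hk + (w - 1) * θ * k * hw3
  have h2 : l + θ * u - w * θ * u = m := by
    rw [hl, hu]; linear_combination -(m + η * G) * hk' - m * hw
  have h3 : l + θ * u - w ^ 2 * θ * u = -η * G := by
    have hk2 : (1 - w ^ 2) * θ * k = -w := by linear_combination (1 + w) * hk' + hw3 + hw
    rw [hl, hu]; linear_combination -(m + η * G) * hk2 + η * G * hw
  have h4 : (l + θ * u) ^ 3 - θ ^ 3 * u ^ 3 =
      l * (l + θ * u - w * θ * u) * (l + θ * u - w ^ 2 * θ * u) := by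
    linear_combination l * (l + θ * u) * (θ * u) * hw - l * (θ * u) ^ 2 * hw3
  rw [h1, h4, h2, h3]
  ring

/-- For at least one of the three cube roots `θ` of `θ³`, a given point of the surface lies on the
family `surface_family`. -/
theorem exists_cubeRoot_ne_zero {K : Type*} [Field K] [Algebra ℂ K] {w : ℂ}
    (hw : w ^ 2 + w + 1 = 0) {W u p v θ a b g : K} (hθ : θ ≠ 0) (hW : W ≠ 0)
    (hp : p ≠ 0) (hG : a * p + b + g * u ≠ 0)
    (hF : v * (W ^ 3 - θ ^ 3 * u ^ 3) + p * (a * p + b + g * u) = 0) (hab : (a * p) ^ 3 ≠ b ^ 3) :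
    ∃ j : ℂ, j ^ 3 = 1 ∧
      1 - a * v * algebraMap ℂ K w ^ 2 * (W - algebraMap ℂ K w * (algebraMap ℂ K j * θ) * u) *
          (-(W - algebraMap ℂ K w ^ 2 * (algebraMap ℂ K j * θ) * u) / (a * p + b + g * u)) ^ 2 +
        g * (-(W - algebraMap ℂ K w ^ 2 * (algebraMap ℂ K j * θ) * u) / (a * p + b + g * u)) *
          ((algebraMap ℂ K j * θ) * (algebraMap ℂ K w - algebraMap ℂ K w ^ 2))⁻¹ ≠ 0 := by
  obtain ⟨z, hz⟩ : ∃ z, z = algebraMap ℂ K w := ⟨_, rfl⟩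
  have hz1 : z ^ 2 + z + 1 = 0 := by
    rw [hz, ← map_pow, ← map_add, ← map_one (algebraMap ℂ K), ← map_add, hw, map_zero]
  have hz3 : z ^ 3 = 1 := by linear_combination (z - 1) * hz1
  have hz0 : z ≠ 0 := by rintro rfl; norm_num at hz3
  have hzz : z - z ^ 2 ≠ 0 := by
    intro h
    have h1 : (3 : K) = 0 := by linear_combination hz1 - (2 * z + 1) * h - 2 * hz3
    have h2 : (algebraMap ℂ K) 3 = 0 := by rw [map_ofNat]; exact h1
    rw [map_eq_zero] at h2
    norm_num at h2
  obtain ⟨G, hGd⟩ : ∃ G, G = a * p + b + g * u := ⟨_, rfl⟩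
  rw [← hGd] at hF hG ⊢
  rw [← hz]
  by_contra! hcon
  -- If the expression is zero for the cube root `t`, then eliminating `v` yields a relation between
  -- the first two of the linear factors of `W³ - t³ u³`.
  have step : ∀ t : K, t ≠ 0 → t ^ 3 = θ ^ 3 →
      1 - a * v * z ^ 2 * (W - z * t * u) * (-(W - z ^ 2 * t * u) / G) ^ 2 +
        g * (-(W - z ^ 2 * t * u) / G) * (t * (z - z ^ 2))⁻¹ = 0 →
      -z * (a * p) * (W - z * t * u) * (t * (z - z ^ 2)) + b * (W - t * u) * (t * (z - z ^ 2)) =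
        g * (W - t * u) * (W - z * t * u) := by
    intro t ht ht3 h
    have hFt : v * ((W - t * u) * (W - z * t * u) * (W - z ^ 2 * t * u)) = -(p * G) := by
      have : (W - t * u) * (W - z * t * u) * (W - z ^ 2 * t * u) = W ^ 3 - t ^ 3 * u ^ 3 := by
        linear_combination -(W - t * u) * W * (t * u) * hz1 + (W - t * u) * (t * u) ^ 2 * hz3
      rw [this, ht3]
      linear_combination hF
    have h4 : (W - z ^ 2 * t * u) - (W - z * t * u) = t * (z - z ^ 2) * u := by ring
    have h5 : (W - t * u) + z * (W - z * t * u) + z ^ 2 * (W - z ^ 2 * t * u) = 0 := by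
      linear_combination W * hz1 - t * u * hz1 - z * t * u * hz3
    have hκ : t * (z - z ^ 2) ≠ 0 := mul_ne_zero ht hzz
    generalize t * (z - z ^ 2) = κ at *
    generalize W - t * u = L₀ at *
    generalize W - z * t * u = L₁ at *
    generalize W - z ^ 2 * t * u = L₂ at *
    have hh : G ^ 2 * κ - a * v * z ^ 2 * L₁ * L₂ ^ 2 * κ - g * L₂ * G = 0 := by
      have h6 : G ^ 2 * κ * (1 - a * v * z ^ 2 * L₁ * (-L₂ / G) ^ 2 + g * (-L₂ / G) * κ⁻¹) =
          G ^ 2 * κ - a * v * z ^ 2 * L₁ * L₂ ^ 2 * κ - g * L₂ * G := by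
        field_simp
        ring
      rw [← h6, h, mul_zero]
    refine mul_left_cancel₀ hG ?_
    linear_combination L₀ * hh + a * z ^ 2 * L₂ * κ * hFt - G * (L₀ * κ * hGd) + g * L₀ * G * h4 +
      (-G * a * p * κ) * h5
  have hL : v * ((W - θ * u) * (W - z * θ * u) * (W - z ^ 2 * θ * u)) = -(p * G) := by
    have : (W - θ * u) * (W - z * θ * u) * (W - z ^ 2 * θ * u) = W ^ 3 - θ ^ 3 * u ^ 3 := by
      linear_combination -(W - θ * u) * W * (θ * u) * hz1 + (W - θ * u) * (θ * u) ^ 2 * hz3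
    rw [this]
    linear_combination hF
  have hne : (W - θ * u) * (W - z * θ * u) * (W - z ^ 2 * θ * u) ≠ 0 := by
    intro h
    rw [h, mul_zero] at hL
    exact mul_ne_zero hp hG (neg_eq_zero.1 hL.symm)
  have hw3 : w ^ 3 = 1 := by linear_combination (w - 1) * hw
  have s0 := step θ hθ rfl (by simpa using hcon 1 (by norm_num))
  have s1 := step (z * θ) (mul_ne_zero hz0 hθ) (by rw [mul_pow, hz3, one_mul])
    (by have := hcon w hw3; rw [← hz] at this; exact this)
  have s2 := step (z ^ 2 * θ) (mul_ne_zero (pow_ne_zero 2 hz0) hθ)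
    (by rw [mul_pow, ← pow_mul, mul_comm 2, pow_mul, hz3, one_pow, one_mul])
    (by
      have := hcon (w ^ 2) (by rw [← pow_mul, mul_comm, pow_mul, hw3, one_pow])
      rw [map_pow, ← hz] at this
      exact this)
  have hz1' : z - 1 ≠ 0 := fun h => hzz (by linear_combination -z * h)
  have hm1 : W - z * (z * θ) * u = W - z ^ 2 * θ * u := by ring
  have hm2 : W - z * (z ^ 2 * θ) * u = W - θ * u := by linear_combination -θ * u * hz3
  rw [hm1] at s1
  rw [hm2] at s2
  have d0 : z * (W - θ * u) - (W - z * θ * u) = (z - 1) * W := by ring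
  have d1 : z * (W - z * θ * u) - (W - z ^ 2 * θ * u) = (z - 1) * W := by ring
  have d2 : z * (W - z ^ 2 * θ * u) - (W - θ * u) = (z - 1) * W := by
    linear_combination -θ * u * hz3
  have hκ : θ * (z - z ^ 2) * ((z - 1) * W) ≠ 0 :=
    mul_ne_zero (mul_ne_zero hθ hzz) (mul_ne_zero hz1' hW)
  generalize W - θ * u = L₀ at *
  generalize W - z * θ * u = L₁ at *
  generalize W - z ^ 2 * θ * u = L₂ at *
  obtain ⟨κ, hκd⟩ : ∃ κ, κ = θ * (z - z ^ 2) := ⟨_, rfl⟩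
  rw [← hκd] at hκ s0
  have e1 : z * θ * (z - z ^ 2) = z * κ := by rw [hκd]; ring
  have e2 : z ^ 2 * θ * (z - z ^ 2) = z ^ 2 * κ := by rw [hκd]; ring
  rw [e1] at s1
  rw [e2] at s2
  -- Eliminating `g` from two of the relations leaves binomial ones, whose product is `(a p)³ = b³` up
  -- to nonzero factors.
  have r0 : z * (a * p) * L₂ = b * L₀ := by
    refine mul_left_cancel₀ hκ ?_
    linear_combination L₂ * s0 - L₀ * s1 - κ * z * (a * p) * L₂ * d0 + κ * b * L₀ * d1
  have r1 : z * (a * p) * L₀ = b * L₁ := by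
    refine mul_left_cancel₀ hκ ?_
    linear_combination z ^ 2 * (L₀ * s1 - L₁ * s2 - κ * z ^ 2 * (a * p) * L₀ * d1 +
      κ * z * b * L₁ * d2) - κ * ((z - 1) * W) * (z * (a * p) * L₀ - b * L₁) * hz3
  have r2 : z * (a * p) * L₁ = b * L₂ := by
    refine mul_left_cancel₀ hκ ?_
    linear_combination z * (L₁ * s2 - L₂ * s0) - κ * (-z * (a * p) * L₀ * L₁ + b * L₁ * L₂) * hz3 -
      κ * z * (a * p) * L₁ * d2 + κ * b * L₂ * d0
  apply hab
  refine mul_right_cancel₀ hne ?_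
  linear_combination (z * (a * p) * L₀) * (z * (a * p) * L₁) * r0 +
    b * L₀ * (z * (a * p) * L₁) * r1 + b * L₀ * (b * L₁) * r2 - (a * p) ^ 3 * (L₀ * L₁ * L₂) * hz3

/-- Lifting points of the surface of `surface_family`: if a point of the family over `B`, scaled by
`π`, is given together with its parameters, then it lifts along `A → B`. -/
theorem exists_surface_lift {A B : Type*} [CommRing A] [Algebra ℂ A] [CommRing B] [Algebra ℂ B]
    {Φ : A →ₐ[ℂ] B} (hΦ : IsLocalSurj Φ) {w a b g : ℂ} (hw : w ^ 2 + w + 1 = 0)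
    {θ k v π : A} (hk : θ * (algebraMap ℂ A w - algebraMap ℂ A w ^ 2) * k = 1)
    {m η p u W G : B}
    (hc : IsUnit (1 - algebraMap ℂ B a * Φ v * algebraMap ℂ B w ^ 2 * (Φ π * m) * (Φ π * η) ^ 2 +
      algebraMap ℂ B g * (Φ π * η) * Φ k))
    (h1 : W - algebraMap ℂ B w * Φ θ * u = m)
    (h2 : W - algebraMap ℂ B w ^ 2 * Φ θ * u = -(η * G))
    (hG : G = algebraMap ℂ B a * (Φ π * p) + algebraMap ℂ B b + algebraMap ℂ B g * (Φ π * u))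
    (hp : p = Φ π ^ 2 * Φ v * m * η * (W - Φ θ * u)) :
    ∃ p' u' W' : A, Φ p' = p ∧ Φ u' = u ∧ Φ W' = W ∧
      v * ((π * W') ^ 3 - θ ^ 3 * (π * u') ^ 3) + π * p' *
        (algebraMap ℂ A a * (π * p') + algebraMap ℂ A b + algebraMap ℂ A g * (π * u')) = 0 := by
  have hwA : algebraMap ℂ A w ^ 2 + algebraMap ℂ A w + 1 = 0 := by
    rw [← map_pow, ← map_add, ← map_one (algebraMap ℂ A), ← map_add, hw, map_zero]
  have hwB : algebraMap ℂ B w ^ 2 + algebraMap ℂ B w + 1 = 0 := by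
    rw [← map_pow, ← map_add, ← map_one (algebraMap ℂ B), ← map_add, hw, map_zero]
  have hkB : Φ θ * (algebraMap ℂ B w - algebraMap ℂ B w ^ 2) * Φ k = 1 := by
    have := congrArg Φ hk
    simpa using this
  -- The parameters `m` and `η` lift, and they determine the point.
  obtain ⟨M, rfl⟩ := hΦ.surj m
  obtain ⟨N, rfl⟩ := hΦ.surj η
  have hcA : IsUnit (1 - algebraMap ℂ A a * v * algebraMap ℂ A w ^ 2 * (π * M) * (π * N) ^ 2 +
      algebraMap ℂ A g * (π * N) * k) := by
    apply hΦ.unit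
    simpa using hc
  obtain ⟨c, hc1⟩ := hcA.exists_right_inv
  have hF := surface_family (m := π * M) (η := π * N) (b := algebraMap ℂ A b) hwA hk hc1 rfl
  obtain ⟨Γ, hΓ⟩ : ∃ Γ, Γ = (algebraMap ℂ A b - algebraMap ℂ A a * v * algebraMap ℂ A w *
      (π * M) ^ 2 * (π * N) - algebraMap ℂ A g * (π * M) * k) * c := ⟨_, rfl⟩
  rw [← hΓ] at hF
  have hu : u = -(Φ M + Φ N * G) * Φ k := by
    linear_combination -u * hkB - Φ k * (h1 - h2)
  have hL : W - Φ θ * u = -algebraMap ℂ B w * Φ M + algebraMap ℂ B w ^ 2 * (Φ N * G) := by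
    linear_combination -(algebraMap ℂ B w) * h1 - algebraMap ℂ B w ^ 2 * h2 + W * hwB -
      Φ θ * u * (1 - algebraMap ℂ B w + algebraMap ℂ B w ^ 2) * hwB
  have hΓG : Φ Γ = G := by
    refine hc.mul_left_cancel ?_
    have e1 := congrArg Φ hc1
    simp only [map_mul, map_sub, map_add, map_one, map_pow, AlgHom.commutes] at e1
    have e2 := congrArg Φ hΓ
    simp only [map_mul, map_sub, map_pow, AlgHom.commutes] at e2
    rw [e2]
    linear_combination (algebraMap ℂ B b - algebraMap ℂ B a * Φ v * algebraMap ℂ B w *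
      (Φ π * Φ M) ^ 2 * (Φ π * Φ N) - algebraMap ℂ B g * (Φ π * Φ M) * Φ k) * e1 - hG -
      algebraMap ℂ B a * Φ π * hp - algebraMap ℂ B g * Φ π * hu -
      algebraMap ℂ B a * Φ v * Φ π ^ 3 * Φ M * Φ N * hL
  refine ⟨π ^ 2 * v * M * N * (-algebraMap ℂ A w * M + algebraMap ℂ A w ^ 2 * N * Γ),
    -(M + N * Γ) * k, (-algebraMap ℂ A w * M + algebraMap ℂ A w ^ 2 * N * Γ) +
      θ * (-(M + N * Γ) * k), ?_, ?_, ?_, ?_⟩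
  · simp only [map_mul, map_add, map_neg, map_pow, AlgHom.commutes, hΓG]
    rw [hp, hL]; ring
  · simp only [map_mul, map_add, map_neg, hΓG]
    rw [hu]
  · simp only [map_mul, map_add, map_neg, map_pow, AlgHom.commutes, hΓG]
    rw [← hu]
    linear_combination -hL
  · linear_combination hF

end Surface

/-! ### Eckardt points -/

section Eckardt

variable {ι : Type*} [Fintype ι] [DecidableEq ι]

/-- The cubic form `F` is `x_p x_q (a x_p + b x_q + g x_u)` plus a form without the variable `x_q`.
Then the coordinate point `c` of `x_q` is an Eckardt point of the hypersurface `F = 0`: the tangent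
hyperplane `x_p = 0` meets it in a cone with vertex `c`. -/
structure IsEckardt (F : MvPolynomial ι ℂ) (q p u : ι) (a b g : ℂ) : Prop where
  isHomogeneous : F.IsHomogeneous 3
  p_ne : p ≠ q
  u_ne : u ≠ q
  b_ne : b ≠ 0
  aeval_update : ∀ (A : Type) [CommRing A] [Algebra ℂ A] (x : ι → A) (y : A),
    aeval (Function.update x q y) F = aeval x F + x p *
      (y * (algebraMap ℂ A a * x p + algebraMap ℂ A b * y + algebraMap ℂ A g * x u) -
        x q * (algebraMap ℂ A a * x p + algebraMap ℂ A b * x q + algebraMap ℂ A g * x u))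

/-- The involution of the affine cone that interchanges the two points residual to the Eckardt point
on each line through it. -/
def eckardtInv (q p u : ι) (a b g : ℂ) {A : Type*} [CommRing A] [Algebra ℂ A] (x : ι → A) : ι → A :=
  Function.update x q (-x q - algebraMap ℂ A b⁻¹ * (algebraMap ℂ A a * x p + algebraMap ℂ A g * x u))

variable {F : MvPolynomial ι ℂ} {q p u : ι} {a b g : ℂ} {A C : Type} [CommRing A] [Algebra ℂ A]
  [CommRing C] [Algebra ℂ C]

namespace IsEckardt

variable (h : IsEckardt F q p u a b g)
include h

omit [Fintype ι] in
theorem b_mul_inv : algebraMap ℂ A b * algebraMap ℂ A b⁻¹ = 1 := by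
  rw [← map_mul, mul_inv_cancel₀ h.b_ne, map_one]

omit [Fintype ι] in
theorem aeval_eckardtInv (x : ι → A) : aeval (eckardtInv q p u a b g x) F = aeval x F := by
  rw [eckardtInv, h.aeval_update]
  linear_combination (2 * x p * x q * (algebraMap ℂ A a * x p + algebraMap ℂ A g * x u) + x p *
    algebraMap ℂ A b⁻¹ * (algebraMap ℂ A a * x p + algebraMap ℂ A g * x u) ^ 2) *
    h.b_mul_inv (A := A)

omit [Fintype ι] in
theorem eckardtInv_eckardtInv (x : ι → A) :
    eckardtInv q p u a b g (eckardtInv q p u a b g x) = x := by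
  funext i
  simp only [eckardtInv, Function.update_of_ne h.p_ne, Function.update_of_ne h.u_ne,
    Function.update_self]
  by_cases hi : i = q
  · subst hi; rw [Function.update_self]; ring
  · rw [Function.update_of_ne hi, Function.update_of_ne hi]

omit [Fintype ι] in
theorem liftable_of_eckardtInv {φ : A →ₐ[ℂ] C} {R : ι → C}
    (hR : Liftable φ F (eckardtInv q p u a b g R)) : Liftable φ F R := by
  obtain ⟨S, hS, hSR⟩ := hR
  refine ⟨eckardtInv q p u a b g S, by rw [h.aeval_eckardtInv, hS], fun i => ?_⟩
  rw [← h.eckardtInv_eckardtInv R]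
  have h1 : (fun i => φ (S i)) = eckardtInv q p u a b g R := funext hSR
  rw [← h1]
  unfold eckardtInv
  by_cases hi : i = q
  · subst hi; simp
  · rw [Function.update_of_ne hi, Function.update_of_ne hi]

omit [Fintype ι] in
theorem aeval_single : aeval (Pi.single q (1 : A)) F = 0 := by
  have h1 := h.aeval_update A 0 1
  have h2 : aeval (0 : ι → A) F = 0 := by
    have := IsHomogeneous.aeval_const_mul h.isHomogeneous (0 : A) (0 : ι → A)
    simpa using this
  rw [h2] at h1
  simpa [Pi.single] using h1

theorem polar_single (x : ι → A) :
    polar F x (Pi.single q 1) = x p * (algebraMap ℂ A a * x p + 2 * algebraMap ℂ A b * x q +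
      algebraMap ℂ A g * x u) ∧ polar F (Pi.single q 1) x = algebraMap ℂ A b * x p := by
  have key : ∀ t : A, t * polar F x (Pi.single q 1) + t ^ 2 * polar F (Pi.single q 1) x =
      x p * (t * (algebraMap ℂ A a * x p + algebraMap ℂ A b * (2 * x q + t) +
        algebraMap ℂ A g * x u)) := by
    intro t
    have h1 := aeval_cubic_add h.isHomogeneous x (Pi.single q 1) 1 t
    have h2 : (fun i => 1 * x i + t * (Pi.single q 1 : ι → A) i) =
        Function.update x q (x q + t) := by
      funext i
      by_cases hi : i = q
      · subst hi; simp
      · simp [hi]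
    rw [h2, h.aeval_single, h.aeval_update] at h1
    linear_combination -h1
  have h16 : IsUnit (algebraMap ℂ A 2) := (IsUnit.mk0 (2 : ℂ) two_ne_zero).map _
  rw [map_ofNat] at h16
  have k1 := key 1
  have k2 := key (-1)
  constructor <;> refine h16.mul_left_cancel ?_
  · linear_combination k1 - k2
  · linear_combination k1 + k2

/-- The third point of a line through a point `R` and the Eckardt point is the image of `R` under
the involution. -/
theorem thirdPoint (x y : ι → A) (R : ι → A) (r s t : A) (hu : ∀ i, x i + r * y i = s * R i)
    (hv : ∀ i, x i - r * y i = t * (Pi.single q 1 : ι → A) i) (hR : aeval (fun i => s * R i) F = 0)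
    (i : ι) : 8 * r ^ 3 * _root_.thirdPoint F x y i =
      s ^ 2 * t ^ 2 * algebraMap ℂ A b * R p * eckardtInv q p u a b g R i := by
  have h1 := thirdPoint_eq h.isHomogeneous x y (fun i => s * R i)
    (fun i => t * (Pi.single q 1 : ι → A) i) r (fun i => (hu i).symm) (fun i => (hv i).symm) hR
    (by rw [IsHomogeneous.aeval_const_mul h.isHomogeneous, h.aeval_single, mul_zero]) i
  rw [h1, polar_smul h.isHomogeneous, polar_smul h.isHomogeneous, (h.polar_single R).1,
    (h.polar_single R).2, eckardtInv]
  by_cases hi : i = q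
  · subst hi
    simp only [Pi.single_eq_same, Function.update_self]
    linear_combination s ^ 2 * t ^ 2 * R p * (algebraMap ℂ A a * R p + algebraMap ℂ A g * R u) *
      h.b_mul_inv (A := A)
  · rw [Function.update_of_ne hi, Pi.single_eq_of_ne hi]
    ring

/-- A point `R` lifts if, after adjoining a square root that splits over the residue ring, there is
a point whose two conjugates specialise to `R` and to the Eckardt point. -/
theorem liftable_of_evalSqrt {φ : A →ₐ[ℂ] C} (hφ : IsLocalSurj φ) {D : A} {r : C}
    (hr : r ^ 2 = φ D) (hru : IsUnit r) {R : ι → C} {S : ι → QuadraticAlgebra A D 0}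
    (hS : aeval S F = 0) {s t : C} (hs : IsUnit s) (ht : IsUnit t) (hp : IsUnit (R p))
    (h1 : ∀ i, evalSqrt φ D r hr (S i) = s * R i)
    (h2 : ∀ i, evalSqrt φ D (-r) (by rw [neg_sq, hr]) (S i) = t * (Pi.single q 1 : ι → C) i) :
    Liftable φ F R := by
  obtain ⟨e1, e2⟩ := aeval_quadratic h.isHomogeneous S hS
  have e3 := aeval_thirdPoint h.isHomogeneous e1 e2
  have hlift : Liftable φ F
      (fun i => φ (_root_.thirdPoint F (fun i => (S i).re) (fun i => (S i).im) i)) :=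
    ⟨_, e3, fun i => rfl⟩
  have hb : IsUnit (algebraMap ℂ C b) := (IsUnit.mk0 b h.b_ne).map _
  have h8 : IsUnit (algebraMap ℂ C 8) := (IsUnit.mk0 (8 : ℂ) (by norm_num)).map _
  rw [map_ofNat] at h8
  obtain ⟨c, hc⟩ := (h8.mul (hru.pow 3)).exists_right_inv
  have hcu : IsUnit c := IsUnit.of_mul_eq_one_right _ hc
  refine h.liftable_of_eckardtInv (hlift.of_smul hφ h.isHomogeneous
    (u := c * (s ^ 2 * t ^ 2 * algebraMap ℂ C b * R p))
    (hcu.mul ((((hs.pow 2).mul (ht.pow 2)).mul hb).mul hp)) fun i => ?_)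
  have e4 := h.thirdPoint (fun i => φ (S i).re) (fun i => φ (S i).im) R r s t
    (fun i => by rw [← h1, evalSqrt_apply]; ring) (fun i => by rw [← h2, evalSqrt_apply]; ring)
    (by simp only [← h1]; rw [aeval_fun_algHom, hS, map_zero]) i
  rw [map_thirdPoint]
  linear_combination c * e4 - _root_.thirdPoint F (fun i => φ (S i).re) (fun i => φ (S i).im) i * hc

end IsEckardt

end Eckardt

/-! ### Lifting points when the value of the second form is a cube -/

section NiceForm

variable {ρ : Type}

/-- The variables of `h₁` and `h₀` among those of `niceForm`. -/
def tailIndex : Option ρ → Fin 5 ⊕ ρ := fun o => o.elim (Sum.inl 4) Sum.inr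

/-- The cubic form `x₁ x₃ (t₁ x₁ + t₃ x₃ + t₆ x₂) + t₂ x₂³ + l r² + s x₂ r l + r h₁ + h₀` in the
variables `x₁, x₂, x₃, r, l` (with indices `0, …, 4` of the first summand) and those of `ρ`, where
`h₁` and `h₀` are forms in `l` and the variables of `ρ`. -/
def niceForm (t₁ t₂ t₃ t₆ s : ℂ) (h₁ h₀ : MvPolynomial (Option ρ) ℂ) :
    MvPolynomial (Fin 5 ⊕ ρ) ℂ :=
  X (Sum.inl 0) * X (Sum.inl 2) *
      (C t₁ * X (Sum.inl 0) + C t₃ * X (Sum.inl 2) + C t₆ * X (Sum.inl 1)) +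
    C t₂ * X (Sum.inl 1) ^ 3 + X (Sum.inl 4) * X (Sum.inl 3) ^ 2 +
    C s * (X (Sum.inl 1) * X (Sum.inl 3) * X (Sum.inl 4)) +
    X (Sum.inl 3) * rename tailIndex h₁ + rename tailIndex h₀

variable {t₁ t₂ t₃ t₆ s : ℂ} {h₁ h₀ : MvPolynomial (Option ρ) ℂ}

theorem aeval_niceForm {A : Type*} [CommRing A] [Algebra ℂ A] (x : Fin 5 ⊕ ρ → A) :
    aeval x (niceForm t₁ t₂ t₃ t₆ s h₁ h₀) =
      x (Sum.inl 0) * x (Sum.inl 2) * (algebraMap ℂ A t₁ * x (Sum.inl 0) +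
        algebraMap ℂ A t₃ * x (Sum.inl 2) + algebraMap ℂ A t₆ * x (Sum.inl 1)) +
      algebraMap ℂ A t₂ * x (Sum.inl 1) ^ 3 + x (Sum.inl 4) * x (Sum.inl 3) ^ 2 +
      algebraMap ℂ A s * (x (Sum.inl 1) * x (Sum.inl 3) * x (Sum.inl 4)) +
      x (Sum.inl 3) * aeval (fun o => x (tailIndex o)) h₁ + aeval (fun o => x (tailIndex o)) h₀ := by
  simp only [niceForm, map_add, map_mul, map_pow, aeval_X, aeval_C, aeval_rename]
  rfl

theorem isHomogeneous_niceForm (hh₁ : h₁.IsHomogeneous 2) (hh₀ : h₀.IsHomogeneous 3) :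
    (niceForm t₁ t₂ t₃ t₆ s h₁ h₀).IsHomogeneous 3 := by
  have hX := fun i : Fin 5 ⊕ ρ => isHomogeneous_X ℂ i
  have hC := fun c : ℂ => isHomogeneous_C (Fin 5 ⊕ ρ) c
  refine ((((((((hX _).mul (hX _)).mul (((((hC _).mul (hX _))).add ?_).add ?_))).add ?_).add
    ((hX _).mul ((hX _).pow 2))).add ?_).add ((hX _).mul (hh₁.rename_isHomogeneous))).add
    (hh₀.rename_isHomogeneous)
  · exact (hC _).mul (hX _)
  · exact (hC _).mul (hX _)
  · simpa using (hC t₂).mul ((hX (Sum.inl 1)).pow 3)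
  · simpa using (hC s).mul (((hX (Sum.inl 1)).mul (hX (Sum.inl 3))).mul (hX (Sum.inl 4)))

theorem isEckardt_niceForm [DecidableEq ρ] (hh₁ : h₁.IsHomogeneous 2) (hh₀ : h₀.IsHomogeneous 3)
    (ht₃ : t₃ ≠ 0) : IsEckardt (niceForm t₁ t₂ t₃ t₆ s h₁ h₀) (Sum.inl 2) (Sum.inl 0) (Sum.inl 1)
      t₁ t₃ t₆ := by
  refine ⟨isHomogeneous_niceForm hh₁ hh₀, by simp, by simp, ht₃, fun A _ _ x y => ?_⟩
  have h1 : (fun o => Function.update x (Sum.inl 2) y (tailIndex o)) =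
      fun o => x (tailIndex o) := by
    funext o
    cases o <;> simp [tailIndex]
  rw [aeval_niceForm, aeval_niceForm, h1]
  simp
  ring

/-- Lifting a point of `g(x₁, x₂, x₃) + H(z) = 0`, where `H = l r² + r h₁ + h₀` and the value `H(z)`
is a cube `σ³`, so that `H` takes the value `σ³` on the line of `r` twice. At one of these two
points one specialises to the given point, at the other one to the Eckardt point. -/
theorem liftable_niceForm_of_cube [Fintype ρ] {O K : Type} [CommRing O] [Algebra ℂ O] [Field K]
    [Algebra ℂ K] {φ : O →ₐ[ℂ] K} (hφ : IsLocalSurj φ) (hh₁ : h₁.IsHomogeneous 2)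
    (hh₀ : h₀.IsHomogeneous 3) (ht₂ : t₂ ≠ 0) (ht₃ : t₃ ≠ 0) {P : Fin 5 ⊕ ρ → K}
    (hP : aeval P (niceForm t₁ t₂ t₃ t₆ 0 h₁ h₀) = 0) {σ : K}
    (hσ : σ ^ 3 = P (Sum.inl 4) * P (Sum.inl 3) ^ 2 +
      P (Sum.inl 3) * aeval (fun o => P (tailIndex o)) h₁ + aeval (fun o => P (tailIndex o)) h₀)
    (hσ0 : σ ≠ 0) (h0 : P (Sum.inl 0) ≠ 0) (h2 : P (Sum.inl 2) ≠ 0) (h4 : P (Sum.inl 4) ≠ 0)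
    (hr : 2 * P (Sum.inl 4) * P (Sum.inl 3) + aeval (fun o => P (tailIndex o)) h₁ ≠ 0)
    (hG : algebraMap ℂ K t₁ * P (Sum.inl 0) + algebraMap ℂ K t₃ * P (Sum.inl 2) +
      algebraMap ℂ K t₆ * P (Sum.inl 1) ≠ 0)
    (hab : (algebraMap ℂ K t₁ * P (Sum.inl 0)) ^ 3 ≠ (algebraMap ℂ K t₃ * P (Sum.inl 2)) ^ 3) :
    Liftable φ (niceForm t₁ t₂ t₃ t₆ 0 h₁ h₀) P := by
  classical
  obtain ⟨w, hw, hww⟩ := exists_primitive_cubeRoot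
  obtain ⟨θ₀, hθ₀⟩ := IsAlgClosed.exists_pow_nat_eq (-t₂) (n := 3) (by norm_num)
  have hθ₀0 : θ₀ ≠ 0 := by rintro rfl; apply ht₂; simpa using hθ₀
  obtain ⟨p, hp⟩ : ∃ p, p = P (Sum.inl 0) / P (Sum.inl 2) := ⟨_, rfl⟩
  obtain ⟨u, hu⟩ : ∃ u, u = P (Sum.inl 1) / P (Sum.inl 2) := ⟨_, rfl⟩
  obtain ⟨W, hW⟩ : ∃ W, W = σ / P (Sum.inl 2) := ⟨_, rfl⟩
  have hp' : P (Sum.inl 0) = P (Sum.inl 2) * p := by rw [hp]; field_simp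
  have hu' : P (Sum.inl 1) = P (Sum.inl 2) * u := by rw [hu]; field_simp
  have hW' : σ = P (Sum.inl 2) * W := by rw [hW]; field_simp
  have hW0 : W ≠ 0 := by rintro rfl; simp at hW'; exact hσ0 hW'
  have hp0 : p ≠ 0 := by rintro rfl; simp at hp'; exact h0 hp'
  rw [hp', hu'] at hG
  have hG0 : algebraMap ℂ K t₁ * p + algebraMap ℂ K t₃ + algebraMap ℂ K t₆ * u ≠ 0 := by
    intro h; apply hG; linear_combination P (Sum.inl 2) * h
  rw [aeval_niceForm, hp', hu', map_zero] at hP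
  have hθ₀K : algebraMap ℂ K θ₀ ^ 3 = -algebraMap ℂ K t₂ := by rw [← map_pow, hθ₀, map_neg]
  have hF : 1 * (W ^ 3 - algebraMap ℂ K θ₀ ^ 3 * u ^ 3) +
      p * (algebraMap ℂ K t₁ * p + algebraMap ℂ K t₃ + algebraMap ℂ K t₆ * u) = 0 := by
    refine (mul_eq_zero.1 ?_).resolve_left (pow_ne_zero 3 h2)
    rw [hθ₀K]
    rw [hW'] at hσ
    linear_combination hP + hσ
  obtain ⟨j, hj, hc⟩ := exists_cubeRoot_ne_zero hw ((map_ne_zero _).2 hθ₀0) hW0 hp0 hG0 hF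
    (by
      rw [hp'] at hab
      intro h; apply hab; linear_combination P (Sum.inl 2) ^ 3 * h)
  have hj0 : j ≠ 0 := by rintro rfl; norm_num at hj
  obtain ⟨θ, hθ⟩ : ∃ θ, θ = j * θ₀ := ⟨_, rfl⟩
  have hθ3 : θ ^ 3 = -t₂ := by rw [hθ, mul_pow, hj, one_mul, hθ₀]
  have hθ0 : θ ≠ 0 := by rw [hθ]; exact mul_ne_zero hj0 hθ₀0
  rw [← map_mul, ← hθ] at hc
  choose z hz using fun o => hφ.surj (P (tailIndex o))
  obtain ⟨σ', hσ'⟩ := hφ.surj σ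
  have hl : IsUnit (z none) := by
    apply hφ.unit
    rw [hz]
    exact (Ne.isUnit h4)
  obtain ⟨li, hli⟩ := hl.exists_right_inv
  have hz4 : φ (z none) = P (Sum.inl 4) := hz none
  have hφh : ∀ h : MvPolynomial (Option ρ) ℂ,
      φ (aeval z h) = aeval (fun o => P (tailIndex o)) h := by
    intro h
    rw [← aeval_fun_algHom]
    simp only [hz]
  -- The discriminant of the quadratic equation `H(r, z) = σ³` for `r`, with lifts of `z` and `σ`.
  obtain ⟨D, hD⟩ : ∃ D, D = aeval z h₁ ^ 2 - 4 * z none * (aeval z h₀ - σ' ^ 3) := ⟨_, rfl⟩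
  obtain ⟨r, hrd⟩ : ∃ r, r = 2 * P (Sum.inl 4) * P (Sum.inl 3) +
    aeval (fun o => P (tailIndex o)) h₁ := ⟨_, rfl⟩
  have hrD : r ^ 2 = φ D := by
    simp only [hD, map_sub, map_mul, map_pow, map_ofNat, hφh, hz4, hσ']
    rw [hrd, hσ]
    ring
  rw [← hrd] at hr
  have hΦ := isLocalSurj_evalSqrt_prod hφ D r hrD (Ne.isUnit hr)
  obtain ⟨G, hGd⟩ : ∃ G, G = algebraMap ℂ K t₁ * p + algebraMap ℂ K t₃ + algebraMap ℂ K t₆ * u :=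
    ⟨_, rfl⟩
  rw [← hGd] at hc hG0 hF
  have hkw : θ * (w - w ^ 2) * (θ * (w - w ^ 2))⁻¹ = 1 := mul_inv_cancel₀ (mul_ne_zero hθ0 hww)
  have hwK : algebraMap ℂ K w ^ 2 + algebraMap ℂ K w + 1 = 0 := by
    rw [← map_pow, ← map_add, ← map_one (algebraMap ℂ K), ← map_add, hw, map_zero]
  have hθK : algebraMap ℂ K θ ^ 3 = algebraMap ℂ K θ₀ ^ 3 := by rw [hθ₀K, ← map_pow, hθ3, map_neg]
  -- A point over `O[√D]`: its parameters are the given ones for `√D = r` and zero for `√D = -r`,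
  -- which leads to the Eckardt point.
  obtain ⟨p', u', W', hp1, hu1, hW1, hS⟩ := exists_surface_lift hΦ (w := w) (a := t₁) (b := t₃)
    (g := t₆) hw (v := 1) (π := 1) (θ := algebraMap ℂ _ θ)
    (k := algebraMap ℂ _ (θ * (w - w ^ 2))⁻¹)
    (by rw [← map_pow, ← map_sub, ← map_mul, ← map_mul, hkw, map_one])
    (m := (W - algebraMap ℂ K w * algebraMap ℂ K θ * u, 0))
    (η := (-(W - algebraMap ℂ K w ^ 2 * algebraMap ℂ K θ * u) / G, 0))
    (p := (p, 0)) (u := (u, 0)) (W := (W, 0)) (G := (G, algebraMap ℂ K t₃))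
    (by
      simp only [map_one, one_mul, mul_one, AlgHom.commutes]
      rw [Prod.isUnit_iff]
      constructor
      · simp only [Prod.algebraMap_apply, Prod.fst_mul, Prod.fst_add, Prod.fst_sub, Prod.fst_one,
          Prod.pow_fst, map_inv₀, map_mul, map_sub, map_pow]
        refine Ne.isUnit ?_
        convert hc using 3
        ring
      · simp)
    (by ext <;> simp [Prod.algebraMap_apply])
    (by
      ext
      · simp [Prod.algebraMap_apply]
        field_simp
        ring
      · simp)
    (by ext <;> simp [Prod.algebraMap_apply, hGd])
    (by
      ext
      · simp [Prod.algebraMap_apply]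
        field_simp
        rw [← hθK] at hF
        linear_combination hF + (-(W - algebraMap ℂ K θ * u) * W * algebraMap ℂ K θ * u +
          (W - algebraMap ℂ K θ * u) * (algebraMap ℂ K w - 1) * (algebraMap ℂ K θ * u) ^ 2) * hwK
      · simp)
  simp only [AlgHom.prod_apply, Prod.ext_iff] at hp1 hu1 hW1
  let j : O →ₐ[ℂ] QuadraticAlgebra O D 0 := IsScalarTower.toAlgHom ℂ O _
  have hj1 : ∀ x, evalSqrt φ D r hrD (j x) = φ x := fun x => by
    rw [evalSqrt_apply]; simp [j, QuadraticAlgebra.algebraMap_eq]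
  have hj2 : ∀ x, evalSqrt φ D (-r) (by rw [neg_sq, hrD]) (j x) = φ x := fun x => by
    rw [evalSqrt_apply]; simp [j, QuadraticAlgebra.algebraMap_eq]
  have hev : evalSqrt φ D r hrD ⟨0, 1⟩ = r := by simp [evalSqrt_apply]
  have hroot : (⟨0, 1⟩ : QuadraticAlgebra O D 0) ^ 2 = j D := by
    rw [pow_two]; ext <;> simp [j, QuadraticAlgebra.algebraMap_eq]
  -- The root of the quadratic equation.
  obtain ⟨R, hR⟩ : ∃ R : QuadraticAlgebra O D 0, R = algebraMap ℂ _ 2⁻¹ * j li *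
    (⟨0, 1⟩ - j (aeval z h₁)) := ⟨_, rfl⟩
  have hφli : P (Sum.inl 4) * φ li = 1 := by rw [← hz4, ← map_mul, hli, map_one]
  have h22 : algebraMap ℂ K 2⁻¹ * 2 = 1 := by
    rw [map_inv₀, map_ofNat]
    refine inv_mul_cancel₀ ?_
    rw [← map_ofNat (algebraMap ℂ K)]
    exact (map_ne_zero _).2 two_ne_zero
  have hRev : evalSqrt φ D r hrD R = P (Sum.inl 3) := by
    rw [hR, map_mul, map_mul, map_sub, hev, hj1, hj1, AlgHom.commutes, hφh, hrd]
    linear_combination algebraMap ℂ K 2⁻¹ * 2 * P (Sum.inl 3) * hφli + P (Sum.inl 3) * h22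
  have hRq : j (z none) * R ^ 2 + R * j (aeval z h₁) + j (aeval z h₀) = j σ' ^ 3 := by
    have e1 : j (z none) * j li = 1 := by rw [← map_mul, hli, map_one]
    have e2 : algebraMap ℂ (QuadraticAlgebra O D 0) 2⁻¹ * 2 = 1 := by
      rw [← map_ofNat (algebraMap ℂ (QuadraticAlgebra O D 0)) 2, ← map_mul]
      norm_num
    have e3 : j D = j (aeval z h₁) ^ 2 - 4 * j (z none) * (j (aeval z h₀) - j σ' ^ 3) :=
      (congrArg j hD).trans (by simp only [map_sub, map_mul, map_pow, map_ofNat])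
    rw [e3] at hroot
    generalize algebraMap ℂ (QuadraticAlgebra O D 0) 2⁻¹ = f at *
    generalize (⟨0, 1⟩ : QuadraticAlgebra O D 0) = ε at *
    generalize j (aeval z h₁) = H₁ at *
    generalize j (aeval z h₀) = H₀ at *
    generalize j (z none) = ll at *
    generalize j li = lj at *
    rw [hR]
    linear_combination (f ^ 2 * lj) * hroot + (f ^ 2 * lj * (ε - H₁) ^ 2 -
      4 * f ^ 2 * (H₀ - j σ' ^ 3)) * e1 + (- f * lj * (ε - H₁) * H₁ -
      (H₀ - j σ' ^ 3) * (2 * f + 1)) * e2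
  -- As `g(σ p', σ u', σ) = σ³ g(p', u', 1)` and `H(W' z) = W'³ σ³`, the two terms cancel.
  obtain ⟨S, hSd⟩ : ∃ S : Fin 5 ⊕ ρ → QuadraticAlgebra O D 0, S =
    Sum.elim ![j σ' * p', j σ' * u', j σ', W' * R, W' * j (z none)]
      (fun i => W' * j (z (some i))) := ⟨_, rfl⟩
  have hS0 : S (Sum.inl 0) = j σ' * p' := by rw [hSd]; rfl
  have hS1 : S (Sum.inl 1) = j σ' * u' := by rw [hSd]; rfl
  have hS2 : S (Sum.inl 2) = j σ' := by rw [hSd]; rfl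
  have hS3 : S (Sum.inl 3) = W' * R := by rw [hSd]; rfl
  have hS4 : S (Sum.inl 4) = W' * j (z none) := by rw [hSd]; rfl
  have hSt : (fun o => S (tailIndex o)) = fun o => W' * j (z o) := by
    funext o
    cases o <;> rw [hSd] <;> rfl
  have hθQ : algebraMap ℂ (QuadraticAlgebra O D 0) θ ^ 3 = -algebraMap ℂ _ t₂ := by
    rw [← map_pow, hθ3, map_neg]
  have hSF : aeval S (niceForm t₁ t₂ t₃ t₆ 0 h₁ h₀) = 0 := by
    rw [aeval_niceForm, hSt, IsHomogeneous.aeval_const_mul hh₁, IsHomogeneous.aeval_const_mul hh₀,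
      aeval_fun_algHom, aeval_fun_algHom, hS0, hS1, hS2, hS3, hS4, map_zero]
    rw [hθQ] at hS
    linear_combination j σ' ^ 3 * hS + W' ^ 3 * hRq
  refine (isEckardt_niceForm hh₁ hh₀ ht₃).liftable_of_evalSqrt hφ hrD (Ne.isUnit hr) hSF
    (s := W) (t := σ) (Ne.isUnit hW0) (Ne.isUnit hσ0) (Ne.isUnit h0) ?_ ?_
  · have ht : ∀ o, evalSqrt φ D r hrD (S (tailIndex o)) = W * P (tailIndex o) := by
      intro o
      rw [congrFun hSt o, map_mul, hj1, hz, hW1.1]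
    rintro (i | i)
    · fin_cases i
      · change evalSqrt φ D r hrD (S (Sum.inl 0)) = W * P (Sum.inl 0)
        rw [hS0, map_mul, hj1, hp1.1, hσ', hp', hW']
        ring
      · change evalSqrt φ D r hrD (S (Sum.inl 1)) = W * P (Sum.inl 1)
        rw [hS1, map_mul, hj1, hu1.1, hσ', hu', hW']
        ring
      · change evalSqrt φ D r hrD (S (Sum.inl 2)) = W * P (Sum.inl 2)
        rw [hS2, hj1, hσ', hW']
        ring
      · change evalSqrt φ D r hrD (S (Sum.inl 3)) = W * P (Sum.inl 3)
        rw [hS3, map_mul, hRev, hW1.1]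
      · exact ht none
    · exact ht (some i)
  · have ht : ∀ o, evalSqrt φ D (-r) (by rw [neg_sq, hrD]) (S (tailIndex o)) = 0 := by
      intro o
      rw [congrFun hSt o, map_mul, hW1.2, zero_mul]
    rintro (i | i)
    · fin_cases i
      · change evalSqrt φ D (-r) _ (S (Sum.inl 0)) = _
        rw [hS0, map_mul, hp1.2]
        simp
      · change evalSqrt φ D (-r) _ (S (Sum.inl 1)) = _
        rw [hS1, map_mul, hu1.2]
        simp
      · change evalSqrt φ D (-r) _ (S (Sum.inl 2)) = _
        rw [hS2, hj2, hσ']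
        simp
      · change evalSqrt φ D (-r) _ (S (Sum.inl 3)) = _
        rw [hS3, map_mul, hW1.2]
        simp
      · refine (ht none).trans ?_
        simp
    · refine (ht (some i)).trans ?_
      simp

end NiceForm

/-! ### The curve `x³ + y³ = Δ (1 + x³ y³)` -/

section CubicCurve

theorem evalSqrt_algebraMap {A C : Type*} [CommRing A] [Algebra ℂ A] [CommRing C] [Algebra ℂ C]
    (φ : A →ₐ[ℂ] C) (D : A) (r : C) (hr : r ^ 2 = φ D) (a : A) :
    evalSqrt φ D r hr (algebraMap A _ a) = φ a := by
  simp [evalSqrt_apply, QuadraticAlgebra.algebraMap_eq]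

/-- The function field of the curve `x³ + y³ = Δ (1 + x³ y³)` is obtained from the field of
rational functions in `m = (x + y) / (1 + x y)` by adjoining two square roots. -/
theorem cubicCurve_identity {A : Type*} [CommRing A] {Q m Δ r₁ r₃ h x y : A}
    (h1 : Q * (m ^ 3 - Δ) = 3 * (m - Δ)) (hr₁ : r₁ ^ 2 = Q * (Q - 4))
    (hr₃ : r₃ ^ 2 = Q * (m ^ 2 * Q - 4)) (hh : 4 * Q * h = 1)
    (hx : x = h * (Q + r₁) * (m * Q + r₃)) (hy : y = h * (Q + r₁) * (m * Q - r₃)) :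
    x ^ 3 + y ^ 3 = Δ * (1 + x ^ 3 * y ^ 3) := by
  obtain ⟨P, hP⟩ : ∃ P, P = 2 * Q * h * (Q + r₁) := ⟨_, rfl⟩
  have hN : x * y = P - 1 := by
    rw [hx, hy, hP]
    linear_combination -h ^ 2 * (Q + r₁) ^ 2 * hr₃ + h * hr₁ + (h * (Q + r₁) ^ 2 - 1) * hh
  have hS : x + y = m * P := by rw [hx, hy, hP]; ring
  have hPP : P ^ 2 = Q * (P - 1) := by
    rw [hP]
    linear_combination 4 * Q ^ 2 * h ^ 2 * hr₁ + (2 * Q ^ 2 * h * (Q + r₁ - 2) + Q) * hh -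
      2 * Q * hh
  have e1 : x ^ 3 + y ^ 3 = (x + y) ^ 3 - 3 * (x * y) * (x + y) := by ring
  have e2 : x ^ 3 * y ^ 3 = (x * y) ^ 3 := by ring
  rw [e1, e2, hN, hS]
  linear_combination P * (m ^ 3 - Δ) * hPP + P * (P - 1) * h1

/-- The adjoined element of `A[√D]` is a square root of `D`. -/
theorem sqrt_sq {A : Type*} [CommRing A] (D : A) :
    (⟨0, 1⟩ : QuadraticAlgebra A D 0) ^ 2 = algebraMap A _ D := by
  rw [pow_two]; ext <;> simp [QuadraticAlgebra.algebraMap_eq]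

/-- The parameters of a point of the curve `x³ + y³ = Δ (1 + x³ y³)` lift along a local
homomorphism. -/
theorem exists_lift_cubicCurve_param {A C : Type*} [CommRing A] [Algebra ℂ A] [Field C]
    [Algebra ℂ C] {φ : A →ₐ[ℂ] C} (hφ : IsLocalSurj φ) {Δ : ℂ} (hΔ : Δ ^ 2 ≠ 1) (hΔ0 : Δ ≠ 0)
    {x y : C} (hx : x ≠ 0) (hy : y ≠ 0) (hN : (x * y) ^ 2 ≠ 1)
    (h : x ^ 3 + y ^ 3 = algebraMap ℂ C Δ * (1 + x ^ 3 * y ^ 3)) :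
    ∃ Q M g : A, Q * (M ^ 3 - algebraMap ℂ A Δ) = 3 * (M - algebraMap ℂ A Δ) ∧ 4 * Q * g = 1 ∧
      φ Q = (1 + x * y) ^ 2 / (x * y) ∧ x + y = φ M * (1 + x * y) := by
  obtain ⟨δ, hδ⟩ : ∃ δ, δ = algebraMap ℂ C Δ := ⟨_, rfl⟩
  have hδ1 : δ ^ 2 ≠ 1 := by
    rw [hδ, ← map_pow, ← map_one (algebraMap ℂ C)]
    exact fun h => hΔ ((algebraMap ℂ C).injective h)
  have hδ0 : δ ≠ 0 := by rw [hδ]; exact (map_ne_zero _).2 hΔ0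
  rw [← hδ] at h
  have h4 : (4 : C) ≠ 0 := by
    rw [← map_ofNat (algebraMap ℂ C) 4]; exact (map_ne_zero _).2 (by norm_num)
  have h3 : (3 : C) ≠ 0 := by
    rw [← map_ofNat (algebraMap ℂ C) 3]; exact (map_ne_zero _).2 (by norm_num)
  have hN1 : 1 + x * y ≠ 0 := fun h => hN (by linear_combination (x * y - 1) * h)
  have hN2 : x * y - 1 ≠ 0 := fun h => hN (by linear_combination (x * y + 1) * h)
  have hN0 : x * y ≠ 0 := mul_ne_zero hx hy
  obtain ⟨m, hm⟩ : ∃ m, m = (x + y) / (1 + x * y) := ⟨_, rfl⟩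
  have hm' : x + y = m * (1 + x * y) := by rw [hm]; field_simp
  have hmQ : (1 + x * y) ^ 2 * (m ^ 3 - δ) = 3 * (x * y) * (m - δ) := by
    refine mul_left_cancel₀ hN1 ?_
    have e1 : x ^ 3 + y ^ 3 = (x + y) ^ 3 - 3 * (x * y) * (x + y) := by ring
    rw [e1, hm'] at h
    linear_combination h
  have hmδ : m ^ 3 - δ ≠ 0 := by
    intro h0
    rw [h0, mul_zero] at hmQ
    have h5 : m = δ := sub_eq_zero.1 ((mul_eq_zero.1 hmQ.symm).resolve_left (mul_ne_zero h3 hN0))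
    rw [h5] at h0
    apply hδ1
    refine mul_left_cancel₀ hδ0 ?_
    linear_combination h0
  obtain ⟨M, hM⟩ := hφ.surj m
  have hu : IsUnit (M ^ 3 - algebraMap ℂ A Δ) := by
    apply hφ.unit
    rw [map_sub, map_pow, hM, AlgHom.commutes, ← hδ]
    exact Ne.isUnit hmδ
  obtain ⟨c, hc⟩ := hu.exists_right_inv
  obtain ⟨Q, hQ⟩ : ∃ Q, Q = 3 * (M - algebraMap ℂ A Δ) * c := ⟨_, rfl⟩
  have hφQ : φ Q = (1 + x * y) ^ 2 / (x * y) := by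
    have e1 := congrArg φ hc
    simp only [map_sub, map_mul, map_pow, map_one, AlgHom.commutes, ← hδ, hM] at e1
    rw [eq_div_iff hN0, hQ]
    simp only [map_sub, map_mul, map_ofNat, AlgHom.commutes, ← hδ, hM]
    linear_combination -φ c * hmQ + (1 + x * y) ^ 2 * e1
  have hQu : IsUnit (4 * Q) := by
    apply hφ.unit
    rw [map_mul, map_ofNat, hφQ]
    exact Ne.isUnit (mul_ne_zero h4 (div_ne_zero (pow_ne_zero 2 hN1) hN0))
  obtain ⟨g, hg⟩ := hQu.exists_right_inv
  refine ⟨Q, M, g, ?_, hg, hφQ, by rw [hM]; exact hm'⟩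
  rw [hQ]; linear_combination 3 * (M - algebraMap ℂ A Δ) * hc

/-- The point of the curve with given parameters, over `A[√D]`, where the first of the two square
roots of `cubicCurve_identity` is supposed to be the element `e` of `A`. -/
theorem exists_cubicCurve_point {A : Type*} [CommRing A] [Algebra ℂ A] {Δ : ℂ} {Q M g e D : A}
    (hQ : Q * (M ^ 3 - algebraMap ℂ A Δ) = 3 * (M - algebraMap ℂ A Δ)) (hg : 4 * Q * g = 1)
    (he : e ^ 2 = Q * (Q - 4)) (hD : D = Q * (M ^ 2 * Q - 4)) :
    ∃ X Y : QuadraticAlgebra A D 0, X ^ 3 + Y ^ 3 = algebraMap ℂ _ Δ * (1 + X ^ 3 * Y ^ 3) ∧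
      IsUnit Y ∧ ∀ (C : Type) [CommRing C] [Algebra ℂ C] (χ : A →ₐ[ℂ] C) (r : C)
        (hr : r ^ 2 = χ D),
        evalSqrt χ D r hr X = χ g * (χ Q + χ e) * (χ M * χ Q + r) ∧
        evalSqrt χ D r hr Y = χ g * (χ Q + χ e) * (χ M * χ Q - r) := by
  let j : A →ₐ[ℂ] QuadraticAlgebra A D 0 := IsScalarTower.toAlgHom ℂ A _
  have hj : ∀ a, j a = algebraMap A (QuadraticAlgebra A D 0) a := fun _ => rfl
  obtain ⟨f, hf⟩ : ∃ f, f = (⟨0, 1⟩ : QuadraticAlgebra A D 0) := ⟨_, rfl⟩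
  have he' : j e ^ 2 = j Q * (j Q - 4) := by
    rw [← map_pow, he]
    simp only [map_mul, map_sub, map_ofNat]
  have hf' : f ^ 2 = j Q * (j M ^ 2 * j Q - 4) := by
    rw [hf, sqrt_sq, ← hj]
    refine (congrArg j hD).trans ?_
    simp only [map_mul, map_sub, map_pow, map_ofNat]
  have hjg : 4 * j Q * j g = 1 := by
    rw [← map_one j, ← hg]
    simp only [map_mul, map_ofNat]
  have hjQ : j Q * (j M ^ 3 - algebraMap ℂ _ Δ) = 3 * (j M - algebraMap ℂ _ Δ) := by
    have := congrArg j hQ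
    simpa only [map_mul, map_sub, map_pow, map_ofNat, AlgHom.commutes] using this
  obtain ⟨X, hX⟩ : ∃ X, X = j g * (j Q + j e) * (j M * j Q + f) := ⟨_, rfl⟩
  obtain ⟨Y, hY⟩ : ∃ Y, Y = j g * (j Q + j e) * (j M * j Q - f) := ⟨_, rfl⟩
  refine ⟨X, Y, cubicCurve_identity hjQ he' hf' hjg hX hY, ?_, ?_⟩
  · rw [hY]
    refine IsUnit.of_mul_eq_one (j g * (j Q - j e) * (j M * j Q + f)) ?_
    linear_combination -j g ^ 2 * (j M ^ 2 * j Q ^ 2 - f ^ 2) * he' -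
      4 * j g ^ 2 * j Q * hf' + (4 * j Q * j g + 1) * hjg
  · intro C _ _ χ r hr
    have h1 : ∀ a, evalSqrt χ D r hr (j a) = χ a := fun a => by rw [hj, evalSqrt_algebraMap]
    have h2 : evalSqrt χ D r hr f = r := by rw [hf, evalSqrt_apply]; simp
    rw [hX, hY]
    simp only [map_mul, map_add, map_sub, h1, h2, and_self]

end CubicCurve

/-! ### The norm form -/

section CubicA

/-- The cubic form `k₀ (e₂³ - e₁³ + 3 e₁ e₂ u + u³) + t₂ u³ + p q (t₄ p + t₅ q + t₇ u)` in the
variables `e₁, e₂, u, p, q`. If `τ` and `σ` are the roots of `T² - e₁ T + e₂`, then the first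
summand is `k₀ (τ³ - 1) (σ³ - 1)` for `u = 1`. -/
def normForm (k₀ t₂ t₄ t₅ t₇ : ℂ) : MvPolynomial (Fin 5) ℂ :=
  C k₀ * (X 1 ^ 3 - X 0 ^ 3 + C 3 * (X 0 * X 1 * X 2) + X 2 ^ 3) + C t₂ * X 2 ^ 3 +
    X 3 * X 4 * (C t₄ * X 3 + C t₅ * X 4 + C t₇ * X 2)

variable {k₀ t₂ t₄ t₅ t₇ : ℂ}

theorem aeval_normForm {A : Type*} [CommRing A] [Algebra ℂ A] (x : Fin 5 → A) :
    aeval x (normForm k₀ t₂ t₄ t₅ t₇) =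
      algebraMap ℂ A k₀ * (x 1 ^ 3 - x 0 ^ 3 + 3 * (x 0 * x 1 * x 2) + x 2 ^ 3) +
      algebraMap ℂ A t₂ * x 2 ^ 3 +
      x 3 * x 4 * (algebraMap ℂ A t₄ * x 3 + algebraMap ℂ A t₅ * x 4 + algebraMap ℂ A t₇ * x 2) := by
  simp only [normForm, map_add, map_sub, map_mul, map_pow, aeval_X, aeval_C, map_ofNat]

theorem isHomogeneous_normForm : (normForm k₀ t₂ t₄ t₅ t₇).IsHomogeneous 3 := by
  have hX := fun i : Fin 5 => isHomogeneous_X ℂ i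
  have hC := fun c : ℂ => isHomogeneous_C (Fin 5) c
  have h3 := fun i : Fin 5 => (hX i).pow 3
  simp only [one_mul] at h3
  have hl : ∀ (c : ℂ) (i : Fin 5), (C c * X i : MvPolynomial (Fin 5) ℂ).IsHomogeneous 1 :=
    fun c i => by simpa using (hC c).mul (hX i)
  have hCm : ∀ (c : ℂ) {G : MvPolynomial (Fin 5) ℂ}, G.IsHomogeneous 3 →
      (C c * G).IsHomogeneous 3 := fun c G hG => by simpa using (hC c).mul hG
  refine ((hCm _ (((((h3 1).sub (h3 0)).add (hCm _ (((hX 0).mul (hX 1)).mul (hX 2)))).add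
    (h3 2)))).add (hCm _ (h3 2))).add (((hX 3).mul (hX 4)).mul (((hl _ _).add (hl _ _)).add (hl _ _)))

theorem isEckardt_normForm (ht₅ : t₅ ≠ 0) :
    IsEckardt (normForm k₀ t₂ t₄ t₅ t₇) 4 3 2 t₄ t₅ t₇ := by
  refine ⟨isHomogeneous_normForm, by decide, by decide, ht₅, fun A _ _ x y => ?_⟩
  rw [aeval_normForm, aeval_normForm]
  simp [Function.update_of_ne]
  ring

/-- The two specialisations, at `χ₁` and `χ₂`, of a point of `normForm = 0`: one is conjugate to the
given point `R` and the other one is the Eckardt point. -/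
theorem exists_normForm_point {A C : Type} [CommRing A] [Algebra ℂ A] [Field C] [Algebra ℂ C]
    {χ₁ χ₂ : A →ₐ[ℂ] C} (hχ : IsLocalSurj (χ₁.prod χ₂)) {π : A} (hπ : π ∈ nonZeroDivisors A)
    (hπ₁ : χ₁ π = 1) (hπ₂ : χ₂ π = 0) {w ε Δ : ℂ} (hw : w ^ 2 + w + 1 = 0) (hww : w - w ^ 2 ≠ 0)
    (hε : ε ^ 3 = Δ) (hε0 : ε ≠ 0) (ht₂ : t₂ ≠ 0) (ht₅ : t₅ ≠ 0) (hΔ : k₀ * Δ ^ 2 = k₀ + t₂)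
    {D : A} {X Y : QuadraticAlgebra A D 0}
    (hXY : X ^ 3 + Y ^ 3 = algebraMap ℂ _ Δ * (1 + X ^ 3 * Y ^ 3)) (hY : IsUnit Y)
    {r : C} (hr0 : r ≠ 0) (hr₁ : r ^ 2 = χ₁ D) (hr₂ : r ^ 2 = χ₂ D) {τ θ W u p : C}
    (hτ : algebraMap ℂ C ε * evalSqrt χ₁ D r hr₁ X = τ)
    (hθ : algebraMap ℂ C ε * evalSqrt χ₁ D r hr₁ Y = θ) (hp0 : p ≠ 0)
    (hG0 : algebraMap ℂ C t₄ * p + algebraMap ℂ C t₅ + algebraMap ℂ C t₇ * u ≠ 0)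
    (hF : algebraMap ℂ C k₀ * (τ ^ 3 - 1) * (W ^ 3 - θ ^ 3 * u ^ 3) +
      p * (algebraMap ℂ C t₄ * p + algebraMap ℂ C t₅ + algebraMap ℂ C t₇ * u) = 0)
    (hc : 1 - algebraMap ℂ C t₄ * (algebraMap ℂ C k₀ * (τ ^ 3 - 1)) * algebraMap ℂ C w ^ 2 *
        (W - algebraMap ℂ C w * θ * u) * (-(W - algebraMap ℂ C w ^ 2 * θ * u) /
          (algebraMap ℂ C t₄ * p + algebraMap ℂ C t₅ + algebraMap ℂ C t₇ * u)) ^ 2 +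
        algebraMap ℂ C t₇ * (-(W - algebraMap ℂ C w ^ 2 * θ * u) /
          (algebraMap ℂ C t₄ * p + algebraMap ℂ C t₅ + algebraMap ℂ C t₇ * u)) *
        (θ * (algebraMap ℂ C w - algebraMap ℂ C w ^ 2))⁻¹ ≠ 0) :
    ∃ (N : Fin 5 → A) (s t : C), aeval N (normForm k₀ t₂ t₄ t₅ t₇) = 0 ∧ s ≠ 0 ∧ t ≠ 0 ∧
      (∀ i, χ₁ (N i) = s * eckardtInv 4 3 2 t₄ t₅ t₇ ![τ * u + W, τ * W, u, p, 1] i) ∧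
      ∀ i, χ₂ (N i) = t * (Pi.single 4 1 : Fin 5 → C) i := by
  have hE := isEckardt_normForm (k₀ := k₀) (t₂ := t₂) (t₄ := t₄) (t₇ := t₇) ht₅
  have hrr : ((r, r) : C × C) ^ 2 = (χ₁.prod χ₂) D := Prod.ext hr₁ hr₂
  have hru : IsUnit ((r, r) : C × C) := Prod.isUnit_iff.2 ⟨Ne.isUnit hr0, Ne.isUnit hr0⟩
  have hΦ := isLocalSurj_evalSqrt_prod hχ D (r, r) hrr hru
  obtain ⟨Φ, hΦd⟩ : ∃ Φ, Φ = (evalSqrt (χ₁.prod χ₂) D (r, r) hrr).prod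
    (evalSqrt (χ₁.prod χ₂) D (-(r, r)) (by rw [neg_sq, hrr])) := ⟨_, rfl⟩
  have hΦe : ∀ z, Φ z = ((χ₁ z.re + χ₁ z.im * r, χ₂ z.re + χ₂ z.im * r),
      (χ₁ z.re + χ₁ z.im * -r, χ₂ z.re + χ₂ z.im * -r)) := fun z => by rw [hΦd]; rfl
  rw [← hΦd] at hΦ
  obtain ⟨y, hy⟩ := hY.exists_right_inv
  have hεinv : algebraMap ℂ (QuadraticAlgebra A D 0) ε * algebraMap ℂ _ ε⁻¹ = 1 := by
    rw [← map_mul, mul_inv_cancel₀ hε0, map_one]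
  obtain ⟨T, hT⟩ : ∃ T, T = algebraMap ℂ (QuadraticAlgebra A D 0) ε * X := ⟨_, rfl⟩
  obtain ⟨Θ, hΘ⟩ : ∃ T, T = algebraMap ℂ (QuadraticAlgebra A D 0) ε * Y := ⟨_, rfl⟩
  obtain ⟨k, hk⟩ : ∃ k, Θ * (algebraMap ℂ (QuadraticAlgebra A D 0) w - algebraMap ℂ _ w ^ 2) * k
      = 1 := by
    refine ⟨algebraMap ℂ _ ε⁻¹ * y * algebraMap ℂ _ (w - w ^ 2)⁻¹, ?_⟩
    have h1 : (algebraMap ℂ (QuadraticAlgebra A D 0) w - algebraMap ℂ _ w ^ 2) *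
        algebraMap ℂ _ (w - w ^ 2)⁻¹ = 1 := by
      rw [← map_pow, ← map_sub, ← map_mul, mul_inv_cancel₀ hww, map_one]
    calc _ = (algebraMap ℂ (QuadraticAlgebra A D 0) ε * algebraMap ℂ _ ε⁻¹) * (Y * y) *
        ((algebraMap ℂ (QuadraticAlgebra A D 0) w - algebraMap ℂ _ w ^ 2) *
        algebraMap ℂ _ (w - w ^ 2)⁻¹) := by rw [hΘ]; ring
      _ = 1 := by rw [hεinv, hy, h1]; ring
  obtain ⟨v, hv⟩ : ∃ v, v = algebraMap ℂ (QuadraticAlgebra A D 0) k₀ * (T ^ 3 - 1) := ⟨_, rfl⟩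
  have hvΘ : v * (Θ ^ 3 - 1) + algebraMap ℂ _ t₂ = 0 := by
    have e1 : algebraMap ℂ (QuadraticAlgebra A D 0) ε ^ 3 = algebraMap ℂ _ Δ := by
      rw [← map_pow, hε]
    have e2 : algebraMap ℂ (QuadraticAlgebra A D 0) k₀ * algebraMap ℂ _ Δ ^ 2 =
        algebraMap ℂ _ k₀ + algebraMap ℂ _ t₂ := by
      rw [← map_pow, ← map_mul, hΔ, map_add]
    rw [hv, hT, hΘ, mul_pow, mul_pow, e1]
    linear_combination -algebraMap ℂ (QuadraticAlgebra A D 0) k₀ * algebraMap ℂ _ Δ * hXY - e2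
  have hT11 : (Φ T).1.1 = τ := by
    rw [hT, map_mul, AlgHom.commutes, ← hτ, hΦe X]; rfl
  have hΘ11 : (Φ Θ).1.1 = θ := by
    rw [hΘ, map_mul, AlgHom.commutes, ← hθ, hΦe Y]; rfl
  have hv11 : (Φ v).1.1 = algebraMap ℂ C k₀ * (τ ^ 3 - 1) := by
    rw [hv, map_mul, map_sub, map_pow, map_one, AlgHom.commutes, ← hT11]; rfl
  have hk11 : (Φ k).1.1 = (θ * (algebraMap ℂ C w - algebraMap ℂ C w ^ 2))⁻¹ := by
    refine eq_inv_of_mul_eq_one_right ?_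
    have := congrArg (fun z => (Φ z).1.1) hk
    simp only [map_mul, map_sub, map_pow, map_one, AlgHom.commutes] at this
    rw [← hΘ11]
    exact this
  have hθ0 : θ ≠ 0 := by
    rintro rfl
    have := congrArg (fun z => (Φ z).1.1) hk
    simp only [map_mul, map_sub, map_pow, map_one, AlgHom.commutes, Prod.fst_mul, hΘ11,
      zero_mul, Prod.fst_one] at this
    exact zero_ne_one this
  have hwC : algebraMap ℂ C w ^ 2 + algebraMap ℂ C w + 1 = 0 := by
    rw [← map_pow, ← map_add, ← map_one (algebraMap ℂ C), ← map_add, hw, map_zero]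
  have ht₅C : algebraMap ℂ C t₅ ≠ 0 := (map_ne_zero _).2 ht₅
  let jπ : QuadraticAlgebra A D 0 := algebraMap A _ π
  have hjπ : Φ jπ = ((1, 0), (1, 0)) := by
    rw [hΦe]
    simp [jπ, QuadraticAlgebra.algebraMap_eq, hπ₁, hπ₂]
  obtain ⟨G, hGd⟩ : ∃ G, G = algebraMap ℂ C t₄ * p + algebraMap ℂ C t₅ + algebraMap ℂ C t₇ * u :=
    ⟨_, rfl⟩
  rw [← hGd] at hc hF hG0
  -- There are four specialisations of `A[√D]`: `χ₁` and `χ₂`, combined with `√D = r` and `√D = -r`.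
  -- The parameters are zero for `√D = -r`; for `√D = r` they are the given ones over `χ₁`, and
  -- `(1, -1 / t₅)` over `χ₂`.
  obtain ⟨p', u', W', hp', hu', hW', hS⟩ := exists_surface_lift hΦ (w := w) (a := t₄) (b := t₅)
    (g := t₇) hw (v := v) (π := jπ) (θ := Θ) (k := k) hk
    (m := ((W - algebraMap ℂ C w * θ * u, 1), (0, 0)))
    (η := ((-(W - algebraMap ℂ C w ^ 2 * θ * u) / G, -(algebraMap ℂ C t₅)⁻¹), (0, 0)))
    (p := ((p, 0), (0, 0))) (u := ((u, 0), (0, 0))) (W := ((W, 1), (0, 0)))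
    (G := ((G, algebraMap ℂ C t₅), (algebraMap ℂ C t₅, algebraMap ℂ C t₅)))
    (by
      rw [hjπ]
      simp only [Prod.isUnit_iff]
      refine ⟨⟨?_, ?_⟩, ?_, ?_⟩
      · simp only [Prod.algebraMap_apply, Prod.fst_mul, Prod.fst_add, Prod.fst_sub, Prod.fst_one,
          Prod.pow_fst, one_mul, hv11, hk11]
        exact Ne.isUnit hc
      · simp
      · simp
      · simp)
    (by ext <;> simp [Prod.algebraMap_apply, hΘ11])
    (by
      ext
      · simp [Prod.algebraMap_apply, hΘ11]
        field_simp
        ring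
      · simp [ht₅C]
      · simp
      · simp)
    (by ext <;> simp [Prod.algebraMap_apply, hjπ, hGd])
    (by
      ext
      · simp [hΘ11, hv11, hjπ]
        field_simp
        linear_combination hF + algebraMap ℂ C k₀ * (τ ^ 3 - 1) *
          (-(W - θ * u) * W * θ * u +
          (W - θ * u) * (algebraMap ℂ C w - 1) * (θ * u) ^ 2) * hwC
      · simp [hjπ]
      · simp
      · simp)
  -- The point `π V + E`, where `E` is the Eckardt point. It is equal to `E` where `π = 0`, and
  -- there the direction of the chord is given by `V`.
  obtain ⟨V, hV⟩ : ∃ V : Fin 5 → QuadraticAlgebra A D 0, V = ![T * u' + W', T * W', u', p', 0] :=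
    ⟨_, rfl⟩
  have hV0 : V 0 = T * u' + W' := by rw [hV]; rfl
  have hV1 : V 1 = T * W' := by rw [hV]; rfl
  have hV2 : V 2 = u' := by rw [hV]; rfl
  have hV3 : V 3 = p' := by rw [hV]; rfl
  have hV4 : V 4 = 0 := by rw [hV]; rfl
  have hΦV : (∀ i, (Φ (V i)).1.1 + (Pi.single 4 1 : Fin 5 → C) i =
      (![τ * u + W, τ * W, u, p, 1] : Fin 5 → C) i) ∧ (∀ i, (Φ (V i)).2.1 = 0) ∧
      (∀ i, (Φ (V i)).1.2 = (![1, (Φ T).1.2, 0, 0, 0] : Fin 5 → C) i) ∧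
      (∀ i, (Φ (V i)).2.2 = 0) := by
    refine ⟨fun i => ?_, fun i => ?_, fun i => ?_, fun i => ?_⟩ <;> fin_cases i <;>
      simp [hV, hp', hu', hW', hT11]
  let F := normForm k₀ t₂ t₄ t₅ t₇
  have hVF : aeval (fun i => jπ * V i + (Pi.single 4 1 : Fin 5 → QuadraticAlgebra A D 0) i) F =
      0 := by
    rw [aeval_normForm]
    simp only [hV0, hV1, hV2, hV3, hV4]
    simp
    rw [hv] at hS hvΘ
    linear_combination hS + jπ ^ 3 * u' ^ 3 * hvΘ
  obtain ⟨e1, e2⟩ := aeval_quadratic hE.isHomogeneous _ hVF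
  have hre : (fun i => (jπ * V i + (Pi.single 4 1 : Fin 5 → QuadraticAlgebra A D 0) i).re) =
      fun i => 1 * (π * (V i).re + (Pi.single 4 1 : Fin 5 → A) i) := by
    funext i
    by_cases hi : i = 4
    · subst hi; simp [jπ, QuadraticAlgebra.algebraMap_eq]
    · simp [jπ, QuadraticAlgebra.algebraMap_eq, hi]
  have him : (fun i => (jπ * V i + (Pi.single 4 1 : Fin 5 → QuadraticAlgebra A D 0) i).im) =
      fun i => π * (V i).im := by
    funext i
    by_cases hi : i = 4
    · subst hi; simp [jπ, QuadraticAlgebra.algebraMap_eq]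
    · simp [jπ, QuadraticAlgebra.algebraMap_eq, hi]
  rw [hre, him, polar_smul hE.isHomogeneous, IsHomogeneous.aeval_const_mul hE.isHomogeneous] at e1
  rw [hre, him, polar_smul hE.isHomogeneous, IsHomogeneous.aeval_const_mul hE.isHomogeneous] at e2
  obtain ⟨x₁, hx₁⟩ : ∃ x : Fin 5 → A, x = fun i => π * (V i).re + (Pi.single 4 1 : Fin 5 → A) i :=
    ⟨_, rfl⟩
  obtain ⟨y₁, hy₁⟩ : ∃ x : Fin 5 → A, x = fun i => (V i).im := ⟨_, rfl⟩
  rw [← hx₁, ← hy₁] at e1 e2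
  -- Dividing the direction `π y₁` by `π` gives the equations of conjugate points `x₁ ± √(D π²) y₁`,
  -- the third point of which remains defined where `π = 0`.
  have e1' : aeval x₁ F + (D * π ^ 2) * polar F y₁ x₁ = 0 := by linear_combination e1
  have e2' : polar F x₁ y₁ + (D * π ^ 2) * aeval y₁ F = 0 := by
    refine (mul_left_mem_nonZeroDivisors_eq_zero_iff hπ).1 ?_
    linear_combination e2
  have h2 : (2 : C) ≠ 0 := by
    rw [← map_ofNat (algebraMap ℂ C) 2]; exact (map_ne_zero _).2 (by norm_num)
  have h8 : (8 : C) ≠ 0 := by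
    rw [← map_ofNat (algebraMap ℂ C) 8]; exact (map_ne_zero _).2 (by norm_num)
  have hs1 : ∀ i, ((Pi.single 4 1 : Fin 5 → C)) i = χ₁ ((Pi.single 4 1 : Fin 5 → A) i) := by
    intro i; by_cases hi : i = 4
    · subst hi; simp
    · simp [hi]
  have hs2 : ∀ i, ((Pi.single 4 1 : Fin 5 → C)) i = χ₂ ((Pi.single 4 1 : Fin 5 → A) i) := by
    intro i; by_cases hi : i = 4
    · subst hi; simp
    · simp [hi]
  have hy2 : ∀ i, 2 * r * χ₂ (y₁ i) = (![1, (Φ T).1.2, 0, 0, 0] : Fin 5 → C) i := by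
    intro i
    have i1 := hΦV.2.2.1 i
    have i2 := hΦV.2.2.2 i
    rw [hΦe] at i1 i2
    simp only at i2
    rw [← i1, hy₁]
    linear_combination -i2
  refine ⟨thirdPoint F x₁ y₁, algebraMap ℂ C t₅ * p / (8 * r ^ 3),
    aeval (fun i => χ₂ (y₁ i)) F, aeval_thirdPoint hE.isHomogeneous e1' e2', ?_, ?_, ?_, ?_⟩
  · exact div_ne_zero (mul_ne_zero ht₅C hp0) (mul_ne_zero h8 (pow_ne_zero 3 hr0))
  · intro h0
    have i1 := IsHomogeneous.aeval_const_mul hE.isHomogeneous (2 * r) (fun i => χ₂ (y₁ i))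
    rw [h0, mul_zero] at i1
    simp only [hy2] at i1
    rw [aeval_normForm] at i1
    simp at i1
    have i2 := congrArg (fun z => (Φ z).1.2) hvΘ
    simp only [hv, map_mul, map_sub, map_add, map_pow, map_one, AlgHom.commutes, map_zero] at i2
    simp [Prod.algebraMap_apply] at i2
    apply ht₂
    rcases i1 with i1 | i1
    · rw [i1] at i2; simpa using i2
    · rw [i1] at i2; simpa using i2
  -- Over `χ₁`, one conjugate is the given point and the other one the Eckardt point.
  · intro i
    have i1 := hE.thirdPoint (fun i => χ₁ (x₁ i)) (fun i => χ₁ (y₁ i))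
      ![τ * u + W, τ * W, u, p, 1] r 1 1
      (fun i => by
        rw [one_mul, ← hΦV.1, hΦe, hs1, hx₁, hy₁]
        simp only [map_add, map_mul, hπ₁]
        ring)
      (fun i => by
        have := hΦV.2.1 i
        rw [hΦe] at this
        simp only at this
        rw [one_mul, hs1, hx₁, hy₁]
        simp only [map_add, map_mul, hπ₁]
        linear_combination this)
      (by
        rw [aeval_normForm]
        have i2 := congrArg (fun z => (Φ z).1.1) hvΘ
        simp only [map_mul, map_sub, map_add, map_pow, map_one, AlgHom.commutes, map_zero,
          Prod.algebraMap_apply, Prod.fst_add, Prod.fst_mul, Prod.fst_sub, Prod.pow_fst,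
          Prod.fst_one, Prod.fst_zero, hv11, hΘ11] at i2
        simp
        linear_combination hF + u ^ 3 * i2 - p * hGd) i
    rw [map_thirdPoint, div_mul_eq_mul_div, eq_div_iff (mul_ne_zero h8 (pow_ne_zero 3 hr0))]
    simp at i1 ⊢
    linear_combination i1
  -- Over `χ₂`, the chord is a tangent at the Eckardt point, which is its third intersection point.
  · intro i
    have i1 : (fun i => χ₂ (x₁ i)) = Pi.single 4 1 := by
      funext i
      rw [hs2, hx₁]
      simp only [map_add, map_mul, hπ₂]
      ring
    have i2 : χ₂ (y₁ 3) = 0 := by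
      have := hy2 3
      simpa [h2, hr0] using this
    rw [map_thirdPoint, i1]
    simp only [thirdPoint]
    rw [(hE.polar_single (fun i => χ₂ (y₁ i))).1, i2]
    ring

end CubicA

/-! ### Lifting points of the norm form, given a root and a cube root -/

section LiftNormForm

/-- The two specialisations of `A[√D]` are separated by an element which is not a zero divisor. As
`D` may be a square in `A`, the ring `A[√D]` may have zero divisors; they are avoided by adding a
nonzero element `t` of the kernel of `φ`. -/
theorem exists_idempotent_lift {A C : Type*} [CommRing A] [IsDomain A] [Algebra ℂ A] [Field C]
    [Algebra ℂ C] {φ : A →ₐ[ℂ] C} (hφ : IsLocalSurj φ) {t : A} (ht : t ≠ 0) (hφt : φ t = 0)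
    {D : A} {r : C} (hr : r ^ 2 = φ D) (hr0 : r ≠ 0) :
    ∃ π ∈ nonZeroDivisors (QuadraticAlgebra A D 0), evalSqrt φ D r hr π = 1 ∧
      evalSqrt φ D (-r) (by rw [neg_sq, hr]) π = 0 := by
  obtain ⟨π, hπ⟩ := (isLocalSurj_evalSqrt_prod hφ D r hr (Ne.isUnit hr0)).surj (1, 0)
  simp only [AlgHom.prod_apply, Prod.mk.injEq] at hπ
  have key : ∀ z : QuadraticAlgebra A D 0, QuadraticAlgebra.norm z ≠ 0 →
      z ∈ nonZeroDivisors (QuadraticAlgebra A D 0) := fun z hz =>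
    QuadraticAlgebra.norm_mem_nonZeroDivisors_iff.1 (mem_nonZeroDivisors_of_ne_zero hz)
  by_cases h : QuadraticAlgebra.norm π = 0
  · refine ⟨π + algebraMap A _ t, key _ fun h1 => ?_, ?_, ?_⟩
    · have h2 : t * (2 * π.re + t) = 0 := by
        rw [QuadraticAlgebra.norm_def] at h h1
        simp [QuadraticAlgebra.algebraMap_eq] at h h1
        linear_combination h1 - h
      have h3 := (mul_eq_zero.1 h2).resolve_left ht
      have h4 := congrArg φ h3
      simp only [map_add, map_mul, map_ofNat, hφt, map_zero, add_zero] at h4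
      rw [evalSqrt_apply, evalSqrt_apply] at hπ
      exact one_ne_zero (by linear_combination h4 - hπ.1 - hπ.2 : (1 : C) = 0)
    · rw [map_add, hπ.1, evalSqrt_algebraMap, hφt, add_zero]
    · rw [map_add, hπ.2, evalSqrt_algebraMap, hφt, add_zero]
  · exact ⟨π, key _ h, hπ.1, hπ.2⟩

variable {k₀ t₂ t₄ t₅ t₇ : ℂ}

/-- Lifting a point of `normForm = 0` with `q = 1` which lies on the family of `surface_family` for
the given cube root `θ`. The plane cubic curve of the pairs `(τ, θ)` is parametrized after adjoining
two square roots; the first one separates the given point from the Eckardt point, the second one is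
that of `exists_normForm_point`. -/
theorem liftable_normForm_of_family {A C : Type} [CommRing A] [IsDomain A] [Algebra ℂ A] [Field C]
    [Algebra ℂ C] {φ : A →ₐ[ℂ] C} (hφ : IsLocalSurj φ) {t : A} (ht : t ≠ 0) (hφt : φ t = 0)
    {w ε Δ : ℂ} (hw : w ^ 2 + w + 1 = 0) (hww : w - w ^ 2 ≠ 0)
    (hε : ε ^ 3 = Δ) (hΔ0 : Δ ≠ 0) (ht₂ : t₂ ≠ 0) (ht₅ : t₅ ≠ 0) (hk₀ : k₀ ≠ 0)
    (hΔ : k₀ * Δ ^ 2 = k₀ + t₂) {τ θ W u p : C}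
    (hτθ : algebraMap ℂ C k₀ * (τ ^ 3 - 1) * (θ ^ 3 - 1) + algebraMap ℂ C t₂ = 0)
    (hτ : τ ≠ 0) (hθ : θ ≠ 0) (h6 : (τ ^ 3 * θ ^ 3) ^ 2 ≠ algebraMap ℂ C Δ ^ 4)
    (h3 : τ ^ 3 ≠ θ ^ 3) (hp0 : p ≠ 0)
    (hG0 : algebraMap ℂ C t₄ * p + algebraMap ℂ C t₅ + algebraMap ℂ C t₇ * u ≠ 0)
    (hF : algebraMap ℂ C k₀ * (τ ^ 3 - 1) * (W ^ 3 - θ ^ 3 * u ^ 3) +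
      p * (algebraMap ℂ C t₄ * p + algebraMap ℂ C t₅ + algebraMap ℂ C t₇ * u) = 0)
    (hc : 1 - algebraMap ℂ C t₄ * (algebraMap ℂ C k₀ * (τ ^ 3 - 1)) * algebraMap ℂ C w ^ 2 *
        (W - algebraMap ℂ C w * θ * u) * (-(W - algebraMap ℂ C w ^ 2 * θ * u) /
          (algebraMap ℂ C t₄ * p + algebraMap ℂ C t₅ + algebraMap ℂ C t₇ * u)) ^ 2 +
        algebraMap ℂ C t₇ * (-(W - algebraMap ℂ C w ^ 2 * θ * u) /
          (algebraMap ℂ C t₄ * p + algebraMap ℂ C t₅ + algebraMap ℂ C t₇ * u)) *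
        (θ * (algebraMap ℂ C w - algebraMap ℂ C w ^ 2))⁻¹ ≠ 0) :
    Liftable φ (normForm k₀ t₂ t₄ t₅ t₇) ![τ * u + W, τ * W, u, p, 1] := by
  have hE := isEckardt_normForm (k₀ := k₀) (t₂ := t₂) (t₄ := t₄) (t₇ := t₇) ht₅
  have hΔ1 : Δ ^ 2 ≠ 1 := fun h => ht₂ (by rw [h] at hΔ; linear_combination -hΔ)
  have hε0 : ε ≠ 0 := by rintro rfl; apply hΔ0; rw [← hε]; simp
  obtain ⟨e, he⟩ : ∃ e, e = algebraMap ℂ C ε := ⟨_, rfl⟩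
  have he0 : e ≠ 0 := by rw [he]; exact (map_ne_zero _).2 hε0
  have heΔ : e ^ 3 = algebraMap ℂ C Δ := by rw [he, ← map_pow, hε]
  -- The equation of `τ³` and `θ³`, in the normalisation `x³ + y³ = Δ (1 + x³ y³)`.
  obtain ⟨x, hx⟩ : ∃ x, x = τ / e := ⟨_, rfl⟩
  obtain ⟨y, hy⟩ : ∃ y, y = θ / e := ⟨_, rfl⟩
  have hx' : e * x = τ := by rw [hx]; field_simp
  have hy' : e * y = θ := by rw [hy]; field_simp
  have hx0 : x ≠ 0 := by rw [hx]; exact div_ne_zero hτ he0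
  have hy0 : y ≠ 0 := by rw [hy]; exact div_ne_zero hθ he0
  have hN : (x * y) ^ 2 ≠ 1 := by
    intro h
    apply h6
    rw [← hx', ← hy', ← heΔ]
    linear_combination e ^ 12 * ((x * y) ^ 4 + (x * y) ^ 2 + 1) * h
  have hxy : x ≠ y := by
    rintro h
    apply h3
    rw [← hx', ← hy', h]
  have hcurve : x ^ 3 + y ^ 3 = algebraMap ℂ C Δ * (1 + x ^ 3 * y ^ 3) := by
    have hΔC : algebraMap ℂ C k₀ * algebraMap ℂ C Δ ^ 2 =
        algebraMap ℂ C k₀ + algebraMap ℂ C t₂ := by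
      rw [← map_pow, ← map_mul, hΔ, map_add]
    have hkΔ : algebraMap ℂ C k₀ * algebraMap ℂ C Δ ≠ 0 :=
      mul_ne_zero ((map_ne_zero _).2 hk₀) ((map_ne_zero _).2 hΔ0)
    refine mul_left_cancel₀ hkΔ ?_
    rw [← hx', ← hy', mul_pow, mul_pow, heΔ] at hτθ
    linear_combination -hτθ - hΔC
  obtain ⟨Q, M, g, hQ, hg, hφQ, hm⟩ := exists_lift_cubicCurve_param hφ hΔ1 hΔ0 hx0 hy0 hN hcurve
  have hN1 : 1 + x * y ≠ 0 := fun h => hN (by linear_combination (x * y - 1) * h)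
  have hN2 : x * y - 1 ≠ 0 := fun h => hN (by linear_combination (x * y + 1) * h)
  have hN0 : x * y ≠ 0 := mul_ne_zero hx0 hy0
  have hφg : 4 * (1 + x * y) ^ 2 * φ g = x * y := by
    have e1 := congrArg φ hg
    simp only [map_mul, map_ofNat, hφQ, map_one] at e1
    field_simp at e1
    exact e1
  -- The squares of the two elements `r₁` and `r₃` of `cubicCurve_identity`.
  obtain ⟨D₁, hD₁⟩ : ∃ D, D = Q * (Q - 4) := ⟨_, rfl⟩
  obtain ⟨D₃, hD₃⟩ : ∃ D, D = Q * (M ^ 2 * Q - 4) := ⟨_, rfl⟩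
  obtain ⟨r₁, hr₁⟩ : ∃ r, r = (1 + x * y) * (x * y - 1) / (x * y) := ⟨_, rfl⟩
  obtain ⟨r₃, hr₃⟩ : ∃ r, r = (x - y) * (1 + x * y) / (x * y) := ⟨_, rfl⟩
  have h₁ : r₁ ^ 2 = φ D₁ := by
    simp only [hr₁, hD₁, map_mul, map_sub, map_ofNat, hφQ]
    field_simp
    ring
  have h₃ : r₃ ^ 2 = φ D₃ := by
    simp only [hr₃, hD₃, map_mul, map_sub, map_pow, map_ofNat, hφQ]
    field_simp
    linear_combination (x + y + φ M * (1 + x * y)) * hm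
  have hr₁0 : r₁ ≠ 0 := by rw [hr₁]; exact div_ne_zero (mul_ne_zero hN1 hN2) hN0
  have hr₃0 : r₃ ≠ 0 := by
    rw [hr₃]; exact div_ne_zero (mul_ne_zero (sub_ne_zero.2 hxy) hN1) hN0
  obtain ⟨π, hπ, hπ₁, hπ₂⟩ := exists_idempotent_lift hφ ht hφt h₁ hr₁0
  let j : A →ₐ[ℂ] QuadraticAlgebra A D₁ 0 := IsScalarTower.toAlgHom ℂ A _
  have hj1 : ∀ a, evalSqrt φ D₁ r₁ h₁ (j a) = φ a := evalSqrt_algebraMap _ _ _ _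
  have hj2 : ∀ a, evalSqrt φ D₁ (-r₁) (by rw [neg_sq, h₁]) (j a) = φ a :=
    evalSqrt_algebraMap _ _ _ _
  obtain ⟨X, Y, hXY, hYu, hev⟩ := exists_cubicCurve_point (Δ := Δ) (Q := j Q) (M := j M) (g := j g)
    (e := ⟨0, 1⟩) (D := j D₃)
    (by
      have := congrArg j hQ
      simpa only [map_mul, map_sub, map_pow, map_ofNat, AlgHom.commutes] using this)
    (by
      have := congrArg j hg
      simpa only [map_mul, map_ofNat, map_one] using this)
    (by
      rw [sqrt_sq]
      refine (congrArg j hD₁).trans ?_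
      simp only [map_mul, map_sub, map_ofNat])
    (by
      refine (congrArg j hD₃).trans ?_
      simp only [map_mul, map_sub, map_pow, map_ofNat])
  have hr₃₁ : r₃ ^ 2 = evalSqrt φ D₁ r₁ h₁ (j D₃) := by rw [hj1, h₃]
  have hr₃₂ : r₃ ^ 2 = evalSqrt φ D₁ (-r₁) (by rw [neg_sq, h₁]) (j D₃) := by rw [hj2, h₃]
  obtain ⟨hX1, hY1⟩ := hev C (evalSqrt φ D₁ r₁ h₁) r₃ hr₃₁
  have hee : evalSqrt φ D₁ r₁ h₁ ⟨0, 1⟩ = r₁ := by simp [evalSqrt_apply]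
  rw [hj1, hj1, hj1, hee, hφQ] at hX1 hY1
  have e1 : (1 + x * y) ^ 2 / (x * y) + r₁ = 2 * (1 + x * y) := by
    rw [hr₁]; field_simp; ring
  obtain ⟨N, s, t, hN, hs, ht, hN1, hN2⟩ := exists_normForm_point
    (isLocalSurj_evalSqrt_prod hφ D₁ r₁ h₁ (Ne.isUnit hr₁0)) hπ hπ₁ hπ₂ hw hww hε hε0 ht₂ ht₅ hΔ
    hXY hYu hr₃0 hr₃₁ hr₃₂ (τ := τ) (θ := θ)
    (by
      rw [← he, ← hx']
      refine (congrArg (e * ·) hX1).trans (congrArg (e * ·) ?_)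
      have e2 : φ M * ((1 + x * y) ^ 2 / (x * y)) + r₃ = 2 * x * (1 + x * y) / (x * y) := by
        rw [hr₃, eq_div_iff hN0]
        field_simp
        linear_combination -hm
      rw [e1, e2]
      field_simp
      linear_combination hφg)
    (by
      rw [← he, ← hy']
      refine (congrArg (e * ·) hY1).trans (congrArg (e * ·) ?_)
      have e2 : φ M * ((1 + x * y) ^ 2 / (x * y)) - r₃ = 2 * y * (1 + x * y) / (x * y) := by
        rw [hr₃, eq_div_iff hN0]
        field_simp
        linear_combination -hm
      rw [e1, e2]
      field_simp
      linear_combination hφg) hp0 hG0 hF hc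
  refine hE.liftable_of_eckardtInv (hE.liftable_of_evalSqrt hφ h₁ (Ne.isUnit hr₁0) hN
    (Ne.isUnit hs) (Ne.isUnit ht) ?_ hN1 hN2)
  refine Ne.isUnit ?_
  simpa [eckardtInv] using hp0

/-- Lifting a point of `normForm = 0`, given a root `τ` of `T² - e₁ T + e₂` and a cube root `θ` of
`1 - t₂ / (k₀ (τ³ - 1))`. -/
theorem liftable_normForm_of_roots {A C : Type} [CommRing A] [IsDomain A] [Algebra ℂ A] [Field C]
    [Algebra ℂ C] {φ : A →ₐ[ℂ] C} (hφ : IsLocalSurj φ) {t : A} (ht : t ≠ 0) (hφt : φ t = 0)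
    {Δ : ℂ} (hΔ0 : Δ ≠ 0) (ht₂ : t₂ ≠ 0) (ht₅ : t₅ ≠ 0) (hk₀ : k₀ ≠ 0)
    (hΔ : k₀ * Δ ^ 2 = k₀ + t₂) {τ θ W u p q : C}
    (hτθ : algebraMap ℂ C k₀ * (τ ^ 3 - 1) * (θ ^ 3 - 1) + algebraMap ℂ C t₂ = 0)
    (hτ : τ ≠ 0) (hθ : θ ≠ 0) (h6 : (τ ^ 3 * θ ^ 3) ^ 2 ≠ algebraMap ℂ C Δ ^ 4)
    (h3 : τ ^ 3 ≠ θ ^ 3) (hW : W ≠ 0) (hp : p ≠ 0) (hq : q ≠ 0)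
    (hG : algebraMap ℂ C t₄ * p + algebraMap ℂ C t₅ * q + algebraMap ℂ C t₇ * u ≠ 0)
    (hab : (algebraMap ℂ C t₄ * p) ^ 3 ≠ (algebraMap ℂ C t₅ * q) ^ 3)
    (hF : aeval ![τ * u + W, τ * W, u, p, q] (normForm k₀ t₂ t₄ t₅ t₇) = 0) :
    Liftable φ (normForm k₀ t₂ t₄ t₅ t₇) ![τ * u + W, τ * W, u, p, q] := by
  obtain ⟨w, hw, hww⟩ := exists_primitive_cubeRoot
  obtain ⟨ε, hε⟩ := IsAlgClosed.exists_pow_nat_eq Δ (n := 3) (by norm_num)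
  obtain ⟨p', hp'⟩ : ∃ p', p' = p / q := ⟨_, rfl⟩
  obtain ⟨u', hu'⟩ : ∃ p', p' = u / q := ⟨_, rfl⟩
  obtain ⟨W', hW'⟩ : ∃ p', p' = W / q := ⟨_, rfl⟩
  obtain rfl : p = q * p' := by rw [hp']; field_simp
  obtain rfl : u = q * u' := by rw [hu']; field_simp
  obtain rfl : W = q * W' := by rw [hW']; field_simp
  have hp0 : p' ≠ 0 := right_ne_zero_of_mul hp
  have hW0 : W' ≠ 0 := right_ne_zero_of_mul hW
  have hG0 : algebraMap ℂ C t₄ * p' + algebraMap ℂ C t₅ + algebraMap ℂ C t₇ * u' ≠ 0 := by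
    intro h; apply hG; linear_combination q * h
  have hF' : algebraMap ℂ C k₀ * (τ ^ 3 - 1) * (W' ^ 3 - θ ^ 3 * u' ^ 3) +
      p' * (algebraMap ℂ C t₄ * p' + algebraMap ℂ C t₅ + algebraMap ℂ C t₇ * u') = 0 := by
    rw [aeval_normForm] at hF
    simp at hF
    refine (mul_eq_zero.1 ?_).resolve_left (pow_ne_zero 3 hq)
    linear_combination hF - q ^ 3 * u' ^ 3 * hτθ
  obtain ⟨j, hj, hc⟩ := exists_cubeRoot_ne_zero hw hθ hW0 hp0 hG0 hF' (by
    intro h; apply hab; linear_combination q ^ 3 * h)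
  have hj3 : (algebraMap ℂ C j * θ) ^ 3 = θ ^ 3 := by
    rw [mul_pow, ← map_pow, hj, map_one, one_mul]
  have hj0 : algebraMap ℂ C j ≠ 0 := by
    rw [map_ne_zero]; rintro rfl; norm_num at hj
  have := liftable_normForm_of_family hφ ht hφt hw hww hε hΔ0 ht₂ ht₅ hk₀ hΔ (τ := τ)
    (θ := algebraMap ℂ C j * θ) (W := W') (u := u') (p := p') (by rw [hj3, hτθ]) hτ
    (mul_ne_zero hj0 hθ) (by rw [hj3]; exact h6) (by rw [hj3]; exact h3) hp0 hG0
    (by rw [hj3]; exact hF') hc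
  refine this.of_smul hφ isHomogeneous_normForm (u := q⁻¹) (Ne.isUnit (inv_ne_zero hq)) fun i => ?_
  fin_cases i <;> simp <;> field_simp

end LiftNormForm

/-! ### Lifting general points of the norm form -/

section LiftNormFormPoint

/-- An element of `K` outside of `ℂ` is transcendental over `ℂ`. -/
theorem aeval_ne_zero_of_forall_ne {K : Type*} [Field K] [Algebra ℂ K] {τ : K}
    (h : ∀ c : ℂ, τ ≠ algebraMap ℂ K c) {f : Polynomial ℂ} (hf : f.Monic) :
    Polynomial.aeval τ f ≠ 0 := by
  intro h0
  have hτ : IsIntegral ℂ τ := ⟨f, hf, h0⟩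
  obtain ⟨c, hc⟩ := minpoly.mem_range_of_degree_eq_one ℂ τ
    (IsAlgClosed.degree_eq_one_of_irreducible ℂ (minpoly.irreducible hτ))
  exact h c hc.symm

/-- On a line through two conjugate points which differ only in `e₁`, the third intersection point
has the same coordinates `e₂, u, p, q` as those two. -/
theorem thirdPoint_normForm {k₀ t₂ t₄ t₅ t₇ : ℂ} {A : Type*} [CommRing A] [Algebra ℂ A]
    (a b c p q : A) (i : Fin 5) :
    thirdPoint (normForm k₀ t₂ t₄ t₅ t₇) ![a, c, 1, p, q] ![b, 0, 0, 0, 0] i =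
      -(algebraMap ℂ A k₀ * b ^ 3) * (![-(2 * a), c, 1, p, q] : Fin 5 → A) i := by
  have h1 : polar (normForm k₀ t₂ t₄ t₅ t₇) ![b, 0, 0, 0, 0] ![a, c, 1, p, q] =
      -(algebraMap ℂ A k₀ * (3 * b ^ 2 * a)) := by
    simp only [polar, normForm, Fin.sum_univ_five, map_add, map_sub, Derivation.leibniz,
      Derivation.leibniz_pow, pderiv_C, pderiv_X, smul_eq_mul, Pi.single_apply]
    simp
    ring
  rw [thirdPoint, h1, aeval_normForm]
  fin_cases i <;> (simp; try ring)

/-- Cardano's trick: a cube root of `z` in terms of a cube root `n` of `z z'` and a root `s` of the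
resolvent `s³ - 3 n s = z + z'`. -/
theorem exists_cubeRoot {C : Type*} [Field C] [CharZero C] {z z' n s : C} (hn : n ^ 3 = z * z')
    (hs : s ^ 3 - 3 * n * s = z + z') (hz : z ≠ z') : ∃ θ, θ ^ 3 = z := by
  have h1 : (s ^ 2 - n) ^ 2 * (s ^ 2 - 4 * n) = (z - z') ^ 2 := by
    linear_combination (s ^ 3 - 3 * n * s + z + z') * hs - 4 * hn
  have h2 : s ^ 2 - n ≠ 0 := by
    intro h
    rw [h] at h1
    exact hz (sub_eq_zero.1 (pow_eq_zero_iff two_ne_zero |>.1 (by linear_combination -h1)))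
  obtain ⟨g, hg⟩ : ∃ g, g = (z - z') / (s ^ 2 - n) := ⟨_, rfl⟩
  have hg' : g * (s ^ 2 - n) = z - z' := by rw [hg]; field_simp
  have hg2 : g ^ 2 = s ^ 2 - 4 * n := by
    refine mul_left_cancel₀ (pow_ne_zero 2 h2) ?_
    linear_combination (g * (s ^ 2 - n) + (z - z')) * hg' - h1
  refine ⟨(s + g) / 2, ?_⟩
  field_simp
  linear_combination (3 * s + g) * hg2 + 4 * hs + 4 * hg'

variable {k₀ t₂ t₄ t₅ t₇ : ℂ}

/-- Lifting a twist of the point `(τ + σ, τ σ, 1, p, q)`. -/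
theorem liftable_normForm_twist {A C : Type} [CommRing A] [IsDomain A] [Algebra ℂ A] [Field C]
    [Algebra ℂ C] {φ : A →ₐ[ℂ] C} (hφ : IsLocalSurj φ) {t : A} (ht : t ≠ 0) (hφt : φ t = 0)
    {w Δ : ℂ} (hw : w ^ 2 + w + 1 = 0)
    (hΔ0 : Δ ≠ 0) (ht₂ : t₂ ≠ 0) (ht₅ : t₅ ≠ 0) (hk₀ : k₀ ≠ 0)
    (hΔ : k₀ * Δ ^ 2 = k₀ + t₂) {τ σ p q n s : C} (hτ : ∀ c : ℂ, τ ≠ algebraMap ℂ C c)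
    (hσ : ∀ c : ℂ, σ ≠ algebraMap ℂ C c) (hτσ : τ ^ 3 ≠ σ ^ 3)
    (hn : ((τ ^ 3 - 1) * (σ ^ 3 - 1)) * n ^ 3 = (τ ^ 3 - 1) * (σ ^ 3 - 1) -
      algebraMap ℂ C (t₂ / k₀) * (τ ^ 3 + σ ^ 3 - 2) + algebraMap ℂ C (t₂ / k₀) ^ 2)
    (hs : ((τ ^ 3 - 1) * (σ ^ 3 - 1)) * (s ^ 3 - 3 * n * s) = 2 * ((τ ^ 3 - 1) * (σ ^ 3 - 1)) -
      algebraMap ℂ C (t₂ / k₀) * (τ ^ 3 + σ ^ 3 - 2))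
    (hp : p ≠ 0) (hq : q ≠ 0)
    (hG : algebraMap ℂ C t₄ * p + algebraMap ℂ C t₅ * q + algebraMap ℂ C t₇ ≠ 0)
    (hab : (algebraMap ℂ C t₄ * p) ^ 3 ≠ (algebraMap ℂ C t₅ * q) ^ 3)
    (hF : aeval ![τ + σ, τ * σ, 1, p, q] (normForm k₀ t₂ t₄ t₅ t₇) = 0) :
    Liftable φ (normForm k₀ t₂ t₄ t₅ t₇)
      ![τ + algebraMap ℂ C w * σ, algebraMap ℂ C w * (τ * σ), 1, p, q] := by
  have : CharZero C := charZero_of_injective_algebraMap (algebraMap ℂ C).injective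
  have hτ1 : τ ^ 3 - 1 ≠ 0 := by
    have := aeval_ne_zero_of_forall_ne hτ (f := Polynomial.X ^ 3 - 1) (by monicity!)
    simpa using this
  have hσ1 : σ ^ 3 - 1 ≠ 0 := by
    have := aeval_ne_zero_of_forall_ne hσ (f := Polynomial.X ^ 3 - 1) (by monicity!)
    simpa using this
  have hw0 : w ≠ 0 := by rintro rfl; norm_num at hw
  have hw3 : w ^ 3 = 1 := by linear_combination (w - 1) * hw
  have hwC : algebraMap ℂ C w ^ 3 = 1 := by rw [← map_pow, hw3, map_one]
  obtain ⟨c, hc⟩ : ∃ c, c = t₂ / k₀ := ⟨_, rfl⟩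
  have hkc : algebraMap ℂ C k₀ * algebraMap ℂ C c = algebraMap ℂ C t₂ := by
    rw [← map_mul, hc, mul_div_cancel₀ _ hk₀]
  have hc0 : algebraMap ℂ C c ≠ 0 := by
    rw [map_ne_zero, hc]; exact div_ne_zero ht₂ hk₀
  rw [← hc] at hn hs
  -- The numbers whose cube roots are needed for the points with the root `τ` and with the root `σ`.
  obtain ⟨z, hz⟩ : ∃ z, z = 1 - algebraMap ℂ C c / (τ ^ 3 - 1) := ⟨_, rfl⟩
  obtain ⟨z', hz'⟩ : ∃ z, z = 1 - algebraMap ℂ C c / (σ ^ 3 - 1) := ⟨_, rfl⟩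
  have hzτ : z * (τ ^ 3 - 1) = τ ^ 3 - 1 - algebraMap ℂ C c := by rw [hz]; field_simp
  have hzσ : z' * (σ ^ 3 - 1) = σ ^ 3 - 1 - algebraMap ℂ C c := by rw [hz']; field_simp
  have hzz : z ≠ z' := by
    intro h
    apply hτσ
    refine mul_left_cancel₀ hc0 ?_
    rw [h] at hzτ
    linear_combination (τ ^ 3 - 1) * hzσ - (σ ^ 3 - 1) * hzτ
  obtain ⟨θ, hθ⟩ := exists_cubeRoot (z := z) (z' := z') (n := n) (s := s)
    (by
      refine mul_left_cancel₀ (mul_ne_zero hτ1 hσ1) ?_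
      linear_combination hn - z' * (σ ^ 3 - 1) * hzτ - (τ ^ 3 - 1 - algebraMap ℂ C c) * hzσ)
    (by
      refine mul_left_cancel₀ (mul_ne_zero hτ1 hσ1) ?_
      linear_combination hs - (σ ^ 3 - 1) * hzτ - (τ ^ 3 - 1) * hzσ) hzz
  have hτ0 : τ ≠ 0 := by simpa using hτ 0
  have hσ0 : σ ≠ 0 := by simpa using hσ 0
  have hz0 : z ≠ 0 := by
    intro h
    rw [h] at hzτ
    have := aeval_ne_zero_of_forall_ne hτ (f := Polynomial.X ^ 3 - Polynomial.C (1 + c))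
      (by monicity!)
    apply this
    simp
    linear_combination -hzτ
  -- The excluded positions of the point are algebraic conditions on `τ`, hence satisfied by every
  -- `τ` outside of `ℂ`.
  have hlift := liftable_normForm_of_roots hφ ht hφt hΔ0 ht₂ ht₅ hk₀ hΔ (τ := τ) (θ := θ)
    (W := algebraMap ℂ C w * σ) (u := 1) (p := p) (q := q)
    (by rw [hθ]; linear_combination algebraMap ℂ C k₀ * hzτ - hkc) hτ0
    (by rintro rfl; apply hz0; rw [← hθ]; simp)
    (by
      rw [hθ]
      intro h
      have := aeval_ne_zero_of_forall_ne hτ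
        (f := Polynomial.X ^ 6 * (Polynomial.X ^ 3 - Polynomial.C (1 + c)) ^ 2 -
          Polynomial.C (Δ ^ 4) * (Polynomial.X ^ 3 - 1) ^ 2) (by monicity!)
      apply this
      simp
      linear_combination (τ ^ 3 - 1) ^ 2 * h - τ ^ 6 * (z * (τ ^ 3 - 1) +
        (τ ^ 3 - 1 - algebraMap ℂ C c)) * hzτ)
    (by
      rw [hθ]
      intro h
      have := aeval_ne_zero_of_forall_ne hτ
        (f := Polynomial.X ^ 3 * (Polynomial.X ^ 3 - 1) - (Polynomial.X ^ 3 -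
          Polynomial.C (1 + c))) (by monicity!)
      apply this
      simp
      linear_combination (τ ^ 3 - 1) * h + hzτ)
    (mul_ne_zero ((map_ne_zero _).2 hw0) hσ0) hp hq (by rw [mul_one]; exact hG) hab
    (by
      rw [aeval_normForm] at hF ⊢
      simp at hF ⊢
      linear_combination hF + algebraMap ℂ C k₀ * (τ ^ 3 - 1) * σ ^ 3 * hwC)
  convert hlift using 1
  funext i
  fin_cases i <;> (simp; try ring)

/-- For `e₁ = τ + σ` and `e₂ = τ σ`, the line through the twists `(τ + ω σ, ω e₂, 1, p, q)` and
`(σ + ω τ, ω e₂, 1, p, q)` meets the hypersurface again at `(ω² e₁, ω e₂, 1, p, q)`, which an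
automorphism of the form takes to the point `(e₁, e₂, 1, p, q)`. -/
theorem liftable_normForm_of_chord {O K : Type} [CommRing O] [Algebra ℂ O] [Field K] [Algebra ℂ K]
    {φ : O →ₐ[ℂ] K} (hφ : IsLocalSurj φ) {w : ℂ} (hw : w ^ 2 + w + 1 = 0) (hk₀ : k₀ ≠ 0)
    {e₁ e₂ p q s : K} (hs : s ≠ 0)
    (h : Liftable φ (normForm k₀ t₂ t₄ t₅ t₇)
      (fun i => s * thirdPoint (normForm k₀ t₂ t₄ t₅ t₇)
        ![(1 + algebraMap ℂ K w) / 2 * e₁, algebraMap ℂ K w * e₂, 1, p, q]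
        ![(1 - algebraMap ℂ K w) / 2, 0, 0, 0, 0] i)) :
    Liftable φ (normForm k₀ t₂ t₄ t₅ t₇) ![e₁, e₂, 1, p, q] := by
  have : CharZero K := charZero_of_injective_algebraMap (algebraMap ℂ K).injective
  have hw1 : 1 - algebraMap ℂ K w ≠ 0 := by
    rw [← map_one (algebraMap ℂ K), ← map_sub, map_ne_zero]
    intro h
    have h1 : w = 1 := by linear_combination -h
    rw [h1] at hw
    norm_num at hw
  have hw3 : w ^ 3 = 1 := by linear_combination (w - 1) * hw
  have hwK : algebraMap ℂ K w ^ 2 + algebraMap ℂ K w + 1 = 0 := by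
    rw [← map_pow, ← map_add, ← map_one (algebraMap ℂ K), ← map_add, hw, map_zero]
  have hw3K : algebraMap ℂ K w ^ 3 = 1 := by rw [← map_pow, hw3, map_one]
  obtain ⟨S, hS, hSR⟩ := h.of_smul hφ isHomogeneous_normForm
    (u := s * -(algebraMap ℂ K k₀ * ((1 - algebraMap ℂ K w) / 2) ^ 3))
    (R' := ![algebraMap ℂ K w ^ 2 * e₁, algebraMap ℂ K w * e₂, 1, p, q])
    (Ne.isUnit (mul_ne_zero hs (neg_ne_zero.2 (mul_ne_zero ((map_ne_zero _).2 hk₀)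
      (pow_ne_zero 3 (div_ne_zero hw1 two_ne_zero)))))) fun i => by
        rw [thirdPoint_normForm, mul_assoc]
        congr 2
        fin_cases i <;> simp
        linear_combination -e₁ * hwK
  -- the automorphism of the form that multiplies `e₁` and `e₂` by inverse cube roots of unity
  refine ⟨![algebraMap ℂ O w * S 0, algebraMap ℂ O w ^ 2 * S 1, S 2, S 3, S 4], ?_, fun i => ?_⟩
  · have hw3O : algebraMap ℂ O w ^ 3 = 1 := by rw [← map_pow, hw3, map_one]
    rw [aeval_normForm] at hS ⊢
    simp
    linear_combination hS + algebraMap ℂ O k₀ * ((algebraMap ℂ O w ^ 3 + 1) * S 1 ^ 3 -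
      S 0 ^ 3 + 3 * S 0 * S 1 * S 2) * hw3O
  · fin_cases i
    · simp [hSR]; linear_combination e₁ * hw3K
    · simp [hSR]; linear_combination e₂ * hw3K
    · simp [hSR]
    · simp [hSR]
    · simp [hSR]

/-- Lifting a sufficiently general point of `normForm = 0` to an integrally closed local ring. -/
theorem liftable_normForm {O K : Type} [CommRing O] [IsDomain O] [IsIntegrallyClosed O]
    [Algebra ℂ O] [Field K] [Algebra ℂ K] {φ : O →ₐ[ℂ] K} (hφ : IsLocalSurj φ) {t : O}
    (ht : t ≠ 0) (hφt : φ t = 0) {Δ : ℂ} (hΔ0 : Δ ≠ 0) (ht₂ : t₂ ≠ 0) (ht₅ : t₅ ≠ 0) (hk₀ : k₀ ≠ 0)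
    (hΔ : k₀ * Δ ^ 2 = k₀ + t₂) {e₁ e₂ p q n s : K}
    (hroot : ∀ c : ℂ, algebraMap ℂ K c ^ 2 - e₁ * algebraMap ℂ K c + e₂ ≠ 0)
    (hd : e₁ ^ 2 ≠ 4 * e₂) (hd' : e₁ ^ 2 ≠ e₂)
    (hn : (e₂ ^ 3 - (e₁ ^ 3 - 3 * e₁ * e₂) + 1) * n ^ 3 =
      (e₂ ^ 3 - (e₁ ^ 3 - 3 * e₁ * e₂) + 1) -
      algebraMap ℂ K (t₂ / k₀) * (e₁ ^ 3 - 3 * e₁ * e₂ - 2) + algebraMap ℂ K (t₂ / k₀) ^ 2)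
    (hs : (e₂ ^ 3 - (e₁ ^ 3 - 3 * e₁ * e₂) + 1) * (s ^ 3 - 3 * n * s) =
      2 * (e₂ ^ 3 - (e₁ ^ 3 - 3 * e₁ * e₂) + 1) -
      algebraMap ℂ K (t₂ / k₀) * (e₁ ^ 3 - 3 * e₁ * e₂ - 2))
    (hp : p ≠ 0) (hq : q ≠ 0)
    (hG : algebraMap ℂ K t₄ * p + algebraMap ℂ K t₅ * q + algebraMap ℂ K t₇ ≠ 0)
    (hab : (algebraMap ℂ K t₄ * p) ^ 3 ≠ (algebraMap ℂ K t₅ * q) ^ 3)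
    (hF : aeval ![e₁, e₂, 1, p, q] (normForm k₀ t₂ t₄ t₅ t₇) = 0) :
    Liftable φ (normForm k₀ t₂ t₄ t₅ t₇) ![e₁, e₂, 1, p, q] := by
  obtain ⟨w, hw, hww⟩ := exists_primitive_cubeRoot
  have hcz : CharZero K := charZero_of_injective_algebraMap (algebraMap ℂ K).injective
  by_cases hsq : ∃ δ : K, δ ^ 2 = e₁ ^ 2 - 4 * e₂
  -- If `e₁² - 4 e₂` is a square, then the two twists are defined over `K` and lift to `O`.
  · obtain ⟨δ, hδ⟩ := hsq
    have hδ0 : δ ≠ 0 := by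
      rintro rfl; apply hd; linear_combination -hδ
    obtain ⟨τ, hτ⟩ : ∃ τ, τ = (e₁ + δ) / 2 := ⟨_, rfl⟩
    obtain ⟨σ, hσ⟩ : ∃ τ, τ = (e₁ - δ) / 2 := ⟨_, rfl⟩
    have hsum : τ + σ = e₁ := by rw [hτ, hσ]; ring
    have hmul : τ * σ = e₂ := by rw [hτ, hσ]; linear_combination -hδ / 4
    have hdiff : τ - σ = δ := by rw [hτ, hσ]; ring
    rw [← hsum, ← hmul] at hroot hd hd' hn hs hF ⊢
    have hτc : ∀ c : ℂ, τ ≠ algebraMap ℂ K c := by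
      rintro c rfl; exact hroot c (by ring)
    have hσc : ∀ c : ℂ, σ ≠ algebraMap ℂ K c := by
      rintro c rfl; exact hroot c (by ring)
    have h3 : τ ^ 3 ≠ σ ^ 3 := by
      intro h
      refine mul_ne_zero (hdiff ▸ hδ0 : τ - σ ≠ 0) (sub_ne_zero.2 hd') ?_
      linear_combination h
    have l1 := liftable_normForm_twist hφ ht hφt hw hΔ0 ht₂ ht₅ hk₀ hΔ hτc hσc h3 (n := n) (s := s)
      (by linear_combination hn) (by linear_combination hs) hp hq hG hab hF
    have l2 := liftable_normForm_twist hφ ht hφt hw hΔ0 ht₂ ht₅ hk₀ hΔ hσc hτc h3.symm (n := n)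
      (s := s) (by linear_combination hn) (by linear_combination hs) hp hq hG hab
      (by rw [add_comm, mul_comm]; exact hF)
    obtain ⟨U, hU, hUR⟩ := l1
    obtain ⟨V, hV, hVR⟩ := l2
    refine liftable_normForm_of_chord hφ hw hk₀ (s := 8 * δ ^ 3)
      (mul_ne_zero (by norm_num) (pow_ne_zero 3 hδ0))
      ⟨_, aeval_chord isHomogeneous_normForm hU hV, fun i => ?_⟩
    rw [map_sub, map_mul, map_mul, map_polar, map_polar]
    have hU' : (fun i => φ (U i)) = _ := funext hUR
    have hV' : (fun i => φ (V i)) = _ := funext hVR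
    have hU0 : aeval (fun i => φ (U i)) (normForm k₀ t₂ t₄ t₅ t₇) = 0 := by
      rw [aeval_fun_algHom, hU, map_zero]
    have hV0 : aeval (fun i => φ (V i)) (normForm k₀ t₂ t₄ t₅ t₇) = 0 := by
      rw [aeval_fun_algHom, hV, map_zero]
    refine (thirdPoint_eq isHomogeneous_normForm _ _ _ _ δ (fun i => ?_) (fun i => ?_) hU0 hV0
      i).symm
    · rw [hUR]
      fin_cases i <;> simp
      rw [← hdiff]; ring
    · rw [hVR]
      fin_cases i <;> simp
      · rw [← hdiff]; ring
      · left; ring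
  -- Otherwise the two twists are conjugate over `K[√d]`. One of them lifts to `O[√D]`, and with it
  -- the chord lifts to `O`.
  · push Not at hsq
    obtain ⟨E₁, hE₁⟩ := hφ.surj e₁
    obtain ⟨E₂, hE₂⟩ := hφ.surj e₂
    obtain ⟨D, hD⟩ : ∃ D, D = E₁ ^ 2 - 4 * E₂ := ⟨_, rfl⟩
    obtain ⟨d, hdd⟩ : ∃ d, d = e₁ ^ 2 - 4 * e₂ := ⟨_, rfl⟩
    have hφD : φ D = d := by
      rw [hD, hdd, ← hE₁, ← hE₂]; simp only [map_sub, map_pow, map_mul, map_ofNat]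
    rw [← hdd] at hsq
    have hfact : Fact (∀ r : K, r ^ 2 ≠ d + 0 * r) := ⟨fun r h => hsq r (by rw [h]; ring)⟩
    have hsqD : ∀ r : O, r ^ 2 ≠ D := fun r h => hsq (φ r) (by rw [← map_pow, h, hφD])
    -- As `O` is integrally closed, `D` is not a square in its fraction field.
    have hdom : IsDomain (QuadraticAlgebra O D 0) := by
      have hnorm : ∀ z : QuadraticAlgebra O D 0, QuadraticAlgebra.norm z = 0 → z = 0 := by
        intro z hz
        rw [QuadraticAlgebra.norm_def] at hz
        have h1 : z.re ^ 2 = D * z.im ^ 2 := by linear_combination hz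
        have h2 : z.im ∣ z.re :=
          (IsIntegrallyClosed.pow_dvd_pow_iff two_ne_zero).1 ⟨D, by rw [h1, mul_comm]⟩
        obtain ⟨r, hr⟩ := h2
        have h3 : z.im = 0 := by
          by_contra h0
          apply hsqD r
          refine mul_left_cancel₀ (pow_ne_zero 2 h0) ?_
          rw [hr] at h1
          linear_combination h1
        ext
        · rw [hr, h3]; simp
        · exact h3
      have : NoZeroDivisors (QuadraticAlgebra O D 0) := ⟨fun {a b} hab => by
        have h1 := congrArg QuadraticAlgebra.norm hab
        rw [map_mul, show QuadraticAlgebra.norm (0 : QuadraticAlgebra O D 0) = 0 by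
          simp [QuadraticAlgebra.norm_def]] at h1
        exact (mul_eq_zero.1 h1).imp (hnorm a) (hnorm b)⟩
      exact NoZeroDivisors.to_isDomain _
    have hφ' := isLocalSurj_mapSqrt hφ D d hφD
    let j : K →ₐ[ℂ] QuadraticAlgebra K d 0 := IsScalarTower.toAlgHom ℂ K _
    have hjinj : Function.Injective j := fun a b h => congrArg QuadraticAlgebra.re h
    have hjre : ∀ x, (j x).re = x := fun _ => rfl
    have hjim : ∀ x, (j x).im = 0 := fun _ => rfl
    obtain ⟨δ, hδ⟩ : ∃ δ : QuadraticAlgebra K d 0, δ = ⟨0, 1⟩ := ⟨_, rfl⟩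
    have hδ2 : δ ^ 2 = j d := by rw [hδ, sqrt_sq]; rfl
    have hδ2' : δ ^ 2 = j e₁ ^ 2 - 4 * j e₂ := by
      rw [hδ2]
      refine (congrArg j hdd).trans ?_
      simp only [map_sub, map_mul, map_pow, map_ofNat]
    have hδ0 : δ ≠ 0 := by
      intro h
      have := congrArg QuadraticAlgebra.im h
      rw [hδ] at this
      exact one_ne_zero this
    obtain ⟨f, hf⟩ : ∃ f, f = j (1 / 2) := ⟨_, rfl⟩
    have hf2 : 2 * f = 1 := by
      rw [hf, ← map_ofNat j 2, ← map_mul, ← map_one j]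
      norm_num
    obtain ⟨τ, hτ⟩ : ∃ τ, τ = f * (j e₁ + δ) := ⟨_, rfl⟩
    obtain ⟨σ, hσ⟩ : ∃ τ, τ = f * (j e₁ - δ) := ⟨_, rfl⟩
    have hsum : τ + σ = j e₁ := by rw [hτ, hσ]; linear_combination j e₁ * hf2
    have hmul : τ * σ = j e₂ := by
      rw [hτ, hσ]; linear_combination -f ^ 2 * hδ2' + j e₂ * (2 * f + 1) * hf2
    have hdiff : τ - σ = δ := by rw [hτ, hσ]; linear_combination δ * hf2
    have hrootτ : ∀ c : ℂ, algebraMap ℂ (QuadraticAlgebra K d 0) c ^ 2 -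
        j e₁ * algebraMap ℂ _ c + j e₂ ≠ 0 := by
      intro c h
      apply hroot c
      apply hjinj
      simp only [map_add, map_sub, map_mul, map_pow, AlgHom.commutes, map_zero]
      exact h
    have hτc : ∀ c : ℂ, τ ≠ algebraMap ℂ _ c := by
      rintro c h
      apply hrootτ c
      rw [← hsum, ← hmul, ← h]
      ring
    have hσc : ∀ c : ℂ, σ ≠ algebraMap ℂ _ c := by
      rintro c h
      apply hrootτ c
      rw [← hsum, ← hmul, ← h]
      ring
    have h3 : τ ^ 3 ≠ σ ^ 3 := by
      intro h
      have h4 : δ * j (e₁ ^ 2 - e₂) = 0 := by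
        rw [map_sub, map_pow, ← hsum, ← hmul, ← hdiff]
        linear_combination h
      rcases mul_eq_zero.1 h4 with h5 | h5
      · exact hδ0 h5
      · rw [← map_zero j] at h5
        exact sub_ne_zero.2 hd' (hjinj h5)
    have hnj := congrArg j hn
    have hsj := congrArg j hs
    simp only [map_add, map_sub, map_mul, map_pow, AlgHom.commutes, map_one, map_ofNat,
      ← hsum, ← hmul] at hnj hsj
    have hinj : ∀ {x y : K}, x ≠ y → j x ≠ j y := fun h h' => h (hjinj h')
    have l1 := liftable_normForm_twist hφ' (t := algebraMap O _ t)
      (by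
        intro h
        exact ht (congrArg QuadraticAlgebra.re h))
      (by
        ext
        · exact hφt
        · exact map_zero φ)
      hw hΔ0 ht₂ ht₅ hk₀ hΔ hτc hσc h3 (n := j n) (s := j s) (p := j p) (q := j q)
      (by linear_combination hnj) (by linear_combination hsj)
      (by rw [← map_zero j]; exact hinj hp) (by rw [← map_zero j]; exact hinj hq)
      (by
        have := hinj hG
        simpa only [map_add, map_mul, AlgHom.commutes, map_zero] using this)
      (by
        have := hinj hab
        simpa only [map_mul, map_pow, AlgHom.commutes, map_zero] using this)
      (by
        rw [hsum, hmul]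
        have h1 := congrArg j hF
        rw [← aeval_fun_algHom, map_zero] at h1
        rw [← h1]
        congr 2
        funext i
        fin_cases i <;> simp)
    obtain ⟨S, hS, hSR⟩ := l1
    obtain ⟨q1, q2⟩ := aeval_quadratic isHomogeneous_normForm S hS
    have hS1 : ∀ i, φ (S i).re = _ := fun i => congrArg QuadraticAlgebra.re (hSR i)
    have hS2 : ∀ i, φ (S i).im = _ := fun i => congrArg QuadraticAlgebra.im (hSR i)
    refine liftable_normForm_of_chord hφ hw hk₀ (s := 1) one_ne_zero
      ⟨_, aeval_thirdPoint isHomogeneous_normForm q1 q2, fun i => ?_⟩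
    simp only [map_thirdPoint, one_mul]
    have hfre : f.re = 1 / 2 := by rw [hf]; rfl
    have hfim : f.im = 0 := by rw [hf]; rfl
    have hδre : δ.re = 0 := by rw [hδ]
    have hδim : δ.im = 1 := by rw [hδ]
    have hτ1 : τ.re = e₁ / 2 ∧ τ.im = 1 / 2 := by
      rw [hτ]
      simp [hjre, hjim, hfre, hfim, hδre, hδim]
      ring
    have hσ1 : σ.re = e₁ / 2 ∧ σ.im = -(1 / 2) := by
      rw [hσ]
      simp [hjre, hjim, hfre, hfim, hδre, hδim]
      ring
    have hwre : ∀ c : ℂ, (algebraMap ℂ (QuadraticAlgebra K d 0) c).re = algebraMap ℂ K c ∧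
      (algebraMap ℂ (QuadraticAlgebra K d 0) c).im = 0 := fun c => ⟨rfl, rfl⟩
    congr 1
    · funext i
      rw [hS1]
      fin_cases i
      · simp [hτ1, hσ1, hwre]; ring
      · simp [hmul, hwre, hjre, hjim]
      · simp
      · simp [hjre]
      · simp [hjre]
    · funext i
      rw [hS2]
      fin_cases i
      · simp [hτ1, hσ1, hwre]; ring
      · simp [hmul, hwre, hjre, hjim]
      · simp
      · simp [hjim]
      · simp [hjim]

end LiftNormFormPoint

/-! ### Generic points of the normal form -/

section GenericPoint

variable {ρ : Type}

/-- The affine point with coordinates `x₂ = ξ`, `x₃ = 1` and the other ones given by `a`. -/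
def genPoint {A : Type*} [One A] (a : Fin 3 ⊕ ρ → A) (ξ : A) : Fin 5 ⊕ ρ → A :=
  Sum.elim ![a (Sum.inl 0), ξ, 1, a (Sum.inl 1), a (Sum.inl 2)] (fun i => a (Sum.inr i))

theorem map_genPoint {A B G : Type*} [CommSemiring A] [CommSemiring B] [FunLike G A B]
    [RingHomClass G A B] (f : G) (a : Fin 3 ⊕ ρ → A) (ξ : A) :
    (fun i => f (genPoint a ξ i)) = genPoint (fun i => f (a i)) (f ξ) := by
  funext i
  rcases i with i | i
  · fin_cases i <;> simp [genPoint]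
  · rfl

theorem update_genPoint [DecidableEq ρ] {A : Type*} [One A] (a : Fin 3 ⊕ ρ → A) (ξ ξ' : A) :
    Function.update (genPoint a ξ) (Sum.inl 1) ξ' = genPoint a ξ' := by
  funext i
  rcases i with i | i
  · fin_cases i <;> simp [genPoint]
  · simp [genPoint]

variable {t₁ t₂ t₃ t₆ s : ℂ} {h₁ h₀ : MvPolynomial (Option ρ) ℂ}

/-- Up to the factor `t₂`, the value of `niceForm` as a polynomial in the coordinate `x₂`. -/
def niceCubic [DecidableEq ρ] (t₁ t₂ t₃ t₆ s : ℂ) (h₁ h₀ : MvPolynomial (Option ρ) ℂ) {A : Type*}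
    [CommRing A] [Algebra ℂ A] (x : Fin 5 ⊕ ρ → A) : Polynomial A :=
  Polynomial.X ^ 3 + Polynomial.C (algebraMap ℂ A t₂⁻¹ * (algebraMap ℂ A t₆ *
      (x (Sum.inl 0) * x (Sum.inl 2)) + algebraMap ℂ A s * (x (Sum.inl 3) * x (Sum.inl 4)))) *
      Polynomial.X + Polynomial.C (algebraMap ℂ A t₂⁻¹ *
      aeval (Function.update x (Sum.inl 1) 0) (niceForm t₁ t₂ t₃ t₆ s h₁ h₀))

theorem niceCubic_monic [DecidableEq ρ] {A : Type*} [CommRing A] [Algebra ℂ A]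
    (x : Fin 5 ⊕ ρ → A) : (niceCubic t₁ t₂ t₃ t₆ s h₁ h₀ x).Monic := by
  unfold niceCubic; monicity!

theorem niceCubic_natDegree [DecidableEq ρ] {A : Type*} [CommRing A] [Algebra ℂ A] [Nontrivial A]
    (x : Fin 5 ⊕ ρ → A) : (niceCubic t₁ t₂ t₃ t₆ s h₁ h₀ x).natDegree = 3 := by
  unfold niceCubic; compute_degree!

theorem update_tailIndex [DecidableEq ρ] {A : Type*} (x : Fin 5 ⊕ ρ → A) (ξ : A) :
    (fun o => Function.update x (Sum.inl 1) ξ (tailIndex o)) = fun o => x (tailIndex o) := by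
  funext o
  cases o <;> simp [tailIndex]

theorem eval_niceCubic [DecidableEq ρ] (ht₂ : t₂ ≠ 0) {A : Type*} [CommRing A] [Algebra ℂ A]
    (x : Fin 5 ⊕ ρ → A) (ξ : A) :
    algebraMap ℂ A t₂ * (niceCubic t₁ t₂ t₃ t₆ s h₁ h₀ x).eval ξ =
      aeval (Function.update x (Sum.inl 1) ξ) (niceForm t₁ t₂ t₃ t₆ s h₁ h₀) := by
  have h2 : algebraMap ℂ A t₂ * algebraMap ℂ A t₂⁻¹ = 1 := by
    rw [← map_mul, mul_inv_cancel₀ ht₂, map_one]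
  simp only [niceCubic, Polynomial.eval_add, Polynomial.eval_mul, Polynomial.eval_pow,
    Polynomial.eval_X, Polynomial.eval_C]
  rw [aeval_niceForm, aeval_niceForm, update_tailIndex, update_tailIndex]
  simp
  linear_combination ((algebraMap ℂ A t₆ *
      (x (Sum.inl 0) * x (Sum.inl 2)) + algebraMap ℂ A s * (x (Sum.inl 3) * x (Sum.inl 4))) * ξ +
      (x (Sum.inl 0) * x (Sum.inl 2) * (algebraMap ℂ A t₁ * x (Sum.inl 0) +
        algebraMap ℂ A t₃ * x (Sum.inl 2)) + x (Sum.inl 4) * x (Sum.inl 3) ^ 2 +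
      x (Sum.inl 3) * aeval (fun o => x (tailIndex o)) h₁ +
      aeval (fun o => x (tailIndex o)) h₀)) * h2

theorem map_niceCubic [DecidableEq ρ] {A B : Type*} [CommRing A] [Algebra ℂ A] [CommRing B]
    [Algebra ℂ B] (f : A →ₐ[ℂ] B) (x : Fin 5 ⊕ ρ → A) :
    (niceCubic t₁ t₂ t₃ t₆ s h₁ h₀ x).map (f : A →+* B) =
      niceCubic t₁ t₂ t₃ t₆ s h₁ h₀ (fun i => f (x i)) := by
  have h : (fun i => f (Function.update x (Sum.inl 1) 0 i)) =
      Function.update (fun i => f (x i)) (Sum.inl 1) 0 := by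
    funext i
    by_cases hi : i = Sum.inl 1
    · subst hi; simp
    · simp [hi]
  simp only [niceCubic, Polynomial.map_add, Polynomial.map_mul, Polynomial.map_pow,
    Polynomial.map_X, Polynomial.map_C, RingHom.coe_coe, map_add, map_mul, AlgHom.commutes,
    ← aeval_fun_algHom, h]

theorem aeval_update_eq_zero [DecidableEq ρ] (ht₂ : t₂ ≠ 0) {A : Type*} [CommRing A] [Algebra ℂ A]
    {x : Fin 5 ⊕ ρ → A} {ξ : A} : (niceCubic t₁ t₂ t₃ t₆ s h₁ h₀ x).eval ξ = 0 ↔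
      aeval (Function.update x (Sum.inl 1) ξ) (niceForm t₁ t₂ t₃ t₆ s h₁ h₀) = 0 := by
  rw [← eval_niceCubic ht₂]
  have h2 : IsUnit (algebraMap ℂ A t₂) := (IsUnit.mk0 _ ht₂).map _
  rw [h2.mul_right_eq_zero]

/-- The generic cubic has no root: specialising `x₁` to `T`, `x₃` to `1` and the other coordinates
to zero, a root would be a polynomial `p(T)` with `t₂ p³ + t₆ T p + T (t₁ T + t₃) = 0`. -/
theorem niceCubic_eval_ne_zero [DecidableEq ρ] {κ : Type} (ht₂ : t₂ ≠ 0) (ht₃ : t₃ ≠ 0)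
    (hh₀ : h₀.IsHomogeneous 3) (p : MvPolynomial ((Fin 3 ⊕ ρ) ⊕ κ) ℂ) :
    (niceCubic t₁ t₂ t₃ t₆ s h₁ h₀ (genPoint (fun v => X (Sum.inl v)) 0)).eval p ≠ 0 := by
  intro h
  let φ : MvPolynomial ((Fin 3 ⊕ ρ) ⊕ κ) ℂ →ₐ[ℂ] Polynomial ℂ :=
    aeval (Sum.elim (Sum.elim ![Polynomial.X, 0, 0] 0) 0)
  rw [aeval_update_eq_zero ht₂, update_genPoint] at h
  have h1 := congrArg φ h
  rw [← aeval_fun_algHom, map_genPoint, map_zero, aeval_niceForm] at h1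
  have hz : (fun o => genPoint (fun i => φ (X (Sum.inl i))) (φ p) (tailIndex o)) = 0 := by
    funext o
    cases o <;> simp [tailIndex, genPoint, φ]
  have hh : aeval (0 : Option ρ → Polynomial ℂ) h₀ = 0 := by
    have := IsHomogeneous.aeval_const_mul hh₀ (0 : Polynomial ℂ) (0 : Option ρ → Polynomial ℂ)
    simpa using this
  rw [hz, hh] at h1
  obtain ⟨q, hq⟩ : ∃ q, q = φ p := ⟨_, rfl⟩
  rw [← hq] at h1
  simp [genPoint, φ] at h1
  have hX : (Polynomial.X : Polynomial ℂ) ∣ q := by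
    have h2 : (Polynomial.X : Polynomial ℂ) ∣ Polynomial.C t₂ * q ^ 3 :=
      ⟨-(Polynomial.C t₁ * Polynomial.X + Polynomial.C t₃ + Polynomial.C t₆ * q), by
        linear_combination h1⟩
    rw [(Polynomial.isUnit_C.2 (Ne.isUnit ht₂)).dvd_mul_left] at h2
    exact Polynomial.prime_X.dvd_of_dvd_pow h2
  obtain ⟨r, rfl⟩ := hX
  have h3 : Polynomial.C t₁ * Polynomial.X + Polynomial.C t₃ + Polynomial.C t₆ *
      (Polynomial.X * r) + Polynomial.C t₂ * Polynomial.X ^ 2 * r ^ 3 = 0 := by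
    refine (mul_eq_zero.1 ?_).resolve_left (Polynomial.X_ne_zero (R := ℂ))
    linear_combination h1
  have h4 := congrArg (Polynomial.eval 0) h3
  simp at h4
  exact ht₃ h4

/-- The cubic equation of `x₂` over the field of rational functions in the other coordinates is
irreducible, by Gauss's lemma. -/
theorem irreducible_map_niceCubic [DecidableEq ρ] {κ : Type} (ht₂ : t₂ ≠ 0) (ht₃ : t₃ ≠ 0)
    (hh₀ : h₀.IsHomogeneous 3) {k : Type*} [Field k]
    [Algebra (MvPolynomial ((Fin 3 ⊕ ρ) ⊕ κ) ℂ) k]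
    [IsFractionRing (MvPolynomial ((Fin 3 ⊕ ρ) ⊕ κ) ℂ) k] :
    Irreducible ((niceCubic t₁ t₂ t₃ t₆ s h₁ h₀ (genPoint (fun v =>
      (X (Sum.inl v) : MvPolynomial ((Fin 3 ⊕ ρ) ⊕ κ) ℂ)) 0)).map (algebraMap _ k)) := by
  have hm := niceCubic_monic (t₁ := t₁) (t₂ := t₂) (t₃ := t₃) (t₆ := t₆) (s := s) (h₁ := h₁)
    (h₀ := h₀) (genPoint (fun v => (X (Sum.inl v) : MvPolynomial ((Fin 3 ⊕ ρ) ⊕ κ) ℂ)) 0)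
  have hd := niceCubic_natDegree (t₁ := t₁) (t₂ := t₂) (t₃ := t₃) (t₆ := t₆) (s := s) (h₁ := h₁)
    (h₀ := h₀) (genPoint (fun v => (X (Sum.inl v) : MvPolynomial ((Fin 3 ⊕ ρ) ⊕ κ) ℂ)) 0)
  rw [← hm.irreducible_iff_irreducible_map_fraction_map,
    hm.irreducible_iff_roots_eq_zero_of_degree_le_three (by rw [hd]; norm_num) (by rw [hd])]
  refine Multiset.eq_zero_of_forall_notMem fun p hp => ?_
  exact niceCubic_eval_ne_zero ht₂ ht₃ hh₀ p (Polynomial.isRoot_of_mem_roots hp)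

/-- The coordinate `x₂` of a generic point satisfies no polynomial relation of degree at most two
over the other coordinates. -/
theorem coeff_eq_zero_of_genPoint [DecidableEq ρ] {κ : Type} (ht₂ : t₂ ≠ 0) (ht₃ : t₃ ≠ 0)
    (hh₀ : h₀.IsHomogeneous 3) {L : Type*} [Field L] [Algebra ℂ L] {v : (Fin 3 ⊕ ρ) ⊕ κ → L}
    (hv : AlgebraicIndependent ℂ v) {ξ : L}
    (hξ : aeval (genPoint (fun i => v (Sum.inl i)) ξ) (niceForm t₁ t₂ t₃ t₆ s h₁ h₀) = 0)
    {c : Fin 3 → MvPolynomial ((Fin 3 ⊕ ρ) ⊕ κ) ℂ}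
    (h : aeval v (c 0) + aeval v (c 1) * ξ + aeval v (c 2) * ξ ^ 2 = 0) : c = 0 := by
  let R := MvPolynomial ((Fin 3 ⊕ ρ) ⊕ κ) ℂ
  let _ : Algebra R L := (aeval v : R →ₐ[ℂ] L).toRingHom.toAlgebra
  have hinj : Function.Injective (algebraMap R L) := hv
  have : FaithfulSMul R L := (faithfulSMul_iff_algebraMap_injective R L).2 hinj
  let _ := FractionRing.liftAlgebra R L
  have : IsScalarTower R (FractionRing R) L := FractionRing.isScalarTower_liftAlgebra R L
  have hirr := irreducible_map_niceCubic (t₁ := t₁) (t₆ := t₆) (s := s) (h₁ := h₁) (κ := κ)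
    ht₂ ht₃ hh₀ (k := FractionRing R)
  have hm := (niceCubic_monic (t₁ := t₁) (t₂ := t₂) (t₃ := t₃) (t₆ := t₆) (s := s) (h₁ := h₁)
    (h₀ := h₀) (genPoint (fun v => (X (Sum.inl v) : R)) 0)).map (algebraMap R (FractionRing R))
  have hroot : Polynomial.aeval ξ ((niceCubic t₁ t₂ t₃ t₆ s h₁ h₀ (genPoint (fun v =>
      (X (Sum.inl v) : R)) 0)).map (algebraMap R (FractionRing R))) = 0 := by
    rw [Polynomial.aeval_map_algebraMap, Polynomial.aeval_def, ← Polynomial.eval_map]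
    have h1 := map_niceCubic (t₁ := t₁) (t₂ := t₂) (t₃ := t₃) (t₆ := t₆) (s := s) (h₁ := h₁)
      (h₀ := h₀) (aeval v : R →ₐ[ℂ] L) (genPoint (fun v => (X (Sum.inl v) : R)) 0)
    have h2 : algebraMap R L = ((aeval v : R →ₐ[ℂ] L) : R →+* L) := rfl
    rw [h2, h1, aeval_update_eq_zero ht₂, map_genPoint, update_genPoint]
    simpa using hξ
  have hmin := minpoly.eq_of_irreducible_of_monic hirr hroot hm
  let g : Polynomial R := Polynomial.C (c 0) + Polynomial.C (c 1) * Polynomial.X +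
    Polynomial.C (c 2) * Polynomial.X ^ 2
  have hg : Polynomial.aeval ξ (g.map (algebraMap R (FractionRing R))) = 0 := by
    rw [Polynomial.aeval_map_algebraMap]
    simp [g]
    exact h
  have hdvd := minpoly.dvd _ _ hg
  rw [← hmin] at hdvd
  have hg0 : g.map (algebraMap R (FractionRing R)) = 0 := by
    refine Polynomial.eq_zero_of_dvd_of_natDegree_lt hdvd ?_
    rw [(niceCubic_monic _).natDegree_map, niceCubic_natDegree]
    refine lt_of_le_of_lt Polynomial.natDegree_map_le (lt_of_le_of_lt (b := 2) ?_ (by norm_num))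
    simp only [g]
    compute_degree
  have hg1 : g = 0 := by
    refine Polynomial.map_injective (algebraMap R (FractionRing R))
      (IsFractionRing.injective R (FractionRing R)) ?_
    rw [hg0, Polynomial.map_zero]
  funext i
  have hc := fun n => congrArg (fun p : Polynomial R => p.coeff n) hg1
  fin_cases i
  · simpa [g, Polynomial.coeff_X, Polynomial.coeff_C] using hc 0
  · simpa [g, Polynomial.coeff_X, Polynomial.coeff_C] using hc 1
  · simpa [g, Polynomial.coeff_X, Polynomial.coeff_C] using hc 2

/-- Division by the cubic: on the hypersurface, every polynomial agrees with one of degree at most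
two in the coordinate `x₂`. -/
theorem exists_remainder [DecidableEq ρ] {κ : Type} (ht₂ : t₂ ≠ 0)
    (G : MvPolynomial ((Fin 5 ⊕ ρ) ⊕ κ) ℂ) :
    ∃ c : Fin 3 → MvPolynomial ((Fin 5 ⊕ ρ) ⊕ κ) ℂ,
      ∀ (A : Type) [CommRing A] [Algebra ℂ A] (x : Fin 5 ⊕ ρ → A) (y : κ → A),
        aeval x (niceForm t₁ t₂ t₃ t₆ s h₁ h₀) = 0 →
        aeval (Sum.elim x y) G =
          aeval (Sum.elim (Function.update x (Sum.inl 1) 0) y) (c 0) +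
          aeval (Sum.elim (Function.update x (Sum.inl 1) 0) y) (c 1) * x (Sum.inl 1) +
          aeval (Sum.elim (Function.update x (Sum.inl 1) 0) y) (c 2) * x (Sum.inl 1) ^ 2 := by
  obtain ⟨Θ, hΘ⟩ : ∃ Θ : Polynomial (MvPolynomial ((Fin 5 ⊕ ρ) ⊕ κ) ℂ),
      ∀ (A : Type) [CommRing A] [Algebra ℂ A] (x : Fin 5 ⊕ ρ → A) (y : κ → A),
      Θ.eval₂ ((aeval (Sum.elim (Function.update x (Sum.inl 1) 0) y) :
          MvPolynomial ((Fin 5 ⊕ ρ) ⊕ κ) ℂ →ₐ[ℂ] A) : MvPolynomial ((Fin 5 ⊕ ρ) ⊕ κ) ℂ →+* A)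
        (x (Sum.inl 1)) = aeval (Sum.elim x y) G := by
    classical
    refine ⟨aeval (fun w => if w = Sum.inl (Sum.inl 1) then Polynomial.X else Polynomial.C (X w)) G,
      fun A _ _ x y => ?_⟩
    clear * -
    induction G using MvPolynomial.induction_on with
    | C a =>
      rw [aeval_C, aeval_C, IsScalarTower.algebraMap_apply ℂ (MvPolynomial ((Fin 5 ⊕ ρ) ⊕ κ) ℂ)
        (Polynomial _), Polynomial.algebraMap_eq, Polynomial.eval₂_C, RingHom.coe_coe,
        AlgHom.commutes]
    | add p q hp hq => rw [map_add, map_add, Polynomial.eval₂_add, hp, hq]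
    | mul_X p w hp =>
      rw [map_mul, map_mul, Polynomial.eval₂_mul, hp, aeval_X, aeval_X]
      congr 1
      by_cases hw : w = Sum.inl (Sum.inl 1)
      · subst hw; rw [if_pos rfl, Polynomial.eval₂_X, Sum.elim_inl]
      · rw [if_neg hw, Polynomial.eval₂_C, RingHom.coe_coe, aeval_X]
        rcases w with w | w
        · have hw' : w ≠ Sum.inl 1 := fun h => hw (by rw [h])
          simp [hw']
        · rfl
  obtain ⟨f, hfd⟩ : ∃ f, f = niceCubic (A := MvPolynomial ((Fin 5 ⊕ ρ) ⊕ κ) ℂ)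
    t₁ t₂ t₃ t₆ s h₁ h₀ (fun i => X (Sum.inl i)) := ⟨_, rfl⟩
  have hfm : f.Monic := hfd ▸ niceCubic_monic _
  have hf3 : f.natDegree = 3 := hfd ▸ niceCubic_natDegree _
  have hrd : (Θ %ₘ f).natDegree < 3 := by
    rw [← hf3]
    refine Polynomial.natDegree_modByMonic_lt _ hfm fun h1 => ?_
    rw [h1, Polynomial.natDegree_one] at hf3
    omega
  refine ⟨fun i => (Θ %ₘ f).coeff i, fun A _ _ x y hx => ?_⟩
  have hf : f.eval₂ ((aeval (Sum.elim (Function.update x (Sum.inl 1) 0) y) :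
      MvPolynomial ((Fin 5 ⊕ ρ) ⊕ κ) ℂ →ₐ[ℂ] A) : MvPolynomial ((Fin 5 ⊕ ρ) ⊕ κ) ℂ →+* A)
        (x (Sum.inl 1)) = 0 := by
    rw [hfd, ← Polynomial.eval_map, map_niceCubic, aeval_update_eq_zero ht₂, ← hx]
    congr 2
    funext i
    by_cases hi : i = Sum.inl 1
    · subst hi; simp
    · simp [hi]
  conv_lhs => rw [← hΘ, ← Polynomial.modByMonic_add_div Θ f, Polynomial.eval₂_add,
    Polynomial.eval₂_mul, hf, zero_mul, add_zero, Polynomial.eval₂_eq_sum_range' _ hrd]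
  rw [Finset.sum_range_succ, Finset.sum_range_succ, Finset.sum_range_one]
  simp

/-- Every bihomogeneous form that vanishes at a generic point of the product of the hypersurface
with a projective space vanishes on this product. -/
theorem eval_eq_zero_of_genPoint [DecidableEq ρ] {m : ℕ} (ht₂ : t₂ ≠ 0) (ht₃ : t₃ ≠ 0)
    (hh₁ : h₁.IsHomogeneous 2) (hh₀ : h₀.IsHomogeneous 3) {L : Type} [Field L] [Algebra ℂ L]
    {v : (Fin 3 ⊕ ρ) ⊕ Fin m → L} (hv : AlgebraicIndependent ℂ v) {ξ : L}
    (hξ : aeval (genPoint (fun i => v (Sum.inl i)) ξ) (niceForm t₁ t₂ t₃ t₆ s h₁ h₀) = 0)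
    {e : ℕ × ℕ} {G : MvPolynomial ((Fin 5 ⊕ ρ) ⊕ Fin (m + 1)) ℂ}
    (hG : IsWeightedHomogeneous (sumWeight _ _) G e)
    (h : aeval (Sum.elim (genPoint (fun i => v (Sum.inl i)) ξ)
      (Fin.cons 1 (fun i => v (Sum.inr i)))) G = 0)
    (x : Fin 5 ⊕ ρ → ℂ) (y : Fin (m + 1) → ℂ)
    (hx : eval x (niceForm t₁ t₂ t₃ t₆ s h₁ h₀) = 0) : eval (Sum.elim x y) G = 0 := by
  obtain ⟨r, hrG⟩ := exists_remainder (t₁ := t₁) (t₃ := t₃) (t₆ := t₆) (s := s) (h₁ := h₁)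
    (h₀ := h₀) ht₂ G
  -- Where `x₃` and `y₀` do not vanish, the generic point may be scaled to have the given values of
  -- these coordinates, and the coefficients of the remainder vanish since `x₂` satisfies no
  -- relation of degree two.
  have hcoef : ∀ (i : Fin 3) (x : Fin 5 ⊕ ρ → ℂ) (y : Fin (m + 1) → ℂ), x (Sum.inl 2) ≠ 0 →
      y 0 ≠ 0 → eval (Sum.elim (Function.update x (Sum.inl 1) 0) y) (r i) = 0 := by
    intro i x y hx hy
    obtain ⟨η, hηd⟩ : ∃ η : MvPolynomial ((Fin 5 ⊕ ρ) ⊕ Fin (m + 1)) ℂ →ₐ[ℂ]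
        MvPolynomial ((Fin 3 ⊕ ρ) ⊕ Fin m) ℂ, η = aeval (Sum.elim
      (fun i => C (x (Sum.inl 2)) * genPoint (fun i => X (Sum.inl i)) 0 i)
      (fun j => C (y 0) * (Fin.cons 1 (fun i => X (Sum.inr i)) :
        Fin (m + 1) → MvPolynomial ((Fin 3 ⊕ ρ) ⊕ Fin m) ℂ) j)) := ⟨_, rfl⟩
    have hη : ∀ p : MvPolynomial ((Fin 5 ⊕ ρ) ⊕ Fin (m + 1)) ℂ, aeval v (η p) = aeval (Sum.elim
        (Function.update (fun i => algebraMap ℂ L (x (Sum.inl 2)) *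
          genPoint (fun i => v (Sum.inl i)) ξ i) (Sum.inl 1) 0)
        (fun j => algebraMap ℂ L (y 0) *
          (Fin.cons 1 (fun i => v (Sum.inr i)) : Fin (m + 1) → L) j)) p := by
      intro p
      rw [← AlgHom.comp_apply]
      refine DFunLike.congr_fun (algHom_ext fun w => ?_) p
      rw [AlgHom.comp_apply, hηd, aeval_X, aeval_X]
      rcases w with (w | w) | w
      · fin_cases w <;> simp [-Function.update_eq_self, genPoint]
      · simp [-Function.update_eq_self, genPoint]
      · refine Fin.cases ?_ (fun w => ?_) w <;> simp
    have h1 := aeval_biscale hG (algebraMap ℂ L (x (Sum.inl 2))) (algebraMap ℂ L (y 0))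
      (genPoint (fun i => v (Sum.inl i)) ξ) (Fin.cons 1 (fun i => v (Sum.inr i)))
    have h1' : aeval (fun i => algebraMap ℂ L (x (Sum.inl 2)) *
        genPoint (fun i => v (Sum.inl i)) ξ i) (niceForm t₁ t₂ t₃ t₆ s h₁ h₀) = 0 := by
      rw [IsHomogeneous.aeval_const_mul (isHomogeneous_niceForm hh₁ hh₀), hξ, mul_zero]
    rw [h, mul_zero, hrG L _ _ h1'] at h1
    · rw [← hη, ← hη, ← hη] at h1
      have h2 := coeff_eq_zero_of_genPoint ht₂ ht₃ hh₀ hv hξ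
        (c := ![η (r 0), C (x (Sum.inl 2)) * η (r 1),
          C (x (Sum.inl 2)) ^ 2 * η (r 2)])
        (by
          simp [-Function.update_eq_self, genPoint] at h1 ⊢
          linear_combination h1)
      have h3 : η (r i) = 0 := by
        have h4 := congrFun h2 i
        fin_cases i
        · simpa using h4
        · simpa [hx] using h4
        · simpa [hx] using h4
      have h4 := congrArg (aeval (Sum.elim (Sum.elim
        ![x (Sum.inl 0) / x (Sum.inl 2), x (Sum.inl 3) / x (Sum.inl 2),
          x (Sum.inl 4) / x (Sum.inl 2)] (fun i => x (Sum.inr i) / x (Sum.inl 2)))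
        (fun j => y j.succ / y 0)) : MvPolynomial ((Fin 3 ⊕ ρ) ⊕ Fin m) ℂ →ₐ[ℂ] ℂ) h3
      rw [map_zero, ← AlgHom.comp_apply] at h4
      refine Eq.trans ?_ h4
      rw [← MvPolynomial.coe_aeval_eq_eval, RingHom.coe_coe]
      refine DFunLike.congr_fun (algHom_ext fun w => ?_) _
      rw [AlgHom.comp_apply, hηd, aeval_X, aeval_X]
      rcases w with (w | w) | w
      · fin_cases w <;> simp [-Function.update_eq_self, genPoint] <;> field_simp
      · simp [-Function.update_eq_self, genPoint]; field_simp
      · refine Fin.cases ?_ (fun w => ?_) w <;> simp; field_simp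
  -- The restriction on `x₃` and `y₀` is removed by density.
  have hcoef' : ∀ (i : Fin 3) (x : Fin 5 ⊕ ρ → ℂ) (y : Fin (m + 1) → ℂ),
      eval (Sum.elim (Function.update x (Sum.inl 1) 0) y) (r i) = 0 := by
    intro i x y
    let c : MvPolynomial ((Fin 5 ⊕ ρ) ⊕ Fin (m + 1)) ℂ := aeval
      (Sum.elim (Function.update (fun i => X (Sum.inl i)) (Sum.inl 1) 0)
      (fun j => X (Sum.inr j))) (r i)
    have hc : ∀ z : (Fin 5 ⊕ ρ) ⊕ Fin (m + 1) → ℂ, eval z c = eval (Sum.elim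
        (Function.update (fun i => z (Sum.inl i)) (Sum.inl 1) 0) (fun j => z (Sum.inr j)))
        (r i) := by
      intro z
      rw [← MvPolynomial.coe_aeval_eq_eval, ← MvPolynomial.coe_aeval_eq_eval, RingHom.coe_coe,
        RingHom.coe_coe]
      simp only [c]
      rw [← AlgHom.comp_apply]
      refine DFunLike.congr_fun (algHom_ext fun w => ?_) _
      rw [AlgHom.comp_apply, aeval_X, aeval_X]
      rcases w with w | w
      · by_cases hw : w = Sum.inl 1
        · subst hw; simp [-Function.update_eq_self]
        · simp [-Function.update_eq_self, hw]
      · simp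
    have h0 : X (Sum.inl (Sum.inl 2)) * X (Sum.inr 0) * c = 0 := by
      refine MvPolynomial.funext fun z => ?_
      rw [map_mul, map_mul, eval_X, eval_X, map_zero]
      by_cases h1 : z (Sum.inl (Sum.inl 2)) = 0
      · rw [h1]; ring
      · by_cases h2 : z (Sum.inr 0) = 0
        · rw [h2]; ring
        · rw [hc, hcoef i (fun i => z (Sum.inl i)) (fun j => z (Sum.inr j)) h1 h2, mul_zero]
    have h1 : c = 0 := (mul_eq_zero.1 h0).resolve_left (mul_ne_zero (X_ne_zero _) (X_ne_zero _))
    have h2 := hc (Sum.elim x y)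
    rw [h1, map_zero] at h2
    exact h2.symm
  have h5 := hrG ℂ x y (by rw [← hx]; rfl)
  have h6 : ∀ (z : (Fin 5 ⊕ ρ) ⊕ Fin (m + 1) → ℂ)
      (p : MvPolynomial ((Fin 5 ⊕ ρ) ⊕ Fin (m + 1)) ℂ), aeval z p = eval z p := fun _ _ => rfl
  rw [h6, h6, h6, h6, hcoef' 0 x y, hcoef' 1 x y, hcoef' 2 x y] at h5
  rw [h5]
  ring

end GenericPoint

/-! ### Local rings with a given residue field -/

section ExtendResidueField

open Module IntermediateField

/-- A finite separable extension `K / k` is the residue field of a local ring of the affine line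
over `k`: the local ring at the minimal polynomial of a primitive element. -/
theorem exists_localRing_of_finiteDimensional (k K : Type) [Field k] [Field K] [Algebra k K]
    [FiniteDimensional k K] [Algebra.IsSeparable k K] :
    ∃ (O L : Type) (_ : CommRing O) (_ : IsDomain O) (_ : IsIntegrallyClosed O) (_ : Field L)
      (_ : Algebra k O) (_ : Algebra O L) (_ : Algebra k L) (_ : IsScalarTower k O L)
      (_ : IsFractionRing O L) (φ : O →ₐ[k] K) (τ : O) (T : L),
      Function.Surjective φ ∧ (∀ x, φ x ≠ 0 → IsUnit x) ∧ τ ≠ 0 ∧ φ τ = 0 ∧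
        τ ∉ RingHom.ker φ ^ 2 ∧ Transcendental k T ∧ k⟮T⟯ = ⊤ := by
  obtain ⟨θ, hθ⟩ := Field.exists_primitive_element k K
  obtain ⟨H, hH⟩ : ∃ H, H = minpoly k θ := ⟨_, rfl⟩
  have hint : IsIntegral k θ := Algebra.IsIntegral.isIntegral θ
  have hirr : Irreducible H := hH ▸ minpoly.irreducible hint
  have hP : (Ideal.span {H}).IsPrime := (Ideal.span_singleton_prime hirr.ne_zero).2 hirr.prime
  have hev : ∀ p : Polynomial k, Polynomial.aeval θ p = 0 ↔ p ∈ Ideal.span {H} := by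
    intro p
    rw [Ideal.mem_span_singleton, hH, minpoly.dvd_iff]
  have hfr : IsFractionRing (Localization.AtPrime (Ideal.span {H})) (FractionRing (Polynomial k)) :=
    IsFractionRing.isFractionRing_of_isDomain_of_isLocalization (Ideal.span {H}).primeCompl _ _
  have hunits : ∀ y : (Ideal.span {H}).primeCompl,
      IsUnit ((Polynomial.aeval θ : Polynomial k →ₐ[k] K) y) := fun y =>
    Ne.isUnit fun h => y.2 ((hev _).1 h)
  let φ : Localization.AtPrime (Ideal.span {H}) →ₐ[k] K :=
    IsLocalization.liftAlgHom (M := (Ideal.span {H}).primeCompl) hunits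
  have hφ : ∀ p : Polynomial k, φ (algebraMap _ _ p) = Polynomial.aeval θ p := fun p =>
    IsLocalization.lift_eq _ _
  have hdom : IsDomain (Localization.AtPrime (Ideal.span {H})) :=
    IsLocalization.isDomain_localization (Ideal.span {H}).primeCompl_le_nonZeroDivisors
  have hinj : Function.Injective
      (algebraMap (Polynomial k) (Localization.AtPrime (Ideal.span {H}))) :=
    IsLocalization.injective _ (Ideal.span {H}).primeCompl_le_nonZeroDivisors
  have hker : RingHom.ker φ = Ideal.span {algebraMap (Polynomial k)
      (Localization.AtPrime (Ideal.span {H})) H} := by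
    refine le_antisymm (fun x hx => ?_) ((Ideal.span_singleton_le_iff_mem _).2 ?_)
    · obtain ⟨p, y, rfl⟩ := IsLocalization.exists_mk'_eq (Ideal.span {H}).primeCompl x
      have h1 := IsLocalization.mk'_spec (Localization.AtPrime (Ideal.span {H})) p y
      have h2 := congrArg φ h1
      rw [map_mul, (RingHom.mem_ker).1 hx, zero_mul, hφ] at h2
      obtain ⟨q, hq⟩ := Ideal.mem_span_singleton.1 ((hev p).1 h2.symm)
      refine Ideal.mem_span_singleton.2 ?_
      rw [← (IsLocalization.map_units
        (Localization.AtPrime (Ideal.span {H})) y).dvd_mul_right, h1, hq, map_mul]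
      exact Dvd.intro _ rfl
    · rw [RingHom.mem_ker, hφ]
      exact (hev _).2 (Ideal.mem_span_singleton_self H)
  have htower : IsScalarTower k (Localization.AtPrime (Ideal.span {H}))
      (FractionRing (Polynomial k)) := by
    refine IsScalarTower.of_algebraMap_eq fun c => ?_
    rw [IsScalarTower.algebraMap_apply k (Polynomial k) (FractionRing (Polynomial k)) c,
      IsScalarTower.algebraMap_apply k (Polynomial k) (Localization.AtPrime (Ideal.span {H})),
      IsScalarTower.algebraMap_apply (Polynomial k) (Localization.AtPrime (Ideal.span {H}))
        (FractionRing (Polynomial k))]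
  refine ⟨Localization.AtPrime (Ideal.span {H}), FractionRing (Polynomial k), inferInstance, hdom,
    isIntegrallyClosed_of_isLocalization _ (Ideal.span {H}).primeCompl
      (Ideal.span {H}).primeCompl_le_nonZeroDivisors, inferInstance, inferInstance, inferInstance,
    inferInstance, htower, hfr, φ, algebraMap (Polynomial k) _ H,
    algebraMap (Polynomial k) _ Polynomial.X,
    ?_, ?_, ?_, ?_, ?_, ?_, ?_⟩
  · intro x
    have h1 : x ∈ k⟮θ⟯ := hθ ▸ mem_top
    rw [← IntermediateField.mem_toSubalgebra,
      adjoin_simple_toSubalgebra_of_isAlgebraic hint.isAlgebraic,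
      Algebra.adjoin_singleton_eq_range_aeval] at h1
    obtain ⟨p, rfl⟩ := h1
    exact ⟨algebraMap _ _ p, hφ p⟩
  · intro x hx
    obtain ⟨p, y, rfl⟩ := IsLocalization.exists_mk'_eq (Ideal.span {H}).primeCompl x
    have h1 := IsLocalization.mk'_spec (Localization.AtPrime (Ideal.span {H})) p y
    have h2 : p ∈ (Ideal.span {H}).primeCompl := by
      intro hp
      rw [SetLike.mem_coe, ← hev, ← hφ, ← h1, map_mul, mul_eq_zero] at hp
      refine hp.elim hx fun h => y.2 ((hev _).1 ?_)
      rw [← hφ, h]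
    exact (IsLocalization.AtPrime.isUnit_mk'_iff _ _ p y).2 h2
  · rw [Ne, map_eq_zero_iff _ hinj]
    exact hirr.ne_zero
  · rw [hφ, hev]
    exact Ideal.mem_span_singleton_self H
  · rw [hker, Ideal.span_singleton_pow, Ideal.mem_span_singleton]
    rintro ⟨q, hq⟩
    have h1 : algebraMap (Polynomial k) (Localization.AtPrime (Ideal.span {H})) H * q = 1 := by
      refine mul_left_cancel₀ (b := algebraMap (Polynomial k) _ H * q)
        (mt (map_eq_zero_iff _ hinj).1 hirr.ne_zero) ?_
      rw [mul_one, ← mul_assoc, ← pow_two, ← hq]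
    have h2 := congrArg φ h1
    rw [map_mul, hφ, (hev H).2 (Ideal.mem_span_singleton_self H), zero_mul, map_one] at h2
    exact zero_ne_one h2
  · rw [transcendental_iff_injective]
    have h1 : (Polynomial.aeval (algebraMap (Polynomial k) (FractionRing (Polynomial k))
        Polynomial.X) : Polynomial k →ₐ[k] _) =
        IsScalarTower.toAlgHom k (Polynomial k) (FractionRing (Polynomial k)) := by
      ext; simp
    rw [h1]
    exact IsFractionRing.injective _ _
  · refine eq_top_iff.2 fun z _ => ?_
    have hp : ∀ p : Polynomial k, algebraMap (Polynomial k) (FractionRing (Polynomial k)) p ∈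
        k⟮algebraMap (Polynomial k) (FractionRing (Polynomial k)) Polynomial.X⟯ := by
      intro p
      induction p using Polynomial.induction_on' with
      | add p q hp hq => rw [map_add]; exact add_mem hp hq
      | monomial n a =>
        rw [← Polynomial.C_mul_X_pow_eq_monomial, map_mul, map_pow]
        exact mul_mem (IntermediateField.algebraMap_mem _ a)
          (pow_mem (mem_adjoin_simple_self k _) n)
    obtain ⟨a, b, hb, rfl⟩ := IsFractionRing.div_surjective (A := Polynomial k) z
    exact div_mem (hp a) (hp b)

/-- The function field `L` of a curve over `E` is finite over `E(x)`, for every `x` which is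
transcendental over `E`. -/
theorem finiteDimensional_adjoin_of_transcendental {N : ℕ} {E L : Type} [Field E] [Field L]
    [Algebra ℂ E] [Algebra ℂ L] [Algebra E L] [IsScalarTower ℂ E L]
    (hL : IsRationalFunctionField (N + 1) L) (hE : Algebra.trdeg ℂ E = N) {x : L}
    (hx : Transcendental E x) : FiniteDimensional E⟮x⟯ L := by
  have htr : Algebra.trdeg E L = 1 := by
    have h1 := trdeg_add_eq ℂ E (A := L)
    rw [hL.trdeg_eq, hE] at h1
    push_cast at h1
    rw [add_comm, add_comm _ (1 : Cardinal)] at h1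
    exact (Cardinal.add_right_inj_of_lt_aleph0 (Cardinal.natCast_lt_aleph0)).1 h1
  have hb : IsTranscendenceBasis E (fun _ : Unit => x) := by
    refine AlgebraicIndependent.isTranscendenceBasis_of_trdeg_le_of_finite ?_ (by rw [htr]; simp)
    exact (algebraicIndependent_unique_type_iff).2 hx
  have halg : Algebra.IsAlgebraic E⟮x⟯ L := by
    have h1 := hb.isAlgebraic_field
    rwa [Set.range_const] at h1
  obtain ⟨y, -, hy⟩ := hL
  have htower : IsScalarTower ℂ E⟮x⟯ L := IsScalarTower.of_algebraMap_eq fun c => by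
    rw [IsScalarTower.algebraMap_apply ℂ E L, IsScalarTower.algebraMap_apply ℂ E E⟮x⟯]
    rfl
  have htop : IntermediateField.adjoin E⟮x⟯ (Set.range y) = ⊤ := by
    refine eq_top_iff.2 fun z _ => ?_
    have h1 : IntermediateField.adjoin ℂ (Set.range y) ≤
        (IntermediateField.adjoin E⟮x⟯ (Set.range y)).restrictScalars ℂ :=
      IntermediateField.adjoin_le_iff.2 (IntermediateField.subset_adjoin E⟮x⟯ (Set.range y))
    rw [hy] at h1
    exact h1 mem_top
  have := IntermediateField.finiteDimensional_adjoin (K := E⟮x⟯) (S := Set.range y)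
    fun z _ => Algebra.IsIntegral.isIntegral z
  rw [htop] at this
  exact Module.Finite.equiv (IntermediateField.topEquiv (F := E⟮x⟯) (E := L)).toLinearEquiv

end ExtendResidueField

/-! ### Simple extensions of fields of rational functions -/

section GenericField

open Module IntermediateField

variable {V : Type}

/-- The field of rational functions in the variables `V`. -/
abbrev RationalField (V : Type) : Type := FractionRing (MvPolynomial V ℂ)

variable (f : Polynomial (RationalField V))

/-- The variables, as elements of a simple extension of the field of rational functions. -/
def genericVar (v : V) : AdjoinRoot f := AdjoinRoot.of f (algebraMap (MvPolynomial V ℂ) _ (X v))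

theorem aeval_genericVar (p : MvPolynomial V ℂ) :
    aeval (genericVar f) p = AdjoinRoot.of f (algebraMap (MvPolynomial V ℂ) _ p) := by
  induction p using MvPolynomial.induction_on with
  | C a =>
    rw [aeval_C, ← MvPolynomial.algebraMap_eq,
      ← IsScalarTower.algebraMap_apply ℂ (MvPolynomial V ℂ) (RationalField V),
      ← AdjoinRoot.algebraMap_eq, ← IsScalarTower.algebraMap_apply]
  | add p q hp hq => simp only [map_add, hp, hq]
  | mul_X p i hp => rw [map_mul, map_mul, map_mul, hp, aeval_X]; rfl

variable [Fact (Irreducible f)]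

theorem mem_of_genericVar_mem {L : Type} [Field L] [Algebra ℂ L] {A : IntermediateField ℂ L}
    (j : AdjoinRoot f →ₐ[ℂ] L) (hv : ∀ v, j (genericVar f v) ∈ A)
    (hr : j (AdjoinRoot.root f) ∈ A) (e : AdjoinRoot f) : j e ∈ A := by
  have hp : ∀ p : MvPolynomial V ℂ, j (aeval (genericVar f) p) ∈ A := by
    intro p
    induction p using MvPolynomial.induction_on with
    | C a => rw [aeval_C, j.commutes]; exact IntermediateField.algebraMap_mem _ a
    | add p q hp hq => rw [map_add, map_add]; exact add_mem hp hq
    | mul_X p i hp => rw [map_mul, map_mul, aeval_X]; exact mul_mem hp (hv i)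
  have hk : ∀ z, j (AdjoinRoot.of f z) ∈ A := by
    intro z
    obtain ⟨a, b, hb, rfl⟩ := IsFractionRing.div_surjective (A := MvPolynomial V ℂ) z
    rw [map_div₀, map_div₀, ← aeval_genericVar, ← aeval_genericVar]
    exact div_mem (hp a) (hp b)
  induction e using AdjoinRoot.induction_on with
  | ih p =>
    induction p using Polynomial.induction_on' with
    | add p q hp hq => rw [map_add, map_add]; exact add_mem hp hq
    | monomial n a =>
      rw [← Polynomial.C_mul_X_pow_eq_monomial, map_mul, map_mul, map_pow, map_pow,
        AdjoinRoot.mk_C, AdjoinRoot.mk_X]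
      exact mul_mem (hk a) (pow_mem hr n)

theorem algebraicIndependent_genericVar : AlgebraicIndependent ℂ (genericVar f) := by
  intro p q hpq
  rw [aeval_genericVar, aeval_genericVar] at hpq
  exact IsFractionRing.injective (MvPolynomial V ℂ) (RationalField V)
    ((AdjoinRoot.of f).injective hpq)

/-- A lift of the generators of a simple extension of the field of rational functions to a local
ring, if it respects the equation of the extension, is a lift of the extension. -/
theorem exists_section {O K : Type} [CommRing O] [Algebra ℂ O] [Field K] [Algebra ℂ K]
    [Algebra (AdjoinRoot f) K] [IsScalarTower ℂ (AdjoinRoot f) K] {φ : O →ₐ[ℂ] K}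
    (hφ : IsLocalSurj φ) {f₀ : Polynomial (MvPolynomial V ℂ)}
    (hf₀ : f₀.map (algebraMap (MvPolynomial V ℂ) (RationalField V)) = f) {b : V → O} {ξ : O}
    (hb : ∀ v, φ (b v) = algebraMap (AdjoinRoot f) K (genericVar f v))
    (hξ : φ ξ = algebraMap (AdjoinRoot f) K (AdjoinRoot.root f))
    (h : (f₀.map ((aeval b : MvPolynomial V ℂ →ₐ[ℂ] O) : MvPolynomial V ℂ →+* O)).eval ξ = 0) :
    ∃ ψ : AdjoinRoot f →ₐ[ℂ] O, ∀ e, φ (ψ e) = algebraMap _ K e := by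
  obtain ⟨η, hη⟩ : ∃ η : MvPolynomial V ℂ →ₐ[ℂ] O, η = aeval b := ⟨_, rfl⟩
  rw [← hη] at h
  have hφη : ∀ p, φ (η p) = algebraMap (AdjoinRoot f) K (aeval (genericVar f) p) := by
    intro p
    have h1 : φ.comp η = (IsScalarTower.toAlgHom ℂ (AdjoinRoot f) K).comp
        (aeval (genericVar f)) := by
      refine algHom_ext fun v => ?_
      rw [AlgHom.comp_apply, AlgHom.comp_apply, hη, aeval_X, aeval_X]
      exact hb v
    exact DFunLike.congr_fun h1 p
  have hunit : ∀ y : nonZeroDivisors (MvPolynomial V ℂ),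
      IsUnit ((η : MvPolynomial V ℂ →+* O) y) := by
    intro y
    refine hφ.unit _ (Ne.isUnit ?_)
    rw [RingHom.coe_coe, hφη, Ne, map_eq_zero, ← map_zero (aeval (R := ℂ) (genericVar f))]
    exact fun h => nonZeroDivisors.ne_zero y.2 (algebraicIndependent_genericVar f h)
  have hlift : ∀ p, IsLocalization.lift (S := RationalField V)
      hunit (algebraMap _ _ p) = η p := fun p => IsLocalization.lift_eq _ _
  have hroot : f.eval₂ (IsLocalization.lift hunit) ξ = 0 := by
    rw [← hf₀, Polynomial.eval₂_map, IsLocalization.lift_comp, ← Polynomial.eval_map]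
    exact h
  let ψ : AdjoinRoot f →+* O := AdjoinRoot.lift (IsLocalization.lift hunit) _ hroot
  have hψv : ∀ p, ψ (aeval (genericVar f) p) = η p := fun p => by
    rw [aeval_genericVar]
    exact (AdjoinRoot.lift_of hroot).trans (hlift p)
  refine ⟨{ ψ with commutes' := fun c => ?_ }, fun e => ?_⟩
  · have h1 := hψv (C c)
    rw [aeval_C, ← MvPolynomial.algebraMap_eq, AlgHom.commutes] at h1
    exact h1
  · have h1 : (φ : O →+* K).comp ψ = algebraMap _ K := by
      have h2 : ((φ : O →+* K).comp ψ).comp (AdjoinRoot.of f) =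
          (algebraMap (AdjoinRoot f) K).comp (AdjoinRoot.of f) := by
        refine IsLocalization.ringHom_ext (nonZeroDivisors (MvPolynomial V ℂ)) ?_
        refine RingHom.ext fun p => ?_
        have h3 := hφη p
        rw [← hψv, aeval_genericVar] at h3
        exact h3
      refine AdjoinRoot.ringHom_ext h2 ?_
      refine Eq.trans ?_ hξ
      exact congrArg φ (AdjoinRoot.lift_root hroot)
    exact DFunLike.congr_fun h1 e

end GenericField

/-! ### Parametrizations of odd degree from lifts of the generic point -/

section OddParametrization

open Module IntermediateField

/-- Adjoining one more variable to a rational function field. -/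
theorem isRationalFunctionField_of_adjoin_simple {N : ℕ} {k L : Type} [Field k] [Field L]
    [Algebra ℂ k] [Algebra ℂ L] [Algebra k L] [IsScalarTower ℂ k L]
    (hk : IsRationalFunctionField N k) {T : L} (hT : Transcendental k T) (htop : k⟮T⟯ = ⊤) :
    IsRationalFunctionField (N + 1) L := by
  have htr : Algebra.trdeg ℂ L = (N + 1 : ℕ) := by
    have h1 := trdeg_add_eq ℂ k (A := L)
    have hb : IsTranscendenceBasis k (fun _ : Unit => T) := by
      refine (AlgebraicIndependent.isTranscendenceBasis_iff_isAlgebraic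
        ((algebraicIndependent_unique_type_iff).2 hT)).2 ?_
      rw [Set.range_const]
      open scoped IntermediateField.algebraAdjoinAdjoin in
      have : Algebra.IsAlgebraic k⟮T⟯ L := by
        rw [htop]
        exact ⟨fun y => isAlgebraic_algebraMap (⟨y, trivial⟩ : (⊤ : IntermediateField k L))⟩
      exact Algebra.IsAlgebraic.trans _ k⟮T⟯ _
    rw [hk.trdeg_eq, ← hb.cardinalMk_eq_trdeg] at h1
    rw [← h1]
    simp
  obtain ⟨x, -, hx⟩ := hk
  refine isRationalFunctionField_of_trdeg (ι := Option (Fin N)) (by simp)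
    (fun o => o.elim T (fun i => algebraMap k L (x i))) htr (eq_top_iff.2 fun y _ => ?_)
  obtain ⟨A, hA⟩ : ∃ A, A = IntermediateField.adjoin ℂ (Set.range fun o : Option (Fin N) =>
    o.elim T (fun i => algebraMap k L (x i))) := ⟨_, rfl⟩
  rw [← hA]
  have hkA : ∀ c : k, algebraMap k L c ∈ A := by
    intro c
    have h1 : (⊤ : IntermediateField ℂ k) ≤ A.comap (IsScalarTower.toAlgHom ℂ k L) := by
      rw [← hx, adjoin_le_iff]
      rintro _ ⟨i, rfl⟩
      rw [hA]
      exact subset_adjoin _ _ ⟨some i, rfl⟩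
    exact h1 (mem_top (x := c))
  let A' : IntermediateField k L := { A.toSubfield with algebraMap_mem' := hkA }
  have h2 : k⟮T⟯ ≤ A' := by
    rw [adjoin_simple_le_iff]
    change T ∈ A
    rw [hA]
    exact subset_adjoin _ _ ⟨none, rfl⟩
  rw [htop] at h2
  exact h2 mem_top

/-- If the function field `E`, over some extension `K` of odd degree, lifts to the local rings with
residue field `K`, then `E` embeds into a field of rational functions `L` of one more variable with
`L` of odd degree over `E(z)` for some `z`. -/
theorem exists_odd_finrank_of_section {N : ℕ} {k E K : Type} [Field k] [Algebra ℂ k] [Field E]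
    [Algebra ℂ E] [Algebra k E] [IsScalarTower ℂ k E] [FiniteDimensional k E]
    (hk : IsRationalFunctionField N k) [Field K] [Algebra E K] [Algebra ℂ K]
    [IsScalarTower ℂ E K] [FiniteDimensional E K] (hodd : Odd (finrank E K))
    (hsec : ∀ (O : Type) [CommRing O] [IsDomain O] [IsIntegrallyClosed O] [Algebra ℂ O]
      (φ : O →ₐ[ℂ] K) (τ : O), IsLocalSurj φ → τ ≠ 0 → φ τ = 0 →
      ∃ ψ : E →ₐ[ℂ] O, ∀ e, φ (ψ e) = algebraMap E K e) :
    ∃ (L : Type) (_ : Field L) (_ : Algebra ℂ L) (j : E →ₐ[ℂ] L) (z : L),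
      IsRationalFunctionField (N + 1) L ∧
      (∀ (ι : Type) (v : ι → E), AlgebraicIndependent ℂ v →
        AlgebraicIndependent ℂ (Sum.elim (fun _ : Unit => z) (fun i => j (v i)))) ∧
      Odd (finrank (IntermediateField.adjoin ℂ (insert z (Set.range j))) L) := by
  let _ : Algebra k K := ((algebraMap E K).comp (algebraMap k E)).toAlgebra
  have : IsScalarTower k E K := IsScalarTower.of_algebraMap_eq fun _ => rfl
  have : FiniteDimensional k K := Module.Finite.trans E K
  have : CharZero k := charZero_of_injective_algebraMap (algebraMap ℂ k).injective
  have : CharZero E := charZero_of_injective_algebraMap (algebraMap ℂ E).injective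
  obtain ⟨O, L, _, _, _, _, _, _, _, _, _, φ, τ, T, hsurj, hunit, hτ, hφτ, hτ2, hT, hTtop⟩ :=
    exists_localRing_of_finiteDimensional k K
  let _ : Algebra ℂ O := ((algebraMap k O).comp (algebraMap ℂ k)).toAlgebra
  let _ : Algebra ℂ L := ((algebraMap k L).comp (algebraMap ℂ k)).toAlgebra
  have : IsScalarTower ℂ k L := IsScalarTower.of_algebraMap_eq fun _ => rfl
  have : IsScalarTower ℂ O L := IsScalarTower.of_algebraMap_eq fun c =>
    IsScalarTower.algebraMap_apply k O L (algebraMap ℂ k c)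
  let φ' : O →ₐ[ℂ] K := { (φ : O →+* K) with
    commutes' := fun c => by
      refine (φ.commutes (algebraMap ℂ k c)).trans ?_
      rw [IsScalarTower.algebraMap_apply ℂ E K, IsScalarTower.algebraMap_apply ℂ k E]
      rfl }
  obtain ⟨ψ, hψ⟩ := hsec O φ' τ ⟨hsurj, fun x hx => hunit x hx.ne_zero⟩ hτ hφτ
  let _ : Algebra E O := (ψ : E →+* O).toAlgebra
  let _ : Algebra E L := ((algebraMap O L).comp (ψ : E →+* O)).toAlgebra
  have : IsScalarTower E O L := IsScalarTower.of_algebraMap_eq fun _ => rfl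
  have : IsScalarTower ℂ E L := IsScalarTower.of_algebraMap_eq fun c => by
    rw [IsScalarTower.algebraMap_apply ℂ O L]
    exact congrArg (algebraMap O L) (ψ.commutes c).symm
  let φE : O →ₐ[E] K := { (φ : O →+* K) with commutes' := hψ }
  have hL : IsRationalFunctionField (N + 1) L := isRationalFunctionField_of_adjoin_simple hk hT hTtop
  have hE : Algebra.trdeg ℂ E = N := by
    have h1 := trdeg_add_eq ℂ k (A := E)
    rw [hk.trdeg_eq, trdeg_eq_zero (R := k), add_zero] at h1
    exact h1.symm
  obtain ⟨z, hz, hzodd⟩ := exists_odd_finrank_adjoin (L := L) hodd φE hunit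
    (fun x hx => finiteDimensional_adjoin_of_transcendental hL hE hx) hφτ hτ2
  refine ⟨L, inferInstance, inferInstance, IsScalarTower.toAlgHom ℂ E L, z, hL, ?_, ?_⟩
  · intro ι v hv
    exact hv.sumElim_comp ((algebraicIndependent_unique_type_iff).2 hz)
  · have h1 : (IntermediateField.adjoin ℂ (insert z (Set.range
        (IsScalarTower.toAlgHom ℂ E L)))) = (E⟮z⟯).restrictScalars ℂ := by
      refine le_antisymm (adjoin_le_iff.2 ?_) ?_
      · rintro y (rfl | ⟨e, rfl⟩)
        · exact mem_adjoin_simple_self E y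
        · exact (E⟮z⟯).algebraMap_mem e
      · let A' : IntermediateField E L :=
          { (IntermediateField.adjoin ℂ (insert z (Set.range
              (IsScalarTower.toAlgHom ℂ E L)))).toSubfield with
            algebraMap_mem' := fun e => subset_adjoin ℂ _ (Set.mem_insert_of_mem _ ⟨e, rfl⟩) }
        have h2 : E⟮z⟯ ≤ A' := by
          rw [adjoin_simple_le_iff]
          exact subset_adjoin ℂ _ (Set.mem_insert _ _)
        exact h2
    rw [h1]
    exact hzodd

/-- The product of the hypersurface `F = 0` with `ℙᵐ` has a generic point with values in a rational
function field of transcendence degree `N` and of degree `d` over the field generated by the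
coordinates of that point. The coordinates are normalised: a linear form takes the value `1` at
`α`, and `β 0 = 1`. -/
def HasGenericParametrization {ι : Type} [Fintype ι] (N m : ℕ) (F : MvPolynomial ι ℂ) (d : ℕ) :
    Prop :=
  ∃ (L : Type) (_ : Field L) (_ : Algebra ℂ L) (α : ι → L) (β : Fin (m + 1) → L) (c : ι → ℂ),
    IsRationalFunctionField N L ∧ ∑ i, algebraMap ℂ L (c i) * α i = 1 ∧ β 0 = 1 ∧
    aeval α F = 0 ∧
    (∀ (e : ℕ × ℕ) (G : MvPolynomial (ι ⊕ Fin (m + 1)) ℂ),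
      IsWeightedHomogeneous (sumWeight _ _) G e → aeval (Sum.elim α β) G = 0 →
      ∀ x y, eval x F = 0 → eval (Sum.elim x y) G = 0) ∧
    finrank (IntermediateField.adjoin ℂ (Set.range α ∪ Set.range β)) L = d

variable {ρ : Type} [DecidableEq ρ]

/-- The cubic equation of the coordinate `x₂` over the field of rational functions in the other
affine coordinates of the hypersurface, and in `κ` further variables. -/
def genericCubic (t₁ t₂ t₃ t₆ s : ℂ) (h₁ h₀ : MvPolynomial (Option ρ) ℂ) (κ : ℕ) :
    Polynomial (RationalField ((Fin 3 ⊕ ρ) ⊕ Fin κ)) :=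
  (niceCubic t₁ t₂ t₃ t₆ s h₁ h₀ (genPoint (fun v =>
    (X (Sum.inl v) : MvPolynomial ((Fin 3 ⊕ ρ) ⊕ Fin κ) ℂ)) 0)).map (algebraMap _ _)

/-- The generic point of the hypersurface. -/
def genericCoord {κ : ℕ} (f : Polynomial (RationalField ((Fin 3 ⊕ ρ) ⊕ Fin κ))) :
    Fin 5 ⊕ ρ → AdjoinRoot f :=
  genPoint (fun v => genericVar f (Sum.inl v)) (AdjoinRoot.root f)

variable {t₁ t₂ t₃ t₆ s : ℂ} {h₁ h₀ : MvPolynomial (Option ρ) ℂ} {κ : ℕ}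
  {f : Polynomial (RationalField ((Fin 3 ⊕ ρ) ⊕ Fin κ))}

theorem aeval_genericCoord (hf : f = genericCubic t₁ t₂ t₃ t₆ s h₁ h₀ κ) (ht₂ : t₂ ≠ 0) :
    aeval (genericCoord f) (niceForm t₁ t₂ t₃ t₆ s h₁ h₀) = 0 := by
  have h1 := AdjoinRoot.eval₂_root f
  have h3 : (AdjoinRoot.of f).comp (algebraMap (MvPolynomial ((Fin 3 ⊕ ρ) ⊕ Fin κ) ℂ) _) =
      ((aeval (genericVar f) : MvPolynomial ((Fin 3 ⊕ ρ) ⊕ Fin κ) ℂ →ₐ[ℂ] _) :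
        MvPolynomial ((Fin 3 ⊕ ρ) ⊕ Fin κ) ℂ →+* AdjoinRoot f) :=
    RingHom.ext fun p => (aeval_genericVar f p).symm
  have h4 : f.eval₂ (AdjoinRoot.of f) (AdjoinRoot.root f) = ((niceCubic t₁ t₂ t₃ t₆ s h₁ h₀
      (genPoint (fun v => (X (Sum.inl v) : MvPolynomial ((Fin 3 ⊕ ρ) ⊕ Fin κ) ℂ)) 0)).map
      ((AdjoinRoot.of f).comp (algebraMap (MvPolynomial ((Fin 3 ⊕ ρ) ⊕ Fin κ) ℂ) _))).eval
      (AdjoinRoot.root f) := by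
    rw [Polynomial.eval_map, ← Polynomial.eval₂_map]
    congr 1
  rw [h4, h3, map_niceCubic, aeval_update_eq_zero ht₂, map_genPoint, update_genPoint] at h1
  simp only [aeval_X] at h1
  exact h1

/-- An odd parametrization exists as soon as the generic point of the hypersurface, over some
extension of odd degree, lifts to local rings. -/
theorem hasGenericParametrization_of_liftable [Fintype ρ] [Fact (Irreducible f)]
    (hf : f = genericCubic t₁ t₂ t₃ t₆ s h₁ h₀ κ) (ht₂ : t₂ ≠ 0) (ht₃ : t₃ ≠ 0)
    (hh₁ : h₁.IsHomogeneous 2) (hh₀ : h₀.IsHomogeneous 3) {K : Type} [Field K]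
    [Algebra (AdjoinRoot f) K] [Algebra ℂ K] [IsScalarTower ℂ (AdjoinRoot f) K]
    [FiniteDimensional (AdjoinRoot f) K] (hodd : Odd (finrank (AdjoinRoot f) K))
    (hlift : ∀ (O : Type) [CommRing O] [IsDomain O] [IsIntegrallyClosed O] [Algebra ℂ O]
      (φ : O →ₐ[ℂ] K) (τ : O), IsLocalSurj φ → τ ≠ 0 → φ τ = 0 →
      Liftable φ (niceForm t₁ t₂ t₃ t₆ s h₁ h₀)
        (fun i => algebraMap (AdjoinRoot f) K (genericCoord f i))) :
    ∃ d, Odd d ∧ HasGenericParametrization (3 + Fintype.card ρ + κ + 1) (κ + 1)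
      (niceForm t₁ t₂ t₃ t₆ s h₁ h₀) d := by
  have hfin := (AdjoinRoot.powerBasis (Fact.out : Irreducible f).ne_zero).finite
  have hk : IsRationalFunctionField (3 + Fintype.card ρ + κ)
      (RationalField ((Fin 3 ⊕ ρ) ⊕ Fin κ)) :=
    isRationalFunctionField_fractionRing _ (by simp)
  obtain ⟨L, _, _, j, z, hL, hind, hodd⟩ := exists_odd_finrank_of_section hk hodd (by
    intro O _ _ _ _ φ τ hφ hτ hφτ
    obtain ⟨S, hS, hSφ⟩ := hlift O φ τ hφ hτ hφτ
    have h2 : φ (S (Sum.inl 2)) = 1 := by rw [hSφ]; simp [genericCoord, genPoint]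
    -- The lift is normalised to have the coordinate `x₃ = 1`.
    obtain ⟨w, hw⟩ := (hφ.unit (S (Sum.inl 2)) (h2 ▸ isUnit_one)).exists_left_inv
    have hw1 : φ w = 1 := by
      have := congrArg φ hw
      rwa [map_mul, h2, mul_one, map_one] at this
    choose b hb using fun i : Fin κ => hφ.surj (algebraMap (AdjoinRoot f) K
      (genericVar f (Sum.inr i)))
    obtain ⟨a, ha⟩ : ∃ a : Fin 3 ⊕ ρ → O, a = Sum.elim ![w * S (Sum.inl 0), w * S (Sum.inl 3),
      w * S (Sum.inl 4)] (fun i => w * S (Sum.inr i)) := ⟨_, rfl⟩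
    have haS : genPoint a (w * S (Sum.inl 1)) = fun i => w * S i := by
      funext i
      rcases i with i | i
      · fin_cases i <;> simp [genPoint, ha, hw]
      · simp [genPoint, ha]
    have haF : aeval (genPoint a (w * S (Sum.inl 1))) (niceForm t₁ t₂ t₃ t₆ s h₁ h₀) = 0 := by
      rw [haS, IsHomogeneous.aeval_const_mul (isHomogeneous_niceForm hh₁ hh₀), hS, mul_zero]
    refine exists_section f hφ hf.symm (b := Sum.elim a b) (ξ := w * S (Sum.inl 1)) ?_ ?_ ?_
    · intro v
      rcases v with (v | v) | v
      · fin_cases v <;> simp [ha, hw1, hSφ, genericCoord, genPoint]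
      · simp [ha, hw1, hSφ, genericCoord, genPoint]
      · exact hb v
    · simp [hw1, hSφ, genericCoord, genPoint]
    · rw [map_niceCubic, aeval_update_eq_zero ht₂, map_genPoint, update_genPoint]
      simpa using haF)
  refine ⟨_, hodd, L, inferInstance, inferInstance, fun i => j (genericCoord f i),
    Fin.cons 1 (Fin.cons z (fun i => j (genericVar f (Sum.inr i)))), Pi.single (Sum.inl 2) 1, hL,
    ?_, rfl, ?_, ?_, ?_⟩
  · rw [Finset.sum_eq_single (Sum.inl 2)]
    · simp [genericCoord, genPoint]
    · intro i _ hi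
      simp [hi]
    · simp
  · rw [aeval_fun_algHom, aeval_genericCoord hf ht₂, map_zero]
  · intro e G hG h x y hx
    let v : (Fin 3 ⊕ ρ) ⊕ Fin (κ + 1) → L := Sum.elim (fun v => j (genericVar f (Sum.inl v)))
      (Fin.cons z (fun i => j (genericVar f (Sum.inr i))))
    have hv : AlgebraicIndependent ℂ v := by
      have h1 := (hind _ _ (algebraicIndependent_genericVar f)).comp
        (Sum.elim (fun v => Sum.inr (Sum.inl v))
          (Fin.cons (Sum.inl ()) (fun i => Sum.inr (Sum.inr i))) :
          (Fin 3 ⊕ ρ) ⊕ Fin (κ + 1) → Unit ⊕ ((Fin 3 ⊕ ρ) ⊕ Fin κ)) (by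
        rintro (a | a) (b | b)
        · simp
        · induction b using Fin.cases <;> simp
        · induction a using Fin.cases <;> simp
        · induction a using Fin.cases <;> induction b using Fin.cases <;> simp)
      convert! h1 using 1
      funext w
      rcases w with w | w
      · rfl
      · refine Fin.cases ?_ (fun w => ?_) w <;> simp [v]
    refine eval_eq_zero_of_genPoint ht₂ ht₃ hh₁ hh₀ hv (ξ := j (AdjoinRoot.root f)) ?_ hG ?_ x y hx
    · have h1 := congrArg j (aeval_genericCoord hf ht₂)
      rw [← aeval_fun_algHom, map_zero] at h1
      rw [← h1, genericCoord, map_genPoint]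
      rfl
    · rw [← h, genericCoord, map_genPoint]
      rfl
  -- The coordinates of the point generate the field generated by `E` and `z`.
  · rw [le_antisymm (IntermediateField.adjoin_le_iff.2 ?_) (IntermediateField.adjoin_le_iff.2 ?_)]
    · rintro y (⟨i, rfl⟩ | ⟨i, rfl⟩)
      · exact subset_adjoin ℂ _ (Set.mem_insert_of_mem _ ⟨_, rfl⟩)
      · induction i using Fin.cases with
        | zero => exact one_mem _
        | succ i =>
          induction i using Fin.cases with
          | zero => exact subset_adjoin ℂ _ (Set.mem_insert _ _)
          | succ i => exact subset_adjoin ℂ _ (Set.mem_insert_of_mem _ ⟨_, rfl⟩)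
    · have hα := fun i => subset_adjoin ℂ ((Set.range fun i => j (genericCoord f i)) ∪
        Set.range (Fin.cons 1 (Fin.cons z fun i => j (genericVar f (Sum.inr i))) :
          Fin (κ + 2) → L)) (Or.inl ⟨i, rfl⟩)
      have hβ := fun i => subset_adjoin ℂ ((Set.range fun i => j (genericCoord f i)) ∪
        Set.range (Fin.cons 1 (Fin.cons z fun i => j (genericVar f (Sum.inr i))) :
          Fin (κ + 2) → L)) (Or.inr ⟨i, rfl⟩)
      rintro y (rfl | ⟨e, rfl⟩)
      · exact hβ 1
      · refine mem_of_genericVar_mem f j ?_ (hα (Sum.inl 1)) e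
        rintro ((v | v) | v)
        · fin_cases v
          · exact hα (Sum.inl 0)
          · exact hα (Sum.inl 3)
          · exact hα (Sum.inl 4)
        · exact hα (Sum.inr v)
        · exact hβ v.succ.succ

/-- An odd parametrization exists if every generic point of the hypersurface lifts, over an
extension of odd degree, to local rings. The condition is stated for all fields `E` in order to be
independent of the construction of the function field. -/
theorem exists_odd_hasGenericParametrization [Fintype ρ] (ht₂ : t₂ ≠ 0) (ht₃ : t₃ ≠ 0)
    (hh₁ : h₁.IsHomogeneous 2) (hh₀ : h₀.IsHomogeneous 3) (κ : ℕ)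
    (hlift : ∀ (E : Type) [Field E] [Algebra ℂ E] (v : (Fin 3 ⊕ ρ) ⊕ Fin κ → E) (ξ : E),
      AlgebraicIndependent ℂ v →
      aeval (genPoint (fun i => v (Sum.inl i)) ξ) (niceForm t₁ t₂ t₃ t₆ s h₁ h₀) = 0 →
      ∃ (K : Type) (_ : Field K) (_ : Algebra E K) (_ : Algebra ℂ K) (_ : IsScalarTower ℂ E K),
        FiniteDimensional E K ∧ Odd (finrank E K) ∧
        ∀ (O : Type) [CommRing O] [IsDomain O] [IsIntegrallyClosed O] [Algebra ℂ O]
          (φ : O →ₐ[ℂ] K) (τ : O), IsLocalSurj φ → τ ≠ 0 → φ τ = 0 →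
          Liftable φ (niceForm t₁ t₂ t₃ t₆ s h₁ h₀)
            (fun i => algebraMap E K (genPoint (fun i => v (Sum.inl i)) ξ i))) :
    ∃ d, Odd d ∧ HasGenericParametrization (3 + Fintype.card ρ + κ + 1) (κ + 1)
      (niceForm t₁ t₂ t₃ t₆ s h₁ h₀) d := by
  obtain ⟨f, hf⟩ : ∃ f, f = genericCubic t₁ t₂ t₃ t₆ s h₁ h₀ κ := ⟨_, rfl⟩
  have hirr : Fact (Irreducible f) := ⟨hf ▸ irreducible_map_niceCubic ht₂ ht₃ hh₀⟩
  have hv := algebraicIndependent_genericVar f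
  have hξ := aeval_genericCoord hf ht₂
  have h1 := hlift (AdjoinRoot f) (genericVar f) (AdjoinRoot.root f)
  have h2 := h1 hv
  have h3 := h2 hξ
  obtain ⟨K, _, _, _, _, hfin, hodd, hK⟩ := h3
  exact hasGenericParametrization_of_liftable hf ht₂ ht₃ hh₁ hh₀ hodd hK

end OddParametrization

/-! ### Parametrizations of odd degree of separated forms -/

section CubeExtension

open Module IntermediateField

/-- A cubic equation acquires a root in a further extension of odd degree. -/
theorem exists_odd_extension_root {E Ω : Type} [Field E] [Field Ω] [Algebra E Ω] [IsAlgClosed Ω]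
    (K : IntermediateField E Ω) [FiniteDimensional E K] (hK : Odd (finrank E K)) {a b : Ω}
    (ha : a ∈ K) (hb : b ∈ K) :
    ∃ K' : IntermediateField E Ω, FiniteDimensional E K' ∧ Odd (finrank E K') ∧ K ≤ K' ∧
      ∃ x ∈ K', x ^ 3 + a * x + b = 0 := by
  by_cases h : ∃ x ∈ K, x ^ 3 + a * x + b = 0
  · exact ⟨K, inferInstance, hK, le_rfl, h⟩
  obtain ⟨p, hp⟩ : ∃ p : Polynomial K, p = Polynomial.X ^ 3 + Polynomial.C ⟨a, ha⟩ * Polynomial.X +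
    Polynomial.C ⟨b, hb⟩ := ⟨_, rfl⟩
  have hm : p.Monic := by rw [hp]; monicity!
  have hd : p.natDegree = 3 := by rw [hp]; compute_degree!
  have hirr : Irreducible p := by
    rw [hm.irreducible_iff_roots_eq_zero_of_degree_le_three (by rw [hd]; norm_num) (by rw [hd])]
    refine Multiset.eq_zero_of_forall_notMem fun x hx => h ⟨x, x.2, ?_⟩
    have h1 : p.eval x = 0 := Polynomial.isRoot_of_mem_roots hx
    rw [hp] at h1
    simpa using congrArg (algebraMap K Ω) h1
  obtain ⟨x, hx⟩ := IsAlgClosed.exists_aeval_eq_zero Ω p (by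
    rw [Polynomial.degree_eq_natDegree hm.ne_zero, hd]; norm_num)
  have hint : IsIntegral K x := ⟨p, hm, hx⟩
  have hfr : finrank K K⟮x⟯ = 3 := by
    rw [adjoin.finrank hint, ← minpoly.eq_of_irreducible_of_monic hirr hx hm, hd]
  have hfin : FiniteDimensional K K⟮x⟯ := adjoin.finiteDimensional hint
  have hfree : Module.Free K K⟮x⟯ := Module.Free.of_divisionRing K K⟮x⟯
  have hfree' : Module.Free E K := Module.Free.of_divisionRing E K
  have hmul : finrank E K * finrank K K⟮x⟯ = finrank E (K⟮x⟯.restrictScalars E) :=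
    finrank_mul_finrank E K K⟮x⟯
  have hfin' : FiniteDimensional E (K⟮x⟯.restrictScalars E) := FiniteDimensional.trans E K K⟮x⟯
  refine ⟨K⟮x⟯.restrictScalars E, hfin', ?_, fun y hy => K⟮x⟯.algebraMap_mem ⟨y, hy⟩, x,
    mem_adjoin_simple_self K x, ?_⟩
  · rw [← hmul, hfr]
    exact hK.mul (by decide)
  · rw [hp] at hx
    simpa using hx

variable {ρ : Type} {t₁ t₂ t₃ t₆ s : ℂ} {h₁ h₀ : MvPolynomial (Option ρ) ℂ} {κ : ℕ}

theorem aeval_ne_zero_of_eval_ne_zero {V E : Type} [Field E] [Algebra ℂ E] {v : V → E}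
    (hv : AlgebraicIndependent ℂ v) {p : MvPolynomial V ℂ} (x : V → ℂ) (h : eval x p ≠ 0) :
    aeval v p ≠ 0 := by
  intro h1
  rw [← map_zero (aeval (R := ℂ) v)] at h1
  rw [hv h1, map_zero] at h
  exact h rfl

/-- The variables of `h₁` and `h₀` among the affine coordinates. -/
def affineTail : Option ρ → (Fin 3 ⊕ ρ) ⊕ Fin κ :=
  fun o => o.elim (Sum.inl (Sum.inl 2)) (fun i => Sum.inl (Sum.inr i))

theorem aeval_genPoint_tailIndex {E : Type} [Field E] [Algebra ℂ E]
    (v : (Fin 3 ⊕ ρ) ⊕ Fin κ → E) (ξ : E) (h : MvPolynomial (Option ρ) ℂ) :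
    aeval (fun o => genPoint (fun i => v (Sum.inl i)) ξ (tailIndex o)) h =
      aeval v (rename affineTail h) := by
  rw [aeval_rename]
  congr 2
  funext o
  cases o <;> rfl

variable [DecidableEq ρ]

/-- An expression of degree at most two in the coordinate `x₂` of a generic point is nonzero as soon
as one of its coefficients is nonzero at one point `x`. -/
theorem genPoint_add_ne_zero {E : Type} [Field E] [Algebra ℂ E] {v : (Fin 3 ⊕ ρ) ⊕ Fin κ → E}
    (hv : AlgebraicIndependent ℂ v) {ξ : E}
    (hξ : aeval (genPoint (fun i => v (Sum.inl i)) ξ) (niceForm t₁ t₂ t₃ t₆ s h₁ h₀) = 0)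
    (ht₂ : t₂ ≠ 0) (ht₃ : t₃ ≠ 0) (hh₀ : h₀.IsHomogeneous 3)
    (c : Fin 3 → MvPolynomial ((Fin 3 ⊕ ρ) ⊕ Fin κ) ℂ) (i : Fin 3)
    (x : (Fin 3 ⊕ ρ) ⊕ Fin κ → ℂ) (hx : eval x (c i) ≠ 0) :
    aeval v (c 0) + aeval v (c 1) * ξ + aeval v (c 2) * ξ ^ 2 ≠ 0 := by
  intro h
  have h1 := coeff_eq_zero_of_genPoint ht₂ ht₃ hh₀ hv hξ h
  rw [h1] at hx
  simp at hx

/-- Over an extension of odd degree which contains a cube root of `H(z)`, the generic point of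
`g(x₁, x₂, x₃) + H(z) = 0` lifts to local rings. -/
theorem exists_odd_extension_liftable [Fintype ρ] {E : Type} [Field E] [Algebra ℂ E]
    {v : (Fin 3 ⊕ ρ) ⊕ Fin κ → E} (hv : AlgebraicIndependent ℂ v) {ξ : E}
    (hξ : aeval (genPoint (fun i => v (Sum.inl i)) ξ) (niceForm t₁ t₂ t₃ t₆ 0 h₁ h₀) = 0)
    (ht₂ : t₂ ≠ 0) (ht₃ : t₃ ≠ 0) (hh₁ : h₁.IsHomogeneous 2) (hh₀ : h₀.IsHomogeneous 3) :
    ∃ K : IntermediateField E (AlgebraicClosure E), FiniteDimensional E K ∧ Odd (finrank E K) ∧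
      ∀ (O : Type) [CommRing O] [Algebra ℂ O] (φ : O →ₐ[ℂ] K), IsLocalSurj φ →
        Liftable φ (niceForm t₁ t₂ t₃ t₆ 0 h₁ h₀)
          (fun i => algebraMap E K (genPoint (fun i => v (Sum.inl i)) ξ i)) := by
  obtain ⟨P, hP⟩ : ∃ P, P = genPoint (fun i => v (Sum.inl i)) ξ := ⟨_, rfl⟩
  have hP0 : P (Sum.inl 0) = v (Sum.inl (Sum.inl 0)) := by rw [hP]; rfl
  have hP2 : P (Sum.inl 2) = 1 := by rw [hP]; rfl
  have hP3 : P (Sum.inl 3) = v (Sum.inl (Sum.inl 1)) := by rw [hP]; rfl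
  have hP4 : P (Sum.inl 4) = v (Sum.inl (Sum.inl 2)) := by rw [hP]; rfl
  have hP1 : P (Sum.inl 1) = ξ := by rw [hP]; rfl
  have htail : ∀ h : MvPolynomial (Option ρ) ℂ, aeval (fun o => P (tailIndex o)) h =
      aeval v (rename affineTail h) := by
    rw [hP]; exact aeval_genPoint_tailIndex v ξ
  -- evaluation at `l = 1`, `r = c` and zero for the other variables
  have hev : ∀ (c : ℂ) (h : MvPolynomial (Option ρ) ℂ),
      eval (Sum.elim (Sum.elim ![0, c, 1] 0) 0 : (Fin 3 ⊕ ρ) ⊕ Fin κ → ℂ) (rename affineTail h) =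
        eval (fun o => o.elim 1 0) h := by
    intro c h
    rw [eval_rename]
    congr 2
    funext o
    cases o <;> simp [affineTail]
  have hH : P (Sum.inl 4) * P (Sum.inl 3) ^ 2 + P (Sum.inl 3) *
      aeval (fun o => P (tailIndex o)) h₁ + aeval (fun o => P (tailIndex o)) h₀ ≠ 0 := by
    have h1 : ∃ c : ℂ, c ^ 2 + c * eval (fun o => o.elim 1 0) h₁ +
        eval (fun o => o.elim 1 0) h₀ ≠ 0 := by
      by_contra! h
      have h2 := h 0
      have h3 := h 1
      have h4 := h (-1)
      have h5 : (2 : ℂ) = 0 := by linear_combination h3 + h4 - 2 * h2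
      norm_num at h5
    obtain ⟨c, hc⟩ := h1
    have h2 := aeval_ne_zero_of_eval_ne_zero hv (p := X (Sum.inl (Sum.inl 2)) *
      X (Sum.inl (Sum.inl 1)) ^ 2 + X (Sum.inl (Sum.inl 1)) * rename affineTail h₁ +
      rename affineTail h₀) (Sum.elim (Sum.elim ![0, c, 1] 0) 0) (by
        rw [map_add, map_add, map_mul, map_mul, hev, hev]
        simpa using hc)
    rw [map_add, map_add, map_mul, map_mul, map_pow, aeval_X, aeval_X] at h2
    rwa [htail, htail, hP3, hP4]
  have hr : 2 * P (Sum.inl 4) * P (Sum.inl 3) + aeval (fun o => P (tailIndex o)) h₁ ≠ 0 := by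
    have h1 : ∃ c : ℂ, 2 * c + eval (fun o => o.elim 1 0) h₁ ≠ 0 := by
      by_contra! h
      have h2 := h 0
      have h3 := h 1
      have h5 : (2 : ℂ) = 0 := by linear_combination h3 - h2
      norm_num at h5
    obtain ⟨c, hc⟩ := h1
    have h2 := aeval_ne_zero_of_eval_ne_zero hv (p := 2 * X (Sum.inl (Sum.inl 2)) *
      X (Sum.inl (Sum.inl 1)) + rename affineTail h₁) (Sum.elim (Sum.elim ![0, c, 1] 0) 0) (by
        rw [map_add, map_mul, map_mul, hev]
        simpa using hc)
    rw [map_add, map_mul, map_mul, map_ofNat, aeval_X, aeval_X] at h2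
    rwa [htail, hP3, hP4]
  have h0 : P (Sum.inl 0) ≠ 0 := by
    have h2 := aeval_ne_zero_of_eval_ne_zero hv (p := X (Sum.inl (Sum.inl 0))) 1 (by simp)
    rwa [aeval_X, ← hP0] at h2
  have h4 : P (Sum.inl 4) ≠ 0 := by
    have h2 := aeval_ne_zero_of_eval_ne_zero hv (p := X (Sum.inl (Sum.inl 2))) 1 (by simp)
    rwa [aeval_X, ← hP4] at h2
  have hG : algebraMap ℂ E t₁ * P (Sum.inl 0) + algebraMap ℂ E t₃ * P (Sum.inl 2) +
      algebraMap ℂ E t₆ * P (Sum.inl 1) ≠ 0 := by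
    have h2 := genPoint_add_ne_zero hv hξ ht₂ ht₃ hh₀
      ![C t₁ * X (Sum.inl (Sum.inl 0)) + C t₃, C t₆, 0] 0 0 (by simpa using ht₃)
    rw [hP0, hP1, hP2, mul_one]
    simpa [MvPolynomial.aeval_C] using h2
  have hab : (algebraMap ℂ E t₁ * P (Sum.inl 0)) ^ 3 ≠ (algebraMap ℂ E t₃ * P (Sum.inl 2)) ^ 3 := by
    have h2 := aeval_ne_zero_of_eval_ne_zero hv
      (p := (C t₁ * X (Sum.inl (Sum.inl 0))) ^ 3 - C t₃ ^ 3) 0 (by simpa using ht₃)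
    rw [hP0, hP2, mul_one, ← sub_ne_zero]
    simpa [MvPolynomial.aeval_C] using h2
  rw [← hP] at hξ ⊢
  obtain ⟨b, hb⟩ : ∃ b, b = P (Sum.inl 4) * P (Sum.inl 3) ^ 2 + P (Sum.inl 3) *
      aeval (fun o => P (tailIndex o)) h₁ + aeval (fun o => P (tailIndex o)) h₀ := ⟨_, rfl⟩
  -- The field `K` contains a cube root of `b = H(z)`.
  obtain ⟨K, hKfin, hKodd, -, σ, hσK, hσ⟩ := exists_odd_extension_root
    (⊥ : IntermediateField E (AlgebraicClosure E)) (by rw [IntermediateField.finrank_bot]; decide)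
    (zero_mem _) ((⊥ : IntermediateField E (AlgebraicClosure E)).algebraMap_mem (-b))
  have hσ' : (⟨σ, hσK⟩ : K) ^ 3 = algebraMap E K b := by
    apply Subtype.ext
    rw [map_neg, zero_mul, add_zero] at hσ
    exact add_neg_eq_zero.1 hσ
  have halg : ∀ c, algebraMap ℂ K c = algebraMap E K (algebraMap ℂ E c) :=
    IsScalarTower.algebraMap_apply ℂ E K
  have hmap : ∀ h : MvPolynomial (Option ρ) ℂ, aeval (fun o => algebraMap E K (P (tailIndex o))) h =
      algebraMap E K (aeval (fun o => P (tailIndex o)) h) := fun h =>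
    aeval_fun_algebraMap _ h
  refine ⟨K, hKfin, hKodd, fun O _ _ φ hφ => liftable_niceForm_of_cube hφ hh₁ hh₀ ht₂ ht₃
    (σ := ⟨σ, hσK⟩) ?_ ?_ ?_ ?_ ?_ ?_ ?_ ?_ ?_⟩
  · rw [aeval_fun_algebraMap, hξ, map_zero]
  · rw [hσ', hmap, hmap, hb]
    simp only [map_add, map_mul, map_pow]
  · intro h
    rw [h, zero_pow three_ne_zero, eq_comm, map_eq_zero, hb] at hσ'
    exact hH hσ'
  · rwa [Ne, map_eq_zero]
  · rw [hP2, map_one]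
    exact one_ne_zero
  · rwa [Ne, map_eq_zero]
  · rw [hmap, ← map_ofNat (algebraMap E K), ← map_mul, ← map_mul, ← map_add, Ne, map_eq_zero]
    exact hr
  · rw [halg, halg, halg, ← map_mul, ← map_mul, ← map_mul, ← map_add, ← map_add, Ne, map_eq_zero]
    exact hG
  · rw [halg, halg, ← map_mul, ← map_mul, ← map_pow, ← map_pow]
    exact fun h => hab ((algebraMap E K).injective h)

/-- The case `s = 0`, by lifting points with a cube root of `H(z)`. -/
theorem exists_odd_hasGenericParametrization_niceForm [Fintype ρ] (ht₂ : t₂ ≠ 0) (ht₃ : t₃ ≠ 0)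
    (hh₁ : h₁.IsHomogeneous 2) (hh₀ : h₀.IsHomogeneous 3) (κ : ℕ) :
    ∃ d, Odd d ∧ HasGenericParametrization (3 + Fintype.card ρ + κ + 1) (κ + 1)
      (niceForm t₁ t₂ t₃ t₆ 0 h₁ h₀) d := by
  refine exists_odd_hasGenericParametrization ht₂ ht₃ hh₁ hh₀ κ fun E _ _ v ξ hv hξ => ?_
  obtain ⟨K, hfin, hodd, hK⟩ := exists_odd_extension_liftable hv hξ ht₂ ht₃ hh₁ hh₀
  exact ⟨K, inferInstance, inferInstance, inferInstance, inferInstance, hfin, hodd,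
    fun O _ _ _ _ φ τ hφ _ _ => hK O φ hφ⟩

end CubeExtension

/-! ### Parametrizations of odd degree of the family of threefolds -/

section FamilyNormalForm

open Module IntermediateField

variable {t₁ t₂ t₃ t₄ t₅ t₆ t₇ w : ℂ}

/-- The member of the family of cubic threefolds, with the coordinates `r = x₅` and `l = t₅ x₄`. -/
abbrev familyNiceForm (t₁ t₂ t₃ t₄ t₅ t₆ t₇ : ℂ) : MvPolynomial (Fin 5 ⊕ Empty) ℂ :=
  niceForm t₁ t₂ t₃ t₆ (t₇ / t₅) (C (t₄ / t₅ ^ 2) * X none ^ 2) 0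

theorem aeval_familyNiceForm (ht₅ : t₅ ≠ 0) {A : Type*} [CommRing A] [Algebra ℂ A]
    (x : Fin 5 ⊕ Empty → A) (y : A) (hy : x (Sum.inl 4) = algebraMap ℂ A t₅ * y) :
    aeval x (familyNiceForm t₁ t₂ t₃ t₄ t₅ t₆ t₇) =
      x (Sum.inl 0) * x (Sum.inl 2) * (algebraMap ℂ A t₁ * x (Sum.inl 0) +
        algebraMap ℂ A t₃ * x (Sum.inl 2) + algebraMap ℂ A t₆ * x (Sum.inl 1)) +
      algebraMap ℂ A t₂ * x (Sum.inl 1) ^ 3 + y * x (Sum.inl 3) * (algebraMap ℂ A t₄ * y +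
        algebraMap ℂ A t₅ * x (Sum.inl 3) + algebraMap ℂ A t₇ * x (Sum.inl 1)) := by
  have h1 : algebraMap ℂ A (t₇ / t₅) * algebraMap ℂ A t₅ = algebraMap ℂ A t₇ := by
    rw [← map_mul, div_mul_cancel₀ _ ht₅]
  have h2 : algebraMap ℂ A (t₄ / t₅ ^ 2) * algebraMap ℂ A t₅ ^ 2 = algebraMap ℂ A t₄ := by
    rw [← map_pow, ← map_mul, div_mul_cancel₀ _ (pow_ne_zero 2 ht₅)]
  rw [aeval_niceForm]
  simp only [tailIndex, map_mul, map_pow, aeval_X, aeval_C, map_zero, Option.elim_none, hy, add_zero]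
  linear_combination x (Sum.inl 1) * x (Sum.inl 3) * y * h1 + x (Sum.inl 3) * y ^ 2 * h2

/-- The plane cubic is in the pencil generated by the product of the three lines `e₂ - e₁ + u`,
`ω e₂ - ω² e₁ + u`, `ω² e₂ - ω e₁ + u` and by `u³`. -/
theorem aeval_familyNiceForm_eq_normForm (ht₁ : t₁ ≠ 0) (ht₃ : t₃ ≠ 0) (ht₅ : t₅ ≠ 0)
    (hw : w ^ 2 + w + 1 = 0) {A : Type*} [CommRing A] [Algebra ℂ A] (S : Fin 5 → A) :
    aeval (Sum.elim ![-(algebraMap ℂ A (t₆ / (3 * t₁)) * (S 1 - S 0 + S 2)), S 2,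
      -(algebraMap ℂ A (t₆ / (3 * t₃)) * (algebraMap ℂ A w * S 1 - algebraMap ℂ A w ^ 2 * S 0 + S 2)),
      S 4, algebraMap ℂ A t₅ * S 3] Empty.elim) (familyNiceForm t₁ t₂ t₃ t₄ t₅ t₆ t₇) =
    aeval S (normForm (t₆ ^ 3 / (27 * t₁ * t₃)) t₂ t₄ t₅ t₇) := by
  have h1 : algebraMap ℂ A t₁ * algebraMap ℂ A (t₆ / (3 * t₁)) = algebraMap ℂ A (t₆ / 3) := by
    rw [← map_mul]; congr 1; field_simp
  have h3 : algebraMap ℂ A t₃ * algebraMap ℂ A (t₆ / (3 * t₃)) = algebraMap ℂ A (t₆ / 3) := by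
    rw [← map_mul]; congr 1; field_simp
  have h6 : algebraMap ℂ A t₆ = 3 * algebraMap ℂ A (t₆ / 3) := by
    rw [← map_ofNat (algebraMap ℂ A), ← map_mul]; congr 1; ring
  have hk : algebraMap ℂ A (t₆ / (3 * t₁)) * algebraMap ℂ A (t₆ / (3 * t₃)) *
      algebraMap ℂ A (t₆ / 3) = algebraMap ℂ A (t₆ ^ 3 / (27 * t₁ * t₃)) := by
    rw [← map_mul, ← map_mul]; congr 1; field_simp; norm_num
  have hwA : algebraMap ℂ A w ^ 2 + algebraMap ℂ A w + 1 = 0 := by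
    rw [← map_pow, ← map_add, ← map_one (algebraMap ℂ A), ← map_add, hw, map_zero]
  rw [aeval_familyNiceForm ht₅ _ (S 3) rfl, aeval_normForm, h6, ← hk]
  simp
  obtain ⟨W, hW⟩ : ∃ W, W = algebraMap ℂ A w := ⟨_, rfl⟩
  obtain ⟨a, ha⟩ : ∃ a, a = algebraMap ℂ A (t₆ / (3 * t₁)) := ⟨_, rfl⟩
  obtain ⟨b, hb⟩ : ∃ a, a = algebraMap ℂ A (t₆ / (3 * t₃)) := ⟨_, rfl⟩
  obtain ⟨c, hc⟩ : ∃ a, a = algebraMap ℂ A (t₆ / 3) := ⟨_, rfl⟩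
  rw [← ha, ← hc] at h1
  rw [← hb, ← hc] at h3
  rw [← hW] at hwA
  rw [← hW, ← ha, ← hb, ← hc]
  linear_combination -(a * b * (S 1 - S 0 + S 2) ^ 2 * (W * S 1 - W ^ 2 * S 0 + S 2)) * h1 -
    a * b * (S 1 - S 0 + S 2) * (W * S 1 - W ^ 2 * S 0 + S 2) ^ 2 * h3 +
    a * b * c * (S 1 - S 0 + S 2) * ((W - 1) * (S 0 ^ 2 + S 1 ^ 2) - S 0 * S 1 -
      S 0 * S 1 * W * (W - 1) + S 1 * S 2 - S 0 * S 2 -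
      (W * S 1 - W ^ 2 * S 0 + S 2) * (S 1 - S 0)) * hwA

theorem isHomogeneous_familyNiceForm : (familyNiceForm t₁ t₂ t₃ t₄ t₅ t₆ t₇).IsHomogeneous 3 := by
  refine isHomogeneous_niceForm ?_ (isHomogeneous_zero _ _ _)
  simpa using (isHomogeneous_C (Option Empty) (t₄ / t₅ ^ 2)).mul ((isHomogeneous_X ℂ none).pow 2)

/-- Over an extension of odd degree the generic point of the cubic threefold lifts to local
rings. -/
theorem exists_odd_extension_liftable_family {κ : ℕ} {E : Type} [Field E] [Algebra ℂ E]
    {v : (Fin 3 ⊕ Empty) ⊕ Fin κ → E} (hv : AlgebraicIndependent ℂ v) {ξ : E}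
    (hξ : aeval (genPoint (fun i => v (Sum.inl i)) ξ) (familyNiceForm t₁ t₂ t₃ t₄ t₅ t₆ t₇) = 0)
    (ht₁ : t₁ ≠ 0) (ht₂ : t₂ ≠ 0) (ht₃ : t₃ ≠ 0) (ht₅ : t₅ ≠ 0) (ht₆ : t₆ ≠ 0)
    (hsm : 27 * t₁ * t₂ * t₃ + t₆ ^ 3 ≠ 0) :
    ∃ K : IntermediateField E (AlgebraicClosure E), FiniteDimensional E K ∧ Odd (finrank E K) ∧
      ∀ (O : Type) [CommRing O] [IsDomain O] [IsIntegrallyClosed O] [Algebra ℂ O] (φ : O →ₐ[ℂ] K)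
        (τ : O), IsLocalSurj φ → τ ≠ 0 → φ τ = 0 →
        Liftable φ (familyNiceForm t₁ t₂ t₃ t₄ t₅ t₆ t₇)
          (fun i => algebraMap E K (genPoint (fun i => v (Sum.inl i)) ξ i)) := by
  have hcz : CharZero E := charZero_of_injective_algebraMap (algebraMap ℂ E).injective
  obtain ⟨w, hw, hww⟩ := exists_primitive_cubeRoot
  have hw0 : w ≠ 0 := by rintro rfl; norm_num at hw
  obtain ⟨A, hA⟩ : ∃ A, A = 3 * t₁ / t₆ := ⟨_, rfl⟩
  obtain ⟨B, hB⟩ : ∃ B, B = 3 * t₃ / t₆ := ⟨_, rfl⟩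
  have hA0 : A ≠ 0 := by rw [hA]; exact div_ne_zero (mul_ne_zero three_ne_zero ht₁) ht₆
  have hB0 : B ≠ 0 := by rw [hB]; exact div_ne_zero (mul_ne_zero three_ne_zero ht₃) ht₆
  obtain ⟨a, ha⟩ : ∃ a : E, a = v (Sum.inl (Sum.inl 0)) := ⟨_, rfl⟩
  obtain ⟨r, hr⟩ : ∃ a : E, a = v (Sum.inl (Sum.inl 1)) := ⟨_, rfl⟩
  obtain ⟨l, hl⟩ : ∃ a : E, a = v (Sum.inl (Sum.inl 2)) := ⟨_, rfl⟩
  let I : ℂ → E := algebraMap ℂ E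
  have hne := genPoint_add_ne_zero hv hξ ht₂ ht₃ (isHomogeneous_zero _ _ _)
  have hcons : ∀ x y z : MvPolynomial ((Fin 3 ⊕ Empty) ⊕ Fin κ) ℂ,
      ![x, y, z] 0 = x ∧ ![x, y, z] 1 = y ∧ ![x, y, z] 2 = z := fun x y z => ⟨rfl, rfl, rfl⟩
  have hξ0 : ξ ≠ 0 := by
    have := hne ![0, 1, 0] 1 0 (by simp)
    simpa using this
  -- `d₁` and `d₂` are the multiples by `w - w²` of the coordinates `e₁` and `e₂`
  obtain ⟨d₁, hd₁⟩ : ∃ d : E, d = -I B + I (w * A) * a + I (w - 1) * ξ := ⟨_, rfl⟩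
  obtain ⟨d₂, hd₂⟩ : ∃ d : E, d = -I B + I (w ^ 2 * A) * a + I (w ^ 2 - 1) * ξ := ⟨_, rfl⟩
  have hroot : ∀ c : ℂ, I ((w - w ^ 2) * c ^ 2) * ξ - d₁ * I c + d₂ ≠ 0 := by
    intro c
    have h1 : ∃ y : ℂ, B * (c - 1) + (w ^ 2 * A - w * A * c) * y ≠ 0 := by
      by_cases hc : c = 1
      · refine ⟨1, ?_⟩
        rw [hc]
        intro h
        refine mul_ne_zero hww hA0 ?_
        linear_combination -h
      · refine ⟨0, ?_⟩
        rw [mul_zero, add_zero]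
        exact mul_ne_zero hB0 (sub_ne_zero.2 hc)
    obtain ⟨y, hy⟩ := h1
    have h2 := hne ![C (B * (c - 1)) + C (w ^ 2 * A - w * A * c) * X (Sum.inl (Sum.inl 0)),
      C ((w - w ^ 2) * c ^ 2 - (w - 1) * c + (w ^ 2 - 1)), 0] 0 (fun _ => y) (by simpa using hy)
    intro h
    apply h2
    simp only [hcons, map_add, map_mul, map_sub, map_pow, aeval_C, aeval_X, map_one, map_zero,
      ← ha]
    simp only [hd₁, hd₂, I, map_mul, map_sub, map_pow, map_one] at h
    linear_combination h
  have hdisc : ∀ k : ℂ, d₁ ^ 2 ≠ I k * d₂ * ξ := by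
    intro k h
    apply hne ![(C (w * A) * X (Sum.inl (Sum.inl 0)) - C B) ^ 2,
      C (2 * (w - 1)) * (C (w * A) * X (Sum.inl (Sum.inl 0)) - C B) -
        C k * (C (w ^ 2 * A) * X (Sum.inl (Sum.inl 0)) - C B),
      C ((w - 1) ^ 2 - k * (w ^ 2 - 1))] 0 0 (by simpa using hB0)
    simp only [hcons, map_mul, map_sub, map_pow, aeval_C, aeval_X, map_one, map_ofNat, ← ha]
    simp only [hd₁, hd₂, I, map_mul, map_sub, map_pow, map_one] at h
    linear_combination h
  obtain ⟨g, hg⟩ : ∃ g : E, g = I (w - w ^ 2) * ξ := ⟨_, rfl⟩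
  have hIw : I (w - w ^ 2) ≠ 0 := by simpa only [I, Ne, map_eq_zero] using hww
  have hg0 : g ≠ 0 := by rw [hg]; exact mul_ne_zero hIw hξ0
  obtain ⟨e₁, he₁⟩ : ∃ e, e = d₁ / g := ⟨_, rfl⟩
  obtain ⟨e₂, he₂⟩ : ∃ e, e = d₂ / g := ⟨_, rfl⟩
  have hroot' : ∀ c : ℂ, I c ^ 2 - e₁ * I c + e₂ ≠ 0 := by
    intro c h
    apply hroot c
    rw [he₁, he₂] at h
    field_simp at h
    rw [hg] at h
    simp only [I, map_mul, map_pow] at h ⊢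
    linear_combination h
  have hd : e₁ ^ 2 ≠ 4 * e₂ := by
    intro h
    apply hdisc (4 * (w - w ^ 2))
    rw [he₁, he₂] at h
    field_simp at h
    rw [h, hg]
    simp only [I, map_mul, map_ofNat]
    ring
  have hd' : e₁ ^ 2 ≠ e₂ := by
    intro h
    apply hdisc (w - w ^ 2)
    rw [he₁, he₂] at h
    field_simp at h
    rw [h, hg]
    ring
  -- For the roots `τ` and `σ` of `T² - e₁ T + e₂`, this is `(τ³ - 1) (σ³ - 1)`, and `Q` below is
  -- `τ³ + σ³ - 2`.
  obtain ⟨M, hM⟩ : ∃ M, M = e₂ ^ 3 - (e₁ ^ 3 - 3 * e₁ * e₂) + 1 := ⟨_, rfl⟩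
  have hIw1 : I w ^ 2 + I w + 1 = 0 := by
    simp only [I]
    rw [← map_pow, ← map_add, ← map_one (algebraMap ℂ E), ← map_add, hw, map_zero]
  have hM0 : M ≠ 0 := by
    have h1 := hroot' 1
    have h2 := hroot' w
    have h3 := hroot' (w ^ 2)
    have h4 : M = (I 1 ^ 2 - e₁ * I 1 + e₂) * ((I w ^ 2 - e₁ * I w + e₂) *
        (I (w ^ 2) ^ 2 - e₁ * I (w ^ 2) + e₂)) := by
      have e1 : I 1 = 1 := map_one _
      have e2 : I (w ^ 2) = I w ^ 2 := map_pow _ _ _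
      obtain ⟨W, hW⟩ : ∃ W, W = I w := ⟨_, rfl⟩
      obtain ⟨U, hU⟩ : ∃ U, U = I w ^ 2 := ⟨_, rfl⟩
      have e3 : W + U = -1 := by rw [hW, hU]; linear_combination hIw1
      have e4 : W * U = 1 := by rw [hW, hU]; linear_combination (I w - 1) * hIw1
      have e5 : U ^ 2 = W := by linear_combination U * e3 - e4 - e3
      rw [hM, e1, e2, ← hU, ← hW, e5]
      linear_combination (1 - e₁ + e₂) * (e₁ * (W + U - 1) - e₂ + e₁ * e₂) * e3 -
        (1 - e₁ + e₂) * (1 + e₁ ^ 2 + 2 * e₁) * e4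
    rw [h4]
    exact mul_ne_zero h1 (mul_ne_zero h2 h3)
  obtain ⟨c, hc⟩ : ∃ c : ℂ, c = t₂ / (t₆ ^ 3 / (27 * t₁ * t₃)) := ⟨_, rfl⟩
  obtain ⟨Q, hQ⟩ : ∃ Q, Q = e₁ ^ 3 - 3 * e₁ * e₂ - 2 := ⟨_, rfl⟩
  -- With `z = 1 - c / (τ³ - 1)` and `z' = 1 - c / (σ³ - 1)`, the two cubic equations are
  -- `n³ = z z'` and the resolvent `s³ - 3 n s = z + z'`.
  obtain ⟨K₁, hfin₁, hodd₁, -, n, hn₁, hn⟩ := exists_odd_extension_root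
    (⊥ : IntermediateField E (AlgebraicClosure E)) (by rw [IntermediateField.finrank_bot]; decide)
    (zero_mem _) ((⊥ : IntermediateField E (AlgebraicClosure E)).algebraMap_mem
      (-(1 - (I c * Q - I c ^ 2) / M)))
  obtain ⟨K, hfin, hodd, hK, s, hs₁, hs⟩ := exists_odd_extension_root K₁ hodd₁
    (mul_mem (neg_mem (ofNat_mem K₁ 3)) hn₁) (K₁.algebraMap_mem (-(2 - I c * Q / M)))
  obtain ⟨Δ, hΔ⟩ := IsAlgClosed.exists_pow_nat_eq (1 + c) (n := 2) (by norm_num)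
  have hk₀ : t₆ ^ 3 / (27 * t₁ * t₃) ≠ 0 :=
    div_ne_zero (pow_ne_zero 3 ht₆) (mul_ne_zero (mul_ne_zero (by norm_num) ht₁) ht₃)
  have hkc : t₆ ^ 3 / (27 * t₁ * t₃) * c = t₂ := by rw [hc]; exact mul_div_cancel₀ _ hk₀
  have hΔ0 : Δ ≠ 0 := by
    rintro rfl
    apply hsm
    rw [hc] at hΔ
    field_simp at hΔ
    linear_combination -hΔ
  obtain ⟨p, hp⟩ : ∃ p, p = I t₅⁻¹ * l / ξ := ⟨_, rfl⟩
  obtain ⟨q, hq⟩ : ∃ q, q = r / ξ := ⟨_, rfl⟩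
  have hIt₅ : I t₅ * I t₅⁻¹ = 1 := by
    simp only [I]; rw [← map_mul, mul_inv_cancel₀ ht₅, map_one]
  have hIt₅' : I t₅⁻¹ ≠ 0 := right_ne_zero_of_mul_eq_one hIt₅
  have hp0 : p ≠ 0 := by
    have h1 := aeval_ne_zero_of_eval_ne_zero hv (p := X (Sum.inl (Sum.inl 2))) 1 (by simp)
    rw [aeval_X, ← hl] at h1
    rw [hp]
    exact div_ne_zero (mul_ne_zero hIt₅' h1) hξ0
  have hq0 : q ≠ 0 := by
    have h1 := aeval_ne_zero_of_eval_ne_zero hv (p := X (Sum.inl (Sum.inl 1))) 1 (by simp)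
    rw [aeval_X, ← hr] at h1
    rw [hq]
    exact div_ne_zero h1 hξ0
  have hG : I t₄ * p + I t₅ * q + I t₇ ≠ 0 := by
    intro h
    apply hne ![C (t₄ * t₅⁻¹) * X (Sum.inl (Sum.inl 2)) + C t₅ * X (Sum.inl (Sum.inl 1)),
      C t₇, 0] 0 (Sum.elim (Sum.elim ![0, 1, 0] 0) 0) (by simpa using ht₅)
    simp only [hcons, map_add, map_mul, aeval_C, aeval_X, map_zero, ← hl, ← hr]
    rw [hp, hq] at h
    simp only [I] at h
    generalize algebraMap ℂ E t₅⁻¹ = z at h ⊢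
    field_simp at h
    linear_combination h
  have hab : (I t₄ * p) ^ 3 ≠ (I t₅ * q) ^ 3 := by
    intro h
    apply aeval_ne_zero_of_eval_ne_zero hv (p := (C (t₄ * t₅⁻¹) * X (Sum.inl (Sum.inl 2))) ^ 3 -
      (C t₅ * X (Sum.inl (Sum.inl 1))) ^ 3) (Sum.elim (Sum.elim ![0, 1, 0] 0) 0)
      (by simpa using ht₅)
    simp only [map_sub, map_mul, map_pow, aeval_C, aeval_X, ← hl, ← hr]
    rw [hp, hq] at h
    simp only [I] at h
    generalize algebraMap ℂ E t₅⁻¹ = z at h ⊢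
    field_simp at h
    linear_combination h
  have hx₁ : -(I (t₆ / (3 * t₁)) * (e₂ - e₁ + 1)) = ξ⁻¹ * a := by
    have h1 : I (t₆ / (3 * t₁)) * I A = 1 := by
      simp only [I]
      rw [← map_mul, hA, ← map_one (algebraMap ℂ E)]
      congr 1
      field_simp
    have h2 : d₂ - d₁ + g = -(I (w - w ^ 2) * I A * a) := by
      simp only [hd₁, hd₂, hg, I, map_mul, map_sub, map_pow, map_one]
      ring
    have h3 : e₂ - e₁ + 1 = (d₂ - d₁ + g) / g := by rw [he₁, he₂]; field_simp
    rw [h3, h2, hg]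
    generalize I (w - w ^ 2) = z at hIw ⊢
    field_simp
    linear_combination a * h1
  have hx₃ : -(I (t₆ / (3 * t₃)) * (I w * e₂ - I w ^ 2 * e₁ + 1)) = ξ⁻¹ := by
    have h1 : I (t₆ / (3 * t₃)) * I B = 1 := by
      simp only [I]
      rw [← map_mul, hB, ← map_one (algebraMap ℂ E)]
      congr 1
      field_simp
    have h2 : I w * d₂ - I w ^ 2 * d₁ + g = -(I (w - w ^ 2) * I B) := by
      simp only [hd₁, hd₂, hg, I, map_mul, map_sub, map_pow, map_one]
      ring
    have h3 : I w * e₂ - I w ^ 2 * e₁ + 1 = (I w * d₂ - I w ^ 2 * d₁ + g) / g := by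
      rw [he₁, he₂]; field_simp
    rw [h3, h2, hg]
    generalize I (w - w ^ 2) = z at hIw ⊢
    field_simp
    linear_combination h1
  -- The generic point, scaled to have `x₂ = 1`, in the coordinates of the norm form.
  have hT : (Sum.elim ![-(I (t₆ / (3 * t₁)) * (e₂ - e₁ + 1)), 1,
      -(I (t₆ / (3 * t₃)) * (I w * e₂ - I w ^ 2 * e₁ + 1)), q, I t₅ * p] Empty.elim) =
      fun i => ξ⁻¹ * genPoint (fun i => v (Sum.inl i)) ξ i := by
    rw [hx₁, hx₃]
    funext i
    rcases i with i | i
    · fin_cases i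
      · simp [genPoint, ha]
      · simp [genPoint, hξ0]
      · simp [genPoint]
      · simp [genPoint, hq, hr]
        ring
      · simp only [genPoint, hp, hl, Sum.elim_inl]
        simp
        linear_combination (v (Sum.inl (Sum.inl 2)) * ξ⁻¹) * hIt₅
    · exact i.elim
  have hF : aeval ![e₁, e₂, 1, p, q] (normForm (t₆ ^ 3 / (27 * t₁ * t₃)) t₂ t₄ t₅ t₇) = 0 := by
    rw [← aeval_familyNiceForm_eq_normForm ht₁ ht₃ ht₅ hw]
    refine Eq.trans (congrArg (fun x => aeval x _) hT) ?_
    rw [IsHomogeneous.aeval_const_mul isHomogeneous_familyNiceForm, hξ, mul_zero]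
  have halg : ∀ c, algebraMap ℂ K c = algebraMap E K (I c) := IsScalarTower.algebraMap_apply ℂ E K
  have hn' : (⟨n, hK hn₁⟩ : K) ^ 3 = algebraMap E K (1 - (I c * Q - I c ^ 2) / M) := by
    apply Subtype.ext
    rw [map_neg, zero_mul, add_zero] at hn
    exact add_neg_eq_zero.1 hn
  have hs' : (⟨s, hs₁⟩ : K) ^ 3 - 3 * ⟨n, hK hn₁⟩ * ⟨s, hs₁⟩ = algebraMap E K (2 - I c * Q / M) := by
    apply Subtype.ext
    rw [map_neg] at hs
    refine Eq.trans ?_ (add_neg_eq_zero.1 hs)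
    have h3 : ((3 : K) : AlgebraicClosure E) = 3 := map_ofNat (algebraMap K (AlgebraicClosure E)) 3
    push_cast
    rw [h3]
    ring
  have hJQ : algebraMap E K e₁ ^ 3 - 3 * algebraMap E K e₁ * algebraMap E K e₂ - 2 =
      algebraMap E K Q := by
    rw [hQ]; simp only [map_mul, map_sub, map_pow, map_ofNat]
  have hJM : algebraMap E K e₂ ^ 3 - (algebraMap E K e₁ ^ 3 -
      3 * algebraMap E K e₁ * algebraMap E K e₂) + 1 = algebraMap E K M := by
    rw [hM]; simp only [map_mul, map_add, map_sub, map_pow, map_one, map_ofNat]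
  refine ⟨K, hfin, hodd, fun O _ _ _ _ φ τ hφ hτ hφτ => ?_⟩
  obtain ⟨S, hS, hSφ⟩ := liftable_normForm hφ hτ hφτ hΔ0 ht₂ ht₅ hk₀ (e₁ := algebraMap E K e₁)
    (e₂ := algebraMap E K e₂) (p := algebraMap E K p) (q := algebraMap E K q) (t₄ := t₄) (t₇ := t₇)
    (n := ⟨n, hK hn₁⟩) (s := ⟨s, hs₁⟩)
    (by rw [hΔ]; linear_combination hkc)
    (by
      intro c
      rw [halg, ← map_pow, ← map_mul, ← map_sub, ← map_add, Ne, map_eq_zero]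
      exact hroot' c)
    (by
      rw [← map_pow, ← map_ofNat (algebraMap E K), ← map_mul]
      exact fun h => hd ((algebraMap E K).injective h))
    (by
      rw [← map_pow]
      exact fun h => hd' ((algebraMap E K).injective h))
    (by
      rw [hn', halg, ← hc]
      have h1 := congrArg (algebraMap E K) (show M * (1 - (I c * Q - I c ^ 2) / M) =
        M - I c * Q + I c ^ 2 by field_simp; ring)
      rw [hJM, hJQ]
      simp only [map_mul, map_sub, map_add, map_pow, map_one] at h1 ⊢
      linear_combination h1)
    (by
      rw [hs', halg, ← hc]
      have h1 := congrArg (algebraMap E K) (show M * (2 - I c * Q / M) = 2 * M - I c * Q by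
        field_simp)
      rw [hJM, hJQ]
      simp only [map_mul, map_sub, map_ofNat] at h1 ⊢
      linear_combination h1)
    (by rwa [Ne, map_eq_zero]) (by rwa [Ne, map_eq_zero])
    (by
      rw [halg, halg, halg, ← map_mul, ← map_mul, ← map_add, ← map_add, Ne, map_eq_zero]
      exact hG)
    (by
      rw [halg, halg, ← map_mul, ← map_mul, ← map_pow, ← map_pow]
      exact fun h => hab ((algebraMap E K).injective h))
    (by
      have h1 := congrArg (algebraMap E K) hF
      rw [← aeval_fun_algebraMap, map_zero] at h1
      rw [← h1]
      congr 2
      funext i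
      fin_cases i <;> simp)
  have hlift : Liftable φ (familyNiceForm t₁ t₂ t₃ t₄ t₅ t₆ t₇)
      (fun i => algebraMap E K ξ⁻¹ * algebraMap E K (genPoint (fun i => v (Sum.inl i)) ξ i)) := by
    refine ⟨_, (aeval_familyNiceForm_eq_normForm ht₁ ht₃ ht₅ hw S).trans hS, fun i => ?_⟩
    refine Eq.trans ?_ ((congrArg (algebraMap E K) (congrFun hT i)).trans (map_mul _ _ _))
    rcases i with i | i
    · have hS0 := hSφ 0
      have hS1 := hSφ 1
      have hS2 := hSφ 2
      have hS3 := hSφ 3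
      have hS4 := hSφ 4
      simp at hS0 hS1 hS2 hS3 hS4
      fin_cases i <;> simp [hS0, hS1, hS2, hS3, hS4, halg]
    · exact i.elim
  exact hlift.of_smul hφ isHomogeneous_familyNiceForm
    (IsUnit.mk0 _ ((map_ne_zero _).2 (inv_ne_zero hξ0))) fun i => rfl

/-- The threefolds of the family with `t₆ ≠ 0`, by lifting points of the norm form. -/
theorem exists_odd_hasGenericParametrization_familyNiceForm (ht₁ : t₁ ≠ 0) (ht₂ : t₂ ≠ 0)
    (ht₃ : t₃ ≠ 0) (ht₅ : t₅ ≠ 0) (ht₆ : t₆ ≠ 0)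
    (hsm : 27 * t₁ * t₂ * t₃ + t₆ ^ 3 ≠ 0) (κ : ℕ) :
    ∃ d, Odd d ∧ HasGenericParametrization (3 + κ + 1) (κ + 1)
      (familyNiceForm t₁ t₂ t₃ t₄ t₅ t₆ t₇) d := by
  refine exists_odd_hasGenericParametrization (ρ := Empty) ht₂ ht₃ ?_ (isHomogeneous_zero _ _ _) κ
    fun E _ _ v ξ hv hξ => ?_
  · simpa using (isHomogeneous_C (Option Empty) (t₄ / t₅ ^ 2)).mul ((isHomogeneous_X ℂ none).pow 2)
  · obtain ⟨K, hfin, hodd, hK⟩ :=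
      exists_odd_extension_liftable_family hv hξ ht₁ ht₂ ht₃ ht₅ ht₆ hsm
    exact ⟨K, inferInstance, inferInstance, inferInstance, inferInstance, hfin, hodd,
      fun O _ _ _ _ φ τ hφ hτ hφτ => hK O φ τ hφ hτ hφτ⟩

end FamilyNormalForm

/-! ### Parametrizations of degree at most two -/

section QuadraticParametrization

open Module IntermediateField

variable {ρ : Type} [DecidableEq ρ] {t₁ t₂ t₃ t₆ s : ℂ} {h₁ h₀ : MvPolynomial (Option ρ) ℂ}

/-- If all coordinates of a generic point other than `x₂` are adjoined, then `x₂` is algebraic. -/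
theorem isAlgebraic_of_genPoint (ht₂ : t₂ ≠ 0) {L : Type} [Field L] [Algebra ℂ L]
    (F₀ : IntermediateField ℂ L) {a : Fin 3 ⊕ ρ → L} (ha : ∀ i, a i ∈ F₀) {ξ : L}
    (hξ : aeval (genPoint a ξ) (niceForm t₁ t₂ t₃ t₆ s h₁ h₀) = 0) : IsAlgebraic F₀ ξ := by
  refine ⟨niceCubic t₁ t₂ t₃ t₆ s h₁ h₀ (genPoint (fun i => (⟨a i, ha i⟩ : F₀)) 0),
    (niceCubic_monic _).ne_zero, ?_⟩
  have h1 := map_niceCubic (t₁ := t₁) (t₂ := t₂) (t₃ := t₃) (t₆ := t₆) (s := s) (h₁ := h₁)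
    (h₀ := h₀) F₀.val (genPoint (fun i => (⟨a i, ha i⟩ : F₀)) 0)
  rw [Polynomial.aeval_def, ← Polynomial.eval_map]
  refine (congrArg (Polynomial.eval ξ) h1).trans ?_
  rw [aeval_update_eq_zero ht₂, map_genPoint, update_genPoint]
  exact hξ

/-- After the substitution `x₁ = -ϱ² / t₃`, `r = r' + ϱ x₃`, with `l = 1`, the equation is linear in
`x₃`. This parametrizes the hypersurface by the variables `ϱ`, `x₂`, `r'` and those of `ρ`, and `ϱ`
is quadratic over the field generated by the coordinates. -/
theorem hasGenericParametrization_of_adjoin_eq_top [Fintype ρ] (ht₂ : t₂ ≠ 0) (ht₃ : t₃ ≠ 0)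
    (hh₁ : h₁.IsHomogeneous 2) (hh₀ : h₀.IsHomogeneous 3) {m : ℕ} {L : Type} [Field L] [Algebra ℂ L]
    {x : (Fin 3 ⊕ ρ) ⊕ Fin m → L} (hxi : AlgebraicIndependent ℂ x)
    (hx : IntermediateField.adjoin ℂ (Set.range x) = ⊤) :
    ∃ d, (d = 1 ∨ d = 2) ∧ HasGenericParametrization (3 + Fintype.card ρ + m) m
      (niceForm t₁ t₂ t₃ t₆ s h₁ h₀) d := by
  have htr : Algebra.trdeg ℂ L = Fintype.card ((Fin 3 ⊕ ρ) ⊕ Fin m) := by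
    have hb : IsTranscendenceBasis ℂ x := by
      have := isAlgebraic_of_adjoin_eq_top hx
      exact hxi.isTranscendenceBasis_iff_isAlgebraic.2 (isAlgebraic_algebra_adjoin _)
    simpa using hb.cardinalMk_eq_trdeg.symm
  have hrat : IsRationalFunctionField (3 + Fintype.card ρ + m) L :=
    isRationalFunctionField_of_trdeg (by simp) x (by rw [htr]; simp) hx
  obtain ⟨ϱ, hϱ⟩ : ∃ a, a = x (Sum.inl (Sum.inl 0)) := ⟨_, rfl⟩
  obtain ⟨u, hu⟩ : ∃ a, a = x (Sum.inl (Sum.inl 1)) := ⟨_, rfl⟩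
  obtain ⟨q, hq⟩ : ∃ a, a = x (Sum.inl (Sum.inl 2)) := ⟨_, rfl⟩
  obtain ⟨z, hz⟩ : ∃ z : Option ρ → L, z = fun o => o.elim 1 (fun i => x (Sum.inl (Sum.inr i))) :=
    ⟨_, rfl⟩
  have h3 : algebraMap ℂ L t₃ * algebraMap ℂ L t₃⁻¹ = 1 := by
    rw [← map_mul, mul_inv_cancel₀ ht₃, map_one]
  obtain ⟨p, hp⟩ : ∃ p, p = -(algebraMap ℂ L t₃⁻¹ * ϱ ^ 2) := ⟨_, rfl⟩
  have hϱp : ϱ ^ 2 = -(algebraMap ℂ L t₃ * p) := by rw [hp]; linear_combination -ϱ ^ 2 * h3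
  obtain ⟨b₁, hb₁⟩ : ∃ b, b = algebraMap ℂ L t₁ * p ^ 2 + algebraMap ℂ L t₆ * (p * u) := ⟨_, rfl⟩
  obtain ⟨b₂, hb₂⟩ : ∃ b, b = aeval z h₁ + algebraMap ℂ L s * u := ⟨_, rfl⟩
  obtain ⟨c₀, hc₀⟩ : ∃ c, c = algebraMap ℂ L t₂ * u ^ 3 + aeval z h₀ := ⟨_, rfl⟩
  obtain ⟨τ, hτ⟩ : ∃ τ : Option ρ → MvPolynomial ((Fin 3 ⊕ ρ) ⊕ Fin m) ℂ,
    τ = fun o => o.elim 1 (fun i => X (Sum.inl (Sum.inr i))) := ⟨_, rfl⟩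
  have hτz : ∀ h : MvPolynomial (Option ρ) ℂ, aeval x (aeval τ h) = aeval z h := by
    intro h
    rw [← aeval_fun_algHom, hτ, hz]
    congr 2
    funext o
    cases o <;> simp
  have hτe : ∀ (a b : ℂ) (h : MvPolynomial (Option ρ) ℂ),
      eval (Sum.elim (Sum.elim ![a, 0, b] 0) 0 : (Fin 3 ⊕ ρ) ⊕ Fin m → ℂ) (aeval τ h) =
        eval (fun o => o.elim 1 0) h := by
    intro a b h
    have h1 := aeval_fun_algHom
      (aeval (Sum.elim (Sum.elim ![a, 0, b] 0) 0 : (Fin 3 ⊕ ρ) ⊕ Fin m → ℂ)) τ h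
    refine h1.symm.trans ?_
    refine congrArg (fun y : Option ρ → ℂ => aeval y h) ?_
    funext o
    rw [hτ]
    cases o <;> simp
  have hD : 2 * ϱ * q + b₁ + b₂ * ϱ ≠ 0 := by
    obtain ⟨b, hb⟩ : ∃ b : ℂ, 2 * b + t₁ * t₃⁻¹ ^ 2 + eval (fun o => o.elim 1 0) h₁ ≠ 0 := by
      by_contra! h
      have h5 : (2 : ℂ) = 0 := by linear_combination h 1 - h 0
      norm_num at h5
    have h4 := aeval_ne_zero_of_eval_ne_zero hxi
      (p := 2 * X (Sum.inl (Sum.inl 0)) * X (Sum.inl (Sum.inl 2)) +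
        (C t₁ * (C t₃⁻¹ * X (Sum.inl (Sum.inl 0)) ^ 2) ^ 2 -
          C t₆ * ((C t₃⁻¹ * X (Sum.inl (Sum.inl 0)) ^ 2) * X (Sum.inl (Sum.inl 1)))) +
        (aeval τ h₁ + C s * X (Sum.inl (Sum.inl 1))) * X (Sum.inl (Sum.inl 0)))
      (Sum.elim (Sum.elim ![1, 0, b] 0) 0) (by
        simp only [map_add, map_mul, map_sub, map_pow, hτe]
        simpa [add_assoc] using hb)
    simp only [map_add, map_mul, map_sub, map_pow, hτz, aeval_X, aeval_C, map_ofNat, ← hϱ, ← hu,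
      ← hq] at h4
    rw [hb₁, hb₂, hp]
    intro h
    apply h4
    linear_combination h
  have hN : q ^ 2 + b₂ * q + c₀ ≠ 0 := by
    obtain ⟨c, hc⟩ : ∃ c : ℂ, c ^ 2 + eval (fun o => o.elim 1 0) h₁ * c +
        eval (fun o => o.elim 1 0) h₀ ≠ 0 := by
      by_contra! h
      have h5 : (2 : ℂ) = 0 := by linear_combination h 1 + h (-1) - 2 * h 0
      norm_num at h5
    have h4 := aeval_ne_zero_of_eval_ne_zero hxi
      (p := X (Sum.inl (Sum.inl 2)) ^ 2 + (aeval τ h₁ + C s * X (Sum.inl (Sum.inl 1))) *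
        X (Sum.inl (Sum.inl 2)) + (C t₂ * X (Sum.inl (Sum.inl 1)) ^ 3 + aeval τ h₀))
      (Sum.elim (Sum.elim ![0, 0, c] 0) 0) (by
        simp only [map_add, map_mul, map_pow, hτe]
        simpa using hc)
    simp only [map_add, map_mul, map_pow, hτz, aeval_X, aeval_C, ← hu, ← hq] at h4
    rw [hb₂, hc₀]
    exact h4
  -- The solution of the linear equation.
  obtain ⟨x₃, hx₃⟩ : ∃ x₃, x₃ = -(q ^ 2 + b₂ * q + c₀) / (2 * ϱ * q + b₁ + b₂ * ϱ) := ⟨_, rfl⟩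
  have hx₃0 : x₃ ≠ 0 := by rw [hx₃]; exact div_ne_zero (neg_ne_zero.2 hN) hD
  have hx₃' : x₃ * (2 * ϱ * q + b₁ + b₂ * ϱ) = -(q ^ 2 + b₂ * q + c₀) := by
    rw [hx₃, div_mul_cancel₀ _ hD]
  obtain ⟨r, hr⟩ : ∃ r, r = q + ϱ * x₃ := ⟨_, rfl⟩
  obtain ⟨P, hP⟩ : ∃ P : Fin 5 ⊕ ρ → L,
    P = Sum.elim ![p, u, x₃, r, 1] (fun i => x (Sum.inl (Sum.inr i))) := ⟨_, rfl⟩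
  have hPtail : (fun o => P (tailIndex o)) = z := by
    rw [hP, hz]
    funext o
    cases o <;> rfl
  have hPF : aeval P (niceForm t₁ t₂ t₃ t₆ s h₁ h₀) = 0 := by
    rw [aeval_niceForm, hPtail, hP]
    simp
    rw [hr]
    rw [hb₁, hb₂, hc₀] at hx₃'
    linear_combination hx₃' + x₃ ^ 2 * hϱp
  obtain ⟨v, hv⟩ : ∃ v : (Fin 3 ⊕ ρ) ⊕ Fin m → L, v = Sum.elim (Sum.elim
    ![x₃⁻¹ * p, x₃⁻¹ * r, x₃⁻¹] (fun i => x₃⁻¹ * x (Sum.inl (Sum.inr i))))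
    (fun j => x (Sum.inr j)) := ⟨_, rfl⟩
  have hPv : (fun i => x₃⁻¹ * P i) = genPoint (fun i => v (Sum.inl i)) (x₃⁻¹ * u) := by
    rw [hP, hv]
    funext i
    rcases i with i | i
    · fin_cases i <;> simp [genPoint, hx₃0]
    · simp [genPoint]
  have hα : aeval (genPoint (fun i => v (Sum.inl i)) (x₃⁻¹ * u))
      (niceForm t₁ t₂ t₃ t₆ s h₁ h₀) = 0 := by
    rw [← hPv, IsHomogeneous.aeval_const_mul (isHomogeneous_niceForm hh₁ hh₀), hPF, mul_zero]
  -- the coordinates together with `ϱ` generate `L`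
  have hgen : ∀ A : IntermediateField ℂ L, (∀ i, v i ∈ A) → x₃⁻¹ * u ∈ A → ϱ ∈ A → A = ⊤ := by
    intro A hvA huA hϱA
    rw [hv] at hvA
    have a3 : x₃ ∈ A := by
      have := inv_mem (hvA (Sum.inl (Sum.inl 2)))
      simpa using this
    have hmul : ∀ a, x₃⁻¹ * a ∈ A → a ∈ A := by
      intro a ha
      have := mul_mem a3 ha
      rwa [mul_inv_cancel_left₀ hx₃0] at this
    refine eq_top_iff.2 ?_
    rw [← hx, adjoin_le_iff]
    rintro _ ⟨(i | i) | i, rfl⟩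
    · fin_cases i
      · exact hϱ ▸ hϱA
      · exact hu ▸ hmul _ huA
      · have h4 := hmul _ (hvA (Sum.inl (Sum.inl 1)))
        have h5 : q = r - ϱ * x₃ := by rw [hr]; ring
        exact hq ▸ h5 ▸ sub_mem h4 (mul_mem hϱA a3)
    · exact hmul _ (hvA (Sum.inl (Sum.inr i)))
    · exact hvA (Sum.inr i)
  have hpow : ∀ A : IntermediateField ℂ L, (∀ i, v i ∈ A) → ϱ ^ 2 ∈ A := by
    intro A hvA
    rw [hv] at hvA
    have a3 : x₃ ∈ A := by
      have := inv_mem (hvA (Sum.inl (Sum.inl 2)))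
      simpa using this
    have h4 := mul_mem a3 (hvA (Sum.inl (Sum.inl 0)))
    rw [hϱp]
    refine neg_mem (mul_mem (IntermediateField.algebraMap_mem _ _) ?_)
    simpa [hx₃0] using h4
  have hvi : AlgebraicIndependent ℂ v := by
    have : Algebra.IsAlgebraic (IntermediateField.adjoin ℂ (Set.range v)) L := by
      have hv0 : ∀ i, v i ∈ IntermediateField.adjoin ℂ (Set.range v) := fun i =>
        subset_adjoin ℂ _ ⟨i, rfl⟩
      have h4 := hgen ((algebraicClosure (IntermediateField.adjoin ℂ (Set.range v)) L).restrictScalars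
        ℂ) (fun i => (algebraicClosure (IntermediateField.adjoin ℂ (Set.range v)) L).algebraMap_mem
          ⟨v i, hv0 i⟩)
        (mem_algebraicClosure_iff.2 (isAlgebraic_of_genPoint ht₂ _ (fun i => hv0 _) hα))
        (mem_algebraicClosure_iff.2 ?_)
      · refine ⟨fun y => mem_algebraicClosure_iff.1 ?_⟩
        have h5 : y ∈ (⊤ : IntermediateField ℂ L) := mem_top
        rw [← h4] at h5
        exact h5
      · refine IsIntegral.isAlgebraic (IsIntegral.of_pow two_pos ?_)
        exact isIntegral_algebraMap (x := (⟨ϱ ^ 2, hpow _ hv0⟩ :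
          IntermediateField.adjoin ℂ (Set.range v)))
    exact algebraicIndependent_of_isAlgebraic v htr
  obtain ⟨E, hE⟩ : ∃ E, E = IntermediateField.adjoin ℂ
    (Set.range (genPoint (fun i => v (Sum.inl i)) (x₃⁻¹ * u)) ∪
      Set.range (Fin.cons 1 (fun j => v (Sum.inr j)) : Fin (m + 1) → L)) := ⟨_, rfl⟩
  have hfin : finrank E L = 1 ∨ finrank E L = 2 := by
    have hvE : ∀ i, v i ∈ E := by
      intro i
      rw [hE]
      rcases i with (i | i) | i
      · fin_cases i
        · exact subset_adjoin ℂ _ (Or.inl ⟨Sum.inl 0, rfl⟩)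
        · exact subset_adjoin ℂ _ (Or.inl ⟨Sum.inl 3, rfl⟩)
        · exact subset_adjoin ℂ _ (Or.inl ⟨Sum.inl 4, rfl⟩)
      · exact subset_adjoin ℂ _ (Or.inl ⟨Sum.inr i, rfl⟩)
      · exact subset_adjoin ℂ _ (Or.inr ⟨i.succ, rfl⟩)
    have huE : x₃⁻¹ * u ∈ E := by
      rw [hE]
      exact subset_adjoin ℂ _ (Or.inl ⟨Sum.inl 1, rfl⟩)
    have hint : IsIntegral E ϱ := IsIntegral.of_pow two_pos
      (isIntegral_algebraMap (x := (⟨ϱ ^ 2, hpow _ hvE⟩ : E)))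
    have htop : E⟮ϱ⟯ = ⊤ := by
      have h4 := hgen (E⟮ϱ⟯.restrictScalars ℂ) (fun i => E⟮ϱ⟯.algebraMap_mem ⟨v i, hvE i⟩)
        (E⟮ϱ⟯.algebraMap_mem ⟨_, huE⟩) (mem_adjoin_simple_self E ϱ)
      refine eq_top_iff.2 fun y _ => ?_
      have h5 : y ∈ (⊤ : IntermediateField ℂ L) := mem_top
      rw [← h4] at h5
      exact h5
    have h4 := adjoin.finrank hint
    rw [htop, finrank_top'] at h4
    have h5 : (minpoly E ϱ).degree ≤ (Polynomial.X ^ 2 - Polynomial.C (⟨ϱ ^ 2, hpow _ hvE⟩ : E)).degree :=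
      minpoly.min _ _ (by monicity!) (by simp)
    have h6 := Polynomial.natDegree_le_natDegree h5
    rw [Polynomial.natDegree_X_pow_sub_C] at h6
    have h7 := minpoly.natDegree_pos hint
    omega
  refine ⟨finrank E L, hfin, L, inferInstance, inferInstance, _, _, Pi.single (Sum.inl 2) 1, hrat,
    ?_, ?_, hα, fun e G hG h y y' hy => eval_eq_zero_of_genPoint ht₂ ht₃ hh₁ hh₀ hvi hα hG h y y' hy,
    by rw [hE]⟩
  · rw [Finset.sum_eq_single (Sum.inl 2)]
    · simp [genPoint]
    · intro i _ hi
      simp [hi]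
    · simp
  · rfl

/-- The substitution of `hasGenericParametrization_of_adjoin_eq_top`, in a field of rational
functions. -/
theorem exists_le_two_hasGenericParametrization_niceForm [Fintype ρ] (ht₂ : t₂ ≠ 0) (ht₃ : t₃ ≠ 0)
    (hh₁ : h₁.IsHomogeneous 2) (hh₀ : h₀.IsHomogeneous 3) (m : ℕ) :
    ∃ d, (d = 1 ∨ d = 2) ∧ HasGenericParametrization (3 + Fintype.card ρ + m) m
      (niceForm t₁ t₂ t₃ t₆ s h₁ h₀) d := by
  have hx := adjoin_range_X_fractionRing ((Fin 3 ⊕ ρ) ⊕ Fin m)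
  exact hasGenericParametrization_of_adjoin_eq_top ht₂ ht₃ hh₁ hh₀
    (algebraicIndependent_of_adjoin_eq_top _ (trdeg_fractionRing_mvPolynomial _) hx) hx

end QuadraticParametrization

/-! ### Linear changes of coordinates -/

section LinearChange

open Module IntermediateField

theorem isWeightedHomogeneous_aeval {σ τ M : Type*} [AddCommMonoid M] {w : σ → M} {w' : τ → M}
    {G : MvPolynomial σ ℂ} {e : M} (hG : IsWeightedHomogeneous w G e)
    {g : σ → MvPolynomial τ ℂ} (hg : ∀ i, IsWeightedHomogeneous w' (g i) (w i)) :
    IsWeightedHomogeneous w' (aeval g G) e := by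
  rw [aeval_def, eval₂_eq]
  refine IsWeightedHomogeneous.sum _ _ _ fun d hd => ?_
  have h1 := hG (mem_support_iff.1 hd)
  rw [← zero_add e, ← h1, Finsupp.weight_apply, Finsupp.sum]
  exact (isWeightedHomogeneous_C w' _).mul (IsWeightedHomogeneous.prod _ _ _ fun i _ => (hg i).pow _)

/-- The values of a linear map as linear forms. -/
def linearForms {ι ι' : Type} [Fintype ι'] [DecidableEq ι'] (e : (ι' → ℂ) →ₗ[ℂ] (ι → ℂ)) (i : ι) :
    MvPolynomial ι' ℂ :=
  ∑ j, C (e (Pi.single j 1) i) * X j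

section

variable {ι ι' : Type} [Fintype ι'] [DecidableEq ι']

theorem eval_linearForms (e : (ι' → ℂ) →ₗ[ℂ] (ι → ℂ)) (x : ι' → ℂ) (i : ι) :
    eval x (linearForms e i) = e x i := by
  conv_rhs => rw [pi_eq_sum_univ' x, map_sum]
  simp only [linearForms, map_sum, map_mul, eval_C, eval_X, map_smul, Finset.sum_apply,
    Pi.smul_apply, smul_eq_mul]
  exact Finset.sum_congr rfl fun j _ => by rw [mul_comm]

theorem eval_aeval_linearForms (e : (ι' → ℂ) →ₗ[ℂ] (ι → ℂ)) (x : ι' → ℂ)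
    (p : MvPolynomial ι ℂ) : eval x (aeval (linearForms e) p) = eval (e x) p := by
  have h1 := aeval_fun_algHom (aeval x : MvPolynomial ι' ℂ →ₐ[ℂ] ℂ) (linearForms e) p
  refine h1.symm.trans ?_
  refine congrArg (fun y : ι → ℂ => aeval y p) ?_
  funext i
  exact eval_linearForms _ x i

end

variable {ι ι' : Type} [Fintype ι] [Fintype ι'] [DecidableEq ι] [DecidableEq ι']

/-- Generic parametrizations are invariant under linear coordinate changes. -/
theorem HasGenericParametrization.of_linearEquiv {F : MvPolynomial ι ℂ} {F' : MvPolynomial ι' ℂ}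
    {N m d : ℕ} (e : (ι' → ℂ) ≃ₗ[ℂ] (ι → ℂ)) (h : ∀ x, eval (e x) F = eval x F')
    (hF' : HasGenericParametrization N m F' d) : HasGenericParametrization N m F d := by
  obtain ⟨L, _, _, α, β, c, hL, hc, hβ, h0, hker, hd⟩ := hF'
  have hF : aeval (linearForms (e : (ι' → ℂ) →ₗ[ℂ] (ι → ℂ))) F = F' :=
    MvPolynomial.funext fun x => by
      rw [eval_aeval_linearForms]
      exact h x
  obtain ⟨γ, hγ⟩ : ∃ γ : ι → L, γ = fun i =>
    aeval α (linearForms (e : (ι' → ℂ) →ₗ[ℂ] (ι → ℂ)) i) := ⟨_, rfl⟩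
  have hγα : ∀ j, aeval γ (linearForms (e.symm : (ι → ℂ) →ₗ[ℂ] (ι' → ℂ)) j) = α j := by
    intro j
    rw [hγ, aeval_fun_algHom]
    have h1 : aeval (linearForms (e : (ι' → ℂ) →ₗ[ℂ] (ι → ℂ)))
        (linearForms (e.symm : (ι → ℂ) →ₗ[ℂ] (ι' → ℂ)) j) = X j := by
      refine MvPolynomial.funext fun x => ?_
      rw [eval_aeval_linearForms, eval_linearForms]
      simp
    rw [h1, aeval_X]
  have hmem : ∀ {κ κ' : Type} [Fintype κ'] [DecidableEq κ'] (A : IntermediateField ℂ L)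
      (y : κ' → L) (e : (κ' → ℂ) →ₗ[ℂ] (κ → ℂ)) (i : κ), (∀ j, y j ∈ A) →
      aeval y (linearForms e i) ∈ A := by
    intro κ κ' _ _ A y e i hy
    rw [linearForms, map_sum]
    refine sum_mem fun j _ => ?_
    rw [map_mul, aeval_C, aeval_X]
    exact mul_mem (IntermediateField.algebraMap_mem _ _) (hy j)
  refine ⟨L, inferInstance, inferInstance, γ, β,
    fun i => ∑ j, c j * e.symm (Pi.single i 1) j, hL, ?_, hβ, ?_, ?_, ?_⟩
  · rw [← hc]
    simp only [← hγα, linearForms, map_sum, map_mul, aeval_C, aeval_X, Finset.sum_mul,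
      Finset.mul_sum]
    rw [Finset.sum_comm]
    refine Finset.sum_congr rfl fun i _ => Finset.sum_congr rfl fun j _ => ?_
    rw [mul_assoc]
    rfl
  · rw [hγ, aeval_fun_algHom, hF, h0]
  · intro e' G hG hG0 x y hx
    have h1 := hker e' (aeval (Sum.elim (fun i => rename Sum.inl
      (linearForms (e : (ι' → ℂ) →ₗ[ℂ] (ι → ℂ)) i)) (fun j => X (Sum.inr j))) G) ?_ ?_ (e.symm x) y ?_
    · have h2 := aeval_fun_algHom (aeval (Sum.elim (e.symm x) y) :
        MvPolynomial (ι' ⊕ Fin (m + 1)) ℂ →ₐ[ℂ] ℂ) (Sum.elim (fun i => rename Sum.inl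
          (linearForms (e : (ι' → ℂ) →ₗ[ℂ] (ι → ℂ)) i)) (fun j => X (Sum.inr j))) G
      have h3 := h2.trans h1
      refine Eq.trans (congrArg (fun z => aeval z G) ?_) h3
      funext i
      rcases i with i | i
      · simp only [Sum.elim_inl, aeval_rename, Sum.elim_comp_inl]
        exact (congrFun (e.apply_symm_apply x) i).symm.trans (eval_linearForms _ _ _).symm
      · simp
    · refine isWeightedHomogeneous_aeval hG fun i => ?_
      rcases i with i | i
      · simp only [Sum.elim_inl, linearForms, map_sum, map_mul, rename_C, rename_X]
        refine IsWeightedHomogeneous.sum _ _ _ fun j _ => ?_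
        rw [← zero_add (sumWeight _ _ _)]
        exact (isWeightedHomogeneous_C _ _).mul (isWeightedHomogeneous_X ℂ _ (Sum.inl j))
      · exact isWeightedHomogeneous_X ℂ _ (Sum.inr i)
    · rw [← aeval_fun_algHom, ← hG0]
      congr 2
      funext i
      rcases i with i | i
      · simp [aeval_rename, hγ]
      · simp
    · rw [← h, LinearEquiv.apply_symm_apply, hx]
  · rw [← hd, le_antisymm (IntermediateField.adjoin_le_iff.2 ?_)
      (IntermediateField.adjoin_le_iff.2 ?_)]
    · rintro y (⟨i, rfl⟩ | ⟨i, rfl⟩)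
      · rw [hγ]
        exact hmem _ _ _ _ fun j => subset_adjoin ℂ _ (Or.inl ⟨j, rfl⟩)
      · exact subset_adjoin ℂ _ (Or.inr ⟨i, rfl⟩)
    · rintro y (⟨i, rfl⟩ | ⟨i, rfl⟩)
      · rw [← hγα]
        exact hmem _ _ _ _ fun j => subset_adjoin ℂ _ (Or.inl ⟨j, rfl⟩)
      · exact subset_adjoin ℂ _ (Or.inr ⟨i, rfl⟩)

theorem HasGenericParametrization.admitsUnirationalParametrization {N m a d : ℕ}
    {F : MvPolynomial (Fin (a + 1)) ℂ} (hF : F.IsHomogeneous 3) (hd : 0 < d)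
    (h : HasGenericParametrization N m F d) :
    AdmitsUnirationalParametrization N (projHypersurface F ×ˢ (Set.univ : Set (CProj m))) d := by
  obtain ⟨L, _, _, α, β, c, hL, hc, hβ, h0, hker, hfin⟩ := h
  exact admitsUnirationalParametrization_of_point hF hL α β c hc hβ h0 hker hd hfin

/-- An odd degree is prime to each of the degrees one and two. -/
theorem admitsCoprimeParametrizations_of_hasGenericParametrization {N m a : ℕ}
    {F : MvPolynomial (Fin (a + 1)) ℂ} (hF : F.IsHomogeneous 3)
    (h₁ : ∃ d, Odd d ∧ HasGenericParametrization N m F d)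
    (h₂ : ∃ d, (d = 1 ∨ d = 2) ∧ HasGenericParametrization N m F d) :
    AdmitsCoprimeParametrizations N (projHypersurface F ×ˢ (Set.univ : Set (CProj m))) := by
  obtain ⟨d₁, hd₁, h₁⟩ := h₁
  obtain ⟨d₂, hd₂, h₂⟩ := h₂
  refine ⟨d₁, d₂, ?_, h₁.admitsUnirationalParametrization hF hd₁.pos,
    h₂.admitsUnirationalParametrization hF (by omega)⟩
  rcases hd₂ with rfl | rfl
  · exact Nat.coprime_one_right _
  · exact Nat.coprime_two_right.2 hd₁

end LinearChange

/-! ### The family of cubic threefolds -/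

section Family

theorem eval_smul_of_isHomogeneous {σ : Type*} {F : MvPolynomial σ ℂ} {d : ℕ}
    (hF : F.IsHomogeneous d) (c : ℂ) (x : σ → ℂ) : eval (c • x) F = c ^ d * eval x F := by
  simp only [eval_eq, Finset.mul_sum]
  refine Finset.sum_congr rfl fun e he => ?_
  rw [← hF (mem_support_iff.1 he), Finsupp.weight_apply, Finsupp.sum]
  simp only [Pi.smul_apply, smul_eq_mul, mul_pow, Finset.prod_mul_distrib, mul_one, Pi.one_apply,
    Finset.prod_pow_eq_pow_sum]
  ring

/-- The Jacobian criterion in terms of nonzero vectors instead of chosen representatives. -/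
theorem IsSmoothProjHypersurface.exists_eval_pderiv_ne_zero {k : ℕ}
    {F : MvPolynomial (Fin (k + 1)) ℂ} (hs : IsSmoothProjHypersurface F) {d : ℕ}
    (hF : F.IsHomogeneous d) {x : Fin (k + 1) → ℂ} (hx : x ≠ 0) (h0 : eval x F = 0) :
    ∃ i, eval x (pderiv i F) ≠ 0 := by
  obtain ⟨a, ha⟩ := Projectivization.exists_smul_eq_mk_rep ℂ x hx
  have ha' : (Projectivization.mk ℂ x hx).rep = (a : ℂ) • x := ha.symm
  obtain ⟨i, hi⟩ := hs (Projectivization.mk ℂ x hx) (by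
    change eval _ F = 0
    rw [ha', eval_smul_of_isHomogeneous hF, h0, mul_zero])
  refine ⟨i, fun h => hi ?_⟩
  rw [ha', eval_smul_of_isHomogeneous hF.pderiv, h, mul_zero]

theorem isHomogeneous_familyCubic (t : Fin 7 → ℂ) : (familyCubic t).IsHomogeneous 3 := by
  have hX : ∀ i : Fin 5, (X i : MvPolynomial (Fin 5) ℂ).IsHomogeneous 1 := isHomogeneous_X ℂ
  have hC : ∀ c : ℂ, (C c : MvPolynomial (Fin 5) ℂ).IsHomogeneous 0 := isHomogeneous_C _
  unfold familyCubic
  refine (((((IsHomogeneous.add ?_ ?_).add ?_).add ?_).add ?_).add ?_).add ?_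
  · exact ((hC _).mul ((hX _).pow 2)).mul (hX _)
  · exact (hC _).mul ((hX _).pow 3)
  · exact ((hC _).mul (hX _)).mul ((hX _).pow 2)
  · exact ((hC _).mul ((hX _).pow 2)).mul (hX _)
  · exact ((hC _).mul (hX _)).mul ((hX _).pow 2)
  · exact (((hC _).mul (hX _)).mul (hX _)).mul (hX _)
  · exact (((hC _).mul (hX _)).mul (hX _)).mul (hX _)

theorem eval_familyCubic (t : Fin 7 → ℂ) (x : Fin 5 → ℂ) : eval x (familyCubic t) =
    t 0 * x 0 ^ 2 * x 2 + t 1 * x 1 ^ 3 + t 2 * x 0 * x 2 ^ 2 + t 3 * x 3 ^ 2 * x 4 +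
      t 4 * x 3 * x 4 ^ 2 + t 5 * x 0 * x 1 * x 2 + t 6 * x 1 * x 3 * x 4 := by
  simp [familyCubic]

/-- If the discriminant vanishes, the plane section `x₄ = x₅ = 0` has a node at which the
threefold is singular as well. -/
theorem discriminant_ne_zero_of_isSmooth_familyCubic {t : Fin 7 → ℂ} (h0 : t 0 ≠ 0) (h2 : t 2 ≠ 0)
    (h5 : t 5 ≠ 0) (hs : IsSmoothProjHypersurface (k := 4) (familyCubic t)) :
    27 * t 0 * t 1 * t 2 + t 5 ^ 3 ≠ 0 := by
  intro h
  have ht : t 1 = - t 5 ^ 3 / (27 * t 0 * t 2) := by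
    field_simp
    linear_combination h
  obtain ⟨i, hi⟩ := hs.exists_eval_pderiv_ne_zero (isHomogeneous_familyCubic t)
    (x := ![1 / t 0, -3 / t 5, 1 / t 2, 0, 0])
    (fun h => by simpa [h0] using congrFun h 0) (by
      rw [eval_familyCubic]
      simp [ht]
      field_simp
      ring)
  refine hi ?_
  fin_cases i <;> simp [familyCubic, pderiv_X, ht] <;> field_simp <;> ring

/-- The linear equivalence which renames the coordinates along `σ` and scales them by `c`. -/
def monomialEquiv {ι ι' : Type} (σ : ι ≃ ι') (c : ι → ℂ) (hc : ∀ i, c i ≠ 0) :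
    (ι' → ℂ) ≃ₗ[ℂ] (ι → ℂ) where
  toFun x i := c i * x (σ i)
  invFun y j := (c (σ.symm j))⁻¹ * y (σ.symm j)
  map_add' x y := by
    funext i
    simp [mul_add]
  map_smul' a x := by
    funext i
    simp [mul_left_comm]
  left_inv x := by
    funext j
    simp [hc]
  right_inv y := by
    funext i
    simp [hc]

theorem monomialEquiv_apply {ι ι' : Type} (σ : ι ≃ ι') (c : ι → ℂ) (hc : ∀ i, c i ≠ 0)
    (x : ι' → ℂ) (i : ι) : monomialEquiv σ c hc x i = c i * x (σ i) := rfl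

theorem admitsCoprimeParametrizations_familyCubic {t : Fin 7 → ℂ} (h0 : t 0 ≠ 0) (h1 : t 1 ≠ 0)
    (h2 : t 2 ≠ 0) (h4 : t 4 ≠ 0)
    (hs : IsSmoothProjHypersurface (k := 4) (familyCubic t)) {m : ℕ} (hm : 1 ≤ m) :
    AdmitsCoprimeParametrizations (a := 4) (b := m) (3 + m)
      (projHypersurface (k := 4) (familyCubic t) ×ˢ Set.univ) := by
  obtain ⟨κ, rfl⟩ := Nat.exists_eq_add_of_le' hm
  have hq : ∀ c : ℂ, (C c * X none ^ 2 : MvPolynomial (Option Empty) ℂ).IsHomogeneous 2 :=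
    fun c => by simpa using (isHomogeneous_C (Option Empty) c).mul ((isHomogeneous_X ℂ none).pow 2)
  by_cases h5 : t 5 = 0
  · -- The three variables `x₄, x₂, x₅` carry the plane cubic, the binary form in `x₁, x₃` is `H`.
    let e := monomialEquiv ((Equiv.ofBijective (![4, 1, 3, 0, 2] : Fin 5 → Fin 5)
      (by decide)).trans (Equiv.sumEmpty (Fin 5) Empty).symm) ![(t 2)⁻¹, 1, 1, 1, 1] (by
        intro i; fin_cases i <;> simp [h2])
    have he : ∀ x, eval (e x) (familyCubic t) = eval x (niceForm (t 3) (t 1) (t 4) (t 6) 0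
        (C (t 0 / t 2 ^ 2) * X none ^ 2 : MvPolynomial (Option Empty) ℂ) 0) := by
      intro x
      refine Eq.trans ?_ (aeval_niceForm x).symm
      simp [e, eval_familyCubic, monomialEquiv_apply, h5, tailIndex]
      field_simp
      ring
    refine admitsCoprimeParametrizations_of_hasGenericParametrization
      (isHomogeneous_familyCubic t) ?_ ?_
    · obtain ⟨d, hd, h⟩ := exists_odd_hasGenericParametrization_niceForm (t₁ := t 3) (t₆ := t 6) h1 h4
        (hq (t 0 / t 2 ^ 2)) (isHomogeneous_zero _ _ _) κ
      exact ⟨d, hd, h.of_linearEquiv e he⟩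
    · obtain ⟨d, hd, h⟩ := exists_le_two_hasGenericParametrization_niceForm (t₁ := t 3) (t₆ := t 6)
        (s := 0) h1 h4 (hq (t 0 / t 2 ^ 2)) (isHomogeneous_zero _ _ _) (κ + 1)
      exact ⟨d, hd, h.of_linearEquiv e he⟩
  · let e := monomialEquiv ((Equiv.ofBijective (![0, 1, 2, 4, 3] : Fin 5 → Fin 5)
      (by decide)).trans (Equiv.sumEmpty (Fin 5) Empty).symm) ![1, 1, 1, (t 4)⁻¹, 1] (by
        intro i; fin_cases i <;> simp [h4])
    have he : ∀ x, eval (e x) (familyCubic t) =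
        eval x (familyNiceForm (t 0) (t 1) (t 2) (t 3) (t 4) (t 5) (t 6)) := by
      intro x
      refine Eq.trans ?_ (aeval_familyNiceForm h4 x ((t 4)⁻¹ * x (Sum.inl 4)) (by simp [h4])).symm
      simp [e, eval_familyCubic, monomialEquiv_apply]
      ring
    refine admitsCoprimeParametrizations_of_hasGenericParametrization
      (isHomogeneous_familyCubic t) ?_ ?_
    · obtain ⟨d, hd, h⟩ := exists_odd_hasGenericParametrization_familyNiceForm h0 h1 h2 h4 h5
        (t₇ := t 6) (discriminant_ne_zero_of_isSmooth_familyCubic h0 h2 h5 hs) κ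
      exact ⟨d, hd, h.of_linearEquiv e he⟩
    · obtain ⟨d, hd, h⟩ := exists_le_two_hasGenericParametrization_niceForm (t₁ := t 0) (t₆ := t 5)
        (s := t 6 / t 4) h1 h2 (hq (t 3 / t 4 ^ 2)) (isHomogeneous_zero _ _ _) (κ + 1)
      exact ⟨d, hd, h.of_linearEquiv e he⟩

end Family

/-! ### A normal form of smooth plane cubics -/

section PlaneCubic

/-- A symmetric trilinear form `T` whose cubic form is `F`, together with its relation to the first
and second derivatives of `F`. -/
structure IsPolarForm {ι : Type} [Fintype ι] (F : MvPolynomial ι ℂ)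
    (T : (ι → ℂ) → (ι → ℂ) → (ι → ℂ) → ℂ) : Prop where
  swap_left : ∀ u v w, T u v w = T v u w
  swap_right : ∀ u v w, T u v w = T u w v
  add_right : ∀ u v w w', T u v (w + w') = T u v w + T u v w'
  smul_right : ∀ u v (a : ℂ) w, T u v (a • w) = a * T u v w
  eval_eq : ∀ x, eval x F = T x x x
  sum_pderiv : ∀ x y, ∑ i, y i * eval x (pderiv i F) = 3 * T x x y
  sum_pderiv_pderiv : ∀ x y z,
    ∑ i, y i * ∑ j, z j * eval x (pderiv j (pderiv i F)) = 6 * T x y z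

theorem sum_mul_sum_mul_eval_pderiv_pderiv {ι : Type} [Fintype ι] (F : MvPolynomial ι ℂ)
    (x y z : ι → ℂ) : ∑ i, y i * ∑ j, z j * eval x (pderiv j (pderiv i F)) =
      polar (polar F X fun i => (C (y i) : MvPolynomial ι ℂ)) x z := by
  have h : ∀ j, pderiv j (polar F X fun i => (C (y i) : MvPolynomial ι ℂ)) =
      ∑ i, C (y i) * pderiv j (pderiv i F) := by
    intro j
    simp [polar, Derivation.leibniz]
  rw [polar]
  simp only [h, map_sum, map_mul, aeval_C, Finset.mul_sum]
  rw [Finset.sum_comm]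
  refine Finset.sum_congr rfl fun i _ => Finset.sum_congr rfl fun j _ => ?_
  exact mul_left_comm _ _ _

theorem exists_isPolarForm {ι : Type} [Fintype ι] {F : MvPolynomial ι ℂ} (hF : F.IsHomogeneous 3) :
    ∃ T, IsPolarForm F T := by
  classical
  refine IsHomogeneous.cubic_induction hF (P := fun F => ∃ T, IsPolarForm F T) ?_ ?_ ?_
  · exact ⟨fun _ _ _ => 0, by constructor <;> simp⟩
  · rintro f g ⟨S, hS⟩ ⟨T, hT⟩
    refine ⟨fun u v w => S u v w + T u v w, ?_, ?_, ?_, ?_, ?_, ?_, ?_⟩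
    · intro u v w; rw [hS.swap_left, hT.swap_left]
    · intro u v w; rw [hS.swap_right, hT.swap_right]
    · intro u v w w'; simp only [hS.add_right, hT.add_right]; ring
    · intro u v a w; simp only [hS.smul_right, hT.smul_right]; ring
    · intro x; rw [map_add, hS.eval_eq, hT.eval_eq]
    · intro x y
      simp only [map_add, mul_add, Finset.sum_add_distrib, hS.sum_pderiv, hT.sum_pderiv]
    · intro x y z
      simp only [map_add, mul_add, Finset.sum_add_distrib, hS.sum_pderiv_pderiv,
        hT.sum_pderiv_pderiv]
  · intro c i j k
    refine ⟨fun u v w => c / 6 * (u i * v j * w k + u i * v k * w j + u j * v i * w k +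
      u j * v k * w i + u k * v i * w j + u k * v j * w i), ?_, ?_, ?_, ?_, ?_, ?_, ?_⟩
    · intro u v w; ring
    · intro u v w; ring
    · intro u v w w'; simp only [Pi.add_apply]; ring
    · intro u v a w; simp only [Pi.smul_apply, smul_eq_mul]; ring
    · intro x; simp only [map_mul, eval_C, eval_X]; ring
    · intro x y
      have h : ∑ l, y l * eval x (pderiv l (C c * (X i * (X j * X k)))) =
        polar (C c * (X i * (X j * X k))) x y := rfl
      rw [h]
      simp only [polar_mul, polar_X, polar_C, map_mul, aeval_X, aeval_C]
      simp only [Algebra.algebraMap_self, RingHom.id_apply]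
      ring
    · intro x y z
      rw [sum_mul_sum_mul_eval_pderiv_pderiv]
      simp only [polar_add_left, polar_mul, polar_X, polar_C, map_mul, aeval_X, aeval_C, map_add,
        algebraMap_eq, mul_zero, add_zero, zero_add]
      simp only [Algebra.algebraMap_self, RingHom.id_apply]
      ring

/-- Two plane curves intersect: by Krull's height theorem, the maximal ideal of the origin of affine
three-space, which has height three, is not the radical of an ideal with two generators. -/
theorem exists_common_zero {f g : MvPolynomial (Fin 3) ℂ} (hf : eval 0 f = 0) (hg : eval 0 g = 0) :
    ∃ x : Fin 3 → ℂ, x ≠ 0 ∧ eval x f = 0 ∧ eval x g = 0 := by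
  classical
  by_contra! hno
  obtain ⟨p, hp⟩ : ∃ p : Fin 4 → Ideal (MvPolynomial (Fin 3) ℂ), p = fun k =>
    RingHom.ker (aeval fun i : Fin 3 => if i.1 < k.1 then (0 : MvPolynomial (Fin 3) ℂ) else X i) :=
    ⟨_, rfl⟩
  have hprime : ∀ k, (p k).IsPrime := fun k => by
    rw [hp]; exact RingHom.ker_isPrime _
  have hmem : ∀ k (i : Fin 3), X i ∈ p k ↔ i.1 < k.1 := fun k i => by
    rw [hp]
    simp [RingHom.mem_ker]
  have hlt : ∀ k l : Fin 4, k < l → p k < p l := by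
    intro k l hkl
    refine lt_of_le_of_ne ?_ ?_
    · intro F hF
      rw [hp, RingHom.mem_ker] at hF ⊢
      have h1 := congrArg (aeval fun i : Fin 3 =>
        if i.1 < l.1 then (0 : MvPolynomial (Fin 3) ℂ) else X i) hF
      rw [map_zero, ← aeval_fun_algHom] at h1
      refine (congrArg (fun y : Fin 3 → MvPolynomial (Fin 3) ℂ => aeval y F) (funext fun i => ?_)).trans
        h1
      split_ifs with h2 h3 h3
      · simp
      · simp [h2]
      · exact absurd (h3.trans hkl) h2
      · simp [h2]
    · intro h
      have h1 := hmem l ⟨k.1, by omega⟩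
      rw [← h, hmem] at h1
      simpa using h1.2 hkl
  have hheight : (3 : ℕ∞) ≤ (p 3).height := by
    have := hprime
    have h1 := fun k l (h : k < l) => Ideal.height_add_one_le_of_lt_of_isPrime (hlt k l h)
    calc (3 : ℕ∞) = 0 + 1 + 1 + 1 := by norm_num
      _ ≤ (p 0).height + 1 + 1 + 1 := by gcongr; exact zero_le
      _ ≤ (p 1).height + 1 + 1 := by gcongr; exact h1 0 1 (by decide)
      _ ≤ (p 2).height + 1 := by gcongr; exact h1 1 2 (by decide)
      _ ≤ (p 3).height := h1 2 3 (by decide)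
  have hrad : (Ideal.span {f, g}).radical = p 3 := by
    rw [← vanishingIdeal_zeroLocus_eq_radical (K := ℂ), zeroLocus_span]
    have h1 : {x : Fin 3 → ℂ | ∀ q ∈ ({f, g} : Set (MvPolynomial (Fin 3) ℂ)), aeval x q = 0} =
        {0} := by
      ext x
      simp only [Set.mem_insert_iff, Set.mem_singleton_iff, forall_eq_or_imp, forall_eq,
        Set.mem_ofPred_eq]
      refine ⟨fun h => by_contra fun hx => hno x hx h.1 h.2, ?_⟩
      rintro rfl
      exact ⟨hf, hg⟩
    rw [h1, hp]
    ext F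
    rw [mem_vanishingIdeal_singleton_iff, RingHom.mem_ker]
    have h2 : (fun i : Fin 3 => if i.1 < (3 : Fin 4).1 then (0 : MvPolynomial (Fin 3) ℂ) else X i) =
        fun i => algebraMap ℂ (MvPolynomial (Fin 3) ℂ) 0 := by
      funext i
      exact (if_pos i.2).trans (map_zero _).symm
    rw [h2, aeval_fun_algebraMap]
    exact (map_eq_zero_iff _ (algebraMap ℂ (MvPolynomial (Fin 3) ℂ)).injective).symm
  have hmin : p 3 ∈ (Ideal.span {f, g}).minimalPrimes := by
    rw [← Ideal.radical_minimalPrimes, hrad, Ideal.minimalPrimes_eq_subsingleton_self]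
    rfl
  have h2 := Ideal.height_le_card_of_mem_minimalPrimes_span_finset (s := {f, g}) (p := p 3)
    (by simpa using hmin)
  have h3 : (3 : ℕ∞) ≤ 2 := hheight.trans (h2.trans (by exact_mod_cast Finset.card_le_two))
  exact absurd h3 (by decide)

namespace IsPolarForm

variable {ι : Type} [Fintype ι] {F : MvPolynomial ι ℂ} {T : (ι → ℂ) → (ι → ℂ) → (ι → ℂ) → ℂ}

theorem add_left (hT : IsPolarForm F T) (u u' v w : ι → ℂ) :
    T (u + u') v w = T u v w + T u' v w := by
  rw [hT.swap_left, hT.swap_right, hT.add_right, hT.swap_right v w u, hT.swap_right v w u',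
    hT.swap_left v u, hT.swap_left v u']

theorem smul_left (hT : IsPolarForm F T) (a : ℂ) (u v w : ι → ℂ) :
    T (a • u) v w = a * T u v w := by
  rw [hT.swap_left, hT.swap_right, hT.smul_right, hT.swap_right v w u, hT.swap_left v u]

theorem add_middle (hT : IsPolarForm F T) (u v v' w : ι → ℂ) :
    T u (v + v') w = T u v w + T u v' w := by
  rw [hT.swap_right, hT.add_right, hT.swap_right u w v, hT.swap_right u w v']

theorem smul_middle (hT : IsPolarForm F T) (a : ℂ) (u v w : ι → ℂ) :
    T u (a • v) w = a * T u v w := by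
  rw [hT.swap_right, hT.smul_right, hT.swap_right u w v]

/-- The cubic form in terms of three vectors. -/
theorem eval_comb (hT : IsPolarForm F T) (u v w : ι → ℂ) (a b c : ℂ) :
    eval (a • u + b • v + c • w) F =
      a ^ 3 * T u u u + b ^ 3 * T v v v + c ^ 3 * T w w w + 3 * a ^ 2 * b * T u u v +
        3 * a ^ 2 * c * T u u w + 3 * a * b ^ 2 * T u v v + 3 * b ^ 2 * c * T v v w +
        3 * a * c ^ 2 * T u w w + 3 * b * c ^ 2 * T v w w + 6 * a * b * c * T u v w := by
  rw [hT.eval_eq]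
  simp only [hT.add_left, hT.smul_left, hT.add_middle, hT.smul_middle, hT.add_right, hT.smul_right]
  rw [hT.swap_right u v u, hT.swap_left v u u, hT.swap_right u v u, hT.swap_left v u v,
    hT.swap_right v v u, hT.swap_left v u v, hT.swap_right u w u, hT.swap_left w u u,
    hT.swap_right u w u, hT.swap_left w u w, hT.swap_right w w u, hT.swap_left w u w,
    hT.swap_right v w v, hT.swap_left w v v, hT.swap_right v w v, hT.swap_left w v w,
    hT.swap_right w w v, hT.swap_left w v w, hT.swap_right u w v, hT.swap_left v u w,
    hT.swap_right v w u, hT.swap_left v u w, hT.swap_left w u v, hT.swap_right u w v,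
    hT.swap_left w v u, hT.swap_right v w u, hT.swap_left v u w]
  ring

end IsPolarForm

/-- Three vectors, two of which are in the kernel of a linear form, the third of which is not, and
such that the first two are independent, are a basis. -/
theorem exists_linearEquiv_of_frame {w k q : Fin 3 → ℂ} {f : (Fin 3 → ℂ) →ₗ[ℂ] ℂ}
    (hw : f w ≠ 0) (hk : f k = 0) (hq : f q = 0) (hq0 : q ≠ 0) (hkq : ∀ c : ℂ, k ≠ c • q) :
    ∃ e : (Fin 3 → ℂ) ≃ₗ[ℂ] (Fin 3 → ℂ), ∀ y, e y = y 0 • w + y 1 • k + y 2 • q := by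
  obtain ⟨E, hE⟩ : ∃ E : (Fin 3 → ℂ) →ₗ[ℂ] (Fin 3 → ℂ), ∀ y, E y = y 0 • w + y 1 • k + y 2 • q :=
    ⟨(LinearMap.proj 0).smulRight w + (LinearMap.proj 1).smulRight k +
      (LinearMap.proj 2).smulRight q, fun y => rfl⟩
  have hinj : Function.Injective E := by
    refine (injective_iff_map_eq_zero E).2 fun y hy => ?_
    rw [hE] at hy
    have h0 : y 0 = 0 := by
      have h1 := congrArg f hy
      simpa [hk, hq, hw] using h1
    rw [h0, zero_smul, zero_add] at hy
    have h1 : y 1 = 0 := by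
      by_contra h
      refine hkq (-(y 1)⁻¹ * y 2) ?_
      have h2 := congrArg ((y 1)⁻¹ • ·) hy
      simp only [smul_add, smul_zero, smul_smul, inv_mul_cancel₀ h, one_smul] at h2
      rw [neg_mul, neg_smul]
      exact eq_neg_of_add_eq_zero_left h2
    rw [h1, zero_smul, zero_add] at hy
    have h2 := (smul_eq_zero.1 hy).resolve_right hq0
    funext i
    fin_cases i
    exacts [h0, h1, h2]
  exact ⟨LinearEquiv.ofInjectiveEndo E hinj, hE⟩

/-- A binary quadratic form with vanishing discriminant is a multiple of a square. -/
theorem exists_sq_of_discrim_eq_zero {A B D b : ℂ} (hb : b ≠ 0) (h : B ^ 2 = 4 * A * D) :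
    ∃ p q : ℂ, A = -b * p ^ 2 ∧ B = -b * (2 * p * q) ∧ D = -b * q ^ 2 := by
  by_cases hA : A = 0
  · obtain ⟨q, hq⟩ := IsAlgClosed.exists_pow_nat_eq (-D / b) two_pos
    have hB : B = 0 := by simpa [hA] using h
    refine ⟨0, q, by simp [hA], by simp [hB], ?_⟩
    rw [hq]; field_simp
  · obtain ⟨p, hp⟩ := IsAlgClosed.exists_pow_nat_eq (-A / b) two_pos
    have hA' : A = -b * p ^ 2 := by rw [hp]; field_simp
    have hp0 : p ≠ 0 := by
      rintro rfl
      exact hA (by simp [hA'])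
    refine ⟨p, -B / (2 * b * p), hA', by field_simp, ?_⟩
    rw [hA'] at h
    field_simp
    linear_combination h

/-- The parameter for which the residual conic of the flex tangent degenerates suitably. -/
theorem exists_quartic_root {a : ℂ} (ha : a ≠ 0) (c d e : ℂ) :
    ∃ x : ℂ, (d - 3 * a * x ^ 2) ^ 2 = 4 * (c - 3 * a * x) * (e - a * x ^ 3) := by
  have h3 : -3 * a ^ 2 ≠ 0 := mul_ne_zero (by norm_num) (pow_ne_zero 2 ha)
  obtain ⟨P, hP⟩ : ∃ P : Polynomial ℂ, P = Polynomial.C (-3 * a ^ 2) * Polynomial.X ^ 4 +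
      Polynomial.C (4 * c * a) * Polynomial.X ^ 3 + Polynomial.C (-6 * a * d) * Polynomial.X ^ 2 +
      Polynomial.C (12 * a * e) * Polynomial.X + Polynomial.C (d ^ 2 - 4 * c * e) := ⟨_, rfl⟩
  have hdeg : P.degree = 4 := by
    rw [hP]
    compute_degree!
  obtain ⟨x, hx⟩ := IsAlgClosed.exists_root P (by rw [hdeg]; decide)
  refine ⟨x, ?_⟩
  rw [Polynomial.IsRoot, hP] at hx
  simp at hx
  linear_combination hx

/-- A smooth plane cubic has a flex `q`, which is a zero of the Hessian. A kernel vector of the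
second derivative at `q` spans the flex tangent together with `q`. -/
theorem exists_flex {g : MvPolynomial (Fin 3) ℂ} (hg : g.IsHomogeneous 3)
    (hs : ∀ x : Fin 3 → ℂ, x ≠ 0 → eval x g = 0 → ∃ i, eval x (pderiv i g) ≠ 0)
    {T : (Fin 3 → ℂ) → (Fin 3 → ℂ) → (Fin 3 → ℂ) → ℂ} (hT : IsPolarForm g T) :
    ∃ q k w : Fin 3 → ℂ, q ≠ 0 ∧ (∀ c : ℂ, k ≠ c • q) ∧ T q q q = 0 ∧ (∀ z, T q z k = 0) ∧
      T q q w ≠ 0 ∧ T q w w = 0 := by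
  obtain ⟨h, hh⟩ : ∃ h : MvPolynomial (Fin 3) ℂ,
    h = (Matrix.of fun i j => pderiv j (pderiv i g)).det := ⟨_, rfl⟩
  have heval : ∀ x, eval x h = (Matrix.of fun i j => eval x (pderiv j (pderiv i g))).det := by
    intro x
    rw [hh, RingHom.map_det]
    rfl
  have hg0 : eval 0 g = 0 := by
    have := eval_smul_of_isHomogeneous hg 0 0
    simpa using this
  have hh0 : eval 0 h = 0 := by
    have h1 : (Matrix.of fun i j => eval 0 (pderiv j (pderiv i g))) =
        (0 : Matrix (Fin 3) (Fin 3) ℂ) := by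
      ext i j
      have := eval_smul_of_isHomogeneous (IsHomogeneous.pderiv (i := j) (IsHomogeneous.pderiv (i := i) hg))
        0 0
      simpa using this
    rw [heval, h1, Matrix.det_zero]
  obtain ⟨q, hq, hgq, hhq⟩ := exists_common_zero hg0 hh0
  rw [heval] at hhq
  obtain ⟨k, hk, hMk⟩ := Matrix.exists_mulVec_eq_zero_iff.2 hhq
  have hqk : ∀ z, T q z k = 0 := by
    intro z
    have h1 := hT.sum_pderiv_pderiv q z k
    have h2 : ∀ i, ∑ j, k j * eval q (pderiv j (pderiv i g)) = 0 := by
      intro i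
      refine Eq.trans ?_ (congrFun hMk i)
      exact Finset.sum_congr rfl fun j _ => mul_comm _ _
    simp only [h2, mul_zero, Finset.sum_const_zero] at h1
    linear_combination -h1 / 6
  obtain ⟨i, hi⟩ := hs q hq hgq
  have hw₀ : T q q (Pi.single i 1) ≠ 0 := by
    intro h1
    have h2 := hT.sum_pderiv q (Pi.single i 1)
    rw [h1, mul_zero] at h2
    refine hi ?_
    simpa [Pi.single_apply] using h2
  obtain ⟨w₀, hw⟩ : ∃ w₀ : Fin 3 → ℂ, w₀ = Pi.single i 1 := ⟨_, rfl⟩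
  rw [← hw] at hw₀
  have hqqq : T q q q = 0 := by rw [← hT.eval_eq, hgq]
  -- The multiple of `q` is chosen such that `T q w w = 0`.
  refine ⟨q, k, w₀ + (-(T q w₀ w₀ / (2 * T q q w₀))) • q, hq, ?_, hqqq, hqk, ?_, ?_⟩
  · intro c hc
    have hc0 : c ≠ 0 := by
      rintro rfl
      exact hk (by rw [hc, zero_smul])
    have h1 := hqk w₀
    rw [hc, hT.smul_right, hT.swap_right] at h1
    exact hw₀ ((mul_eq_zero.1 h1).resolve_left hc0)
  · rw [hT.add_right, hT.smul_right, hqqq, mul_zero, add_zero]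
    exact hw₀
  · simp only [hT.add_right, hT.smul_right, hT.add_middle, hT.smul_middle, hT.swap_right q w₀ q,
      hqqq]
    field_simp
    ring

/-- A smooth plane cubic is the sum of a product of three linear forms, two of which form a
coordinate system together with `y₁`, and of a multiple of `y₁³`. In the Weierstrass form
`a X³ + Z (b Y² + c X² + d X Z + e Z²)` one subtracts `a (X + x₀ Z)³`, where `x₀` is chosen
so that the difference is `Z` times a conic which is a pair of lines. -/
theorem exists_linearEquiv_planeCubic {g : MvPolynomial (Fin 3) ℂ} (hg : g.IsHomogeneous 3)
    (hs : ∀ x : Fin 3 → ℂ, x ≠ 0 → eval x g = 0 → ∃ i, eval x (pderiv i g) ≠ 0) :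
    ∃ (E : (Fin 3 → ℂ) ≃ₗ[ℂ] (Fin 3 → ℂ)) (t₁ t₂ t₃ t₆ : ℂ), t₂ ≠ 0 ∧ t₃ ≠ 0 ∧ ∀ y,
      eval (E y) g = y 0 * y 2 * (t₁ * y 0 + t₃ * y 2 + t₆ * y 1) + t₂ * y 1 ^ 3 := by
  obtain ⟨T, hT⟩ := exists_isPolarForm hg
  obtain ⟨q, k, w, hq, hkq, hqqq, hqk, hqqw, hqww⟩ := exists_flex hg hs hT
  obtain ⟨f, hf⟩ : ∃ f : (Fin 3 → ℂ) →ₗ[ℂ] ℂ, ∀ z, f z = T q q z :=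
    ⟨⟨⟨fun z => T q q z, hT.add_right q q⟩, hT.smul_right q q⟩, fun _ => rfl⟩
  have hfw : f w ≠ 0 := by rwa [hf]
  have hfk : f k = 0 := by rw [hf, hqk]
  have hfq : f q = 0 := by rw [hf, hqqq]
  have hqkw : T q k w = 0 := by rw [hT.swap_right, hqk]
  have hqkq : T q k q = 0 := by rw [hT.swap_right, hqk]
  have h3b : 3 * T q q w ≠ 0 := mul_ne_zero (by norm_num) hqqw
  -- If the flex tangent was a component, then the cubic would be singular at a point of it.
  have hα : T k k k ≠ 0 := by
    intro hkkk
    obtain ⟨e, he⟩ := exists_linearEquiv_of_frame hfw hfk hfq hq hkq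
    obtain ⟨y, hy⟩ := IsAlgClosed.exists_pow_nat_eq (-(T k k w) / T q q w) two_pos
    have hx0 : y • q + k ≠ 0 := fun h => hkq (-y) (by
      rw [neg_smul]; exact (neg_eq_of_add_eq_zero_right h).symm)
    have hsing : ∀ z, T (y • q + k) (y • q + k) z = 0 := by
      intro z
      obtain ⟨v, rfl⟩ := e.surjective z
      rw [he]
      simp only [hT.add_right, hT.smul_right, hT.add_middle, hT.smul_middle, hT.add_left,
        hT.smul_left, hqqq, hqk, hkkk, hT.swap_left k q, hqkw, hqkq,
        hT.swap_right k k q]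
      have h1 : y ^ 2 * T q q w = - T k k w := by rw [hy]; field_simp
      linear_combination v 0 * h1
    obtain ⟨i, hi⟩ := hs _ hx0 (by rw [hT.eval_eq, hsing])
    refine hi ?_
    have h2 := hT.sum_pderiv (y • q + k) (Pi.single i 1)
    rw [hsing, mul_zero] at h2
    simpa [Pi.single_apply] using h2
  obtain ⟨x₀, hx₀⟩ := exists_quartic_root hα (3 * T k k w) (3 * T k w w) (T w w w)
  obtain ⟨p, r, hp, hpr, hr⟩ := exists_sq_of_discrim_eq_zero h3b hx₀
  obtain ⟨E, hE⟩ := exists_linearEquiv_of_frame (w := w + (r - p * x₀) • q + (-x₀) • k)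
    (k := k + p • q) (q := q) (f := f) (by simpa [hfk, hfq] using hfw) (by simp [hfk, hfq]) hfq hq
    (fun c hc => hkq (c - p) (by rw [sub_smul, ← hc, add_sub_cancel_right]))
  refine ⟨E, 2 * (3 * T q q w) * (r - p * x₀), T k k k, 3 * T q q w, 2 * (3 * T q q w) * p, hα, h3b,
    fun y => ?_⟩
  have hEy : E y = (y 2 + p * (y 1 - x₀ * y 0) + r * y 0) • q + (y 1 - x₀ * y 0) • k + y 0 • w := by
    rw [hE]
    module
  rw [hEy, hT.eval_comb, hqqq, hqk, hqkw, hqww, hT.swap_right q k k, hqk]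
  linear_combination y 0 * (y 1 - x₀ * y 0) ^ 2 * hp + (y 1 - x₀ * y 0) * y 0 ^ 2 * hpr +
    y 0 ^ 3 * hr

end PlaneCubic

/-! ### Cubic forms with a given zero -/

section CubicForm

open Module

/-- A nonzero linear form is the first coordinate of a coordinate system. -/
theorem exists_linearEquiv_of_linearForm {V : Type} [AddCommGroup V] [Module ℂ V]
    [FiniteDimensional ℂ V] {ρ : Type} [Fintype ρ] (hV : finrank ℂ V = Fintype.card ρ + 1)
    {f : V →ₗ[ℂ] ℂ} (hf : f ≠ 0) : ∃ e : (Option ρ → ℂ) ≃ₗ[ℂ] V, ∀ z, f (e z) = z none := by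
  obtain ⟨v, hv⟩ : ∃ v, f v = 1 := (LinearMap.surjective hf) 1
  have hker : finrank ℂ (ρ → ℂ) = finrank ℂ (LinearMap.ker f) := by
    have h1 := f.finrank_range_add_finrank_ker
    rw [LinearMap.range_eq_top.2 (LinearMap.surjective hf), finrank_top, finrank_self] at h1
    rw [finrank_fintype_fun_eq_card]
    omega
  obtain ⟨κ⟩ : Nonempty ((ρ → ℂ) ≃ₗ[ℂ] LinearMap.ker f) := ⟨LinearEquiv.ofFinrankEq _ _ hker⟩
  obtain ⟨E, hE⟩ : ∃ E : (Option ρ → ℂ) →ₗ[ℂ] V, ∀ z, E z = z none • v + (κ fun i => z (some i) : V) :=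
    ⟨(LinearMap.proj none).smulRight v +
      (LinearMap.ker f).subtype ∘ₗ κ.toLinearMap ∘ₗ LinearMap.funLeft ℂ ℂ some, fun z => rfl⟩
  have hfE : ∀ z, f (E z) = z none := by
    intro z
    rw [hE, map_add, map_smul, hv, LinearMap.mem_ker.1 (SetLike.coe_mem _)]
    simp
  have hinj : Function.Injective E := by
    refine (injective_iff_map_eq_zero E).2 fun z hz => ?_
    have h0 : z none = 0 := by rw [← hfE z, hz, map_zero]
    rw [hE, h0, zero_smul, zero_add, Submodule.coe_eq_zero, LinearEquiv.map_eq_zero_iff] at hz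
    funext o
    rcases o with _ | i
    exacts [h0, congrFun hz i]
  refine ⟨LinearEquiv.ofInjectiveOfFinrankEq E hinj ?_, hfE⟩
  rw [hV, finrank_fintype_fun_eq_card, Fintype.card_option]

/-- A cubic form in at least two variables has a nontrivial zero. -/
theorem exists_ne_zero_eval_eq_zero {τ : Type} [Fintype τ] (hτ : 2 ≤ Fintype.card τ)
    {H : MvPolynomial τ ℂ} (hH : H.IsHomogeneous 3) : ∃ x : τ → ℂ, x ≠ 0 ∧ eval x H = 0 := by
  classical
  obtain ⟨T, hT⟩ := exists_isPolarForm hH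
  obtain ⟨i, j, hij⟩ := Fintype.exists_pair_of_one_lt_card hτ
  obtain ⟨u, hu⟩ : ∃ u : τ → ℂ, u = Pi.single i 1 := ⟨_, rfl⟩
  obtain ⟨v, hv⟩ : ∃ v : τ → ℂ, v = Pi.single j 1 := ⟨_, rfl⟩
  by_cases h : T v v v = 0
  · exact ⟨v, by simp [hv], by rw [hT.eval_eq, h]⟩
  · obtain ⟨P, hP⟩ : ∃ P : Polynomial ℂ, P = Polynomial.C (T v v v) * Polynomial.X ^ 3 +
        Polynomial.C (3 * T u v v) * Polynomial.X ^ 2 + Polynomial.C (3 * T u u v) * Polynomial.X +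
        Polynomial.C (T u u u) := ⟨_, rfl⟩
    have hdeg : P.degree = 3 := by
      rw [hP]
      compute_degree!
    obtain ⟨t, ht⟩ := IsAlgClosed.exists_root P (by rw [hdeg]; decide)
    rw [Polynomial.IsRoot, hP] at ht
    simp at ht
    refine ⟨(1 : ℂ) • u + t • v + (0 : ℂ) • u, fun h0 => ?_, ?_⟩
    · simpa [hu, hv, hij] using congrFun h0 i
    · rw [hT.eval_comb]
      linear_combination ht

/-- A smooth cubic form is `l r² + r h₁ + h₀` in suitable coordinates, where `r` is the coordinate
along a zero and where `l` cuts out the tangent hyperplane there. -/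
theorem exists_linearEquiv_cubicForm {τ ρ : Type} [Fintype τ] [DecidableEq τ] [Fintype ρ]
    [DecidableEq ρ] (hτ : Fintype.card τ = Fintype.card ρ + 2)
    {H : MvPolynomial τ ℂ} (hH : H.IsHomogeneous 3)
    (hs : ∀ x : τ → ℂ, x ≠ 0 → eval x H = 0 → ∃ i, eval x (pderiv i H) ≠ 0) :
    ∃ (E : (ℂ × (Option ρ → ℂ)) ≃ₗ[ℂ] (τ → ℂ)) (h₁ h₀ : MvPolynomial (Option ρ) ℂ),
      h₁.IsHomogeneous 2 ∧ h₀.IsHomogeneous 3 ∧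
      ∀ r z, eval (E (r, z)) H = z none * r ^ 2 + r * eval z h₁ + eval z h₀ := by
  obtain ⟨T, hT⟩ := exists_isPolarForm hH
  obtain ⟨z₀, hz₀, hHz₀⟩ := exists_ne_zero_eval_eq_zero (by omega) hH
  obtain ⟨i, hi⟩ := hs z₀ hz₀ hHz₀
  have hzzz : T z₀ z₀ z₀ = 0 := by rw [← hT.eval_eq, hHz₀]
  obtain ⟨f, hf⟩ : ∃ f : (τ → ℂ) →ₗ[ℂ] ℂ, ∀ z, f z = 3 * T z₀ z₀ z :=
    ⟨3 • ⟨⟨fun z => T z₀ z₀ z, hT.add_right z₀ z₀⟩, hT.smul_right z₀ z₀⟩, fun _ => by simp⟩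
  have hfi : f (Pi.single i 1) ≠ 0 := by
    rw [hf, ← hT.sum_pderiv]
    simpa [Pi.single_apply] using hi
  obtain ⟨V, hV⟩ := (Submodule.span ℂ {z₀}).exists_isCompl
  have hfV : f.domRestrict V ≠ 0 := by
    intro h0
    have h1 : (⊤ : Submodule ℂ (τ → ℂ)) ≤ LinearMap.ker f := by
      rw [← hV.sup_eq_top, sup_le_iff]
      refine ⟨?_, fun v hv => ?_⟩
      · rw [Submodule.span_singleton_le_iff_mem, LinearMap.mem_ker, hf, hzzz, mul_zero]
      · exact LinearMap.congr_fun h0 ⟨v, hv⟩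
    exact hfi (h1 Submodule.mem_top)
  have hcard : finrank ℂ V = Fintype.card ρ + 1 := by
    have h1 := Submodule.finrank_add_eq_of_isCompl hV
    rw [finrank_span_singleton hz₀, finrank_fintype_fun_eq_card] at h1
    omega
  obtain ⟨e, he⟩ := exists_linearEquiv_of_linearForm hcard hfV
  obtain ⟨W, hW⟩ : ∃ W : (Option ρ → ℂ) →ₗ[ℂ] (τ → ℂ), ∀ z, W z = e z :=
    ⟨V.subtype ∘ₗ e.toLinearMap, fun _ => rfl⟩
  have hfW : ∀ z, f (W z) = z none := fun z => by rw [hW]; exact he z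
  have hWhom : ∀ i, (linearForms W i).IsHomogeneous 1 := fun i =>
    IsHomogeneous.sum _ _ _ fun j _ => by
      simpa using (isHomogeneous_C _ _).mul (isHomogeneous_X ℂ j)
  -- On `r z₀ + z`, with `z` in the complement `V` of `z₀`, the form is
  -- `3 T(z₀, z₀, z) r² + 3 T(z₀, z, z) r + H(z)`.
  refine ⟨((LinearEquiv.toSpanNonzeroSingleton ℂ _ z₀ hz₀).prodCongr e).trans
    (Submodule.prodEquivOfIsCompl _ _ hV),
    aeval (linearForms W) (∑ i, C (z₀ i) * pderiv i H), aeval (linearForms W) H, ?_, ?_, ?_⟩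
  · have h1 : (∑ i, C (z₀ i) * pderiv i H).IsHomogeneous 2 :=
      IsHomogeneous.sum _ _ _ fun i _ => by
        simpa using (isHomogeneous_C _ _).mul (IsHomogeneous.pderiv (i := i) hH)
    simpa using h1.aeval _ hWhom
  · simpa using hH.aeval _ hWhom
  · intro r z
    have h1 : ((LinearEquiv.toSpanNonzeroSingleton ℂ _ z₀ hz₀).prodCongr e).trans
        (Submodule.prodEquivOfIsCompl _ _ hV) (r, z) = r • z₀ + (1 : ℂ) • W z + (0 : ℂ) • z₀ := by
      rw [hW]
      simp
    have h2 : eval (W z) (∑ i, C (z₀ i) * pderiv i H) = 3 * T z₀ (W z) (W z) := by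
      rw [hT.swap_left, hT.swap_right, ← hT.sum_pderiv]
      simp
    have h3 := hfW z
    rw [hf] at h3
    rw [h1, hT.eval_comb, eval_aeval_linearForms, eval_aeval_linearForms, h2, hT.eval_eq, hzzz]
    linear_combination r ^ 2 * h3

end CubicForm

/-! ### Separated cubic forms -/

section Separated

/-- Smoothness of a sum of forms in disjoint sets of variables passes to the summands. -/
theorem exists_eval_pderiv_ne_zero_of_rename_add {α β ι : Type} (σ : α ⊕ β ≃ ι)
    {G : MvPolynomial α ℂ} {H : MvPolynomial β ℂ} (hH : H.IsHomogeneous 3)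
    (hs : ∀ x : ι → ℂ, x ≠ 0 →
      eval x (rename (fun i => σ (Sum.inl i)) G + rename (fun i => σ (Sum.inr i)) H) = 0 →
      ∃ i, eval x
        (pderiv i (rename (fun i => σ (Sum.inl i)) G + rename (fun i => σ (Sum.inr i)) H)) ≠ 0) :
    ∀ y : α → ℂ, y ≠ 0 → eval y G = 0 → ∃ i, eval y (pderiv i G) ≠ 0 := by
  intro y hy hG
  have hzero : ∀ {d : ℕ} {P : MvPolynomial β ℂ}, P.IsHomogeneous (d + 1) → eval 0 P = 0 := by
    intro d P hP
    simpa using eval_smul_of_isHomogeneous hP 0 0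
  obtain ⟨x, hx⟩ : ∃ x : ι → ℂ, x = fun i => Sum.elim y (0 : β → ℂ) (σ.symm i) := ⟨_, rfl⟩
  have hl : ∀ P : MvPolynomial α ℂ, eval x (rename (fun i => σ (Sum.inl i)) P) = eval y P := by
    intro P
    rw [eval_rename, hx]
    congr 1
    simp [Function.comp_def]
  have hr : ∀ P : MvPolynomial β ℂ, eval x (rename (fun i => σ (Sum.inr i)) P) = eval 0 P := by
    intro P
    rw [eval_rename, hx]
    congr 1
    simp [Function.comp_def]
  have hinl : Function.Injective fun i => σ (Sum.inl i) := σ.injective.comp Sum.inl_injective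
  have hinr : Function.Injective fun i => σ (Sum.inr i) := σ.injective.comp Sum.inr_injective
  obtain ⟨i, hi⟩ := hs x (by
    rintro rfl
    refine hy (funext fun i => ?_)
    simpa using (congrFun hx (σ (Sum.inl i))).symm) (by rw [map_add, hl, hr, hG, hzero hH, add_zero])
  obtain ⟨s, rfl⟩ := σ.surjective i
  rw [map_add, map_add] at hi
  rcases s with j | j
  · have h1 : pderiv (σ (Sum.inl j)) (rename (fun i => σ (Sum.inr i)) H) = 0 := by
      classical
      refine pderiv_eq_zero_of_notMem_vars fun h => ?_
      have := vars_rename _ _ h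
      simp at this
    rw [pderiv_rename hinl, hl, h1, map_zero, add_zero] at hi
    exact ⟨j, hi⟩
  · have h1 : pderiv (σ (Sum.inr j)) (rename (fun i => σ (Sum.inl i)) G) = 0 := by
      classical
      refine pderiv_eq_zero_of_notMem_vars fun h => ?_
      have := vars_rename _ _ h
      simp at this
    rw [pderiv_rename hinr, hr, h1, map_zero, hzero (IsHomogeneous.pderiv hH), add_zero] at hi
    exact absurd rfl hi

/-- Among numbers at most three with an odd sum, which is at least three, some have sum three. -/
theorem exists_sum_eq_three {ι : Type} [DecidableEq ι] {A : Finset ι} {c : ι → ℕ} (hc : ∀ i, c i ≤ 3)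
    (hodd : Odd (∑ i ∈ A, c i)) (h3 : 3 ≤ ∑ i ∈ A, c i) : ∃ B : Finset ι, ∑ i ∈ B, c i = 3 := by
  have hex : ∀ A : Finset ι, Odd (∑ i ∈ A, c i) → ∃ i ∈ A, c i = 1 ∨ c i = 3 := by
    intro A hA
    by_contra! h
    refine Nat.not_even_iff_odd.2 hA (Finset.even_sum _ fun i hi => ?_)
    have h1 := hc i
    have h2 := h i hi
    rw [Nat.even_iff]
    omega
  obtain ⟨i, hi, h1 | h1⟩ := hex A hodd
  swap
  · exact ⟨{i}, by simp [h1]⟩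
  have hA := Finset.add_sum_erase A c hi
  obtain ⟨j, hj, hj0⟩ : ∃ j ∈ A.erase i, c j ≠ 0 := by
    by_contra! h
    rw [Finset.sum_eq_zero h] at hA
    omega
  have hij : i ≠ j := (Finset.ne_of_mem_erase hj).symm
  have hAj := Finset.add_sum_erase (A.erase i) c hj
  have hcj := hc j
  obtain h2 | h2 | h2 : c j = 3 ∨ c j = 2 ∨ c j = 1 := by omega
  · exact ⟨{j}, by simp [h2]⟩
  · exact ⟨{i, j}, by rw [Finset.sum_pair hij, h1, h2]⟩
  obtain ⟨k, hk, h4 | h4⟩ := hex ((A.erase i).erase j) (by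
    rw [Nat.odd_iff] at hodd ⊢
    omega)
  · have hk' := Finset.mem_erase.1 hk
    have hk'' := Finset.mem_erase.1 hk'.2
    refine ⟨{i, j, k}, ?_⟩
    rw [Finset.sum_insert (by simp [hij, hk''.1.symm]), Finset.sum_pair hk'.1.symm]
    omega
  · exact ⟨{k}, by simp [h4]⟩

variable {k : ℕ} {F : MvPolynomial (Fin (k + 1)) ℂ}

/-- Every variable occurs in a smooth cubic form. -/
theorem mem_vars_of_isSmooth (hF : F.IsHomogeneous 3) (hs : IsSmoothProjHypersurface F)
    (j : Fin (k + 1)) : j ∈ F.vars := by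
  by_contra hj
  obtain ⟨f, hf⟩ := exists_rename_eq_of_vars_subset_range F
    (fun i : {i // ¬ i = j} => Equiv.sumCompl (· = j) (Sum.inr i))
    ((Equiv.injective _).comp Sum.inr_injective) (by
      intro i hi
      have hij : ¬ i = j := by
        rintro rfl
        exact hj hi
      exact ⟨⟨i, hij⟩, rfl⟩)
  have hfhom : f.IsHomogeneous 3 := by
    rw [← hf] at hF
    exact (IsHomogeneous.rename_isHomogeneous_iff ((Equiv.injective _).comp Sum.inr_injective)).1 hF
  obtain ⟨i, hi⟩ := exists_eval_pderiv_ne_zero_of_rename_add (Equiv.sumCompl (· = j)) (G := 0)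
    hfhom (by
      rw [map_zero, zero_add, hf]
      exact fun x hx h0 => hs.exists_eval_pderiv_ne_zero hF hx h0) (fun _ => 1)
    (fun h => one_ne_zero (congrFun h ⟨j, rfl⟩)) (map_zero _)
  simp at hi

/-- A separated smooth cubic form in an odd number of variables splits off a ternary form. -/
theorem exists_ternary_summand (hF : F.IsHomogeneous 3) (hsep : IsSeparatedCubicForm F)
    (hs : IsSmoothProjHypersurface F) (hodd : Odd (k + 1)) (hk : 3 ≤ k + 1) :
    ∃ (S : Finset (Fin (k + 1))) (g H : MvPolynomial (Fin (k + 1)) ℂ), S.card = 3 ∧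
      g.IsHomogeneous 3 ∧ H.IsHomogeneous 3 ∧ F = g + H ∧ g.vars ⊆ S ∧ Disjoint S H.vars := by
  classical
  obtain ⟨r, G, hFG, hG, hdisj⟩ := hsep
  have hsum : ∑ i, (G i).vars.card = k + 1 := by
    rw [← Finset.card_biUnion fun i _ j _ hij => hdisj i j hij]
    conv_rhs => rw [← Fintype.card_fin (k + 1)]
    rw [← Finset.card_univ]
    congr 1
    refine Finset.eq_univ_iff_forall.2 fun j => ?_
    have h1 := mem_vars_of_isSmooth hF hs j
    rw [hFG] at h1
    exact vars_sum_subset _ _ h1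
  obtain ⟨B, hB⟩ := exists_sum_eq_three (A := Finset.univ) (c := fun i => (G i).vars.card)
    (fun i => (hG i).2) (by rwa [hsum]) (by rwa [hsum])
  refine ⟨B.biUnion fun i => (G i).vars, ∑ i ∈ B, G i, ∑ i ∈ Bᶜ, G i, ?_,
    IsHomogeneous.sum _ _ _ fun i _ => (hG i).1, IsHomogeneous.sum _ _ _ fun i _ => (hG i).1, ?_,
    vars_sum_subset _ _, ?_⟩
  · rw [Finset.card_biUnion fun i _ j _ hij => hdisj i j hij, hB]
  · rw [hFG, Finset.sum_add_sum_compl]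
  · refine Finset.disjoint_of_subset_right (vars_sum_subset _ _) ?_
    rw [Finset.disjoint_biUnion_left]
    intro i hi
    rw [Finset.disjoint_biUnion_right]
    intro j hj
    refine hdisj i j ?_
    rintro rfl
    exact Finset.mem_compl.1 hj hi

/-- The coordinates of `niceForm`, distributed to the ternary form and its complement. -/
def niceCoordinates (ρ : Type) :
    (Fin 5 ⊕ ρ → ℂ) ≃ₗ[ℂ] (Fin 3 → ℂ) × (ℂ × (Option ρ → ℂ)) where
  toFun x := (![x (Sum.inl 0), x (Sum.inl 1), x (Sum.inl 2)], x (Sum.inl 3),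
    fun o => x (tailIndex o))
  invFun y := Sum.elim ![y.1 0, y.1 1, y.1 2, y.2.1, y.2.2 none] fun i => y.2.2 (some i)
  map_add' x y := by
    refine Prod.ext ?_ rfl
    funext i
    fin_cases i <;> rfl
  map_smul' c x := by
    refine Prod.ext ?_ rfl
    funext i
    fin_cases i <;> rfl
  left_inv x := by
    funext i
    rcases i with i | i
    · fin_cases i <;> rfl
    · rfl
  right_inv y := by
    refine Prod.ext ?_ (Prod.ext rfl ?_)
    · funext i
      fin_cases i <;> rfl
    · funext o
      rcases o with _ | o <;> rfl

/-- A separated smooth cubic form in an odd number of variables has the normal form `niceForm`. -/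
theorem exists_linearEquiv_niceForm (hF : F.IsHomogeneous 3) (hsep : IsSeparatedCubicForm F)
    (hs : IsSmoothProjHypersurface F) (hodd : Odd (k + 1)) {ρ : Type} [Fintype ρ] [DecidableEq ρ]
    (hk : k + 1 = Fintype.card ρ + 5) :
    ∃ (t₁ t₂ t₃ t₆ : ℂ) (h₁ h₀ : MvPolynomial (Option ρ) ℂ)
      (E : (Fin 5 ⊕ ρ → ℂ) ≃ₗ[ℂ] (Fin (k + 1) → ℂ)), t₂ ≠ 0 ∧ t₃ ≠ 0 ∧ h₁.IsHomogeneous 2 ∧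
      h₀.IsHomogeneous 3 ∧ ∀ x, eval (E x) F = eval x (niceForm t₁ t₂ t₃ t₆ 0 h₁ h₀) := by
  classical
  obtain ⟨S, g, H, hS, hg, hH, rfl, hgS, hHS⟩ := exists_ternary_summand hF hsep hs hodd (by omega)
  obtain ⟨σ₃⟩ : Nonempty (Fin 3 ≃ {i // i ∈ S}) :=
    ⟨(Fintype.equivFinOfCardEq (by simp [hS])).symm⟩
  obtain ⟨σ, hσ⟩ : ∃ σ : Fin 3 ⊕ {i // i ∉ S} ≃ Fin (k + 1),
      σ = (σ₃.sumCongr (Equiv.refl _)).trans (Equiv.sumCompl (· ∈ S)) := ⟨_, rfl⟩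
  have hinl : Function.Injective fun i => σ (Sum.inl i) := σ.injective.comp Sum.inl_injective
  have hinr : Function.Injective fun i => σ (Sum.inr i) := σ.injective.comp Sum.inr_injective
  obtain ⟨G, hG⟩ := exists_rename_eq_of_vars_subset_range g _ hinl (by
    intro i hi
    exact ⟨σ₃.symm ⟨i, hgS hi⟩, by simp [hσ]⟩)
  obtain ⟨K, hK⟩ := exists_rename_eq_of_vars_subset_range H _ hinr (by
    intro i hi
    exact ⟨⟨i, Finset.disjoint_right.1 hHS hi⟩, by simp [hσ]⟩)
  rw [← hG, IsHomogeneous.rename_isHomogeneous_iff hinl] at hg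
  rw [← hK, IsHomogeneous.rename_isHomogeneous_iff hinr] at hH
  have hs' := fun x hx h0 => hs.exists_eval_pderiv_ne_zero hF (x := x) hx h0
  rw [← hG, ← hK] at hs'
  obtain ⟨E₁, t₁, t₂, t₃, t₆, ht₂, ht₃, hE₁⟩ := exists_linearEquiv_planeCubic hg
    (exists_eval_pderiv_ne_zero_of_rename_add σ hH hs')
  have hcard : Fintype.card {i // i ∉ S} = Fintype.card ρ + 2 := by
    rw [Fintype.card_subtype_compl, Fintype.card_coe, hS, Fintype.card_fin]
    omega
  obtain ⟨E₂, h₁, h₀, hh₁, hh₀, hE₂⟩ := exists_linearEquiv_cubicForm hcard hH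
    (exists_eval_pderiv_ne_zero_of_rename_add ((Equiv.sumComm _ _).trans σ) hg (by
      simpa only [Equiv.trans_apply, Equiv.sumComm_apply, Sum.swap_inl, Sum.swap_inr,
        add_comm (rename _ K)] using hs'))
  refine ⟨t₁, t₂, t₃, t₆, h₁, h₀, ((niceCoordinates ρ).trans (E₁.prodCongr E₂)).trans
    ((LinearEquiv.sumArrowLequivProdArrow (Fin 3) {i // i ∉ S} ℂ ℂ).symm.trans
      (LinearEquiv.funCongrLeft ℂ ℂ σ.symm)), ht₂, ht₃, hh₁, hh₀, fun x => ?_⟩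
  rw [← hG, ← hK, map_add, eval_rename, eval_rename]
  refine Eq.trans ?_ (aeval_niceForm x).symm
  have h₁' := hE₁ (niceCoordinates ρ x).1
  have h₂' := hE₂ (niceCoordinates ρ x).2.1 (niceCoordinates ρ x).2.2
  refine (congrArg₂ (· + ·) (Eq.trans ?_ h₁') (Eq.trans ?_ h₂')).trans ?_
  · congr 2
    funext i
    simp [LinearEquiv.funCongrLeft]
  · congr 2
    funext i
    simp [LinearEquiv.funCongrLeft]
  · simp [niceCoordinates]
    rw [show tailIndex (none : Option ρ) = Sum.inl 4 from rfl]
    ring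

theorem admitsCoprimeParametrizations_of_isSeparatedCubicForm {n : ℕ} (hn : 5 ≤ n) (hodd : Odd n)
    {F : MvPolynomial (Fin (n + 1 + 1)) ℂ} (hF : F.IsHomogeneous 3)
    (hsep : IsSeparatedCubicForm (k := n + 1) F) (hs : IsSmoothProjHypersurface (k := n + 1) F)
    {m : ℕ} (hm : 1 ≤ m) :
    AdmitsCoprimeParametrizations (a := n + 1) (b := m) (n + m)
      (projHypersurface (k := n + 1) F ×ˢ Set.univ) := by
  obtain ⟨κ, rfl⟩ := Nat.exists_eq_add_of_le' hm
  obtain ⟨t₁, t₂, t₃, t₆, h₁, h₀, E, ht₂, ht₃, hh₁, hh₀, hE⟩ := exists_linearEquiv_niceForm hF hsep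
    hs (by rw [Nat.odd_iff] at hodd ⊢; omega) (ρ := Fin (n - 3)) (by simp; omega)
  have hN : n + (κ + 1) = 3 + Fintype.card (Fin (n - 3)) + (κ + 1) := by simp; omega
  rw [hN]
  refine admitsCoprimeParametrizations_of_hasGenericParametrization hF ?_ ?_
  · obtain ⟨d, hd, h⟩ := exists_odd_hasGenericParametrization_niceForm (t₁ := t₁) (t₆ := t₆) ht₂ ht₃
      hh₁ hh₀ κ
    exact ⟨d, hd, h.of_linearEquiv E hE⟩
  · obtain ⟨d, hd, h⟩ := exists_le_two_hasGenericParametrization_niceForm (t₁ := t₁) (t₆ := t₆)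
      (s := 0) ht₂ ht₃ hh₁ hh₀ (κ + 1)
    exact ⟨d, hd, h.of_linearEquiv E hE⟩

end Separated

end

theorem mainTheorem9 :
    (∀ t : Fin 7 → ℂ, t 0 ≠ 0 → t 1 ≠ 0 → t 2 ≠ 0 → t 3 ≠ 0 → t 4 ≠ 0 →
      IsSmoothProjHypersurface (k := 4) (familyCubic t) →
      ∀ m : ℕ, 1 ≤ m →
        AdmitsCoprimeParametrizations (a := 4) (b := m) (3 + m)
          (projHypersurface (k := 4) (familyCubic t) ×ˢ Set.univ)) ∧
    (∀ n : ℕ, 5 ≤ n → Odd n →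
      ∀ F : MvPolynomial (Fin (n + 1 + 1)) ℂ,
        F.IsHomogeneous 3 → IsSeparatedCubicForm (k := n + 1) F →
        IsSmoothProjHypersurface (k := n + 1) F →
        ∀ m : ℕ, 1 ≤ m →
          AdmitsCoprimeParametrizations (a := n + 1) (b := m) (n + m)
            (projHypersurface (k := n + 1) F ×ˢ Set.univ)) := by
  exact ⟨fun _ h0 h1 h2 _ h4 hs _ hm =>
      admitsCoprimeParametrizations_familyCubic h0 h1 h2 h4 hs hm,
    fun _ hn hodd _ hF hsep hs _ hm =>
      admitsCoprimeParametrizations_of_isSeparatedCubicForm hn hodd hF hsep hs hm⟩
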